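/- Let $d\ge 2$ and let $\mathbb{R}^d$ be Minkowski space with $\eta(x,y)=-x_0y_0+\sum_{i=1}^{d-1}x_iy_i$, $\gamma(x)=-\eta(x,x)$, and $J_\pm(0)=\{x:\gamma(x)\ge 0,\ \pm x_0\ge 0\}$. For $\operatorname{Re}\alpha\ge d$ let $R_\pm(\alpha)$ be the distribution given by the function equal to $c_\alpha\gamma(x)^{\frac{\alpha-d}{2}}$ on $J_\pm(0)$ and to $0$ elsewhere, where $$c_\alpha=\frac{2^{1-\alpha}\pi^{\frac{2-d}{2}}}{\Gamma(\frac{\alpha}{2})\,\Gamma(\frac{\alpha-d+2}{2})}.$$ These families extend uniquely to holomorphic distribution-valued maps $\alpha\mapsto R_\pm(\alpha)$ on $\mathbb{C}$. Put $R(\alpha)=R_+(\alpha)-R_-(\alpha)$. Call a covector $\xi$ spacelike if it is spacelike for the dual metric, i.e. $-\xi_0^2+\sum_{i\ge1}\xi_i^2>0$. Let $\Lambda$ be the set of all $(x,\xi)\in\mathbb{R}^d\times(\mathbb{R}^d\setminus\{0\})$ such that $\xi$ is not spacelike and, if $x\neq 0$, then $\gamma(x)=0$ and $\xi$ is a multiple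 of $d\gamma(x)$. Let $\mathcal{D}'_\Lambda$ be the space of distributions $u$ on $\mathbb{R}^d$ with $\mathrm{WF}(u)\subseteq\Lambda$, with the topology generated by the strong topology of distributions together with the seminorms $u\mapsto\sup_{\xi\in V}(1+|\xi|)^N|\mathcal{F}(\chi u)(\xi)|$, where $N\in\mathbb{N}$, $\chi\in C_c^\infty(\mathbb{R}^d)$, and $V\subseteq\mathbb{R}^d$ is a closed cone with $(\operatorname{supp}\chi\times V)\cap\Lambda=\emptyset$. Then $R(\alpha)\in\mathcal{D}'_\Lambda$ for every $\alpha\in\mathbb{C}$, and $\alpha\mapsto R(\alpha)$ is holomorphic on $\mathbb{C}$ as a map into $\mathcal{D}'_\Lambda$. Moreover, let $I\subseteq\mathbb{R}$ be an open interval and $w\colon I\to\mathbb{R}^d$ a smooth timelike curve, i.e. $\gamma(w'(t))>0$ for all $t\in I$. Then the pullback $f\mapsto f\circ w$ of smooth functions extends uniquely to a continuous linear map $w^*\colon\mathcal{D}'_\Lambda\to\mathcal{D}'(I)$, and $\alpha\mapsto w^*(R(\alpha))$ is holomorphic on $\mathbb{C}$ as a map into $\mathcal{D}'(I)$. -/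

import Mathlib

open scoped Distributions ContDiff Topology InnerProductSpace

noncomputable section

/-! ### Complex distributions and their localized Fourier transforms -/

/-- The product of a test function with a smooth function. -/
def mulSmooth {E : Type*} [NormedAddCommGroup E] [NormedSpace ℝ E] {Ω : TopologicalSpace.Opens E}
    (χ : 𝓓(Ω, ℝ)) (g : E → ℝ) (hg : ContDiff ℝ ∞ g) : 𝓓(Ω, ℝ) where
  toFun x := χ x * g x
  contDiff' := χ.contDiff.mul hg
  hasCompactSupport' := χ.hasCompactSupport.mul_right
  tsupport_subset' := (tsupport_mul_subset_left).trans χ.tsupport_subset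

section Wavefront

variable {E : Type*} [NormedAddCommGroup E] [InnerProductSpace ℝ E]

theorem contDiff_cos_inner (ξ : E) : ContDiff ℝ ∞ (fun x : E => Real.cos ⟪x, ξ⟫_ℝ) :=
  Real.contDiff_cos.comp (contDiff_id.inner ℝ contDiff_const)

theorem contDiff_sin_inner (ξ : E) : ContDiff ℝ ∞ (fun x : E => Real.sin ⟪x, ξ⟫_ℝ) :=
  Real.contDiff_sin.comp (contDiff_id.inner ℝ contDiff_const)

/-- The Fourier transform `ℱ(χ u)(ξ) = u[χ · exp(-i⟨·, ξ⟩)]` of the compactly supported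
distribution `χ u`. Mathlib's distributions are tested against real functions, so the exponential
is split into its real and imaginary parts. -/
def localFourier (u : 𝓓'((⊤ : TopologicalSpace.Opens E), ℂ))
    (χ : 𝓓((⊤ : TopologicalSpace.Opens E), ℝ)) (ξ : E) : ℂ :=
  u (mulSmooth χ (fun x => Real.cos ⟪x, ξ⟫_ℝ) (contDiff_cos_inner ξ)) -
    Complex.I * u (mulSmooth χ (fun x => Real.sin ⟪x, ξ⟫_ℝ) (contDiff_sin_inner ξ))

/-- A conic set of covectors: invariant under multiplication by positive reals. -/
def IsConic (V : Set E) : Prop := ∀ ξ ∈ V, ∀ t : ℝ, 0 < t → t • ξ ∈ V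

/-- `u` is microlocally smooth at `(x, ξ)`: there are a neighbourhood `U` of `x` and a conic
neighbourhood `V` of `ξ` such that, for every cut-off `χ` supported in `U`, the Fourier transform
of `χ u` is rapidly decaying on `V`. -/
def MicrolocallySmoothAt (u : 𝓓'((⊤ : TopologicalSpace.Opens E), ℂ)) (x ξ : E) : Prop :=
  ∃ U ∈ 𝓝 x, ∃ V ∈ 𝓝 ξ, IsConic V ∧
    ∀ χ : 𝓓((⊤ : TopologicalSpace.Opens E), ℝ), tsupport χ ⊆ U →
      ∀ N : ℕ, ∃ C : ℝ, ∀ η ∈ V, (1 + ‖η‖) ^ N * ‖localFourier u χ η‖ ≤ C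

/-- The wavefront set, a set of pairs (point, nonzero covector); covectors are identified with
vectors by means of the Euclidean scalar product. -/
def wavefrontSet (u : 𝓓'((⊤ : TopologicalSpace.Opens E), ℂ)) : Set (E × E) :=
  {p | p.2 ≠ 0 ∧ ¬ MicrolocallySmoothAt u p.1 p.2}

theorem localFourier_add (u v : 𝓓'((⊤ : TopologicalSpace.Opens E), ℂ))
    (χ : 𝓓((⊤ : TopologicalSpace.Opens E), ℝ)) (ξ : E) :
    localFourier (u + v) χ ξ = localFourier u χ ξ + localFourier v χ ξ := by
  have h (φ : 𝓓((⊤ : TopologicalSpace.Opens E), ℝ)) : (u + v) φ = u φ + v φ := rfl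
  simp only [localFourier, h]
  ring

theorem localFourier_smul (c : ℂ) (u : 𝓓'((⊤ : TopologicalSpace.Opens E), ℂ))
    (χ : 𝓓((⊤ : TopologicalSpace.Opens E), ℝ)) (ξ : E) :
    localFourier (c • u) χ ξ = c * localFourier u χ ξ := by
  have h (φ : 𝓓((⊤ : TopologicalSpace.Opens E), ℝ)) : (c • u) φ = c * u φ := rfl
  simp only [localFourier, h]
  ring

/-- The vector space of the distributions whose wavefront set is contained in `Λ`. -/
def wavefrontSubmodule (Λ : Set (E × E)) :
    Submodule ℂ 𝓓'((⊤ : TopologicalSpace.Opens E), ℂ) where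
  carrier := {u | wavefrontSet u ⊆ Λ}
  zero_mem' := by
    rintro p ⟨-, hp⟩
    refine absurd ⟨Set.univ, Filter.univ_mem, Set.univ, Filter.univ_mem,
      fun _ _ _ _ => Set.mem_univ _, fun χ _ N => ⟨0, fun η _ => ?_⟩⟩ hp
    have h : localFourier (0 : 𝓓'((⊤ : TopologicalSpace.Opens E), ℂ)) χ η = 0 := by
      have h0 (φ : 𝓓((⊤ : TopologicalSpace.Opens E), ℝ)) :
          (0 : 𝓓'((⊤ : TopologicalSpace.Opens E), ℂ)) φ = 0 := rfl
      simp [localFourier, h0]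
    simp [h]
  add_mem' := by
    rintro u v hu hv p ⟨h0, hp⟩
    by_contra hΛ
    have h1 : MicrolocallySmoothAt u p.1 p.2 := by
      by_contra h; exact hΛ (hu ⟨h0, h⟩)
    have h2 : MicrolocallySmoothAt v p.1 p.2 := by
      by_contra h; exact hΛ (hv ⟨h0, h⟩)
    obtain ⟨U, hU, V, hV, hVc, h1⟩ := h1
    obtain ⟨U', hU', V', hV', hVc', h2⟩ := h2
    refine hp ⟨U ∩ U', Filter.inter_mem hU hU', V ∩ V', Filter.inter_mem hV hV',
      fun ξ hξ t ht => ⟨hVc ξ hξ.1 t ht, hVc' ξ hξ.2 t ht⟩, fun χ hχ N => ?_⟩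
    obtain ⟨C, hC⟩ := h1 χ (hχ.trans Set.inter_subset_left) N
    obtain ⟨C', hC'⟩ := h2 χ (hχ.trans Set.inter_subset_right) N
    refine ⟨C + C', fun η hη => ?_⟩
    rw [localFourier_add]
    calc (1 + ‖η‖) ^ N * ‖localFourier u χ η + localFourier v χ η‖
        ≤ (1 + ‖η‖) ^ N * (‖localFourier u χ η‖ + ‖localFourier v χ η‖) := by
          gcongr; exact norm_add_le _ _
      _ = (1 + ‖η‖) ^ N * ‖localFourier u χ η‖ + (1 + ‖η‖) ^ N * ‖localFourier v χ η‖ := by ring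
      _ ≤ C + C' := add_le_add (hC η hη.1) (hC' η hη.2)
  smul_mem' := by
    rintro c u hu p ⟨h0, hp⟩
    by_contra hΛ
    have h1 : MicrolocallySmoothAt u p.1 p.2 := by
      by_contra h; exact hΛ (hu ⟨h0, h⟩)
    obtain ⟨U, hU, V, hV, hVc, h1⟩ := h1
    refine hp ⟨U, hU, V, hV, hVc, fun χ hχ N => ?_⟩
    obtain ⟨C, hC⟩ := h1 χ hχ N
    refine ⟨‖c‖ * C, fun η hη => ?_⟩
    rw [localFourier_smul, norm_mul]
    calc (1 + ‖η‖) ^ N * (‖c‖ * ‖localFourier u χ η‖)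
        = ‖c‖ * ((1 + ‖η‖) ^ N * ‖localFourier u χ η‖) := by ring
      _ ≤ ‖c‖ * C := mul_le_mul_of_nonneg_left (hC η hη) (norm_nonneg c)

/-- The space `𝓓'_Λ` of the distributions with wavefront set in `Λ`. It is a type synonym of the
submodule above because it carries its own topology, not the subspace topology. -/
def WavefrontSpace (Λ : Set (E × E)) : Type _ := wavefrontSubmodule Λ

namespace WavefrontSpace

variable {Λ : Set (E × E)}

instance : AddCommGroup (WavefrontSpace Λ) := inferInstanceAs (AddCommGroup (wavefrontSubmodule Λ))

instance : Module ℂ (WavefrontSpace Λ) := inferInstanceAs (Module ℂ (wavefrontSubmodule Λ))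

/-- The underlying distribution. -/
def toDistribution (u : WavefrontSpace Λ) : 𝓓'((⊤ : TopologicalSpace.Opens E), ℂ) := u.1

/-- A distribution with wavefront set in `Λ`, as an element of `𝓓'_Λ`. -/
def mk (u : 𝓓'((⊤ : TopologicalSpace.Opens E), ℂ)) (hu : wavefrontSet u ⊆ Λ) :
    WavefrontSpace Λ := ⟨u, hu⟩

/-- The index set of the wavefront seminorms: a cut-off `χ`, a closed conic set `V` of covectors
with `(supp χ × V) ∩ Λ = ∅`, and an order `N`. -/
structure SeminormIndex (Λ : Set (E × E)) where
  χ : 𝓓((⊤ : TopologicalSpace.Opens E), ℝ)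
  V : Set E
  N : ℕ
  isClosed : IsClosed V
  isConic : IsConic V
  disjoint : Disjoint (tsupport χ ×ˢ V) Λ

/-- The weighted localized Fourier transform `ξ ↦ (1 + |ξ|)^N ℱ(χ u)(ξ)` on the cone `V`, in the
space of functions on `V` with the topology of uniform convergence. -/
def weightedFourier (i : SeminormIndex Λ) (u : WavefrontSpace Λ) : UniformFun i.V ℂ :=
  UniformFun.ofFun fun ξ : i.V =>
    (((1 + ‖(ξ : E)‖) ^ i.N : ℝ) : ℂ) * localFourier u.toDistribution i.χ ξ

/-- The (normal) topology of `𝓓'_Λ`: the coarsest one that is finer than the strong topology of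
distributions and for which convergence implies convergence in each of the seminorms
`sup_{ξ ∈ V} (1 + |ξ|)^N |ℱ(χ u)(ξ)|` with `(supp χ × V) ∩ Λ = ∅`. -/
instance : TopologicalSpace (WavefrontSpace Λ) :=
  TopologicalSpace.induced toDistribution inferInstance ⊓
    ⨅ i : SeminormIndex Λ, TopologicalSpace.induced (weightedFourier i) inferInstance

end WavefrontSpace

/-- `P` is the pullback `w^*` along the curve `w`, defined on the parameter domain `I`: it is a
continuous linear map on `𝓓'_Λ` (this is built into the type of `P`) that extends the pullback
`f ↦ f ∘ w` of smooth functions. -/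
def IsPullback {Λ : Set (E × E)} [MeasurableSpace E] [BorelSpace E] [FiniteDimensional ℝ E]
    (I : TopologicalSpace.Opens ℝ) (w : ℝ → E) (P : WavefrontSpace Λ →L[ℂ] 𝓓'(I, ℂ)) : Prop :=
  ∀ (u : WavefrontSpace Λ) (f : E → ℂ), ContDiff ℝ ∞ f →
    (∀ φ : 𝓓((⊤ : TopologicalSpace.Opens E), ℝ), u.toDistribution φ = ∫ x, φ x • f x) →
    ∀ g : 𝓓(I, ℝ), P u g = ∫ t, g t • f (w t)

end Wavefront

/-! ### Minkowski space and the Riesz distributions -/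

/-- `d`-dimensional Minkowski space; the coordinate `x 0` is the time. The Lorentzian form is
`minkowskiForm`; the Euclidean structure only serves to define Lebesgue measure, the Fourier
transform and the identification of covectors with vectors. -/
abbrev Minkowski (d : ℕ) : Type := EuclideanSpace ℝ (Fin d)

section Riesz

variable {d : ℕ} [NeZero d]

/-- The Lorentzian bilinear form `η(x, y) = -x₀ y₀ + ∑_{i ≠ 0} x_i y_i`. -/
def minkowskiForm (x y : Minkowski d) : ℝ :=
  -(x 0 * y 0) + ∑ i ∈ Finset.univ.erase (0 : Fin d), x i * y i

/-- `γ(x) = -η(x, x)`. -/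
def gammaForm (x : Minkowski d) : ℝ := -minkowskiForm x x

/-- A covector is spacelike if it is spacelike for the dual metric, which has in the dual
coordinates the same matrix `diag(-1, 1, …, 1)`. -/
def IsSpacelike (ξ : Minkowski d) : Prop := 0 < minkowskiForm ξ ξ

/-- The causal future (`ε = 1`) or past (`ε = -1`) `J_±(0)` of the origin. -/
def causalCone (d : ℕ) [NeZero d] (ε : ℤˣ) : Set (Minkowski d) :=
  {x | 0 ≤ gammaForm x ∧ 0 ≤ ((ε : ℤ) : ℝ) * x 0}

/-- The constant `c_α = 2^{1-α} π^{(2-d)/2} / (Γ(α/2) Γ((α-d+2)/2))`. -/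
def rieszConst (d : ℕ) (α : ℂ) : ℂ :=
  (2 : ℂ) ^ (1 - α) * (Real.pi : ℂ) ^ ((2 - (d : ℂ)) / 2) /
    (Complex.Gamma (α / 2) * Complex.Gamma ((α - d + 2) / 2))

open Classical in
/-- The function `c_α γ(x)^{(α-d)/2}` on `J_±(0)`, extended by `0`. -/
def rieszFun (d : ℕ) [NeZero d] (ε : ℤˣ) (α : ℂ) (x : Minkowski d) : ℂ :=
  if x ∈ causalCone d ε then rieszConst d α * ((gammaForm x : ℝ) : ℂ) ^ ((α - d) / 2) else 0

/-- `R` is an entire holomorphic family of distributions that is given by the locally integrable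
function `rieszFun d ε α` for `Re α ≥ d`. -/
def IsRieszFamily (d : ℕ) [NeZero d] (ε : ℤˣ)
    (R : ℂ → 𝓓'((⊤ : TopologicalSpace.Opens (Minkowski d)), ℂ)) : Prop :=
  Differentiable ℂ R ∧
    ∀ α : ℂ, (d : ℝ) ≤ α.re → ∀ φ : 𝓓((⊤ : TopologicalSpace.Opens (Minkowski d)), ℝ),
      R α φ = ∫ x, φ x • rieszFun d ε α x

/-- The Riesz distributions `R_+(α)` (`ε = 1`) and `R_-(α)` (`ε = -1`): the holomorphic extension
to all of `ℂ` of the family of functions above. -/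
def riesz (d : ℕ) [NeZero d] (ε : ℤˣ) : ℂ → 𝓓'((⊤ : TopologicalSpace.Opens (Minkowski d)), ℂ) :=
  Classical.epsilon (IsRieszFamily d ε)

/-- The difference Riesz distributions `R(α) = R_+(α) - R_-(α)`. -/
def rieszDiff (d : ℕ) [NeZero d] (α : ℂ) :
    𝓓'((⊤ : TopologicalSpace.Opens (Minkowski d)), ℂ) :=
  riesz d 1 α - riesz d (-1) α

/-- The pairs `(x, ξ)`, `ξ ≠ 0`, such that `ξ` is not spacelike and, if `x ≠ 0`, then `γ(x) = 0`
and `ξ` is a multiple of `dγ` at `x`. -/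
def rieszCone (d : ℕ) [NeZero d] : Set (Minkowski d × Minkowski d) :=
  {p | p.2 ≠ 0 ∧ ¬ IsSpacelike p.2 ∧
    (p.1 ≠ 0 → gammaForm p.1 = 0 ∧ ∃ c : ℝ, p.2 = c • gradient gammaForm p.1)}

/-- `w` is a smooth timelike curve on the open interval `I`. -/
structure IsTimelikeCurve (I : TopologicalSpace.Opens ℝ) (w : ℝ → Minkowski d) : Prop where
  ordConnected : (I : Set ℝ).OrdConnected
  contDiffOn : ContDiffOn ℝ ∞ w I
  timelike : ∀ t ∈ I, 0 < gammaForm (deriv w t)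

end Riesz

end

section

open scoped Distributions ContDiff Topology InnerProductSpace
open MeasureTheory Filter Set

noncomputable section

set_option maxSynthPendingDepth 3
set_option linter.unusedSectionVars false

/-! Two classical ideas carry the theorem: Riesz's continuation by the d'Alembert operator, and
non-stationary phase along a vector field tangent to the light cone.

On the cone, □γ^s = 4s(s-1+d/2)γ^(s-1), and c_α is normalised so that this reads □R_±(α+2) = R_±(α)
(`dalembertian_rieszBase`). Hence R_±(α) = □^k R_±(α+2k) continues the family to ℂ. Holomorphy and
microlocal smoothness survive differentiation, so every claim about the family reduces to Re α ≥
d+4. Uniqueness of the continuation is the identity theorem.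

For the wavefront set, let J be the time reflection and w a covector. The field Y = |x|²w - ⟨Jx,w⟩Jx
+ ⟨x,w⟩x satisfies Yγ = 2⟨x,w⟩γ, so integration by parts along Y against γ^s costs no power of γ and
can be repeated. Moreover ⟨Y,w⟩ = |x|²|w|² - ⟨Jx,w⟩² + ⟨x,w⟩² is positive for nonzero x and w unless
(x,w) lies in Λ (`inner_coneField_pos`). This gives rapid decay away from the origin. At the origin
Y vanishes. For spacelike w there is a Lorentz transformation L that fixes the phase ⟨x,w⟩ and is -1
on the complement; it exchanges the future and the past cone, so the difference of the two powers of
γ is odd under L. The cut-off θ can therefore be replaced by (θ - θ∘L)/2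
(`integral_sub_lorentzMap`), which vanishes near 0, and the previous case applies. Here it matters
that R is the difference of R_+ and R_-.

Holomorphy into 𝓓' and 𝓓'_Λ follows from scalar holomorphy and locally uniform bounds: Cauchy's
estimates make the difference quotients converge uniformly over test functions and frequencies
(`norm_slope_sub_deriv_le`).

For the pullback, Fourier inversion suggests (w^*u)(g) = ∫ A_g(ζ) ℱ(θu)(2πζ) dζ, where A_g is the
Fourier integral of g along the curve. A timelike velocity pairs nontrivially with every nonzero
covector that is not spacelike (`inner_ne_zero_of_timelike`). So frequency space splits into a
closed cone of uniformly spacelike covectors, where ℱ(θu) decays because the cone misses Λ, and its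
complement, where A_g decays because the phase is not stationary. The integral converges and is
continuous in u; density of smooth functions (`WavefrontSpace.exists_smooth_approximation`) gives
independence of the choices and uniqueness. -/

/-! ### Complex-valued test functions -/

section ComplexTest

variable {E : Type*} [NormedAddCommGroup E] [NormedSpace ℝ E] {Ω : TopologicalSpace.Opens E}

/-- The `ℂ`-linear extension of a distribution to complex-valued test functions. -/
def cext (u : 𝓓'(Ω, ℂ)) : 𝓓(Ω, ℂ) →ₗ[ℂ] ℂ where
  toFun φ := u (TestFunction.postcompCLM Complex.reCLM φ) +
    Complex.I * u (TestFunction.postcompCLM Complex.imCLM φ)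
  map_add' φ ψ := by simp only [map_add]; ring
  map_smul' c φ := by
    have h1 : TestFunction.postcompCLM Complex.reCLM (c • φ) =
        c.re • TestFunction.postcompCLM Complex.reCLM φ -
          c.im • TestFunction.postcompCLM Complex.imCLM φ := by
      ext x; simp
    have h2 : TestFunction.postcompCLM Complex.imCLM (c • φ) =
        c.re • TestFunction.postcompCLM Complex.imCLM φ +
          c.im • TestFunction.postcompCLM Complex.reCLM φ := by
      ext x; simp
    rw [h1, h2, map_add, map_sub, map_smul, map_smul, map_smul, map_smul]
    simp only [Complex.real_smul, RingHom.id_apply, smul_eq_mul]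
    conv_rhs => rw [← Complex.re_add_im c]
    linear_combination (-(c.im : ℂ) * u (TestFunction.postcompCLM Complex.imCLM φ)) * Complex.I_sq

lemma cext_apply (u : 𝓓'(Ω, ℂ)) (φ : 𝓓(Ω, ℂ)) :
    cext u φ = u (TestFunction.postcompCLM Complex.reCLM φ) +
      Complex.I * u (TestFunction.postcompCLM Complex.imCLM φ) := rfl

lemma continuous_cext (u : 𝓓'(Ω, ℂ)) : Continuous (cext u) := by
  have h1 : Continuous fun φ : 𝓓(Ω, ℂ) => u (TestFunction.postcompCLM Complex.reCLM φ) :=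
    (ContinuousLinearMap.continuous u).comp (ContinuousLinearMap.continuous _)
  have h2 : Continuous fun φ : 𝓓(Ω, ℂ) => u (TestFunction.postcompCLM Complex.imCLM φ) :=
    (ContinuousLinearMap.continuous u).comp (ContinuousLinearMap.continuous _)
  exact h1.add (continuous_const.mul h2)

/-- A real test function as a complex one. -/
def TestFunction.toComplex (φ : 𝓓(Ω, ℝ)) : 𝓓(Ω, ℂ) :=
  TestFunction.postcompCLM Complex.ofRealCLM φ

@[simp] lemma toComplex_apply (φ : 𝓓(Ω, ℝ)) (x : E) : φ.toComplex x = (φ x : ℂ) := rfl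

@[simp] lemma cext_toComplex (u : 𝓓'(Ω, ℂ)) (φ : 𝓓(Ω, ℝ)) : cext u φ.toComplex = u φ := by
  have h1 : TestFunction.postcompCLM Complex.reCLM φ.toComplex = φ := by ext x; simp
  have h2 : TestFunction.postcompCLM Complex.imCLM φ.toComplex = (0 : 𝓓(Ω, ℝ)) := by ext x; simp
  rw [cext_apply, h1, h2]; simp

lemma cext_add (u v : 𝓓'(Ω, ℂ)) (φ : 𝓓(Ω, ℂ)) : cext (u + v) φ = cext u φ + cext v φ := by
  have h (φ : 𝓓(Ω, ℝ)) : (u + v) φ = u φ + v φ := rfl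
  simp only [cext_apply, h]; ring

lemma cext_sub (u v : 𝓓'(Ω, ℂ)) (φ : 𝓓(Ω, ℂ)) : cext (u - v) φ = cext u φ - cext v φ := by
  have h (φ : 𝓓(Ω, ℝ)) : (u - v) φ = u φ - v φ := rfl
  simp only [cext_apply, h]; ring

lemma cext_smul (c : ℂ) (u : 𝓓'(Ω, ℂ)) (φ : 𝓓(Ω, ℂ)) : cext (c • u) φ = c * cext u φ := by
  have h (φ : 𝓓(Ω, ℝ)) : (c • u) φ = c * u φ := rfl
  simp only [cext_apply, h]; ring

/-- The product of a complex test function with a smooth function. -/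
def TestFunction.mulSmoothC (χ : 𝓓(Ω, ℂ)) (g : E → ℂ) (hg : ContDiff ℝ ∞ g) : 𝓓(Ω, ℂ) where
  toFun x := χ x * g x
  contDiff' := χ.contDiff.mul hg
  hasCompactSupport' := χ.hasCompactSupport.mul_right
  tsupport_subset' := (tsupport_mul_subset_left).trans χ.tsupport_subset

@[simp] lemma mulSmoothC_apply (χ : 𝓓(Ω, ℂ)) (g : E → ℂ) (hg : ContDiff ℝ ∞ g) (x : E) :
    χ.mulSmoothC g hg x = χ x * g x := rfl

/-- Restriction of a test function to `𝓓_K`. -/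
def TestFunction.toSupportedIn {F : Type*} [NormedAddCommGroup F] [NormedSpace ℝ F]
    (φ : 𝓓(Ω, F)) (K : TopologicalSpace.Compacts E) (h : tsupport φ ⊆ K) : 𝓓_{K}(E, F) :=
  .of_support_subset φ.contDiff ((subset_tsupport _).trans h)

end ComplexTest

/-! ### Plane waves and modulated test functions. -/

section PlaneWave

variable {E : Type*} [NormedAddCommGroup E] [InnerProductSpace ℝ E]

/-- The plane wave `x ↦ exp(-i⟨x, ξ⟩)`. -/
def planeWave (ξ x : E) : ℂ := Complex.exp (-(Complex.I * (⟪x, ξ⟫_ℝ : ℂ)))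

lemma norm_planeWave (ξ x : E) : ‖planeWave ξ x‖ = 1 := by
  rw [planeWave, ← mul_neg, ← Complex.ofReal_neg, mul_comm, Complex.norm_exp_ofReal_mul_I]

lemma planeWave_add_left (ξ η x : E) : planeWave (ξ + η) x = planeWave ξ x * planeWave η x := by
  rw [planeWave, planeWave, planeWave, ← Complex.exp_add, inner_add_right]; congr 1; push_cast; ring

lemma planeWave_eq (ξ x : E) : planeWave ξ x =
    (Real.cos ⟪x, ξ⟫_ℝ : ℂ) - Complex.I * (Real.sin ⟪x, ξ⟫_ℝ : ℂ) := by
  rw [planeWave, mul_comm, ← neg_mul, ← Complex.ofReal_neg, Complex.exp_mul_I]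
  push_cast
  rw [Complex.cos_neg, Complex.sin_neg]; ring

lemma contDiff_planeWave_uncurry : ContDiff ℝ ∞ fun p : E × E => planeWave p.2 p.1 := by
  unfold planeWave
  refine ContDiff.cexp (contDiff_const.mul ?_).neg
  exact Complex.ofRealCLM.contDiff.comp (contDiff_fst.inner ℝ contDiff_snd)

lemma contDiff_planeWave (ξ : E) : ContDiff ℝ ∞ (planeWave ξ) :=
  contDiff_planeWave_uncurry.comp (contDiff_id.prodMk contDiff_const)

variable {Ω : TopologicalSpace.Opens E}

/-- The test function `χ · exp(-i⟨·, ξ⟩)`. -/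
def TestFunction.modulate (χ : 𝓓(Ω, ℂ)) (ξ : E) : 𝓓(Ω, ℂ) :=
  χ.mulSmoothC (planeWave ξ) (contDiff_planeWave ξ)

@[simp] lemma modulate_apply (χ : 𝓓(Ω, ℂ)) (ξ x : E) : χ.modulate ξ x = χ x * planeWave ξ x := rfl

lemma tsupport_modulate_subset (χ : 𝓓(Ω, ℂ)) (ξ : E) : tsupport (χ.modulate ξ) ⊆ tsupport χ :=
  tsupport_mul_subset_left

/-- The cosine and sine parts in `localFourier` recombine into one complex modulation, so that a
single complex pairing can replace two real ones. -/
lemma localFourier_eq_cext (u : 𝓓'((⊤ : TopologicalSpace.Opens E), ℂ))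
    (χ : 𝓓((⊤ : TopologicalSpace.Opens E), ℝ)) (ξ : E) :
    localFourier u χ ξ = cext u (χ.toComplex.modulate ξ) := by
  have h : χ.toComplex.modulate ξ =
      (mulSmooth χ (fun x => Real.cos ⟪x, ξ⟫_ℝ) (contDiff_cos_inner ξ)).toComplex -
      Complex.I • (mulSmooth χ (fun x => Real.sin ⟪x, ξ⟫_ℝ) (contDiff_sin_inner ξ)).toComplex := by
    ext x
    have h1 : mulSmooth χ (fun x => Real.cos ⟪x, ξ⟫_ℝ) (contDiff_cos_inner ξ) x =
      χ x * Real.cos ⟪x, ξ⟫_ℝ := rfl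
    have h2 : mulSmooth χ (fun x => Real.sin ⟪x, ξ⟫_ℝ) (contDiff_sin_inner ξ) x =
      χ x * Real.sin ⟪x, ξ⟫_ℝ := rfl
    simp [planeWave_eq, h1, h2]; ring
  rw [h, map_sub, map_smul, cext_toComplex, cext_toComplex]; rfl

end PlaneWave

/-! ### Continuity of families of test functions -/

section Families

variable {E : Type*} [NormedAddCommGroup E] [NormedSpace ℝ E]
  {F : Type*} [NormedAddCommGroup F] [NormedSpace ℝ F]
  {P : Type*} [NormedAddCommGroup P] [NormedSpace ℝ P]

/-- Joint continuity is uniform over the compact set `K` by the tube lemma, and off `K` all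
functions vanish. This upgrades continuity in the parameter to the sup norm. -/
lemma continuous_boundedContinuousFunction_of_compact {E F X : Type*} [TopologicalSpace E]
    [SeminormedAddCommGroup F] [TopologicalSpace X] (K : Set E) (hK : IsCompact K) (H : X → E → F)
    (hH : Continuous fun p : X × E => H p.1 p.2) (h0 : ∀ p, ∀ x ∉ K, H p x = 0)
    (Φ : X → BoundedContinuousFunction E F) (hΦ : ∀ p x, Φ p x = H p x) : Continuous Φ := by
  rw [continuous_iff_continuousAt]
  intro p
  rw [ContinuousAt, Metric.tendsto_nhds]
  intro ε hε
  have h : ∀ᶠ q in 𝓝 p, ∀ x ∈ K, dist (H q x) (H p x) < ε / 2 := by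
    refine hK.eventually_forall_of_forall_eventually fun x _ => ?_
    have hc : Continuous fun z : X × E => dist (H z.1 z.2) (H p z.2) :=
      hH.dist (hH.comp (continuous_const.prodMk continuous_snd))
    exact hc.continuousAt.eventually_lt_const (by simpa using half_pos hε)
  filter_upwards [h] with q hq
  refine lt_of_le_of_lt ((BoundedContinuousFunction.dist_le (half_pos hε).le).2 fun x => ?_)
    (half_lt_self hε)
  rw [hΦ, hΦ]
  by_cases hx : x ∈ K
  · exact (hq x hx).le
  · rw [h0 q x hx, h0 p x hx, dist_self]; exact (half_pos hε).le

/-- A partial derivative is the full derivative restricted to the first factor, and in this form it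
is visibly continuous in both variables. -/
lemma iteratedFDeriv_comp_inl {G : E × P → F} (hG : ContDiff ℝ ∞ G) (i : ℕ) (p : P) (x : E) :
    iteratedFDeriv ℝ i (fun y => G (y, p)) x =
      (iteratedFDeriv ℝ i G (x, p)).compContinuousLinearMap
        fun _ => ContinuousLinearMap.inl ℝ E P := by
  have h : (fun y => G (y, p)) = (fun z => G (z + (0, p))) ∘ ContinuousLinearMap.inl ℝ E P := by
    ext y; simp
  have hG' : ContDiff ℝ ∞ fun z => G (z + (0, p)) := hG.comp (contDiff_id.add contDiff_const)
  rw [h, ContinuousLinearMap.iteratedFDeriv_comp_right _ hG' _ (by exact_mod_cast le_top),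
    iteratedFDeriv_comp_add_right]
  simp

/-- The family `p ↦ G(·, p)` in `𝓓_K` of a jointly smooth function. -/
def smoothFamily (K : TopologicalSpace.Compacts E) (G : E × P → F) (hG : ContDiff ℝ ∞ G)
    (h0 : ∀ p, ∀ x ∉ K, G (x, p) = 0) (p : P) : 𝓓_{K}(E, F) where
  toFun x := G (x, p)
  contDiff' := hG.comp (contDiff_id.prodMk contDiff_const)
  zero_on_compl' x hx := h0 p x hx

lemma continuous_smoothFamily (K : TopologicalSpace.Compacts E) (G : E × P → F)
    (hG : ContDiff ℝ ∞ G) (h0 : ∀ p, ∀ x ∉ K, G (x, p) = 0) :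
    Continuous (smoothFamily K G hG h0) := by
  rw [ContDiffMapSupportedIn.continuous_iff_comp]
  intro i
  have key (p : P) (x : E) : ContDiffMapSupportedIn.structureMapCLM ℝ ⊤ i
      (smoothFamily K G hG h0 p) x = iteratedFDeriv ℝ i (fun y => G (y, p)) x := by
    rw [ContDiffMapSupportedIn.structureMapCLM_top_apply]; rfl
  refine continuous_boundedContinuousFunction_of_compact K K.isCompact
    (fun p x => iteratedFDeriv ℝ i (fun y => G (y, p)) x) ?_ ?_ _ key
  · simp only [iteratedFDeriv_comp_inl hG]
    have h1 : Continuous (iteratedFDeriv ℝ i G) :=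
      hG.continuous_iteratedFDeriv (by exact_mod_cast le_top)
    exact (ContinuousMultilinearMap.compContinuousLinearMapL (F := F)
      (fun _ : Fin i => ContinuousLinearMap.inl ℝ E P)).continuous.comp
        (h1.comp (continuous_snd.prodMk continuous_fst))
  · intro p x hx
    exact (smoothFamily K G hG h0 p).iteratedFDeriv_zero_on_compl hx

end Families

/-! ### Compact sets of test functions -/

section CompactSets

variable {E : Type*} [NormedAddCommGroup E] [NormedSpace ℝ E] {Ω : TopologicalSpace.Opens E}
  {F : Type*} [NormedAddCommGroup F] [NormedSpace ℝ F]

/-- The `i`-th derivative as a continuous map on test functions. -/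
def testFunctionDeriv (i : ℕ) : 𝓓(Ω, F) →L[ℝ] BoundedContinuousFunction E (E [×i]→L[ℝ] F) :=
  TestFunction.limitCLM ℝ
    (fun f => ContDiffMapSupportedIn.structureMapCLM (E := E) (F := F) ℝ ⊤ i
      (f.toSupportedIn ⟨tsupport f, f.hasCompactSupport⟩ subset_rfl))
    (fun _ _ => ContDiffMapSupportedIn.structureMapCLM (E := E) (F := F) ℝ ⊤ i)
    (fun K hK f => by
      ext1 x
      rw [ContDiffMapSupportedIn.structureMapCLM_top_apply,
        ContDiffMapSupportedIn.structureMapCLM_top_apply]; rfl)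

lemma testFunctionDeriv_apply (i : ℕ) (f : 𝓓(Ω, F)) (x : E) :
    testFunctionDeriv i f x = iteratedFDeriv ℝ i f x :=
  congrFun (ContDiffMapSupportedIn.structureMapCLM_top_apply ℝ
    (f.toSupportedIn ⟨tsupport f, f.hasCompactSupport⟩ subset_rfl)) x

/-- Convergence of distributions is tested on compact sets of test functions. Together with the
common support below, this reduces such a set to C^k bounds over one compact support. -/
lemma IsCompact.exists_bound_iteratedFDeriv {S : Set 𝓓(Ω, F)} (hS : IsCompact S) (i : ℕ) :
    ∃ B : ℝ, 0 ≤ B ∧ ∀ φ ∈ S, ∀ x, ‖iteratedFDeriv ℝ i φ x‖ ≤ B := by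
  obtain ⟨B, hB⟩ := (hS.image (testFunctionDeriv (F := F) i).continuous).isBounded.exists_norm_le
  refine ⟨max B 0, le_max_right _ _, fun φ hφ x => ?_⟩
  rw [← testFunctionDeriv_apply]
  exact ((BoundedContinuousFunction.norm_coe_le_norm _ x).trans
    (hB _ (mem_image_of_mem _ hφ))).trans (le_max_left _ _)

/-- A compact set of test functions has a common compact support. -/
lemma IsCompact.exists_common_support [LocallyCompactSpace E] [SecondCountableTopology E]
    {S : Set 𝓓(Ω, F)} (hS : IsCompact S) :
    ∃ K : TopologicalSpace.Compacts E, (K : Set E) ⊆ Ω ∧ ∀ φ ∈ S, tsupport φ ⊆ K := by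
  by_contra hcon
  push Not at hcon
  have : LocallyCompactSpace Ω := Ω.isOpen.locallyCompactSpace
  let c : CompactExhaustion Ω := CompactExhaustion.choice Ω
  let K (n : ℕ) : TopologicalSpace.Compacts E :=
    ⟨Subtype.val '' c n, (c.isCompact n).image continuous_subtype_val⟩
  have hKΩ (n : ℕ) : (K n : Set E) ⊆ Ω := by rintro _ ⟨y, -, rfl⟩; exact y.2
  have hex (L : TopologicalSpace.Compacts E) (hL : (L : Set E) ⊆ Ω) :
      ∃ m, ∀ n ≥ m, (L : Set E) ⊆ K n := by
    have hc : IsCompact (Subtype.val ⁻¹' (L : Set E) : Set Ω) :=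
      Topology.IsInducing.subtypeVal.isCompact_preimage_iff (by simpa using hL) |>.2 L.isCompact
    obtain ⟨m, hm⟩ := c.exists_superset_of_isCompact hc
    exact ⟨m, fun n hn x hx => ⟨⟨x, hL hx⟩, c.subset hn (hm hx), rfl⟩⟩
  -- Without a common support there are members `φ n` of `S` that do not vanish at points `x n`
  -- leaving every compact subset of `Ω`.
  have hch (n : ℕ) : ∃ φ ∈ S, ∃ x, φ x ≠ 0 ∧ x ∉ (K n : Set E) := by
    obtain ⟨φ, hφ, hn⟩ := hcon (K n) (hKΩ n)
    refine ⟨φ, hφ, ?_⟩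
    by_contra h
    push Not at h
    exact hn (closure_minimal (fun x hx => h x hx) (K n).isCompact.isClosed)
  choose φ hφ x hx0 hxK using hch
  -- The weights make the `n`-th entry of `T (φ n)` of norm `n`, where `T f` is the sequence `a n •
  -- f (x n)`.
  let a (n : ℕ) : ℝ := n / ‖φ n (x n)‖
  -- Only finitely many `x n` lie in `L`, so `T f` is a bounded sequence and `T` is continuous on
  -- each 𝓓_L. The image of `S` is then bounded, against the choice of weights.
  have hbd (L : TopologicalSpace.Compacts E) (hL : (L : Set E) ⊆ Ω) : ∃ C : ℝ, 0 ≤ C ∧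
      ∀ f : 𝓓_{L}(E, F), ∀ n, ‖a n • f (x n)‖ ≤ C * N[ℝ]_{L, 0} f := by
    obtain ⟨m, hm⟩ := hex L hL
    refine ⟨∑ n ∈ Finset.range m, ‖a n‖, by positivity, fun f n => ?_⟩
    by_cases hn : m ≤ n
    · rw [f.zero_on_compl (fun h => hxK n (hm n hn h))]
      simp only [Pi.zero_apply, smul_zero, norm_zero]; positivity
    · rw [norm_smul]
      gcongr
      · exact Finset.single_le_sum (f := fun n => ‖a n‖) (fun _ _ => norm_nonneg _)
          (Finset.mem_range.2 (not_le.1 hn))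
      · exact ContDiffMapSupportedIn.norm_apply_le_seminorm ℝ
  have hbd' (f : 𝓓(Ω, F)) : ∃ C : ℝ, ∀ n, ‖a n • f (x n)‖ ≤ C := by
    obtain ⟨C, -, h⟩ := hbd ⟨tsupport f, f.hasCompactSupport⟩ f.tsupport_subset
    exact ⟨_, fun n => h (f.toSupportedIn _ subset_rfl) n⟩
  choose D hD using hbd'
  let T : 𝓓(Ω, F) →L[ℝ] BoundedContinuousFunction ℕ F := TestFunction.mkCLM ℝ
    (fun f => BoundedContinuousFunction.ofNormedAddCommGroupDiscrete
      (fun n => a n • f (x n)) (D f) (hD f))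
    (fun f g => by ext n; simp)
    (fun r f => by ext n; simp [smul_comm r])
    (fun L hL => by
      obtain ⟨C, hC0, hC⟩ := hbd L hL
      refine (ContDiffMapSupportedIn.mkCLMtoNormedSpace (𝕜 := ℝ) (K := L) (n := ⊤)
        (fun f => BoundedContinuousFunction.ofNormedAddCommGroupDiscrete
          (fun n => a n • f (x n)) (D (TestFunction.ofSupportedIn hL f))
          (hD (TestFunction.ofSupportedIn hL f))) (fun f g => BoundedContinuousFunction.ext fun n => smul_add (a n) (f (x n)) (g (x n)))
        (fun r f => BoundedContinuousFunction.ext fun n => smul_comm (a n) r (f (x n))) ⟨{0}, C, hC0, fun f => ?_⟩).continuous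
      rw [BoundedContinuousFunction.norm_le (mul_nonneg hC0 (apply_nonneg _ _))]
      intro n
      exact (hC f n).trans_eq (by simp))
  obtain ⟨B, hB⟩ := (hS.image T.continuous).isBounded.exists_norm_le
  obtain ⟨n, hn⟩ := exists_nat_gt B
  have h1 := (BoundedContinuousFunction.norm_coe_le_norm (T (φ n)) n).trans
    (hB _ (mem_image_of_mem _ (hφ n)))
  have h2 : T (φ n) n = a n • φ n (x n) := rfl
  have h3 : ‖φ n (x n)‖ ≠ 0 := norm_ne_zero_iff.2 (hx0 n)
  rw [h2, norm_smul, Real.norm_of_nonneg (by positivity), div_mul_cancel₀ _ h3] at h1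
  exact absurd hn (not_lt.2 h1)

end CompactSets

/-! ### Superposition of test functions -/

section Superposition

variable {E : Type*} [NormedAddCommGroup E] [NormedSpace ℝ E]

/-- The bound makes `T` a continuous functional on the range of `j` with the norm of `X`;
Hahn–Banach extends it to `X`. -/
lemma LinearMap.exists_clm_comp_eq_of_bound {V X : Type*} [AddCommGroup V] [Module ℂ V]
    [NormedAddCommGroup X] [NormedSpace ℂ X] (T : V →ₗ[ℂ] ℂ) (j : V →ₗ[ℂ] X)
    (hj : Function.Injective j) (C : ℝ) (h : ∀ v, ‖T v‖ ≤ C * ‖j v‖) :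
    ∃ l : X →L[ℂ] ℂ, ∀ v, T v = l (j v) := by
  let e := LinearEquiv.ofInjective j hj
  have hb (y : LinearMap.range j) : ‖(T ∘ₗ e.symm.toLinearMap) y‖ ≤ C * ‖y‖ := by
    obtain ⟨φ, rfl⟩ := e.surjective y
    rw [LinearMap.comp_apply, LinearEquiv.coe_coe, LinearEquiv.symm_apply_apply]
    exact h φ
  let g : StrongDual ℂ (LinearMap.range j) :=
    LinearMap.mkContinuous (T ∘ₗ e.symm.toLinearMap) C hb
  obtain ⟨l, hl, -⟩ := exists_extension_norm_eq _ g
  refine ⟨l, fun φ => ?_⟩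
  have := hl (e φ)
  simp only [g, LinearMap.mkContinuous_apply, LinearMap.comp_apply, LinearEquiv.coe_coe,
    LinearEquiv.symm_apply_apply] at this
  exact this.symm

/-- A continuous functional on `𝓓_K` extends to finitely many derivatives. -/
lemma exists_extension_derivatives {K : TopologicalSpace.Compacts E} (T : 𝓓_{K}(E, ℂ) →L[ℂ] ℂ) :
    ∃ (s : Finset ℕ) (l : (∀ i : s, BoundedContinuousFunction E (E [×i]→L[ℝ] ℂ)) →L[ℂ] ℂ),
      ∀ φ, T φ = l (fun i => ContDiffMapSupportedIn.structureMapCLM ℂ ⊤ i φ) := by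
  obtain ⟨s', C, -, hC⟩ := Seminorm.bound_of_continuous
    (ContDiffMapSupportedIn.withSeminorms ℂ E ℂ ⊤ K) ((normSeminorm ℂ ℂ).comp T.toLinearMap)
    (continuous_norm.comp T.continuous)
  -- The order 0 is added so that the map to the derivatives is injective.
  let s : Finset ℕ := insert 0 s'
  let j : 𝓓_{K}(E, ℂ) →ₗ[ℂ] (∀ i : s, BoundedContinuousFunction E (E [×i]→L[ℝ] ℂ)) :=
    LinearMap.pi fun i => (ContDiffMapSupportedIn.structureMapCLM ℂ ⊤ i).toLinearMap
  have hj : Function.Injective j := by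
    intro f g hfg
    apply ContDiffMapSupportedIn.structureMapCLM_zero_injective ℂ
    exact congrFun hfg ⟨0, Finset.mem_insert_self _ _⟩
  have hbd (φ : 𝓓_{K}(E, ℂ)) : ‖T φ‖ ≤ C * ‖j φ‖ := by
    refine (hC φ).trans ?_
    rw [smul_apply]
    refine mul_le_mul_of_nonneg_left ?_ C.2
    refine Seminorm.finset_sup_apply_le (norm_nonneg _) fun i hi => ?_
    exact norm_le_pi_norm (j φ) ⟨i, Finset.mem_insert_of_mem hi⟩
  obtain ⟨l, hl⟩ := LinearMap.exists_clm_comp_eq_of_bound T.toLinearMap j hj C hbd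
  exact ⟨s, l, hl⟩

/-- A superposition `∫ a(p) Φ(p) dμ(p)` of test functions is a test function, and continuous
functionals commute with it. -/
lemma exists_superposition {P : Type*} [MeasurableSpace P] {μ : Measure P}
    {K : TopologicalSpace.Compacts E} (Φ : P → 𝓓_{K}(E, ℂ)) (a : P → ℂ)
    (hint : ∀ i, Integrable
      (fun p => a p • ContDiffMapSupportedIn.structureMapCLM ℂ ⊤ i (Φ p)) μ) :
    ∃ Ψ : 𝓓_{K}(E, ℂ), (∀ x, Ψ x = ∫ p, a p * Φ p x ∂μ) ∧
      (∀ i x, ‖iteratedFDeriv ℝ i Ψ x‖ ≤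
        ∫ p, ‖a p • ContDiffMapSupportedIn.structureMapCLM ℂ ⊤ i (Φ p)‖ ∂μ) ∧
      ∀ T : 𝓓_{K}(E, ℂ) →L[ℂ] ℂ, T Ψ = ∫ p, a p * T (Φ p) ∂μ := by
  let S (i : ℕ) (p : P) : BoundedContinuousFunction E (E [×i]→L[ℝ] ℂ) :=
    a p • ContDiffMapSupportedIn.structureMapCLM ℂ ⊤ i (Φ p)
  have hSx (i : ℕ) (p : P) (x : E) : S i p x = a p • iteratedFDeriv ℝ i (Φ p) x :=
    congrArg (a p • ·) (congrFun (ContDiffMapSupportedIn.structureMapCLM_top_apply ℂ (Φ p)) x)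
  let ev (i : ℕ) (x : E) : BoundedContinuousFunction E (E [×i]→L[ℝ] ℂ) →L[ℝ] (E [×i]→L[ℝ] ℂ) :=
    BoundedContinuousFunction.evalCLM ℝ x
  have hB (i : ℕ) (x : E) : (∫ p, S i p ∂μ) x = ∫ p, S i p x ∂μ :=
    ((ev i x).integral_comp_comm (hint i)).symm
  have hint' (i : ℕ) (x : E) : Integrable (fun p => S i p x) μ := (ev i x).integrable_comp (hint i)
  -- The derivatives are integrated as Bochner integrals with values in bounded continuous
  -- functions. Differentiation under the integral is dominated by the sup norm of the next
  -- derivative, which `hint` makes integrable.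
  have hT : HasFTaylorSeriesUpTo ∞ (fun x => ∫ p, a p * Φ p x ∂μ)
      (fun x i => (∫ p, S i p ∂μ) x) := by
    refine ⟨fun x => ?_, fun m _ x => ?_, fun m _ => (∫ p, S m p ∂μ).continuous⟩
    · change (continuousMultilinearCurryFin0 ℝ E ℂ) ((∫ p, S 0 p ∂μ) x) = _
      rw [hB]
      have := (continuousMultilinearCurryFin0 ℝ E ℂ).toContinuousLinearEquiv.toContinuousLinearMap
        |>.integral_comp_comm (hint' 0 x)
      refine this.symm.trans (integral_congr_ae (Eventually.of_forall fun p => ?_))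
      change (S 0 p x).curry0 = _
      rw [hSx]
      simp
    · simp only [hB]
      have hL : ((∫ p, S (m + 1) p x ∂μ).curryLeft) = ∫ p, (S (m + 1) p x).curryLeft ∂μ :=
        ((continuousMultilinearCurryLeftEquiv ℝ (fun _ : Fin (m + 1) => E) ℂ
          ).toContinuousLinearEquiv.toContinuousLinearMap.integral_comp_comm
            (hint' (m + 1) x)).symm
      change HasFDerivAt _ ((∫ p, S (m + 1) p x ∂μ).curryLeft) x
      rw [hL]
      refine hasFDerivAt_integral_of_dominated_of_fderiv_le (s := univ)
        (F := fun y p => S m p y) (F' := fun y p => (S (m + 1) p y).curryLeft) (bound := fun p => ‖S (m + 1) p‖) univ_mem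
        (Eventually.of_forall fun y => (hint' m y).1) (hint' m x)
        ((continuousMultilinearCurryLeftEquiv ℝ (fun _ : Fin (m + 1) => E) ℂ
          ).toContinuousLinearEquiv.toContinuousLinearMap.integrable_comp
            (hint' (m + 1) x)).1 (Eventually.of_forall fun p y _ => ?_) (hint (m + 1)).norm
        (Eventually.of_forall fun p y _ => ?_)
      · rw [ContinuousMultilinearMap.curryLeft_norm]
        exact BoundedContinuousFunction.norm_coe_le_norm _ y
      · simp only [hSx]
        have h1 : HasFDerivAt (iteratedFDeriv ℝ m (Φ p))
            (iteratedFDeriv ℝ (m + 1) (Φ p) y).curryLeft y := by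
          have hd : DifferentiableAt ℝ (iteratedFDeriv ℝ m (Φ p)) y :=
            ((Φ p).contDiff.differentiable_iteratedFDeriv
              (by exact_mod_cast WithTop.coe_lt_top m)).differentiableAt
          have := hd.hasFDerivAt
          rwa [fderiv_iteratedFDeriv] at this
        exact h1.const_smul (a p)
  have hzero (x : E) (hx : x ∉ K) : ∫ p, a p * Φ p x ∂μ = 0 := by
    simp [(Φ _).zero_on_compl hx]
  let Ψ : 𝓓_{K}(E, ℂ) := ⟨fun x => ∫ p, a p * Φ p x ∂μ, hT.contDiff, hzero⟩
  have hΨ (i : ℕ) : ContDiffMapSupportedIn.structureMapCLM ℂ ⊤ i Ψ = ∫ p, S i p ∂μ := by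
    ext1 x
    rw [congrFun (ContDiffMapSupportedIn.structureMapCLM_top_apply ℂ Ψ) x]
    exact (hT.eq_iteratedFDeriv (by exact_mod_cast le_top) x).symm
  refine ⟨Ψ, fun x => rfl, fun i x => ?_, fun T => ?_⟩
  · rw [← congrFun (ContDiffMapSupportedIn.structureMapCLM_top_apply ℂ Ψ) x, hΨ]
    exact (BoundedContinuousFunction.norm_coe_le_norm _ x).trans (norm_integral_le_integral_norm _)
  -- As 𝓓_K is not normed, `T` is first extended to a finite product of Banach spaces, where
  -- continuous functionals commute with the Bochner integral.
  · obtain ⟨s, l, hl⟩ := exists_extension_derivatives T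
    have hi : Integrable (fun p => (fun i : s => S i p)) μ :=
      Integrable.of_eval (f := fun p (i : s) => S i p) fun i => hint i
    rw [hl]
    have h1 : (fun i : s => ContDiffMapSupportedIn.structureMapCLM ℂ ⊤ i Ψ) =
        ∫ p, (fun i : s => S i p) ∂μ := by
      ext1 i
      rw [hΨ, eval_integral (f := fun p (i : s) => S i p) fun i => hint i]
    rw [h1, ← l.integral_comp_comm hi]
    refine integral_congr_ae (Eventually.of_forall fun p => ?_)
    change l (fun i : s => S i p) = a p * T (Φ p)
    rw [hl, ← smul_eq_mul, ← map_smul]; rfl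

end Superposition

/-! ### Growth of the localized Fourier transform -/

section Growth

variable {E : Type*} [NormedAddCommGroup E] [InnerProductSpace ℝ E]

lemma iteratedDeriv_cexp_mul_ofReal (n : ℕ) (c : ℂ) :
    iteratedDeriv n (fun s : ℝ => Complex.exp (c * s)) = fun s : ℝ => c ^ n * Complex.exp (c * s) := by
  induction n with
  | zero => simp
  | succ n ih =>
    rw [iteratedDeriv_succ, ih]
    ext s
    have h : HasDerivAt (fun s : ℝ => c ^ n * Complex.exp (c * s))
        (c ^ n * (Complex.exp (c * s) * (c * 1))) s :=
      (((Complex.ofRealCLM.hasDerivAt (x := s)).const_mul c).cexp).const_mul _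
    rw [h.deriv]; ring

lemma norm_iteratedFDeriv_planeWave_le (n : ℕ) (ξ x : E) :
    ‖iteratedFDeriv ℝ n (planeWave ξ) x‖ ≤ ‖ξ‖ ^ n := by
  have h : planeWave ξ = (fun s : ℝ => Complex.exp (-Complex.I * s)) ∘ (innerSL ℝ ξ) := by
    ext y; simp [planeWave, real_inner_comm]
  have hs : ContDiff ℝ ∞ (fun s : ℝ => Complex.exp (-Complex.I * s)) :=
    (contDiff_const.mul Complex.ofRealCLM.contDiff).cexp
  rw [h, ContinuousLinearMap.iteratedFDeriv_comp_right _ hs _ (by exact_mod_cast le_top)]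
  refine (ContinuousMultilinearMap.norm_compContinuousLinearMap_le _ _).trans ?_
  rw [norm_iteratedFDeriv_eq_norm_iteratedDeriv, iteratedDeriv_cexp_mul_ofReal]
  have h1 : ‖Complex.exp (-Complex.I * (innerSL ℝ ξ x : ℝ))‖ = 1 := by
    rw [← Complex.norm_exp_ofReal_mul_I (-(innerSL ℝ ξ x))]; congr 2; push_cast; ring
  rw [norm_mul, h1]
  simp

/-- By the Leibniz rule `n` derivatives of a modulated function cost at most `n` powers of the
frequency. This is the source of the polynomial growth of localized Fourier transforms. -/
lemma exists_norm_iteratedFDeriv_modulate_le {f : E → ℂ} (hf : ContDiff ℝ ∞ f)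
    (hc : HasCompactSupport f) (n : ℕ) : ∃ C : ℝ, 0 ≤ C ∧ ∀ ξ x : E,
      ‖iteratedFDeriv ℝ n (fun x => f x * planeWave ξ x) x‖ ≤ C * (1 + ‖ξ‖) ^ n := by
  have hb (i : ℕ) : ∃ B : ℝ, 0 ≤ B ∧ ∀ x, ‖iteratedFDeriv ℝ i f x‖ ≤ B := by
    obtain ⟨B, hB⟩ := (hf.continuous_iteratedFDeriv
      (by exact_mod_cast le_top : (i : WithTop ℕ∞) ≤ ∞)).bounded_above_of_compact_support
        (hc.iteratedFDeriv i)
    exact ⟨max B 0, le_max_right _ _, fun x => (hB x).trans (le_max_left _ _)⟩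
  choose B hB0 hB using hb
  refine ⟨∑ i ∈ Finset.range (n + 1), n.choose i * B i,
    Finset.sum_nonneg fun i _ => mul_nonneg (Nat.cast_nonneg _) (hB0 i), fun ξ x => ?_⟩
  refine (norm_iteratedFDeriv_mul_le hf (contDiff_planeWave ξ) x
    (by exact_mod_cast le_top)).trans ?_
  rw [Finset.sum_mul]
  refine Finset.sum_le_sum fun i hi => ?_
  have h1 : ‖iteratedFDeriv ℝ (n - i) (planeWave ξ) x‖ ≤ (1 + ‖ξ‖) ^ n :=
    (norm_iteratedFDeriv_planeWave_le _ _ _).trans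
      ((pow_le_pow_left₀ (norm_nonneg _) (by linarith) _).trans
        (pow_le_pow_right₀ (by linarith [norm_nonneg ξ]) (Nat.sub_le _ _)))
  exact mul_le_mul (mul_le_mul_of_nonneg_left (hB i x) (Nat.cast_nonneg _)) h1 (norm_nonneg _)
    (mul_nonneg (Nat.cast_nonneg _) (hB0 i))

/-- The modulations of a test function, as elements of `𝓓_K`. -/
def modulateIn (θ : 𝓓((⊤ : TopologicalSpace.Opens E), ℂ)) (ξ : E) :
    𝓓_{(⟨tsupport θ, θ.hasCompactSupport⟩ : TopologicalSpace.Compacts E)}(E, ℂ) :=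
  smoothFamily _ (fun p : E × E => θ p.1 * planeWave p.2 p.1)
    ((θ.contDiff.comp contDiff_fst).mul contDiff_planeWave_uncurry)
    (fun ξ x hx => by
      change θ x * planeWave ξ x = 0
      rw [image_eq_zero_of_notMem_tsupport hx, zero_mul]) ξ

lemma continuous_modulateIn (θ : 𝓓((⊤ : TopologicalSpace.Opens E), ℂ)) :
    Continuous (modulateIn θ) := by
  unfold modulateIn
  exact continuous_smoothFamily _ _ _ _

lemma exists_norm_structureMapCLM_modulateIn_le (θ : 𝓓((⊤ : TopologicalSpace.Opens E), ℂ))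
    (i : ℕ) : ∃ C : ℝ, 0 ≤ C ∧ ∀ ξ,
      ‖ContDiffMapSupportedIn.structureMapCLM ℂ ⊤ i (modulateIn θ ξ)‖ ≤ C * (1 + ‖ξ‖) ^ i := by
  obtain ⟨C, hC0, hC⟩ := exists_norm_iteratedFDeriv_modulate_le θ.contDiff θ.hasCompactSupport i
  refine ⟨C, hC0, fun ξ => (BoundedContinuousFunction.norm_le (by positivity)).2 fun x => ?_⟩
  rw [congrFun (ContDiffMapSupportedIn.structureMapCLM_top_apply ℂ _) x]
  exact hC ξ x

/-- The continuous functional on `𝓓_K` defined by a distribution. -/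
def cextIn (u : 𝓓'((⊤ : TopologicalSpace.Opens E), ℂ)) (K : TopologicalSpace.Compacts E) :
    𝓓_{K}(E, ℂ) →L[ℂ] ℂ where
  toLinearMap := cext u ∘ₗ
    (TestFunction.ofSupportedInCLM ℂ (Ω := ⊤) (subset_univ (K : Set E))).toLinearMap
  cont := (continuous_cext u).comp (TestFunction.continuous_ofSupportedIn (subset_univ _))

lemma continuous_cext_modulate (u : 𝓓'((⊤ : TopologicalSpace.Opens E), ℂ))
    (θ : 𝓓((⊤ : TopologicalSpace.Opens E), ℂ)) : Continuous fun ξ => cext u (θ.modulate ξ) :=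
  (cextIn u _).continuous.comp (continuous_modulateIn θ)

lemma exists_norm_le_of_clm {K : TopologicalSpace.Compacts E} (T : 𝓓_{K}(E, ℂ) →L[ℂ] ℂ) :
    ∃ (C : ℝ) (s : Finset ℕ), 0 ≤ C ∧ ∀ φ, ‖T φ‖ ≤
      C * ∑ i ∈ s, ‖ContDiffMapSupportedIn.structureMapCLM ℂ ⊤ i φ‖ := by
  obtain ⟨s, C, -, hC⟩ := Seminorm.bound_of_continuous
    (ContDiffMapSupportedIn.withSeminorms ℂ E ℂ ⊤ K) ((normSeminorm ℂ ℂ).comp T.toLinearMap)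
    (continuous_norm.comp T.continuous)
  refine ⟨C, s, C.2, fun φ => (hC φ).trans ?_⟩
  rw [smul_apply]
  refine mul_le_mul_of_nonneg_left ?_ C.2
  refine Seminorm.finset_sup_apply_le (by positivity) fun i hi => ?_
  exact Finset.single_le_sum (f := fun i => ‖ContDiffMapSupportedIn.structureMapCLM ℂ ⊤ i φ‖)
    (fun _ _ => norm_nonneg _) hi

/-- The localized Fourier transform of a distribution has at most polynomial growth. -/
lemma exists_norm_cext_modulate_le (u : 𝓓'((⊤ : TopologicalSpace.Opens E), ℂ))
    (θ : 𝓓((⊤ : TopologicalSpace.Opens E), ℂ)) :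
    ∃ (C : ℝ) (M : ℕ), 0 ≤ C ∧ ∀ ξ, ‖cext u (θ.modulate ξ)‖ ≤ C * (1 + ‖ξ‖) ^ M := by
  obtain ⟨C, s, hC0, hC⟩ := exists_norm_le_of_clm (cextIn u ⟨tsupport θ, θ.hasCompactSupport⟩)
  choose D hD0 hD using exists_norm_structureMapCLM_modulateIn_le θ
  refine ⟨C * ∑ i ∈ s, D i, s.sup id, mul_nonneg hC0 (Finset.sum_nonneg fun i _ => hD0 i), fun ξ => ?_⟩
  refine (hC (modulateIn θ ξ)).trans ?_
  rw [mul_assoc, Finset.sum_mul]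
  refine mul_le_mul_of_nonneg_left (Finset.sum_le_sum fun i hi => (hD i ξ).trans ?_) hC0
  exact mul_le_mul_of_nonneg_left (pow_le_pow_right₀ (by linarith [norm_nonneg ξ])
    (Finset.le_sup (f := id) hi)) (hD0 i)

end Growth

/-! ### Weighted integrability -/

section Moments

variable {E : Type*} [NormedAddCommGroup E] [InnerProductSpace ℝ E] [FiniteDimensional ℝ E]
  [MeasurableSpace E] [BorelSpace E]

/-- Peetre's inequality in its simplest form: it trades a weight at `η` for a weight at `ζ`. -/
lemma one_add_norm_le_mul (ζ η : E) : 1 + ‖η‖ ≤ (1 + ‖ζ‖) * (1 + ‖ζ - η‖) := by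
  have h : ‖η‖ ≤ ‖ζ‖ + ‖ζ - η‖ := by
    simpa [norm_sub_rev] using norm_add_le ζ (η - ζ)
  nlinarith [norm_nonneg ζ, norm_nonneg (ζ - η)]

/-- `a` is integrable against all polynomials. -/
structure HasMoments (a : E → ℂ) : Prop where
  meas : AEStronglyMeasurable a volume
  integrable : ∀ M : ℕ, Integrable fun ζ => (1 + ‖ζ‖) ^ M * ‖a ζ‖

/-- `ψ` decays faster than all powers. -/
def RapidDecay (ψ : E → ℂ) : Prop := ∀ M : ℕ, ∃ C : ℝ, ∀ ζ, (1 + ‖ζ‖) ^ M * ‖ψ ζ‖ ≤ C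

/-- An exponent for which `(1 + |ζ|)^{-r}` is integrable. -/
def intExp (E : Type*) [NormedAddCommGroup E] [InnerProductSpace ℝ E] : ℕ :=
  Module.finrank ℝ E + 1

lemma integrable_inv_one_add_norm_pow : Integrable fun ζ : E => ((1 + ‖ζ‖) ^ intExp E)⁻¹ := by
  have := integrable_one_add_norm (E := E) (μ := volume) (r := (intExp E : ℝ))
    (by simp [intExp])
  refine this.congr (Eventually.of_forall fun ζ => ?_)
  simp only
  rw [Real.rpow_neg (by positivity), Real.rpow_natCast]

lemma RapidDecay.exists_le {ψ : E → ℂ} (h : RapidDecay ψ) (M : ℕ) :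
    ∃ C : ℝ, 0 ≤ C ∧ ∀ ζ, (1 + ‖ζ‖) ^ M * ‖ψ ζ‖ ≤ C * ((1 + ‖ζ‖) ^ intExp E)⁻¹ := by
  obtain ⟨C, hC⟩ := h (M + intExp E)
  refine ⟨C, le_trans (by positivity) (hC 0), fun ζ => ?_⟩
  rw [← div_eq_mul_inv, le_div_iff₀ (by positivity)]
  refine le_trans (le_of_eq ?_) (hC ζ)
  rw [pow_add]; ring

lemma RapidDecay.hasMoments {ψ : E → ℂ} (h : RapidDecay ψ) (hm : AEStronglyMeasurable ψ volume) :
    HasMoments ψ := by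
  refine ⟨hm, fun M => ?_⟩
  obtain ⟨C, -, hC⟩ := h.exists_le M
  refine (integrable_inv_one_add_norm_pow.const_mul C).mono'
    ((by fun_prop : Continuous fun ζ : E => (1 + ‖ζ‖) ^ M).aestronglyMeasurable.mul hm.norm)
    (Eventually.of_forall fun ζ => ?_)
  rw [Real.norm_of_nonneg (by positivity)]
  exact hC ζ

lemma HasMoments.integrable_mul {a : E → ℂ} (ha : HasMoments a) {f : E → ℂ}
    (hf : AEStronglyMeasurable f volume) {C : ℝ} {M : ℕ}
    (h : ∀ ζ, ‖f ζ‖ ≤ C * (1 + ‖ζ‖) ^ M) : Integrable fun ζ => a ζ * f ζ := by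
  refine ((ha.integrable M).const_mul C).mono' (ha.meas.mul hf) (Eventually.of_forall fun ζ => ?_)
  rw [norm_mul]
  calc _ ≤ ‖a ζ‖ * (C * (1 + ‖ζ‖) ^ M) := mul_le_mul_of_nonneg_left (h ζ) (norm_nonneg _)
    _ = _ := by ring

/-- Convolution of a rapidly decaying function with a function of polynomial growth that decays
near `η`. -/
lemma exists_conv_bound {ψ : E → ℂ} (hψ : RapidDecay ψ) (M N : ℕ) {c : ℝ} (hc : 0 < c) :
    ∃ C : ℝ, 0 ≤ C ∧ ∀ (f : E → ℂ) (A : ℝ) (W : Set E), 0 ≤ A →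
      (∀ ζ, ‖f ζ‖ ≤ A * (1 + ‖ζ‖) ^ M) → (∀ ζ ∈ W, (1 + ‖ζ‖) ^ N * ‖f ζ‖ ≤ A) →
      ∀ η, (∀ ζ, ‖ζ - η‖ < c * ‖η‖ → ζ ∈ W) →
        (1 + ‖η‖) ^ N * ‖∫ ζ, ψ (ζ - η) * f ζ‖ ≤ C * A := by
  -- With r = 1 + |ζ - η|: near `η` Peetre's inequality moves the weight to `ζ`, where `f` decays,
  -- at the price of r^N. Far from `η` one has 1 + |η| ≤ (1 + 1/c) r, so the weight and the growth
  -- of `f` are both absorbed in r^(N+2M). The exponent covers the two cases.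
  obtain ⟨C, hC0, hC⟩ := hψ.exists_le (N + 2 * M + N)
  let D : ℝ := (1 + 1 / c) ^ (N + M)
  have hD1 : 1 ≤ D := one_le_pow₀ (by have : 0 < 1 / c := by positivity
                                      linarith)
  refine ⟨D * C * ∫ ζ : E, ((1 + ‖ζ‖) ^ intExp E)⁻¹, ?_, fun f A W hA hf hW η hη => ?_⟩
  · have : 0 ≤ ∫ ζ : E, ((1 + ‖ζ‖) ^ intExp E)⁻¹ := integral_nonneg fun ζ => by positivity
    positivity
  have key (ζ : E) : (1 + ‖η‖) ^ N * ‖f ζ‖ ≤ D * A * (1 + ‖ζ - η‖) ^ (N + 2 * M + N) := by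
    set h := 1 + ‖η‖
    set z := 1 + ‖ζ‖
    set r := 1 + ‖ζ - η‖
    have hr1 : 1 ≤ r := by simp [r]
    have hz0 : 0 ≤ z := by positivity
    have hh0 : 0 ≤ h := by positivity
    have h1 : h ≤ z * r := one_add_norm_le_mul ζ η
    have h2 : z ≤ h * r := by
      have := one_add_norm_le_mul η ζ
      rwa [norm_sub_rev] at this
    by_cases hlt : ‖ζ - η‖ < c * ‖η‖
    · calc h ^ N * ‖f ζ‖ ≤ (z * r) ^ N * ‖f ζ‖ := by gcongr
        _ = z ^ N * ‖f ζ‖ * r ^ N := by rw [mul_pow]; ring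
        _ ≤ A * r ^ N := by gcongr; exact hW ζ (hη ζ hlt)
        _ ≤ D * A * r ^ (N + 2 * M + N) := by
          gcongr
          · exact le_mul_of_one_le_left hA hD1
          · omega
    · have h3 : h ≤ (1 + 1 / c) * r := by
        have : ‖η‖ ≤ 1 / c * ‖ζ - η‖ := by
          rw [one_div, ← div_eq_inv_mul, le_div_iff₀ hc]; linarith
        have h4 : 0 < 1 / c := by positivity
        simp only [h, r]; nlinarith [norm_nonneg (ζ - η)]
      calc h ^ N * ‖f ζ‖ ≤ h ^ N * (A * z ^ M) := by gcongr; exact hf ζ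
        _ ≤ h ^ N * (A * (h * r) ^ M) := by gcongr
        _ = A * h ^ (N + M) * r ^ M := by rw [mul_pow, pow_add]; ring
        _ ≤ A * ((1 + 1 / c) * r) ^ (N + M) * r ^ M := by gcongr
        _ = D * A * r ^ (N + 2 * M) := by rw [mul_pow]; ring
        _ ≤ D * A * r ^ (N + 2 * M + N) :=
          mul_le_mul_of_nonneg_left (pow_le_pow_right₀ hr1 (by omega)) (by positivity)
  have hint : Integrable fun ζ : E => D * A * C * ((1 + ‖ζ - η‖) ^ intExp E)⁻¹ :=
    (integrable_inv_one_add_norm_pow.comp_sub_right η).const_mul _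
  have hle : ‖∫ ζ, ((1 + ‖η‖) ^ N : ℝ) • (ψ (ζ - η) * f ζ)‖ ≤
      ∫ ζ : E, D * A * C * ((1 + ‖ζ - η‖) ^ intExp E)⁻¹ := by
    refine norm_integral_le_of_norm_le hint (Eventually.of_forall fun ζ => ?_)
    rw [norm_smul, norm_mul, Real.norm_of_nonneg (by positivity)]
    calc _ = ‖ψ (ζ - η)‖ * ((1 + ‖η‖) ^ N * ‖f ζ‖) := by ring
      _ ≤ ‖ψ (ζ - η)‖ * (D * A * (1 + ‖ζ - η‖) ^ (N + 2 * M + N)) := by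
        exact mul_le_mul_of_nonneg_left (key ζ) (norm_nonneg _)
      _ = D * A * ((1 + ‖ζ - η‖) ^ (N + 2 * M + N) * ‖ψ (ζ - η)‖) := by ring
      _ ≤ D * A * (C * ((1 + ‖ζ - η‖) ^ intExp E)⁻¹) := by
        exact mul_le_mul_of_nonneg_left (hC _) (by positivity)
      _ = _ := by ring
  rw [integral_smul, norm_smul, Real.norm_of_nonneg (by positivity), integral_const_mul,
    integral_sub_right_eq_self (fun ζ : E => ((1 + ‖ζ‖) ^ intExp E)⁻¹) η] at hle
  linarith

/-- `θ` times the Fourier integral of a function with moments is a test function, and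
distributions commute with the integral. -/
lemma exists_testFunction_fourierIntegral (θ : 𝓓((⊤ : TopologicalSpace.Opens E), ℂ)) {a : E → ℂ}
    (ha : HasMoments a) : ∃ Ψ : 𝓓((⊤ : TopologicalSpace.Opens E), ℂ),
      (∀ x, Ψ x = θ x * ∫ ζ, a ζ * planeWave ((2 * Real.pi) • ζ) x) ∧
      (∀ i x, ‖iteratedFDeriv ℝ i Ψ x‖ ≤ ∫ ζ, ‖a ζ‖ *
        ‖ContDiffMapSupportedIn.structureMapCLM ℂ ⊤ i (modulateIn θ ((2 * Real.pi) • ζ))‖) ∧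
      ∀ u, cext u Ψ = ∫ ζ, a ζ * cext u (θ.modulate ((2 * Real.pi) • ζ)) := by
  have hint (i : ℕ) : Integrable fun ζ => a ζ • ContDiffMapSupportedIn.structureMapCLM ℂ ⊤ i
      (modulateIn θ ((2 * Real.pi) • ζ)) := by
    obtain ⟨C, hC0, hC⟩ := exists_norm_structureMapCLM_modulateIn_le θ i
    have hcont : Continuous fun ζ : E => ContDiffMapSupportedIn.structureMapCLM ℂ ⊤ i
        (modulateIn θ ((2 * Real.pi) • ζ)) :=
      (ContDiffMapSupportedIn.structureMapCLM ℂ ⊤ i).continuous.comp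
        ((continuous_modulateIn θ).comp (continuous_const_smul _))
    refine ((ha.integrable i).const_mul (C * (2 * Real.pi) ^ i)).mono'
      (ha.meas.smul hcont.aestronglyMeasurable) (Eventually.of_forall fun ζ => ?_)
    rw [norm_smul]
    have h2π : 1 ≤ 2 * Real.pi := by linarith [Real.two_le_pi]
    have h1 : 1 + ‖(2 * Real.pi) • ζ‖ ≤ 2 * Real.pi * (1 + ‖ζ‖) := by
      rw [norm_smul, Real.norm_of_nonneg (by positivity)]; linarith
    calc _ ≤ ‖a ζ‖ * (C * (1 + ‖(2 * Real.pi) • ζ‖) ^ i) := by gcongr; exact hC _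
      _ ≤ ‖a ζ‖ * (C * (2 * Real.pi * (1 + ‖ζ‖)) ^ i) := by gcongr
      _ = _ := by rw [mul_pow]; ring
  obtain ⟨Ψ, hΨ, hb, hT⟩ := exists_superposition (μ := volume)
    (fun ζ => modulateIn θ ((2 * Real.pi) • ζ)) a hint
  refine ⟨TestFunction.ofSupportedIn (Ω := ⊤) (subset_univ _) Ψ, fun x => ?_, fun i x => ?_,
    fun u => hT (cextIn u _)⟩
  · refine (hΨ x).trans ?_
    rw [← integral_const_mul]
    refine integral_congr_ae (Eventually.of_forall fun ζ => ?_)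
    change a ζ * (θ x * planeWave _ x) = θ x * (a ζ * planeWave _ x)
    ring
  · refine (hb i x).trans_eq ?_
    simp only [norm_smul]

end Moments

/-! ### Fourier inversion for test functions -/

section Inversion

open scoped FourierTransform SchwartzMap

variable {E : Type*} [NormedAddCommGroup E] [InnerProductSpace ℝ E] [FiniteDimensional ℝ E]
  [MeasurableSpace E] [BorelSpace E]

/-- A test function as a Schwartz function. -/
def TestFunction.toSchwartz (φ : 𝓓((⊤ : TopologicalSpace.Opens E), ℂ)) : 𝓢(E, ℂ) :=
  φ.hasCompactSupport.toSchwartzMap φ.contDiff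

@[simp] lemma toSchwartz_apply (φ : 𝓓((⊤ : TopologicalSpace.Opens E), ℂ)) (x : E) :
    φ.toSchwartz x = φ x := rfl

/-- The inverse Fourier transform of a test function. -/
def invF (φ : 𝓓((⊤ : TopologicalSpace.Opens E), ℂ)) (ζ : E) : ℂ := (𝓕⁻ φ.toSchwartz) ζ

lemma invF_eq (φ : 𝓓((⊤ : TopologicalSpace.Opens E), ℂ)) (ζ : E) :
    invF φ ζ = ∫ x, φ x * planeWave (-(2 * Real.pi) • ζ) x := by
  rw [invF, SchwartzMap.fourierInv_coe, Real.fourierInv_eq']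
  refine integral_congr_ae (Eventually.of_forall fun x => ?_)
  simp only [planeWave, inner_smul_right, toSchwartz_apply, smul_eq_mul]
  rw [mul_comm]; congr 2; push_cast; ring

lemma integral_invF_mul_planeWave (φ : 𝓓((⊤ : TopologicalSpace.Opens E), ℂ)) (x : E) :
    ∫ ζ, invF φ ζ * planeWave ((2 * Real.pi) • ζ) x = φ x := by
  have h : (𝓕 (𝓕⁻ φ.toSchwartz)) x = φ x := by
    rw [FourierTransform.fourier_fourierInv_eq]; rfl
  rw [← h, SchwartzMap.fourier_coe, Real.fourier_eq']
  refine integral_congr_ae (Eventually.of_forall fun ζ => ?_)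
  simp only [planeWave, inner_smul_right, smul_eq_mul, invF]
  rw [mul_comm, real_inner_comm]; congr 2; push_cast; ring

lemma continuous_invF (φ : 𝓓((⊤ : TopologicalSpace.Opens E), ℂ)) : Continuous (invF φ) :=
  (𝓕⁻ φ.toSchwartz).continuous

lemma rapidDecay_invF (φ : 𝓓((⊤ : TopologicalSpace.Opens E), ℂ)) : RapidDecay (invF φ) := by
  intro M
  refine ⟨2 ^ M * (Finset.Iic (M, 0)).sup (fun m => SchwartzMap.seminorm ℝ m.1 m.2)
    (𝓕⁻ φ.toSchwartz), fun ζ => ?_⟩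
  have := SchwartzMap.one_add_le_sup_seminorm_apply (𝕜 := ℝ) (m := (M, 0)) le_rfl le_rfl
    (𝓕⁻ φ.toSchwartz) ζ
  rw [norm_iteratedFDeriv_zero] at this
  exact this

lemma hasMoments_invF (φ : 𝓓((⊤ : TopologicalSpace.Opens E), ℂ)) : HasMoments (invF φ) :=
  (rapidDecay_invF φ).hasMoments (continuous_invF φ).aestronglyMeasurable

/-- Modulation shifts the frequency. The factor 1/2π appears because `planeWave` carries no 2π in
its exponent whereas the Fourier transform does. -/
lemma invF_modulate (φ : 𝓓((⊤ : TopologicalSpace.Opens E), ℂ)) (η ζ : E) :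
    invF (φ.modulate η) ζ = invF φ (ζ - (2 * Real.pi)⁻¹ • η) := by
  rw [invF_eq, invF_eq]
  refine integral_congr_ae (Eventually.of_forall fun x => ?_)
  simp only [modulate_apply]
  rw [mul_assoc, ← planeWave_add_left]
  congr 2
  have := Real.pi_pos.ne'
  rw [smul_sub, smul_smul]
  have : (-(2 * Real.pi) * (2 * Real.pi)⁻¹) = -1 := by field_simp
  rw [this]; simp only [neg_smul, one_smul]; abel

/-- Fourier inversion formula for the pairing of a distribution with a test function. -/
lemma cext_eq_integral (u : 𝓓'((⊤ : TopologicalSpace.Opens E), ℂ))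
    (θ φ : 𝓓((⊤ : TopologicalSpace.Opens E), ℂ)) (h : ∀ x, θ x * φ x = φ x) :
    cext u φ = ∫ ζ, invF φ ζ * cext u (θ.modulate ((2 * Real.pi) • ζ)) := by
  -- Inversion writes `φ` as a superposition of plane waves. Multiplication by `θ` leaves `φ`
  -- unchanged and turns each plane wave into a test function.
  obtain ⟨Ψ, hΨ, -, hu⟩ := exists_testFunction_fourierIntegral θ (hasMoments_invF φ)
  rw [← hu]
  congr 1
  ext x
  rw [hΨ, integral_invF_mul_planeWave, h]

/-- The localized Fourier transform for `φ` is the convolution of the one for `θ` with a rapidly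
decaying function; this transports decay estimates between cut-offs. -/
lemma cext_modulate_eq_integral (u : 𝓓'((⊤ : TopologicalSpace.Opens E), ℂ))
    (θ φ : 𝓓((⊤ : TopologicalSpace.Opens E), ℂ)) (h : ∀ x, θ x * φ x = φ x) (η : E) :
    cext u (φ.modulate η) = ∫ ζ, invF φ (ζ - (2 * Real.pi)⁻¹ • η) *
      cext u (θ.modulate ((2 * Real.pi) • ζ)) := by
  rw [cext_eq_integral u θ (φ.modulate η) fun x => by rw [modulate_apply, ← mul_assoc, h]]
  simp only [invF_modulate]

/-- The inverse Fourier transform of test functions with a common support is bounded in terms of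
finitely many derivatives. -/
lemma exists_invF_bound (K : Set E) (hK : IsCompact K) (M : ℕ) :
    ∃ (C : ℝ) (m : ℕ), 0 ≤ C ∧ ∀ φ : 𝓓((⊤ : TopologicalSpace.Opens E), ℂ), tsupport φ ⊆ K →
      ∀ B : ℝ, (∀ i ≤ m, ∀ x, ‖iteratedFDeriv ℝ i φ x‖ ≤ B) →
        ∀ ζ, (1 + ‖ζ‖) ^ M * ‖invF φ ζ‖ ≤ C * B := by
  let q : Seminorm ℂ 𝓢(E, ℂ) := (Finset.Iic (M, 0)).sup fun m => SchwartzMap.seminorm ℂ m.1 m.2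
  let L : 𝓢(E, ℂ) →L[ℂ] 𝓢(E, ℂ) := FourierTransform.fourierInvCLM ℂ 𝓢(E, ℂ)
  have hq : Continuous q :=
    Seminorm.continuous_finsetSup fun i _ => (schwartz_withSeminorms ℂ E ℂ).continuous_seminorm i
  -- The inverse Fourier transform is continuous on Schwartz space, and for functions supported in
  -- `K` the polynomial weights of the Schwartz seminorms are bounded, so only derivatives remain.
  obtain ⟨s, C, -, hC⟩ := Seminorm.bound_of_continuous (schwartz_withSeminorms ℂ E ℂ)
    (q.comp L.toLinearMap) (hq.comp L.continuous)
  obtain ⟨R, hR⟩ := hK.isBounded.exists_norm_le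
  let R' := max R 0
  let k := s.sup Prod.fst
  let m := s.sup Prod.snd
  refine ⟨2 ^ M * (C * (1 + R') ^ k), m, by positivity, fun φ hφ B hB ζ => ?_⟩
  have hB0 : 0 ≤ B := (norm_nonneg _).trans (hB 0 (Nat.zero_le _) 0)
  have h1 := SchwartzMap.one_add_le_sup_seminorm_apply (𝕜 := ℂ) (m := (M, 0)) le_rfl le_rfl
    (𝓕⁻ φ.toSchwartz) ζ
  rw [norm_iteratedFDeriv_zero] at h1
  refine h1.trans ?_
  rw [mul_assoc]
  refine mul_le_mul_of_nonneg_left ?_ (by positivity)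
  refine (hC φ.toSchwartz).trans ?_
  rw [smul_apply, mul_assoc]
  refine mul_le_mul_of_nonneg_left ?_ C.2
  refine Seminorm.finset_sup_apply_le (by positivity) fun i hi => ?_
  refine SchwartzMap.seminorm_le_bound ℂ _ _ _ (by positivity) fun x => ?_
  by_cases hx : x ∈ K
  · have h2 : ‖x‖ ≤ 1 + R' := (hR x hx).trans ((le_max_left _ _).trans (by linarith))
    have h3 : (1 : ℝ) ≤ 1 + R' := by simp [R']
    refine mul_le_mul ((pow_le_pow_left₀ (norm_nonneg _) h2 _).trans
      (pow_le_pow_right₀ h3 (Finset.le_sup (f := Prod.fst) hi)))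
      (hB _ (Finset.le_sup (f := Prod.snd) hi) x) (norm_nonneg _) (by positivity)
  · have h0 : iteratedFDeriv ℝ i.2 φ x = 0 := by
      by_contra h
      exact hx (hφ (support_iteratedFDeriv_subset i.2 h))
    have h0' : iteratedFDeriv ℝ i.2 φ.toSchwartz x = 0 := h0
    rw [h0', norm_zero, mul_zero]; positivity

/-- Fubini for a test function against a Fourier integral. -/
lemma integral_mul_fourierIntegral {a : E → ℂ} (ha : HasMoments a)
    (φ : 𝓓((⊤ : TopologicalSpace.Opens E), ℂ)) :
    ∫ x, φ x * ∫ ζ, a ζ * planeWave (-(2 * Real.pi) • ζ) x = ∫ ζ, a ζ * invF φ ζ := by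
  have hai : Integrable a := by
    have := ha.integrable 0
    simp only [pow_zero, one_mul] at this
    exact (integrable_norm_iff ha.meas).1 this
  have hφ : Integrable φ := φ.contDiff.continuous.integrable_of_hasCompactSupport φ.hasCompactSupport
  have hp : Continuous fun p : E × E => planeWave (-(2 * Real.pi) • p.2) p.1 :=
    contDiff_planeWave_uncurry.continuous.comp
      (continuous_fst.prodMk (continuous_snd.const_smul _))
  have hint : Integrable (fun p : E × E => φ p.1 * a p.2 * planeWave (-(2 * Real.pi) • p.2) p.1)
      (volume.prod volume) := by
    refine (hφ.mul_prod hai).mono ((hφ.mul_prod hai).aestronglyMeasurable.mul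
      hp.aestronglyMeasurable) (Eventually.of_forall fun p => ?_)
    rw [norm_mul _ (planeWave _ _), norm_planeWave, mul_one]
  have h1 (x : E) : φ x * ∫ ζ, a ζ * planeWave (-(2 * Real.pi) • ζ) x =
      ∫ ζ, φ x * a ζ * planeWave (-(2 * Real.pi) • ζ) x := by
    rw [← integral_const_mul]; simp only [mul_assoc]
  simp only [h1]
  rw [integral_integral_swap hint]
  refine integral_congr_ae (Eventually.of_forall fun ζ => ?_)
  simp only
  rw [invF_eq, ← integral_const_mul]
  congr 1; ext x; ring

end Inversion

/-! ### Cut-offs and localization -/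

section Cutoff

variable {E : Type*} [NormedAddCommGroup E] [InnerProductSpace ℝ E] [FiniteDimensional ℝ E]

open scoped Manifold

/-- A test function from a compactly supported smooth function. -/
def TestFunction.ofCompact {F : Type*} [NormedAddCommGroup F] [NormedSpace ℝ F] (f : E → F)
    (hf : ContDiff ℝ ∞ f) (hc : HasCompactSupport f) : 𝓓((⊤ : TopologicalSpace.Opens E), F) where
  toFun := f
  contDiff' := hf
  hasCompactSupport' := hc
  tsupport_subset' := subset_univ _

/-- The cut-off is 1 on a whole thickening of `K`; this margin absorbs the enlargement of supports
under mollification. -/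
lemma exists_cutoff {K U : Set E} (hK : IsCompact K) (hU : IsOpen U) (hKU : K ⊆ U) :
    ∃ (θ : 𝓓((⊤ : TopologicalSpace.Opens E), ℝ)) (δ : ℝ), 0 < δ ∧
      (∀ x ∈ Metric.cthickening δ K, θ x = 1) ∧ tsupport θ ⊆ U := by
  obtain ⟨ε, hε, hεU⟩ := hK.exists_cthickening_subset_open hU hKU
  have hsub : Metric.cthickening (ε / 2) K ⊆ interior (Metric.cthickening ε K) :=
    (Metric.cthickening_subset_thickening' hε (half_lt_self hε) K).trans
      (interior_maximal (Metric.thickening_subset_cthickening _ _) Metric.isOpen_thickening)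
  obtain ⟨f, hf1, hf0, -⟩ := exists_contMDiffMap_one_nhds_of_subset_interior (n := ⊤) 𝓘(ℝ, E)
    Metric.isClosed_cthickening hsub
  have hts : tsupport f ⊆ Metric.cthickening ε K := by
    refine closure_minimal (fun x hx => ?_) Metric.isClosed_cthickening
    by_contra h
    exact hx (hf0 x h)
  refine ⟨TestFunction.ofCompact f f.contMDiff.contDiff
    (hK.cthickening.of_isClosed_subset (isClosed_tsupport _) hts), ε / 2, half_pos hε,
    fun x hx => hf1.self_of_nhdsSet x hx, hts.trans hεU⟩

lemma tsupport_mulSmooth_subset_left {Ω : TopologicalSpace.Opens E} (χ : 𝓓(Ω, ℝ)) (g : E → ℝ)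
    (hg : ContDiff ℝ ∞ g) : tsupport (mulSmooth χ g hg) ⊆ tsupport χ := tsupport_mul_subset_left

lemma tsupport_mulSmooth_subset_right {Ω : TopologicalSpace.Opens E} (χ : 𝓓(Ω, ℝ)) (g : E → ℝ)
    (hg : ContDiff ℝ ∞ g) : tsupport (mulSmooth χ g hg) ⊆ tsupport g := tsupport_mul_subset_right

/-- An additive property of test functions that holds locally holds globally. -/
lemma TestFunction.induction_local (P : 𝓓((⊤ : TopologicalSpace.Opens E), ℝ) → Prop) (h0 : P 0)
    (hadd : ∀ φ ψ, P φ → P ψ → P (φ + ψ)) (χ : 𝓓((⊤ : TopologicalSpace.Opens E), ℝ))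
    (hloc : ∀ x ∈ tsupport χ, ∃ U ∈ 𝓝 x, ∀ ψ : 𝓓((⊤ : TopologicalSpace.Opens E), ℝ),
      tsupport ψ ⊆ U → tsupport ψ ⊆ tsupport χ → P ψ) : P χ := by
  choose! U hU hP using hloc
  obtain ⟨t, hts, ht⟩ := χ.hasCompactSupport.elim_nhds_subcover (fun x => interior (U x))
    fun x hx => interior_mem_nhds.2 (hU x hx)
  -- A partition of unity subordinate to finitely many of the given neighbourhoods cuts `χ` into
  -- pieces to which `hP` applies.
  obtain ⟨f, hf⟩ := SmoothPartitionOfUnity.exists_isSubordinate 𝓘(ℝ, E)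
    (isClosed_tsupport χ) (fun x : t => interior (U x)) (fun _ => isOpen_interior)
    (by simpa [iUnion_subtype] using ht)
  have hχ : χ = ∑ i : t, mulSmooth χ (f i) (f i).contMDiff.contDiff := by
    ext x
    have h1 : (∑ i : t, mulSmooth χ (f i) (f i).contMDiff.contDiff) x =
        ∑ i : t, χ x * f i x := by
      exact map_sum ({ toFun φ := φ x, map_zero' := rfl, map_add' _ _ := rfl } :
        𝓓((⊤ : TopologicalSpace.Opens E), ℝ) →+ ℝ) _ _
    rw [h1, ← Finset.mul_sum]
    by_cases hx : x ∈ tsupport χ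
    · have := f.sum_eq_one hx
      rw [finsum_eq_sum_of_fintype] at this
      rw [this, mul_one]
    · rw [image_eq_zero_of_notMem_tsupport hx, zero_mul]
  rw [hχ]
  refine Finset.sum_induction _ P hadd h0 fun i _ => hP i (hts i i.2) _ ?_ ?_
  · exact (tsupport_mulSmooth_subset_right _ _ _).trans ((hf i).trans interior_subset)
  · exact tsupport_mulSmooth_subset_left _ _ _

end Cutoff

/-! ### Families of distributions with uniformly rapidly decaying Fourier transforms -/

section RapidFamilies

variable {E : Type*} [NormedAddCommGroup E] [InnerProductSpace ℝ E] {ι : Type*}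

/-- The localized Fourier transforms of a family decay rapidly and uniformly on `W`. -/
def RapidOn (T : ι → 𝓓'((⊤ : TopologicalSpace.Opens E), ℂ))
    (χ : 𝓓((⊤ : TopologicalSpace.Opens E), ℝ)) (W : Set E) : Prop :=
  ∀ N : ℕ, ∃ C : ℝ, 0 ≤ C ∧ ∀ a, ∀ η ∈ W, (1 + ‖η‖) ^ N * ‖localFourier (T a) χ η‖ ≤ C

/-- Uniform microlocal smoothness of a family. -/
def MicroAt (T : ι → 𝓓'((⊤ : TopologicalSpace.Opens E), ℂ)) (x ξ : E) : Prop :=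
  ∃ U ∈ 𝓝 x, ∃ V ∈ 𝓝 ξ, IsConic V ∧
    ∀ χ : 𝓓((⊤ : TopologicalSpace.Opens E), ℝ), tsupport χ ⊆ U → RapidOn T χ V

lemma microlocallySmoothAt_iff (u : 𝓓'((⊤ : TopologicalSpace.Opens E), ℂ)) (x ξ : E) :
    MicrolocallySmoothAt u x ξ ↔ MicroAt (fun _ : Unit => u) x ξ := by
  constructor
  · rintro ⟨U, hU, V, hV, hc, h⟩
    refine ⟨U, hU, V, hV, hc, fun χ hχ N => ?_⟩
    obtain ⟨C, hC⟩ := h χ hχ N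
    exact ⟨max C 0, le_max_right _ _, fun _ η hη => (hC η hη).trans (le_max_left _ _)⟩
  · rintro ⟨U, hU, V, hV, hc, h⟩
    refine ⟨U, hU, V, hV, hc, fun χ hχ N => ?_⟩
    obtain ⟨C, -, hC⟩ := h χ hχ N
    exact ⟨C, hC ()⟩

lemma MicroAt.microlocallySmoothAt {T : ι → 𝓓'((⊤ : TopologicalSpace.Opens E), ℂ)} {x ξ : E}
    (h : MicroAt T x ξ) (a : ι) : MicrolocallySmoothAt (T a) x ξ := by
  obtain ⟨U, hU, V, hV, hc, h⟩ := h
  refine ⟨U, hU, V, hV, hc, fun χ hχ N => ?_⟩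
  obtain ⟨C, -, hC⟩ := h χ hχ N
  exact ⟨C, hC a⟩

lemma localFourier_add_right (u : 𝓓'((⊤ : TopologicalSpace.Opens E), ℂ))
    (χ ψ : 𝓓((⊤ : TopologicalSpace.Opens E), ℝ)) (η : E) :
    localFourier u (χ + ψ) η = localFourier u χ η + localFourier u ψ η := by
  rw [localFourier_eq_cext, localFourier_eq_cext, localFourier_eq_cext, ← map_add]
  congr 1
  ext x
  simp [add_mul]

lemma localFourier_zero_right (u : 𝓓'((⊤ : TopologicalSpace.Opens E), ℂ)) (η : E) :
    localFourier u 0 η = 0 := by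
  rw [localFourier_eq_cext]
  have : (0 : 𝓓((⊤ : TopologicalSpace.Opens E), ℝ)).toComplex.modulate η = 0 := by ext x; simp
  rw [this, map_zero]

/-- A closed cone in a seminorm may contain the frequency 0, about which microlocal smoothness at
nonzero covectors says nothing. There the Fourier transform is the plain pairing. -/
lemma localFourier_zero_frequency (u : 𝓓'((⊤ : TopologicalSpace.Opens E), ℂ))
    (χ : 𝓓((⊤ : TopologicalSpace.Opens E), ℝ)) : localFourier u χ 0 = u χ := by
  rw [localFourier_eq_cext, ← cext_toComplex]
  congr 1
  ext x
  simp [planeWave]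

lemma RapidOn.add {T : ι → 𝓓'((⊤ : TopologicalSpace.Opens E), ℂ)}
    {χ ψ : 𝓓((⊤ : TopologicalSpace.Opens E), ℝ)} {W : Set E} (h : RapidOn T χ W)
    (h' : RapidOn T ψ W) : RapidOn T (χ + ψ) W := by
  intro N
  obtain ⟨C, hC0, hC⟩ := h N
  obtain ⟨C', hC0', hC'⟩ := h' N
  refine ⟨C + C', add_nonneg hC0 hC0', fun a η hη => ?_⟩
  rw [localFourier_add_right]
  calc _ ≤ (1 + ‖η‖) ^ N * (‖localFourier (T a) χ η‖ + ‖localFourier (T a) ψ η‖) := by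
        gcongr; exact norm_add_le _ _
    _ ≤ _ := by rw [mul_add]; exact add_le_add (hC a η hη) (hC' a η hη)

lemma RapidOn.zero (T : ι → 𝓓'((⊤ : TopologicalSpace.Opens E), ℂ)) (W : Set E) :
    RapidOn T 0 W := fun N => ⟨0, le_rfl, fun a η _ => by simp [localFourier_zero_right]⟩

lemma RapidOn.mono {T : ι → 𝓓'((⊤ : TopologicalSpace.Opens E), ℂ)}
    {χ : 𝓓((⊤ : TopologicalSpace.Opens E), ℝ)} {W W' : Set E} (h : RapidOn T χ W) (hW : W' ⊆ W) :
    RapidOn T χ W' := fun N =>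
  let ⟨C, h0, hC⟩ := h N
  ⟨C, h0, fun a η hη => hC a η (hW hη)⟩

lemma RapidOn.biUnion {T : ι → 𝓓'((⊤ : TopologicalSpace.Opens E), ℂ)}
    {χ : 𝓓((⊤ : TopologicalSpace.Opens E), ℝ)} {κ : Type*} {t : Finset κ} {W : κ → Set E}
    (h : ∀ i ∈ t, RapidOn T χ (W i)) : RapidOn T χ (⋃ i ∈ t, W i) := by
  intro N
  have h' : ∀ i ∈ t, ∃ C : ℝ, 0 ≤ C ∧ ∀ a, ∀ η ∈ W i,
    (1 + ‖η‖) ^ N * ‖localFourier (T a) χ η‖ ≤ C := fun i hi => h i hi N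
  choose! C hC0 hC using h'
  refine ⟨∑ i ∈ t, C i, Finset.sum_nonneg hC0, fun a η hη => ?_⟩
  simp only [mem_iUnion] at hη
  obtain ⟨i, hi, hη⟩ := hη
  exact (hC i hi a η hη).trans (Finset.single_le_sum hC0 hi)

/-- Microlocal smoothness in all directions of a closed cone gives rapid decay in a conic
neighbourhood of the cone. -/
lemma exists_rapidOn_of_microAt [FiniteDimensional ℝ E]
    {T : ι → 𝓓'((⊤ : TopologicalSpace.Opens E), ℂ)} {x : E} {V : Set E} (hV : IsClosed V)
    (hVc : IsConic V) (h : ∀ ξ ∈ V, ξ ≠ 0 → MicroAt T x ξ) :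
    ∃ U ∈ 𝓝 x, ∃ (W : Set E) (c : ℝ), 0 < c ∧
      (∀ η ∈ V, ∀ ζ, ‖ζ - η‖ < c * ‖η‖ → ζ ∈ W) ∧
      ∀ χ : 𝓓((⊤ : TopologicalSpace.Opens E), ℝ), tsupport χ ⊆ U → RapidOn T χ W := by
  have : ProperSpace E := FiniteDimensional.proper ℝ E
  -- By homogeneity only unit covectors of `V` have to be covered. A finite subcover leaves a single
  -- neighbourhood of `x`, and a thickening of this compact set inside the cover supplies the
  -- aperture `c`.
  have hK : IsCompact (V ∩ Metric.sphere 0 1) := (isCompact_sphere (0 : E) 1).inter_left hV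
  have h' : ∀ ξ ∈ V ∩ Metric.sphere 0 1, MicroAt T x ξ := fun ξ hξ =>
    h ξ hξ.1 (ne_zero_of_mem_unit_sphere ⟨ξ, hξ.2⟩)
  choose! U hU O hO hOc hR using h'
  obtain ⟨t, hts, ht⟩ := hK.elim_nhds_subcover (fun ξ => interior (O ξ))
    fun ξ hξ => interior_mem_nhds.2 (hO ξ hξ)
  obtain ⟨c, hc, hcO⟩ := hK.exists_thickening_subset_open
    (isOpen_biUnion fun ξ _ => isOpen_interior) ht
  refine ⟨⋂ ξ ∈ t, U ξ, (biInter_finset_mem t).2 fun ξ hξ => hU ξ (hts ξ hξ), ⋃ ξ ∈ t, O ξ, c, hc,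
    fun η hη ζ hζ => ?_, fun χ hχ => RapidOn.biUnion fun ξ hξ => ?_⟩
  · have hη0 : 0 < ‖η‖ := by
      by_contra h0
      have h1 : ‖η‖ = 0 := le_antisymm (not_lt.1 h0) (norm_nonneg _)
      rw [h1, mul_zero] at hζ
      exact absurd hζ (not_lt.2 (norm_nonneg _))
    have h1 : ‖η‖⁻¹ • ζ ∈ Metric.thickening c (V ∩ Metric.sphere 0 1) := by
      refine Metric.mem_thickening_iff.2 ⟨‖η‖⁻¹ • η, ⟨hVc η hη _ (by positivity), ?_⟩, ?_⟩
      · rw [mem_sphere_zero_iff_norm, norm_smul, norm_inv, norm_norm, inv_mul_cancel₀ hη0.ne']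
      · rw [dist_eq_norm, ← smul_sub, norm_smul, norm_inv, norm_norm, inv_mul_lt_iff₀ hη0, mul_comm]
        exact hζ
    have h2 := hcO h1
    simp only [mem_iUnion] at h2 ⊢
    obtain ⟨ξ, hξ, h3⟩ := h2
    refine ⟨ξ, hξ, ?_⟩
    have := hOc ξ (hts ξ hξ) _ (interior_subset h3) ‖η‖ hη0
    rwa [smul_smul, mul_inv_cancel₀ hη0.ne', one_smul] at this
  · exact hR ξ (hts ξ hξ) χ (hχ.trans (iInter₂_subset ξ hξ))

/-- Microlocal smoothness over `supp χ × V` gives rapid decay on `V`. -/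
lemma rapidOn_of_microAt [FiniteDimensional ℝ E]
    {T : ι → 𝓓'((⊤ : TopologicalSpace.Opens E), ℂ)} {V : Set E} (hV : IsClosed V)
    (hVc : IsConic V) (χ : 𝓓((⊤ : TopologicalSpace.Opens E), ℝ))
    (hb : ∀ χ : 𝓓((⊤ : TopologicalSpace.Opens E), ℝ), ∃ C : ℝ, ∀ a, ‖T a χ‖ ≤ C)
    (h : ∀ x ∈ tsupport χ, ∀ ξ ∈ V, ξ ≠ 0 → MicroAt T x ξ) : RapidOn T χ V := by
  refine TestFunction.induction_local (fun χ => RapidOn T χ V) (RapidOn.zero T V)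
    (fun _ _ => RapidOn.add) χ fun x hx => ?_
  obtain ⟨U, hU, W, c, hc, hW, hR⟩ := exists_rapidOn_of_microAt hV hVc (h x hx)
  refine ⟨U, hU, fun ψ hψ _ N => ?_⟩
  obtain ⟨C, hC0, hC⟩ := hR ψ hψ N
  -- This bound serves the frequency 0 only.
  obtain ⟨D, hD⟩ := hb ψ
  refine ⟨max C D, hC0.trans (le_max_left _ _), fun a η hη => ?_⟩
  by_cases hη0 : η = 0
  · rw [hη0, localFourier_zero_frequency]
    simpa using Or.inr (hD a)
  · refine (hC a η (hW η hη η ?_)).trans (le_max_left _ _)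
    rw [sub_self, norm_zero]
    exact mul_pos hc (norm_pos_iff.2 hη0)

end RapidFamilies

/-! ### Finiteness of the wavefront seminorms. -/

namespace WavefrontSpace

variable {E : Type*} [NormedAddCommGroup E] [InnerProductSpace ℝ E] [FiniteDimensional ℝ E]
  {Λ : Set (E × E)}

lemma microAt (u : WavefrontSpace Λ) {x ξ : E} (h0 : ξ ≠ 0) (h : (x, ξ) ∉ Λ) :
    MicroAt (fun _ : Unit => u.toDistribution) x ξ := by
  rw [← microlocallySmoothAt_iff]
  by_contra hm
  exact h (u.2 ⟨h0, hm⟩)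

lemma rapidOn (u : WavefrontSpace Λ) (i : SeminormIndex Λ) :
    RapidOn (fun _ : Unit => u.toDistribution) i.χ i.V :=
  rapidOn_of_microAt i.isClosed i.isConic i.χ (fun _ => ⟨_, fun _ => le_rfl⟩)
    fun _ hx _ hξ h0 => u.microAt h0 fun h => disjoint_left.1 i.disjoint ⟨hx, hξ⟩ h

end WavefrontSpace

/-! ### The topologies -/

section Topologies

/-- In finite dimension the test functions form a Montel space, so uniform convergence on compact
sets is convergence in the strong topology. -/
lemma tendsto_distribution_iff {E : Type*} [NormedAddCommGroup E] [NormedSpace ℝ E]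
    {Ω : TopologicalSpace.Opens E} {κ : Type*} {l : Filter κ} {T : κ → 𝓓'(Ω, ℂ)} {T₀ : 𝓓'(Ω, ℂ)} :
    Tendsto T l (𝓝 T₀) ↔ ∀ S : Set 𝓓(Ω, ℝ), IsCompact S → ∀ ε : ℝ, 0 < ε →
      ∀ᶠ n in l, ∀ φ ∈ S, ‖T n φ - T₀ φ‖ < ε := by
  rw [UniformConvergenceCLM.tendsto_iff_tendstoUniformlyOn]
  refine forall₂_congr fun S _ => ?_
  rw [Metric.tendstoUniformlyOn_iff]
  refine forall₂_congr fun ε _ => ?_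
  simp only [dist_comm (T₀ _), dist_eq_norm]

variable {E : Type*} [NormedAddCommGroup E] [InnerProductSpace ℝ E] {Λ : Set (E × E)}

lemma WavefrontSpace.tendsto_iff {κ : Type*} {l : Filter κ} {U : κ → WavefrontSpace Λ}
    {u : WavefrontSpace Λ} : Tendsto U l (𝓝 u) ↔
      Tendsto (fun n => (U n).toDistribution) l (𝓝 u.toDistribution) ∧
      ∀ i : SeminormIndex Λ, ∀ ε : ℝ, 0 < ε → ∀ᶠ n in l, ∀ η ∈ i.V,
        (1 + ‖η‖) ^ i.N * ‖localFourier (U n).toDistribution i.χ η -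
          localFourier u.toDistribution i.χ η‖ < ε := by
  have h1 : 𝓝 u = @nhds _ (TopologicalSpace.induced toDistribution inferInstance) u ⊓
      ⨅ i : SeminormIndex Λ,
        @nhds _ (TopologicalSpace.induced (weightedFourier i) inferInstance) u := by
    have h0 := nhds_inf (t₁ := TopologicalSpace.induced (toDistribution (Λ := Λ)) inferInstance)
      (t₂ := ⨅ i : SeminormIndex Λ, TopologicalSpace.induced (weightedFourier i) inferInstance)
      (a := u)
    rw [nhds_iInf] at h0
    exact h0
  rw [h1, tendsto_inf, tendsto_iInf]
  simp only [nhds_induced, tendsto_comap_iff]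
  refine and_congr Iff.rfl (forall_congr' fun i => ?_)
  rw [UniformFun.tendsto_iff_tendstoUniformly, Metric.tendstoUniformly_iff]
  refine forall₂_congr fun ε _ => ?_
  refine eventually_congr (Eventually.of_forall fun n => ?_)
  simp only [Subtype.forall]
  refine forall₂_congr fun η hη => ?_
  have h2 (v : WavefrontSpace Λ) : UniformFun.toFun (weightedFourier i v) ⟨η, hη⟩ =
      (((1 + ‖η‖) ^ i.N : ℝ) : ℂ) * localFourier v.toDistribution i.χ η := rfl
  change dist (UniformFun.toFun (weightedFourier i u) ⟨η, hη⟩)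
    (UniformFun.toFun (weightedFourier i (U n)) ⟨η, hη⟩) < ε ↔ _
  rw [h2, h2, dist_comm, dist_eq_norm, ← mul_sub, norm_mul, Complex.norm_real,
    Real.norm_of_nonneg (by positivity)]

end Topologies

/-! ### Distributions given by functions -/

section FunctionDistributions

variable {E : Type*} [NormedAddCommGroup E] [InnerProductSpace ℝ E] [FiniteDimensional ℝ E]
  [MeasurableSpace E] [BorelSpace E]

/-- The distribution given by a locally integrable function. -/
def distOfFun (f : E → ℂ) : 𝓓'((⊤ : TopologicalSpace.Opens E), ℂ) :=
  TestFunction.integralAgainstBilinCLM (ContinuousLinearMap.lsmul ℝ ℝ) volume f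

lemma distOfFun_apply {f : E → ℂ} (hf : LocallyIntegrable f)
    (φ : 𝓓((⊤ : TopologicalSpace.Opens E), ℝ)) : distOfFun f φ = ∫ x, φ x • f x :=
  TestFunction.integralAgainstBilinCLM_eq_integral (hf.locallyIntegrableOn _)

lemma integrable_smul_of_locallyIntegrable {f : E → ℂ} (hf : LocallyIntegrable f)
    (φ : 𝓓((⊤ : TopologicalSpace.Opens E), ℂ)) : Integrable fun x => φ x * f x :=
  hf.integrable_smul_left_of_hasCompactSupport φ.contDiff.continuous φ.hasCompactSupport

lemma cext_eq_integral_of_forall {u : 𝓓'((⊤ : TopologicalSpace.Opens E), ℂ)} {f : E → ℂ}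
    (hf : LocallyIntegrable f)
    (h : ∀ φ : 𝓓((⊤ : TopologicalSpace.Opens E), ℝ), u φ = ∫ x, φ x • f x)
    (φ : 𝓓((⊤ : TopologicalSpace.Opens E), ℂ)) : cext u φ = ∫ x, φ x * f x := by
  have hi (L : ℂ →L[ℝ] ℝ) : Integrable fun x => TestFunction.postcompCLM L φ x • f x := by
    have := integrable_smul_of_locallyIntegrable hf (TestFunction.postcompCLM L φ).toComplex
    simpa only [toComplex_apply, Complex.real_smul] using this
  rw [cext_apply, h, h, ← integral_const_mul, ← integral_add (hi _) ((hi _).const_mul _)]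
  refine integral_congr_ae (Eventually.of_forall fun x => ?_)
  simp only [TestFunction.postcompCLM_apply, Function.comp_apply, Complex.reCLM_apply,
    Complex.imCLM_apply, Complex.real_smul]
  conv_rhs => rw [← Complex.re_add_im (φ x)]
  ring

/-- The localized Fourier transform of a smooth `f` is that of the test function χf, which decays
rapidly in all directions. -/
lemma wavefrontSet_of_smooth {u : 𝓓'((⊤ : TopologicalSpace.Opens E), ℂ)} {f : E → ℂ}
    (hf : ContDiff ℝ ∞ f)
    (h : ∀ φ : 𝓓((⊤ : TopologicalSpace.Opens E), ℝ), u φ = ∫ x, φ x • f x) :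
    wavefrontSet u = ∅ := by
  refine eq_empty_of_forall_notMem fun p hp => hp.2 ⟨univ, univ_mem, univ, univ_mem,
    fun _ _ _ _ => mem_univ _, fun χ _ N => ?_⟩
  obtain ⟨C, hC⟩ := rapidDecay_invF (χ.toComplex.mulSmoothC f hf) N
  refine ⟨(2 * Real.pi) ^ N * C, fun η _ => ?_⟩
  have h1 : localFourier u χ η =
      invF (χ.toComplex.mulSmoothC f hf) (-(2 * Real.pi)⁻¹ • η) := by
    rw [localFourier_eq_cext, cext_eq_integral_of_forall hf.continuous.locallyIntegrable h, invF_eq]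
    refine integral_congr_ae (Eventually.of_forall fun x => ?_)
    have : (-(2 * Real.pi)) • (-(2 * Real.pi)⁻¹) • η = η := by
      rw [smul_smul, neg_mul_neg, mul_inv_cancel₀ (by positivity), one_smul]
    simp only [modulate_apply, mulSmoothC_apply, this]
    ring
  have h2 := hC (-(2 * Real.pi)⁻¹ • η)
  have h3 : 1 + ‖η‖ ≤ 2 * Real.pi * (1 + ‖-(2 * Real.pi)⁻¹ • η‖) := by
    rw [norm_smul, norm_neg, norm_inv, Real.norm_of_nonneg (by positivity : 0 ≤ 2 * Real.pi),
      mul_add, ← mul_assoc, mul_inv_cancel₀ (by positivity)]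
    linarith [Real.two_le_pi]
  rw [h1]
  calc _ ≤ (2 * Real.pi * (1 + ‖-(2 * Real.pi)⁻¹ • η‖)) ^ N * _ := by gcongr
    _ = (2 * Real.pi) ^ N * ((1 + ‖-(2 * Real.pi)⁻¹ • η‖) ^ N *
      ‖invF (χ.toComplex.mulSmoothC f hf) (-(2 * Real.pi)⁻¹ • η)‖) := by rw [mul_pow]; ring
    _ ≤ _ := by gcongr

end FunctionDistributions

/-! ### Mollification -/

section Mollification

variable {E : Type*} [NormedAddCommGroup E] [InnerProductSpace ℝ E] [FiniteDimensional ℝ E]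
  [MeasurableSpace E] [BorelSpace E]

/-- The standard bump function supported in the ball of radius `1 / (n + 1)`. -/
def standardBump (E : Type*) [NormedAddCommGroup E] [InnerProductSpace ℝ E] (n : ℕ) :
    ContDiffBump (0 : E) :=
  ⟨1 / (n + 1) / 2, 1 / (n + 1), by positivity, half_lt_self (by positivity)⟩

/-- The mollifier with support in the ball of radius `1 / (n + 1)`. -/
def mollifier (E : Type*) [NormedAddCommGroup E] [InnerProductSpace ℝ E] [FiniteDimensional ℝ E]
    [MeasurableSpace E] [BorelSpace E] (n : ℕ) : 𝓓((⊤ : TopologicalSpace.Opens E), ℝ) :=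
  TestFunction.ofCompact ((standardBump E n).normed volume)
    (standardBump E n).contDiff_normed (standardBump E n).hasCompactSupport_normed

lemma mollifier_nonneg (n : ℕ) (x : E) : 0 ≤ mollifier E n x :=
  (standardBump E n).nonneg_normed x

lemma integral_mollifier (n : ℕ) : ∫ x, mollifier E n x = 1 := (standardBump E n).integral_normed

lemma integrable_mollifier (n : ℕ) : Integrable (mollifier E n) :=
  (standardBump E n).integrable_normed

lemma mollifier_eq_zero {n : ℕ} {x : E} (h : 1 / ((n : ℝ) + 1) ≤ ‖x‖) : mollifier E n x = 0 := by
  have h1 : x ∉ Function.support ((standardBump E n).normed volume) := by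
    rw [ContDiffBump.support_normed_eq, mem_ball_zero_iff]
    exact not_lt.2 h
  exact Function.notMem_support.1 h1

/-- The Fourier multiplier of the mollifier. -/
def mollMult (n : ℕ) (ζ : E) : ℂ := invF (mollifier E n).toComplex ζ

/-- The mollifier has mass 1 and lives in the ball of radius 1/(n+1), where |exp(iy) - 1| ≤ |y|
applies. So the multiplier tends to 1 at rate 1/(n+1), at the cost of one power of the frequency. -/
lemma norm_mollMult_sub_one_le (n : ℕ) (ζ : E) :
    ‖mollMult n ζ - 1‖ ≤ 2 * Real.pi * ‖ζ‖ / (n + 1) := by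
  have h1 : mollMult n ζ - 1 =
      ∫ x, (mollifier E n x : ℂ) * (planeWave (-(2 * Real.pi) • ζ) x - 1) := by
    have h2 : (1 : ℂ) = ∫ x, (mollifier E n x : ℂ) := by
      rw [integral_complex_ofReal, integral_mollifier, Complex.ofReal_one]
    rw [mollMult, invF_eq]
    nth_rewrite 1 [h2]
    rw [← integral_sub]
    · simp only [mul_sub, mul_one, toComplex_apply]
    · have hm : Integrable fun x : E => (mollifier E n x : ℂ) := (integrable_mollifier n).ofReal
      refine hm.mono ?_ (Eventually.of_forall fun x => ?_)
      · exact ((mollifier E n).toComplex.contDiff.continuous.mul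
          (contDiff_planeWave _).continuous).aestronglyMeasurable
      · rw [norm_mul, norm_planeWave, mul_one]; rfl
    · exact (integrable_mollifier n).ofReal
  rw [h1]
  have h3 : ∫ x, mollifier E n x * (2 * Real.pi * ‖ζ‖ / (n + 1)) = 2 * Real.pi * ‖ζ‖ / (n + 1) := by
    rw [integral_mul_const, integral_mollifier, one_mul]
  rw [← h3]
  refine norm_integral_le_of_norm_le ((integrable_mollifier n).mul_const _)
    (Eventually.of_forall fun x => ?_)
  rw [norm_mul, Complex.norm_real, Real.norm_of_nonneg (mollifier_nonneg n x)]
  by_cases hx : 1 / ((n : ℝ) + 1) ≤ ‖x‖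
  · rw [mollifier_eq_zero hx, zero_mul, zero_mul]
  refine mul_le_mul_of_nonneg_left ?_ (mollifier_nonneg n x)
  have h4 : planeWave (-(2 * Real.pi) • ζ) x =
      Complex.exp (Complex.I * ((2 * Real.pi * ⟪x, ζ⟫_ℝ : ℝ) : ℂ)) := by
    rw [planeWave, inner_smul_right]; congr 1; push_cast; ring
  rw [h4]
  refine (Real.norm_exp_I_mul_ofReal_sub_one_le).trans ?_
  rw [norm_mul, Real.norm_of_nonneg (by positivity), mul_div_assoc]
  refine mul_le_mul_of_nonneg_left ?_ (by positivity)
  refine (norm_inner_le_norm x ζ).trans ?_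
  rw [div_eq_mul_one_div, mul_comm]
  exact mul_le_mul_of_nonneg_left (not_le.1 hx).le (norm_nonneg _)

lemma norm_mollMult_le_one (n : ℕ) (ζ : E) : ‖mollMult n ζ‖ ≤ 1 := by
  rw [mollMult, invF_eq, ← integral_mollifier (E := E) n]
  refine norm_integral_le_of_norm_le (integrable_mollifier n) (Eventually.of_forall fun x => ?_)
  rw [norm_mul, norm_planeWave, mul_one, toComplex_apply, Complex.norm_real,
    Real.norm_of_nonneg (mollifier_nonneg n x)]

lemma HasMoments.mul_bounded {a b : E → ℂ} (ha : HasMoments a) (hb : Continuous b) {C : ℝ}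
    (h : ∀ ζ, ‖b ζ‖ ≤ C) : HasMoments fun ζ => a ζ * b ζ := by
  refine ⟨ha.meas.mul hb.aestronglyMeasurable, fun M => ?_⟩
  refine ((ha.integrable M).const_mul C).mono' ((by fun_prop : Continuous fun ζ : E =>
    (1 + ‖ζ‖) ^ M).aestronglyMeasurable.mul (ha.meas.mul hb.aestronglyMeasurable).norm)
    (Eventually.of_forall fun ζ => ?_)
  rw [Real.norm_of_nonneg (by positivity), norm_mul]
  calc _ ≤ (1 + ‖ζ‖) ^ M * (‖a ζ‖ * C) := by gcongr; exact h ζ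
    _ = _ := by ring

/-- The mollified Fourier inversion formula gives a function supported near the support. -/
lemma integral_invF_mul_mollMult_eq_zero (n : ℕ) (φ : 𝓓((⊤ : TopologicalSpace.Opens E), ℂ)) {x : E}
    (hx : x ∉ Metric.cthickening (1 / (n + 1)) (tsupport φ)) :
    ∫ ζ, (invF φ ζ * mollMult n ζ) * planeWave ((2 * Real.pi) • ζ) x = 0 := by
  have ha : HasMoments fun ζ => invF φ ζ * planeWave ((2 * Real.pi) • ζ) x :=
    (hasMoments_invF φ).mul_bounded (C := 1) (contDiff_planeWave_uncurry.continuous.comp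
      (continuous_const.prodMk (continuous_const_smul _))) fun ζ => (norm_planeWave _ _).le
  -- Fubini turns the integral into the convolution of `φ` with the mollifier, whose integrand
  -- vanishes because `x` is farther than 1/(n+1) from the support of `φ`.
  have h1 := integral_mul_fourierIntegral ha (mollifier E n).toComplex
  have h2 : ∫ ζ, (invF φ ζ * mollMult n ζ) * planeWave ((2 * Real.pi) • ζ) x =
      ∫ ζ, invF φ ζ * planeWave ((2 * Real.pi) • ζ) x * invF (mollifier E n).toComplex ζ := by
    refine integral_congr_ae (Eventually.of_forall fun ζ => ?_)
    simp only [mollMult]; ring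
  rw [h2, ← h1]
  refine integral_eq_zero_of_ae (Eventually.of_forall fun y => ?_)
  have h3 : ∫ ζ, invF φ ζ * planeWave ((2 * Real.pi) • ζ) x * planeWave (-(2 * Real.pi) • ζ) y =
      φ (x - y) := by
    rw [← integral_invF_mul_planeWave φ (x - y)]
    refine integral_congr_ae (Eventually.of_forall fun ζ => ?_)
    simp only [mul_assoc]
    congr 1
    simp only [planeWave, ← Complex.exp_add]
    congr 1
    simp only [inner_sub_left, inner_smul_right]
    push_cast; ring
  change ((mollifier E n y : ℝ) : ℂ) * ∫ ζ, invF φ ζ * planeWave ((2 * Real.pi) • ζ) x *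
    planeWave (-(2 * Real.pi) • ζ) y = 0
  rw [h3]
  by_cases hy : 1 / ((n : ℝ) + 1) ≤ ‖y‖
  · rw [mollifier_eq_zero hy]; simp
  · rw [image_eq_zero_of_notMem_tsupport (f := φ) (fun h => hx ?_), mul_zero]
    refine Metric.mem_cthickening_of_dist_le x (x - y) _ _ h ?_
    rw [dist_eq_norm, sub_sub_cancel]
    exact (not_le.1 hy).le

lemma continuous_cext_modulate_two_pi (u : 𝓓'((⊤ : TopologicalSpace.Opens E), ℂ))
    (θ : 𝓓((⊤ : TopologicalSpace.Opens E), ℂ)) :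
    Continuous fun ζ => cext u (θ.modulate ((2 * Real.pi) • ζ)) :=
  (continuous_cext_modulate u θ).comp (continuous_const_smul _)

lemma exists_norm_cext_modulate_two_pi_le (u : 𝓓'((⊤ : TopologicalSpace.Opens E), ℂ))
    (θ : 𝓓((⊤ : TopologicalSpace.Opens E), ℂ)) :
    ∃ (C : ℝ) (M : ℕ), 0 ≤ C ∧
      ∀ ζ, ‖cext u (θ.modulate ((2 * Real.pi) • ζ))‖ ≤ C * (1 + ‖ζ‖) ^ M := by
  obtain ⟨C, M, hC0, hC⟩ := exists_norm_cext_modulate_le u θ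
  refine ⟨C * (2 * Real.pi) ^ M, M, by positivity, fun ζ => (hC _).trans ?_⟩
  have h1 : 1 + ‖(2 * Real.pi) • ζ‖ ≤ 2 * Real.pi * (1 + ‖ζ‖) := by
    rw [norm_smul, Real.norm_of_nonneg (by positivity)]; linarith [Real.two_le_pi]
  calc _ ≤ C * (2 * Real.pi * (1 + ‖ζ‖)) ^ M := by gcongr
    _ = _ := by rw [mul_pow]; ring

lemma HasMoments.mul_of_le {a f : E → ℂ} (ha : HasMoments a) (hf : Continuous f) {C : ℝ} {M : ℕ}
    (h : ∀ ζ, ‖f ζ‖ ≤ C * (1 + ‖ζ‖) ^ M) : HasMoments fun ζ => a ζ * f ζ := by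
  refine ⟨ha.meas.mul hf.aestronglyMeasurable, fun N => ?_⟩
  refine ((ha.integrable (N + M)).const_mul C).mono' ((by fun_prop : Continuous fun ζ : E =>
    (1 + ‖ζ‖) ^ N).aestronglyMeasurable.mul (ha.meas.mul hf.aestronglyMeasurable).norm)
    (Eventually.of_forall fun ζ => ?_)
  rw [Real.norm_of_nonneg (by positivity), norm_mul]
  calc _ ≤ (1 + ‖ζ‖) ^ N * (‖a ζ‖ * (C * (1 + ‖ζ‖) ^ M)) := by gcongr; exact h ζ
    _ = _ := by rw [pow_add]; ring

/-- The mollified pairing does not depend on the cut-off. -/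
lemma integral_mollMult_congr (u : 𝓓'((⊤ : TopologicalSpace.Opens E), ℂ)) (n : ℕ)
    (φ θ θ' : 𝓓((⊤ : TopologicalSpace.Opens E), ℂ))
    (h : ∀ x ∈ Metric.cthickening (1 / (n + 1)) (tsupport φ), θ x = θ' x) :
    ∫ ζ, (invF φ ζ * mollMult n ζ) * cext u (θ.modulate ((2 * Real.pi) • ζ)) =
      ∫ ζ, (invF φ ζ * mollMult n ζ) * cext u (θ'.modulate ((2 * Real.pi) • ζ)) := by
  have ha : HasMoments fun ζ => invF φ ζ * mollMult n ζ :=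
    (hasMoments_invF φ).mul_bounded (continuous_invF _) (norm_mollMult_le_one n)
  obtain ⟨Ψ, hΨ, -, hu⟩ := exists_testFunction_fourierIntegral θ ha
  obtain ⟨Ψ', hΨ', -, hu'⟩ := exists_testFunction_fourierIntegral θ' ha
  rw [← hu, ← hu']
  congr 1
  ext x
  rw [hΨ, hΨ']
  by_cases hx : x ∈ Metric.cthickening (1 / (n + 1)) (tsupport φ)
  · rw [h x hx]
  · rw [integral_invF_mul_mollMult_eq_zero n φ hx, mul_zero, mul_zero]

lemma contDiff_fourierIntegral {a : E → ℂ} (ha : HasMoments a) :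
    ContDiff ℝ ∞ fun x => ∫ ζ, a ζ * planeWave (-(2 * Real.pi) • ζ) x := by
  have h1 : ContDiff ℝ ∞ (FourierTransform.fourier a : E → ℂ) := by
    refine Real.contDiff_fourier fun n _ => ?_
    refine (ha.integrable n).mono ((by fun_prop : Continuous fun ζ : E =>
      ‖ζ‖ ^ n).aestronglyMeasurable.mul ha.meas.norm) (Eventually.of_forall fun ζ => ?_)
    rw [Real.norm_of_nonneg (by positivity), Real.norm_of_nonneg (by positivity)]
    gcongr; linarith
  have h2 : (fun x => ∫ ζ, a ζ * planeWave (-(2 * Real.pi) • ζ) x) =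
      (FourierTransform.fourier a : E → ℂ) ∘ fun x => -x := by
    ext x
    rw [Function.comp_apply, Real.fourier_eq']
    refine integral_congr_ae (Eventually.of_forall fun ζ => ?_)
    simp only [planeWave, inner_smul_right, smul_eq_mul, inner_neg_right]
    rw [mul_comm, real_inner_comm]; congr 2; push_cast; ring
  rw [h2]
  exact h1.comp contDiff_neg

end Mollification

/-! ### Density of smooth functions -/

section Density

variable {E : Type*} [NormedAddCommGroup E] [InnerProductSpace ℝ E] [FiniteDimensional ℝ E]
  [MeasurableSpace E] [BorelSpace E]

lemma tsupport_toComplex {Ω : TopologicalSpace.Opens E} (φ : 𝓓(Ω, ℝ)) :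
    tsupport φ.toComplex = tsupport φ := by
  unfold tsupport
  congr 1
  ext x
  simp

lemma one_add_norm_le_two_pi (η : E) :
    1 + ‖η‖ ≤ 2 * Real.pi * (1 + ‖(2 * Real.pi)⁻¹ • η‖) := by
  rw [norm_smul, norm_inv, Real.norm_of_nonneg (by positivity : 0 ≤ 2 * Real.pi),
    mul_add, ← mul_assoc, mul_inv_cancel₀ (by positivity)]
  linarith [Real.two_le_pi]

lemma one_add_norm_two_pi_smul_le (ζ : E) :
    1 + ‖(2 * Real.pi) • ζ‖ ≤ 2 * Real.pi * (1 + ‖ζ‖) := by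
  rw [norm_smul, Real.norm_of_nonneg (by positivity)]; linarith [Real.two_le_pi]

lemma one_add_norm_le_one_add_norm_two_pi_smul (ζ : E) :
    1 + ‖ζ‖ ≤ 1 + ‖(2 * Real.pi) • ζ‖ := by
  rw [norm_smul, Real.norm_of_nonneg (by positivity)]
  nlinarith [Real.two_le_pi, norm_nonneg ζ]

lemma exists_cutoff_ball (n : ℕ) : ∃ θ : 𝓓((⊤ : TopologicalSpace.Opens E), ℝ),
    ∀ x ∈ Metric.closedBall (0 : E) n, θ x = 1 := by
  have : ProperSpace E := FiniteDimensional.proper ℝ E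
  obtain ⟨θ, δ, -, h, -⟩ := exists_cutoff (isCompact_closedBall (0 : E) n) isOpen_univ
    (subset_univ _)
  exact ⟨θ, fun x hx => h x (Metric.self_subset_cthickening _ hx)⟩

/-- A cut-off that is `1` on the ball of radius `n`. -/
def ballCutoff (E : Type*) [NormedAddCommGroup E] [InnerProductSpace ℝ E] [FiniteDimensional ℝ E]
    [MeasurableSpace E] [BorelSpace E] (n : ℕ) : 𝓓((⊤ : TopologicalSpace.Opens E), ℝ) :=
  (exists_cutoff_ball (E := E) n).choose

lemma ballCutoff_eq_one {n : ℕ} {x : E} (hx : x ∈ Metric.closedBall (0 : E) n) :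
    ballCutoff E n x = 1 :=
  (exists_cutoff_ball (E := E) n).choose_spec x hx

/-- The Fourier transform of the mollified distribution. -/
def mollifyCoeff (u : 𝓓'((⊤ : TopologicalSpace.Opens E), ℂ)) (n : ℕ) (ζ : E) : ℂ :=
  mollMult n ζ * cext u ((ballCutoff E n).toComplex.modulate ((2 * Real.pi) • ζ))

lemma hasMoments_mollifyCoeff (u : 𝓓'((⊤ : TopologicalSpace.Opens E), ℂ)) (n : ℕ) :
    HasMoments (mollifyCoeff u n) := by
  obtain ⟨C, M, -, hC⟩ := exists_norm_cext_modulate_two_pi_le u (ballCutoff E n).toComplex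
  exact (hasMoments_invF _).mul_of_le (continuous_cext_modulate_two_pi u _) hC

/-- The mollification of a distribution. -/
def mollify (u : 𝓓'((⊤ : TopologicalSpace.Opens E), ℂ)) (n : ℕ) (x : E) : ℂ :=
  ∫ ζ, mollifyCoeff u n ζ * planeWave (-(2 * Real.pi) • ζ) x

lemma contDiff_mollify (u : 𝓓'((⊤ : TopologicalSpace.Opens E), ℂ)) (n : ℕ) :
    ContDiff ℝ ∞ (mollify u n) := contDiff_fourierIntegral (hasMoments_mollifyCoeff u n)

lemma cext_distOfFun_mollify (u : 𝓓'((⊤ : TopologicalSpace.Opens E), ℂ)) (n : ℕ)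
    (φ : 𝓓((⊤ : TopologicalSpace.Opens E), ℂ)) :
    cext (distOfFun (mollify u n)) φ = ∫ ζ, (invF φ ζ * mollMult n ζ) *
      cext u ((ballCutoff E n).toComplex.modulate ((2 * Real.pi) • ζ)) := by
  have hl := (contDiff_mollify u n).continuous.locallyIntegrable (μ := volume)
  rw [cext_eq_integral_of_forall hl (distOfFun_apply hl)]
  refine (integral_mul_fourierIntegral (hasMoments_mollifyCoeff u n) φ).trans ?_
  refine integral_congr_ae (Eventually.of_forall fun ζ => ?_)
  simp only [mollifyCoeff]; ring

/-- The error of the mollification. -/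
lemma cext_mollify_sub (u : 𝓓'((⊤ : TopologicalSpace.Opens E), ℂ)) {K : Set E} (hK : IsCompact K)
    (θ : 𝓓((⊤ : TopologicalSpace.Opens E), ℂ)) {δ : ℝ} (hδ : 0 < δ)
    (hθ : ∀ x ∈ Metric.cthickening δ K, θ x = 1) :
    ∀ᶠ n in atTop, ∀ φ : 𝓓((⊤ : TopologicalSpace.Opens E), ℂ), tsupport φ ⊆ K →
      cext (distOfFun (mollify u n)) φ - cext u φ = ∫ ζ, invF φ ζ * ((mollMult n ζ - 1) *
        cext u (θ.modulate ((2 * Real.pi) • ζ))) := by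
  have : ProperSpace E := FiniteDimensional.proper ℝ E
  obtain ⟨R, hR⟩ := (hK.cthickening (r := δ)).isBounded.exists_norm_le
  obtain ⟨C, M, -, hC⟩ := exists_norm_cext_modulate_two_pi_le u θ
  have h1 : ∀ᶠ n : ℕ in atTop, 1 / ((n : ℝ) + 1) < δ :=
    tendsto_one_div_add_atTop_nhds_zero_nat.eventually_lt_const hδ
  have h2 : ∀ᶠ n : ℕ in atTop, R ≤ n := tendsto_natCast_atTop_atTop.eventually_ge_atTop R
  filter_upwards [h1, h2] with n hn hnR φ hφ
  have hcont := continuous_cext_modulate_two_pi u θ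
  -- For large `n` the ball cut-off and `θ` are both 1 near the support of `φ`, so `θ` may replace
  -- the ball cut-off. The same `θ` represents the pairing of `u` with `φ`, and the two integrals
  -- subtract.
  rw [cext_distOfFun_mollify, integral_mollMult_congr u n φ _ θ fun x hx => ?_,
    cext_eq_integral u θ φ fun x => ?_, ← integral_sub]
  · refine integral_congr_ae (Eventually.of_forall fun ζ => ?_)
    simp only; ring
  · exact ((hasMoments_invF φ).mul_bounded (continuous_invF _)
      (norm_mollMult_le_one n)).integrable_mul hcont.aestronglyMeasurable hC
  · exact (hasMoments_invF φ).integrable_mul hcont.aestronglyMeasurable hC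
  · by_cases hx : x ∈ tsupport φ
    · rw [hθ x (Metric.self_subset_cthickening _ (hφ hx)), one_mul]
    · rw [image_eq_zero_of_notMem_tsupport hx, mul_zero]
  · have hx' : x ∈ Metric.cthickening δ K :=
      Metric.cthickening_mono hn.le K (Metric.cthickening_subset_of_subset _ hφ hx)
    rw [hθ x hx', toComplex_apply, ballCutoff_eq_one, Complex.ofReal_one]
    exact mem_closedBall_zero_iff.2 ((hR x hx').trans hnR)

lemma norm_mollMult_error_le {f : E → ℂ} {C : ℝ} {M : ℕ} (hC0 : 0 ≤ C)
    (hC : ∀ ζ, ‖f ζ‖ ≤ C * (1 + ‖ζ‖) ^ M) (n : ℕ) (ζ : E) :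
    ‖(mollMult n ζ - 1) * f ζ‖ ≤ 2 * Real.pi * C / (n + 1) * (1 + ‖ζ‖) ^ (M + 1) := by
  rw [norm_mul]
  calc _ ≤ 2 * Real.pi * ‖ζ‖ / (n + 1) * (C * (1 + ‖ζ‖) ^ M) :=
        mul_le_mul (norm_mollMult_sub_one_le n ζ) (hC ζ) (norm_nonneg _) (by positivity)
    _ ≤ 2 * Real.pi * (1 + ‖ζ‖) / (n + 1) * (C * (1 + ‖ζ‖) ^ M) := by gcongr; linarith
    _ = _ := by rw [pow_succ]; ring

lemma tendsto_const_div_nat (A : ℝ) : Tendsto (fun n : ℕ => A / ((n : ℝ) + 1)) atTop (𝓝 0) := by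
  have := tendsto_one_div_add_atTop_nhds_zero_nat.const_mul A
  simpa [div_eq_mul_inv] using this

lemma tendsto_distOfFun_mollify (u : 𝓓'((⊤ : TopologicalSpace.Opens E), ℂ)) :
    Tendsto (fun n => distOfFun (mollify u n)) atTop (𝓝 u) := by
  rw [tendsto_distribution_iff]
  intro S hS ε hε
  have hS' : IsCompact (TestFunction.toComplex '' S) :=
    hS.image (TestFunction.postcompCLM Complex.ofRealCLM).continuous
  obtain ⟨K, -, hK⟩ := hS'.exists_common_support
  choose B hB0 hB using hS'.exists_bound_iteratedFDeriv
  obtain ⟨θ, δ, hδ, hθ, -⟩ := exists_cutoff K.isCompact isOpen_univ (subset_univ _)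
  obtain ⟨C, M, hC0, hC⟩ := exists_norm_cext_modulate_two_pi_le u θ.toComplex
  -- The exponent pays for the growth of the Fourier transform of θu, for the extra power in the
  -- multiplier error, and for integrability.
  obtain ⟨D, m, hD0, hD⟩ := exists_invF_bound (K : Set E) K.isCompact (M + 1 + intExp E)
  let B' := ∑ i ∈ Finset.range (m + 1), B i
  let A := 2 * Real.pi * C * (D * B') * ∫ ζ : E, ((1 + ‖ζ‖) ^ intExp E)⁻¹
  filter_upwards [cext_mollify_sub u K.isCompact θ.toComplex hδ
    (fun x hx => by rw [toComplex_apply, hθ x hx, Complex.ofReal_one]),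
    (tendsto_const_div_nat A).eventually_lt_const hε] with n hn hnA φ hφ
  have hφ' := mem_image_of_mem TestFunction.toComplex hφ
  have h1 := hn φ.toComplex (hK _ hφ')
  rw [cext_toComplex, cext_toComplex] at h1
  rw [h1]
  refine lt_of_le_of_lt ?_ hnA
  have h2 : A / (n + 1) = ∫ ζ : E, 2 * Real.pi * C / (n + 1) * (D * B') *
      ((1 + ‖ζ‖) ^ intExp E)⁻¹ := by
    rw [integral_const_mul]; simp only [A]; ring
  rw [h2]
  refine norm_integral_le_of_norm_le (integrable_inv_one_add_norm_pow.const_mul _)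
    (Eventually.of_forall fun ζ => ?_)
  have h3 := norm_mollMult_error_le hC0 hC n ζ
  have h4 := hD φ.toComplex (hK _ hφ') B' (fun i hi x => (hB i _ hφ' x).trans
    (Finset.single_le_sum (f := B) (fun i _ => hB0 i) (Finset.mem_range.2 (by omega)))) ζ
  rw [norm_mul]
  calc _ ≤ ‖invF φ.toComplex ζ‖ * (2 * Real.pi * C / (n + 1) * (1 + ‖ζ‖) ^ (M + 1)) := by
        gcongr
    _ = 2 * Real.pi * C / (n + 1) * ((1 + ‖ζ‖) ^ (M + 1 + intExp E) * ‖invF φ.toComplex ζ‖) *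
        ((1 + ‖ζ‖) ^ intExp E)⁻¹ := by
      rw [pow_add _ (M + 1)]; field_simp
    _ ≤ _ := by gcongr

variable {Λ : Set (E × E)}

/-- Smooth functions are sequentially dense in `𝓓'_Λ`. -/
theorem WavefrontSpace.exists_smooth_approximation (u : WavefrontSpace Λ) :
    ∃ (f : ℕ → E → ℂ) (U : ℕ → WavefrontSpace Λ), (∀ n, ContDiff ℝ ∞ (f n)) ∧
      (∀ n (φ : 𝓓((⊤ : TopologicalSpace.Opens E), ℝ)),
        (U n).toDistribution φ = ∫ x, φ x • f n x) ∧ Tendsto U atTop (𝓝 u) := by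
  have hap (n : ℕ) (φ : 𝓓((⊤ : TopologicalSpace.Opens E), ℝ)) :
      distOfFun (mollify u.toDistribution n) φ = ∫ x, φ x • mollify u.toDistribution n x :=
    distOfFun_apply (contDiff_mollify u.toDistribution n).continuous.locallyIntegrable φ
  have hWF (n : ℕ) : wavefrontSet (distOfFun (mollify u.toDistribution n)) ⊆ Λ := by
    rw [wavefrontSet_of_smooth (contDiff_mollify u.toDistribution n) (hap n)]
    exact empty_subset _
  refine ⟨mollify u.toDistribution, fun n => WavefrontSpace.mk _ (hWF n),
    contDiff_mollify _, hap, WavefrontSpace.tendsto_iff.2 ⟨tendsto_distOfFun_mollify _, fun i => ?_⟩⟩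
  change ∀ ε : ℝ, 0 < ε → ∀ᶠ n in atTop, ∀ η ∈ i.V, (1 + ‖η‖) ^ i.N *
    ‖localFourier (distOfFun (mollify u.toDistribution n)) i.χ η -
      localFourier u.toDistribution i.χ η‖ < ε
  -- Only cut-offs with small support need to be treated, for which the Fourier transform of `u`
  -- decays on one conic neighbourhood of all of `i.V`.
  refine TestFunction.induction_local (fun χ => ∀ ε : ℝ, 0 < ε → ∀ᶠ n in atTop, ∀ η ∈ i.V,
    (1 + ‖η‖) ^ i.N * ‖localFourier (distOfFun (mollify u.toDistribution n)) χ η -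
      localFourier u.toDistribution χ η‖ < ε) ?_ ?_ i.χ ?_
  · intro ε hε
    simp [localFourier_zero_right, hε]
  · intro φ ψ hφ hψ ε hε
    filter_upwards [hφ _ (half_pos hε), hψ _ (half_pos hε)] with n h1 h2 η hη
    rw [localFourier_add_right, localFourier_add_right, add_sub_add_comm]
    calc _ ≤ (1 + ‖η‖) ^ i.N * (‖_‖ + ‖_‖) := by gcongr; exact norm_add_le _ _
      _ < ε := by rw [mul_add]; linarith [h1 η hη, h2 η hη]
  · intro x hx
    obtain ⟨U, hU, W, c, hc, hW, hR⟩ := exists_rapidOn_of_microAt i.isClosed i.isConic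
      fun ξ hξ h0 => u.microAt (x := x) h0 fun h => disjoint_left.1 i.disjoint ⟨hx, hξ⟩ h
    refine ⟨interior U, interior_mem_nhds.2 hU, fun ψ hψ _ ε hε => ?_⟩
    obtain ⟨θ, δ, hδ, hθ, hθU⟩ := exists_cutoff ψ.hasCompactSupport isOpen_interior hψ
    obtain ⟨C, M, hC0, hC⟩ := exists_norm_cext_modulate_two_pi_le u.toDistribution θ.toComplex
    -- One order of decay beyond `i.N` is requested because the multiplier error trades a factor 1 +
    -- |ζ| for the small factor 1/(n+1). The growth exponent `M` is raised by one below for the same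
    -- reason.
    obtain ⟨C', hC0', hC'⟩ := hR θ (hθU.trans interior_subset) (i.N + 1)
    obtain ⟨D, hD0, hD⟩ := exists_conv_bound (rapidDecay_invF ψ.toComplex) (M + 1) i.N hc
    let A := 2 * Real.pi * (C + C')
    filter_upwards [cext_mollify_sub u.toDistribution ψ.hasCompactSupport θ.toComplex hδ
      (fun x hx => by rw [toComplex_apply, hθ x hx, Complex.ofReal_one]),
      (tendsto_const_div_nat ((2 * Real.pi) ^ i.N * D * A)).eventually_lt_const hε]
      with n hn hnA η hη
    refine lt_of_le_of_lt ?_ hnA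
    rw [localFourier_eq_cext, localFourier_eq_cext, hn (ψ.toComplex.modulate η)
      ((tsupport_modulate_subset _ _).trans (tsupport_toComplex ψ).subset)]
    simp only [invF_modulate]
    have hn0 : (0 : ℝ) < n + 1 := by positivity
    have h1 := hD (fun ζ => (mollMult n ζ - 1) *
      cext u.toDistribution (θ.toComplex.modulate ((2 * Real.pi) • ζ))) (A / (n + 1))
      {ζ | (2 * Real.pi) • ζ ∈ W} (by positivity) (fun ζ => ?_) (fun ζ hζ => ?_)
      ((2 * Real.pi)⁻¹ • η) (fun ζ hζ => ?_)
    · calc _ ≤ (2 * Real.pi * (1 + ‖(2 * Real.pi)⁻¹ • η‖)) ^ i.N * _ := by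
            gcongr; exact one_add_norm_le_two_pi η
        _ = (2 * Real.pi) ^ i.N * ((1 + ‖(2 * Real.pi)⁻¹ • η‖) ^ i.N * _) := by
            rw [mul_pow, mul_assoc]
        _ ≤ (2 * Real.pi) ^ i.N * (D * (A / (n + 1))) := by gcongr
        _ = _ := by ring
    · refine (norm_mollMult_error_le hC0 hC n ζ).trans ?_
      gcongr
      simp only [A]; nlinarith [Real.two_le_pi]
    · have h2 := hC' () _ hζ
      rw [localFourier_eq_cext] at h2
      rw [norm_mul]
      calc _ ≤ (1 + ‖ζ‖) ^ i.N * (2 * Real.pi * (1 + ‖ζ‖) / (n + 1) * _) := by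
            gcongr
            refine (norm_mollMult_sub_one_le n ζ).trans ?_
            gcongr; linarith
        _ = 2 * Real.pi / (n + 1) * ((1 + ‖ζ‖) ^ (i.N + 1) *
            ‖cext u.toDistribution (θ.toComplex.modulate ((2 * Real.pi) • ζ))‖) := by
          rw [pow_succ]; ring
        _ ≤ 2 * Real.pi / (n + 1) * C' := by
          refine mul_le_mul_of_nonneg_left (le_trans ?_ h2) (by positivity)
          gcongr ?_ ^ _ * _
          exact one_add_norm_le_one_add_norm_two_pi_smul ζ
        _ ≤ _ := by
          rw [div_mul_eq_mul_div]
          gcongr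
          simp only [A]; nlinarith [Real.two_le_pi]
    · refine hW η hη _ ?_
      have h3 : (2 * Real.pi) • ζ - η = (2 * Real.pi) • (ζ - (2 * Real.pi)⁻¹ • η) := by
        rw [smul_sub, smul_smul, mul_inv_cancel₀ (by positivity), one_smul]
      rw [h3, norm_smul, Real.norm_of_nonneg (by positivity)]
      rw [norm_smul, norm_inv, Real.norm_of_nonneg (by positivity : 0 ≤ 2 * Real.pi)] at hζ
      calc _ < 2 * Real.pi * (c * ((2 * Real.pi)⁻¹ * ‖η‖)) := by gcongr
        _ = _ := by field_simp

end Density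

/-! ### Continuity criteria for linear maps on test functions -/

section ContinuityCriteria

variable {E : Type*} [NormedAddCommGroup E] [NormedSpace ℝ E] {Ω : TopologicalSpace.Opens E}
  {F : Type*} [NormedAddCommGroup F] [NormedSpace ℝ F]
  {E' : Type*} [NormedAddCommGroup E'] [NormedSpace ℝ E'] {Ω' : TopologicalSpace.Opens E'}
  {F' : Type*} [NormedAddCommGroup F'] [NormedSpace ℝ F']

lemma norm_iteratedFDeriv_le_sup_seminorm {K : TopologicalSpace.Compacts E} (φ : 𝓓_{K}(E, F))
    {m j : ℕ} (hj : j ≤ m) (x : E) : ‖iteratedFDeriv ℝ j φ x‖ ≤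
      ((Finset.range (m + 1)).sup fun i => ContDiffMapSupportedIn.seminorm ℝ E F ⊤ K i) φ := by
  have h1 : ‖iteratedFDeriv ℝ j φ x‖ ≤ ContDiffMapSupportedIn.seminorm ℝ E F ⊤ K j φ := by
    rw [ContDiffMapSupportedIn.seminorm_apply,
      ← congrFun (ContDiffMapSupportedIn.structureMapCLM_top_apply ℝ φ) x]
    exact BoundedContinuousFunction.norm_coe_le_norm _ x
  exact h1.trans (Seminorm.le_finset_sup_apply (p := fun i =>
    ContDiffMapSupportedIn.seminorm ℝ E F ⊤ K i) (Finset.mem_range.2 (by omega)))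

/-- A linear map between spaces of test functions is continuous if its values have a common
support and it is bounded with respect to the `C^k` norms. -/
lemma TestFunction.continuous_of_bounds (A : 𝓓(Ω, F) →ₗ[ℝ] 𝓓(Ω', F'))
    (L : TopologicalSpace.Compacts E') (hL : (L : Set E') ⊆ Ω') (hsupp : ∀ φ, tsupport (A φ) ⊆ L)
    (hb : ∀ i : ℕ, ∃ (m : ℕ) (C : ℝ), 0 ≤ C ∧ ∀ φ : 𝓓(Ω, F), ∀ B : ℝ,
      (∀ j ≤ m, ∀ x, ‖iteratedFDeriv ℝ j φ x‖ ≤ B) → ∀ x, ‖iteratedFDeriv ℝ i (A φ) x‖ ≤ C * B) :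
    Continuous A := by
  rw [TestFunction.continuous_iff_continuous_comp]
  intro K hK
  have hadd (f g : 𝓓_{K}(E, F)) : A (TestFunction.ofSupportedIn hK (f + g)) =
      A (TestFunction.ofSupportedIn hK f) + A (TestFunction.ofSupportedIn hK g) :=
    A.map_add (TestFunction.ofSupportedIn hK f) (TestFunction.ofSupportedIn hK g)
  have hsmul (c : ℝ) (f : 𝓓_{K}(E, F)) : A (TestFunction.ofSupportedIn hK (c • f)) =
      c • A (TestFunction.ofSupportedIn hK f) :=
    A.map_smul c (TestFunction.ofSupportedIn hK f)
  let T : 𝓓_{K}(E, F) →ₗ[ℝ] 𝓓_{L}(E', F') :=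
    { toFun φ := (A (TestFunction.ofSupportedIn hK φ)).toSupportedIn L (hsupp _)
      map_add' f g := by ext x; exact DFunLike.congr_fun (hadd f g) x
      map_smul' c f := by ext x; exact DFunLike.congr_fun (hsmul c f) x }
  have hT : Continuous T := by
    refine WithSeminorms.continuous_of_isBounded (ContDiffMapSupportedIn.withSeminorms ℝ E F ⊤ K)
      (ContDiffMapSupportedIn.withSeminorms ℝ E' F' ⊤ L) T fun i => ?_
    obtain ⟨m, C, hC0, hC⟩ := hb i
    refine ⟨Finset.range (m + 1), ⟨C, hC0⟩, fun f => ?_⟩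
    change ContDiffMapSupportedIn.seminorm ℝ E' F' ⊤ L i (T f) ≤
      C * ((Finset.range (m + 1)).sup fun i => ContDiffMapSupportedIn.seminorm ℝ E F ⊤ K i) f
    refine (ContDiffMapSupportedIn.seminorm_top_le_iff ℝ
      (mul_nonneg hC0 (apply_nonneg _ _)) i (T f)).2 fun x _ => ?_
    exact hC (TestFunction.ofSupportedIn hK f) _
      (fun j hj x => norm_iteratedFDeriv_le_sup_seminorm f hj x) x
  exact (TestFunction.continuous_ofSupportedIn hL).comp hT

lemma TestFunction.continuous_functional_of_bounds (A : 𝓓(Ω, F) →ₗ[ℝ] ℂ)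
    (hb : ∀ K : TopologicalSpace.Compacts E, (K : Set E) ⊆ Ω → ∃ (m : ℕ) (C : ℝ), 0 ≤ C ∧
      ∀ φ : 𝓓(Ω, F), tsupport φ ⊆ K → ∀ B : ℝ,
        (∀ j ≤ m, ∀ x, ‖iteratedFDeriv ℝ j φ x‖ ≤ B) → ‖A φ‖ ≤ C * B) :
    Continuous A := by
  rw [TestFunction.continuous_iff_continuous_comp]
  intro K hK
  obtain ⟨m, C, hC0, hC⟩ := hb K hK
  let T : 𝓓_{K}(E, F) →L[ℝ] ℂ := ContDiffMapSupportedIn.mkCLMtoNormedSpace ℝ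
    (fun φ => A (TestFunction.ofSupportedIn hK φ))
    (fun f g => by
      have : TestFunction.ofSupportedIn hK (f + g) =
        TestFunction.ofSupportedIn hK f + TestFunction.ofSupportedIn hK g := rfl
      rw [this, map_add])
    (fun c f => by
      have : TestFunction.ofSupportedIn hK (c • f) = c • TestFunction.ofSupportedIn hK f := rfl
      rw [this, map_smul])
    ⟨Finset.range (m + 1), C, hC0, fun f => hC _ f.tsupport_subset _
        (fun j hj x => norm_iteratedFDeriv_le_sup_seminorm f hj x)⟩
  exact T.continuous

end ContinuityCriteria

/-! ### Bounds for products and families -/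

section Bounds

variable {E : Type*} [NormedAddCommGroup E] [NormedSpace ℝ E]
  {F : Type*} [NormedAddCommGroup F] [NormedSpace ℝ F]
  {P : Type*} [NormedAddCommGroup P] [NormedSpace ℝ P]

lemma exists_bound_iteratedFDeriv_family {G : E × P → F} (hG : ContDiff ℝ ∞ G) {K : Set E}
    (hK : IsCompact K) {L : Set P} (hL : IsCompact L) (N : ℕ) :
    ∃ C : ℝ, 0 ≤ C ∧ ∀ i ≤ N, ∀ p ∈ L, ∀ x ∈ K,
      ‖iteratedFDeriv ℝ i (fun y => G (y, p)) x‖ ≤ C := by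
  have h (i : ℕ) : ∃ C : ℝ, 0 ≤ C ∧ ∀ p ∈ L, ∀ x ∈ K,
      ‖iteratedFDeriv ℝ i (fun y => G (y, p)) x‖ ≤ C := by
    have h1 : Continuous (iteratedFDeriv ℝ i G) :=
      hG.continuous_iteratedFDeriv (by exact_mod_cast le_top)
    have h2 : Continuous fun z : E × P => iteratedFDeriv ℝ i (fun y => G (y, z.2)) z.1 := by
      simp only [iteratedFDeriv_comp_inl hG]
      exact (ContinuousMultilinearMap.compContinuousLinearMapL (F := F)
        (fun _ : Fin i => ContinuousLinearMap.inl ℝ E P)).continuous.comp h1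
    obtain ⟨C, hC⟩ := ((hK.prod hL).image h2).isBounded.exists_norm_le
    exact ⟨max C 0, le_max_right _ _, fun p hp x hx =>
      (hC _ (mem_image_of_mem _ (mk_mem_prod hx hp))).trans (le_max_left _ _)⟩
  choose C hC0 hC using h
  refine ⟨∑ i ∈ Finset.range (N + 1), C i, Finset.sum_nonneg fun i _ => hC0 i,
    fun i hi p hp x hx => (hC i p hp x hx).trans ?_⟩
  exact Finset.single_le_sum (fun i _ => hC0 i) (Finset.mem_range.2 (by omega))

lemma norm_iteratedFDeriv_mul_le_of_bounds {K : Set E} {N : ℕ} {f h : E → ℂ}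
    (hf : ContDiff ℝ ∞ f) (hh : ContDiff ℝ ∞ h) (hfK : tsupport f ⊆ K) {C B : ℝ}
    (hC : ∀ i ≤ N, ∀ x ∈ K, ‖iteratedFDeriv ℝ i h x‖ ≤ C)
    (hB : ∀ i ≤ N, ∀ x, ‖iteratedFDeriv ℝ i f x‖ ≤ B) {i : ℕ} (hi : i ≤ N) (x : E)
    (hC0 : 0 ≤ C) : ‖iteratedFDeriv ℝ i (fun y => f y * h y) x‖ ≤ 2 ^ N * C * B := by
  have hB0 : 0 ≤ B := (norm_nonneg _).trans (hB 0 (Nat.zero_le _) x)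
  by_cases hx : x ∈ K
  · refine (norm_iteratedFDeriv_mul_le hf hh x (by exact_mod_cast le_top)).trans ?_
    calc _ ≤ ∑ j ∈ Finset.range (i + 1), (i.choose j : ℝ) * (C * B) := by
          refine Finset.sum_le_sum fun j hj => ?_
          have hj' : j ≤ i := by have := Finset.mem_range.1 hj; omega
          rw [mul_assoc, mul_comm C B]
          gcongr
          · exact hB j (hj'.trans hi) x
          · exact hC (i - j) (by omega) x hx
      _ = 2 ^ i * (C * B) := by
          rw [← Finset.sum_mul]
          congr 1
          exact_mod_cast Nat.sum_range_choose i
      _ ≤ 2 ^ N * (C * B) := by gcongr; norm_num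
      _ = _ := by ring
  · have h0 : iteratedFDeriv ℝ i (fun y => f y * h y) x = 0 := by
      by_contra h1
      exact hx (hfK (tsupport_mul_subset_left (support_iteratedFDeriv_subset i h1)))
    rw [h0, norm_zero]; positivity

/-- A smooth substitute for 1/s on the whole line: the bump `b` is 1 near 0 and vanishes for |s| ≥
c, so the denominator s² + b(s) has no zero. It permits division by a phase derivative that may
vanish off the relevant support. -/
lemma exists_smooth_inv {c : ℝ} (hc : 0 < c) :
    ∃ H : ℝ → ℝ, ContDiff ℝ ∞ H ∧ ∀ s, c ≤ |s| → H s = s⁻¹ := by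
  let b : ContDiffBump (0 : ℝ) := ⟨c / 2, c, half_pos hc, half_lt_self hc⟩
  have hpos (s : ℝ) : 0 < s ^ 2 + b s := by
    by_cases hs : s = 0
    · have : b s = 1 := b.one_of_mem_closedBall (by rw [hs]; simp [b]; linarith)
      rw [this]; positivity
    · have := b.nonneg (x := s)
      positivity
  refine ⟨fun s => s / (s ^ 2 + b s), ?_, fun s hs => ?_⟩
  · exact contDiff_id.div ((contDiff_id.pow 2).add b.contDiff) fun s => (hpos s).ne'
  · have h0 : b s = 0 := b.zero_of_le_dist (by simpa [b, Real.dist_eq] using hs)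
    have hs0 : s ≠ 0 := by
      rintro rfl
      rw [abs_zero] at hs
      exact absurd hs (not_le.2 hc)
    simp only [h0]; field_simp; ring

end Bounds

/-! ### Non-stationary phase in one variable -/

section NonstationaryPhase

variable {E : Type*} [NormedAddCommGroup E] [InnerProductSpace ℝ E] [FiniteDimensional ℝ E]

lemma norm_iteratedFDeriv_deriv {f : ℝ → ℂ} (i : ℕ) (t : ℝ) :
    ‖iteratedFDeriv ℝ i (deriv f) t‖ = ‖iteratedFDeriv ℝ (i + 1) f t‖ := by
  rw [norm_iteratedFDeriv_eq_norm_iteratedDeriv, norm_iteratedFDeriv_eq_norm_iteratedDeriv,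
    iteratedDeriv_succ']

/-- Integration by parts. On the support of `g` the function `h` inverts the derivative of the
phase, so one power of `s` is gained when the derivative moves to `g * h`. -/
lemma integral_mul_planeWave_curve {v : ℝ → E} (hv : ContDiff ℝ ∞ v) {ξ : E} {h : ℝ → ℂ}
    (hh : ContDiff ℝ ∞ h) {g : ℝ → ℂ} (hg : ContDiff ℝ ∞ g) (hc : HasCompactSupport g)
    (h1 : ∀ t ∈ tsupport g, h t * (⟪deriv v t, ξ⟫_ℝ : ℂ) = 1) (s : ℝ) :
    Complex.I * s * ∫ t, g t * Complex.exp (Complex.I * s * (⟪v t, ξ⟫_ℝ : ℂ)) =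
      -∫ t, deriv (fun t => g t * h t) t * Complex.exp (Complex.I * s * (⟪v t, ξ⟫_ℝ : ℂ)) := by
  let e : ℝ → ℂ := fun t => Complex.exp (Complex.I * s * (⟪v t, ξ⟫_ℝ : ℂ))
  have hin : ContDiff ℝ ∞ fun t => (⟪v t, ξ⟫_ℝ : ℂ) :=
    Complex.ofRealCLM.contDiff.comp (hv.inner ℝ contDiff_const)
  have he : ContDiff ℝ ∞ e := (contDiff_const.mul hin).cexp
  have hdv (t : ℝ) : HasDerivAt v (deriv v t) t :=
    ((hv.differentiable (by simp)) t).hasDerivAt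
  have hde (t : ℝ) : HasDerivAt e (Complex.I * s * (⟪deriv v t, ξ⟫_ℝ : ℂ) * e t) t := by
    have h2 : HasDerivAt (fun t => ⟪v t, ξ⟫_ℝ) ⟪deriv v t, ξ⟫_ℝ t := by
      simpa using (hdv t).inner ℝ (hasDerivAt_const t ξ)
    have h3 := (h2.ofReal_comp.const_mul (Complex.I * s)).cexp
    simpa [e, mul_comm] using h3
  have hgh : ContDiff ℝ ∞ fun t => g t * h t := hg.mul hh
  have hghc : HasCompactSupport fun t => g t * h t := hc.mul_right
  have hd (t : ℝ) : HasDerivAt (fun t => g t * h t * e t)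
      (deriv (fun t => g t * h t) t * e t + Complex.I * s * (g t * e t)) t := by
    have h2 := ((hgh.differentiable (by simp)) t).hasDerivAt.fun_mul (hde t)
    refine h2.congr_deriv ?_
    by_cases ht : t ∈ tsupport g
    · linear_combination (Complex.I * s * g t * e t) * h1 t ht
    · rw [image_eq_zero_of_notMem_tsupport ht]; ring
  have hdc : Continuous (deriv fun t => g t * h t) :=
    hgh.continuous_deriv (by simp)
  have hi1 : Integrable fun t => deriv (fun t => g t * h t) t * e t :=
    (hdc.mul he.continuous).integrable_of_hasCompactSupport (hghc.deriv.mul_right)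
  have hi2 : Integrable fun t => Complex.I * s * (g t * e t) :=
    ((hg.continuous.mul he.continuous).integrable_of_hasCompactSupport hc.mul_right).const_mul _
  have h0 := integral_eq_zero_of_hasDerivAt_of_integrable hd (hi1.add hi2)
    (((hgh.continuous.mul he.continuous).integrable_of_hasCompactSupport hghc.mul_right))
  rw [integral_add hi1 hi2, integral_const_mul] at h0
  exact eq_neg_of_add_eq_zero_right h0

/-- Rapid decay of oscillatory integrals along a curve without stationary points. -/
lemma exists_nonstationary_bound {v : ℝ → E} (hv : ContDiff ℝ ∞ v) {K : Set ℝ} (hK : IsCompact K)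
    {c : ℝ} (hc : 0 < c) (N : ℕ) : ∃ C : ℝ, 0 ≤ C ∧ ∀ ξ : E, ‖ξ‖ ≤ 1 →
      (∀ t ∈ K, c ≤ |⟪deriv v t, ξ⟫_ℝ|) → ∀ s : ℝ, 0 ≤ s → ∀ g : ℝ → ℂ, ContDiff ℝ ∞ g →
        tsupport g ⊆ K → ∀ B : ℝ, (∀ i ≤ N, ∀ t, ‖iteratedFDeriv ℝ i g t‖ ≤ B) →
          s ^ N * ‖∫ t, g t * Complex.exp (Complex.I * s * (⟪v t, ξ⟫_ℝ : ℂ))‖ ≤ C * B := by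
  obtain ⟨H, hH, hHinv⟩ := exists_smooth_inv hc
  have hdv : ContDiff ℝ ∞ (deriv v) := (contDiff_infty_iff_deriv.1 hv).2
  have hG : ContDiff ℝ ∞ fun p : ℝ × E => (H ⟪deriv v p.1, p.2⟫_ℝ : ℂ) :=
    Complex.ofRealCLM.contDiff.comp (hH.comp ((hdv.comp contDiff_fst).inner ℝ contDiff_snd))
  have : ProperSpace E := FiniteDimensional.proper ℝ E
  induction N with
  | zero =>
    refine ⟨volume.real K, measureReal_nonneg (μ := volume), fun ξ _ _ s _ g hg hgK B hB => ?_⟩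
    have hB0 : ∀ t, ‖g t‖ ≤ B := fun t => by simpa using hB 0 le_rfl t
    rw [pow_zero, one_mul, ← setIntegral_eq_integral_of_forall_compl_eq_zero (s := K), mul_comm _ B]
    · refine norm_setIntegral_le_of_norm_le_const (μ := volume) hK.measure_lt_top fun t _ => ?_
      have : Complex.I * s * (⟪v t, ξ⟫_ℝ : ℂ) = ((s * ⟪v t, ξ⟫_ℝ : ℝ) : ℂ) * Complex.I := by
        push_cast; ring
      rw [norm_mul, this, Complex.norm_exp_ofReal_mul_I, mul_one]
      exact hB0 t
    · intro t ht
      rw [image_eq_zero_of_notMem_tsupport fun h => ht (hgK h), zero_mul]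
  | succ N ih =>
    obtain ⟨C, hC0, hC⟩ := ih
    -- Dividing by the phase derivative and differentiating yields an amplitude with the same
    -- support property, at the cost of one derivative of `g`. The covector ranges over a compact
    -- ball, which makes the constant uniform.
    obtain ⟨D, hD0, hD⟩ := exists_bound_iteratedFDeriv_family hG hK
      (isCompact_closedBall (0 : E) 1) (N + 1)
    refine ⟨C * (2 ^ (N + 1) * D), by positivity, fun ξ hξ hcK s hs g hg hgK B hB => ?_⟩
    have hh : ContDiff ℝ ∞ fun t => (H ⟪deriv v t, ξ⟫_ℝ : ℂ) :=
      hG.comp (contDiff_id.prodMk contDiff_const)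
    have hg' : ContDiff ℝ ∞ (deriv fun t => g t * (H ⟪deriv v t, ξ⟫_ℝ : ℂ)) :=
      (contDiff_infty_iff_deriv.1 (hg.mul hh)).2
    have hsupp : tsupport (deriv fun t => g t * (H ⟪deriv v t, ξ⟫_ℝ : ℂ)) ⊆ K :=
      (closure_minimal (support_deriv_subset) (isClosed_tsupport _)).trans
        (tsupport_mul_subset_left.trans hgK)
    have h1 := hC ξ hξ hcK s hs _ hg' hsupp (2 ^ (N + 1) * D * B) fun i hi t => by
      rw [norm_iteratedFDeriv_deriv]
      exact norm_iteratedFDeriv_mul_le_of_bounds hg hh hgK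
        (fun j hj t ht => hD j hj ξ (mem_closedBall_zero_iff.2 hξ) t ht) hB (by omega) t hD0
    have h2 := integral_mul_planeWave_curve hv (ξ := ξ) hh hg
      (hK.of_isClosed_subset (isClosed_tsupport _) hgK) (fun t ht => by
        rw [← Complex.ofReal_mul, hHinv _ (hcK t (hgK ht)), inv_mul_cancel₀, Complex.ofReal_one]
        intro h0
        have := hcK t (hgK ht)
        rw [h0, abs_zero] at this
        exact absurd this (not_le.2 hc)) s
    have h3 := congrArg norm h2
    rw [norm_neg, norm_mul, norm_mul, Complex.norm_I, one_mul, Complex.norm_real,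
      Real.norm_of_nonneg hs] at h3
    rw [← h3] at h1
    calc _ = s ^ N * (s * _) := by rw [pow_succ, mul_assoc]
      _ ≤ _ := h1
      _ = _ := by ring

end NonstationaryPhase

/-! ### Pullback along a curve -/

section Pullback

variable {E : Type*} [NormedAddCommGroup E] [InnerProductSpace ℝ E] [FiniteDimensional ℝ E]
  [MeasurableSpace E] [BorelSpace E]

lemma norm_iteratedFDeriv_toComplex {X : Type*} [NormedAddCommGroup X] [NormedSpace ℝ X]
    {Ω : TopologicalSpace.Opens X} (φ : 𝓓(Ω, ℝ)) (i : ℕ) (x : X) :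
    ‖iteratedFDeriv ℝ i φ.toComplex x‖ = ‖iteratedFDeriv ℝ i φ x‖ :=
  Complex.ofRealLI.norm_iteratedFDeriv_comp_left (n := ∞) φ.contDiff.contDiffAt
    (by exact_mod_cast le_top)

/-- The data needed to define the pullback along `w` over the compact set `K`: a cut-off `κ` in the
parameter, a globally smooth modification `v` of the curve, a cone `V` of covectors that does not
meet `Λ` and outside of which the phase has no stationary points, and a cut-off `θ` in space. -/
structure CurveData (I : TopologicalSpace.Opens ℝ) (w : ℝ → E) (Λ : Set (E × E)) (K : Set ℝ) where
  κ : 𝓓(I, ℝ)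
  v : ℝ → E
  V : Set E
  c : ℝ
  θ : 𝓓((⊤ : TopologicalSpace.Opens E), ℝ)
  κ_eq : ∀ t ∈ K, κ t = 1
  contDiff_v : ContDiff ℝ ∞ v
  v_eq : ∀ t ∈ K, v t = w t
  isClosed : IsClosed V
  isConic : IsConic V
  disjoint : ∀ x, ∀ ξ ∈ V, (x, ξ) ∉ Λ
  c_pos : 0 < c
  cone : ∀ t ∈ tsupport κ, ∀ ζ ∉ V, c * ‖ζ‖ ≤ |⟪deriv v t, ζ⟫_ℝ|
  θ_eq : ∀ t ∈ K, θ (w t) = 1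

namespace CurveData

variable {I : TopologicalSpace.Opens ℝ} {w : ℝ → E} {Λ : Set (E × E)} {K : Set ℝ}
  (D : CurveData I w Λ K)

/-- The Fourier integral of `κ g` along the modified curve. -/
def amp (g : 𝓓(I, ℝ)) (ζ : E) : ℂ :=
  ∫ t, ((D.κ t : ℂ) * (g t : ℂ)) * planeWave (-(2 * Real.pi) • ζ) (D.v t)

lemma continuous_integrand (g : 𝓓(I, ℝ)) :
    Continuous fun p : E × ℝ => ((D.κ p.2 : ℂ) * (g p.2 : ℂ)) *
      planeWave (-(2 * Real.pi) • p.1) (D.v p.2) := by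
  have h1 : Continuous fun p : E × ℝ => planeWave (-(2 * Real.pi) • p.1) (D.v p.2) :=
    contDiff_planeWave_uncurry.continuous.comp
      ((D.contDiff_v.continuous.comp continuous_snd).prodMk (continuous_fst.const_smul _))
  exact (((Complex.continuous_ofReal.comp D.κ.contDiff.continuous).mul
    (Complex.continuous_ofReal.comp g.contDiff.continuous)).comp continuous_snd).mul h1

lemma integrable_norm_kappa_mul (g : 𝓓(I, ℝ)) : Integrable fun t => (D.κ t : ℂ) * (g t : ℂ) := by
  refine ((Complex.continuous_ofReal.comp D.κ.contDiff.continuous).mul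
    (Complex.continuous_ofReal.comp g.contDiff.continuous)).integrable_of_hasCompactSupport ?_
  exact HasCompactSupport.mul_right (f := fun t => (D.κ t : ℂ))
    (D.κ.hasCompactSupport.comp_left Complex.ofReal_zero)

lemma integrable_integrand (g : 𝓓(I, ℝ)) (ζ : E) :
    Integrable fun t => ((D.κ t : ℂ) * (g t : ℂ)) * planeWave (-(2 * Real.pi) • ζ) (D.v t) := by
  refine (D.integrable_norm_kappa_mul g).mono ?_ (Eventually.of_forall fun t => ?_)
  · exact ((D.continuous_integrand g).comp (continuous_const.prodMk
      continuous_id)).aestronglyMeasurable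
  · rw [norm_mul _ (planeWave _ _), norm_planeWave, mul_one]

lemma continuous_amp (g : 𝓓(I, ℝ)) : Continuous (D.amp g) := by
  refine continuous_of_dominated (fun ζ => (D.integrable_integrand g ζ).aestronglyMeasurable)
    (bound := fun t => ‖(D.κ t : ℂ) * (g t : ℂ)‖) ?_ (D.integrable_norm_kappa_mul g).norm ?_
  · refine fun ζ => Eventually.of_forall fun t => ?_
    rw [norm_mul _ (planeWave _ _), norm_planeWave, mul_one]
  · exact Eventually.of_forall fun t => (D.continuous_integrand g).comp
      (continuous_id.prodMk continuous_const)

lemma amp_add (g h : 𝓓(I, ℝ)) (ζ : E) : D.amp (g + h) ζ = D.amp g ζ + D.amp h ζ := by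
  rw [amp, amp, amp, ← integral_add (D.integrable_integrand g ζ) (D.integrable_integrand h ζ)]
  refine integral_congr_ae (Eventually.of_forall fun t => ?_)
  have : (g + h) t = g t + h t := rfl
  simp only [this]; push_cast; ring

lemma amp_smul (r : ℝ) (g : 𝓓(I, ℝ)) (ζ : E) : D.amp (r • g) ζ = r * D.amp g ζ := by
  rw [amp, amp, ← integral_const_mul]
  refine integral_congr_ae (Eventually.of_forall fun t => ?_)
  have : (r • g) t = r * g t := rfl
  simp only [this]; push_cast; ring

/-- The trivial bound, which suffices for the frequencies in the cone `V`. -/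
lemma exists_norm_amp_le : ∃ C : ℝ, 0 ≤ C ∧ ∀ (g : 𝓓(I, ℝ)) (B : ℝ), (∀ t, ‖g t‖ ≤ B) →
    ∀ ζ, ‖D.amp g ζ‖ ≤ C * B := by
  refine ⟨∫ t, ‖D.κ t‖, integral_nonneg fun _ => norm_nonneg _, fun g B hB ζ => ?_⟩
  rw [← integral_mul_const]
  have hi : Integrable fun t => ‖D.κ t‖ :=
    (D.κ.contDiff.continuous.integrable_of_hasCompactSupport D.κ.hasCompactSupport).norm
  refine norm_integral_le_of_norm_le (hi.mul_const B) (Eventually.of_forall fun t => ?_)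
  rw [norm_mul, norm_mul, norm_planeWave, mul_one, Complex.norm_real, Complex.norm_real]
  exact mul_le_mul_of_nonneg_left (hB t) (norm_nonneg _)

/-- Off `V` the pairing of the velocity with ζ/|ζ| is bounded below, so non-stationary phase applies
with large parameter 2π|ζ|. The constant `C₀` takes care of small frequencies. -/
lemma exists_norm_amp_le_of_notMem (N : ℕ) : ∃ C : ℝ, 0 ≤ C ∧ ∀ (g : 𝓓(I, ℝ)) (B : ℝ),
    (∀ i ≤ N, ∀ t, ‖iteratedFDeriv ℝ i g t‖ ≤ B) →
      ∀ ζ ∉ D.V, (1 + ‖ζ‖) ^ N * ‖D.amp g ζ‖ ≤ C * B := by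
  obtain ⟨C₀, hC₀0, hC₀⟩ := D.exists_norm_amp_le
  obtain ⟨C₁, hC₁0, hC₁⟩ := exists_nonstationary_bound D.contDiff_v D.κ.hasCompactSupport D.c_pos N
  have hb (i : ℕ) : ∃ A : ℝ, 0 ≤ A ∧ ∀ t, ‖iteratedFDeriv ℝ i D.κ.toComplex t‖ ≤ A := by
    obtain ⟨A, hA⟩ := (D.κ.toComplex.contDiff.continuous_iteratedFDeriv
      (by exact_mod_cast le_top : (i : WithTop ℕ∞) ≤ ∞)).bounded_above_of_compact_support
        (D.κ.toComplex.hasCompactSupport.iteratedFDeriv i)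
    exact ⟨max A 0, le_max_right _ _, fun x => (hA x).trans (le_max_left _ _)⟩
  choose A hA0 hA using hb
  let A' := ∑ i ∈ Finset.range (N + 1), A i
  have hA'0 : 0 ≤ A' := Finset.sum_nonneg fun i _ => hA0 i
  have hA' : ∀ i ≤ N, ∀ t, ‖iteratedFDeriv ℝ i D.κ.toComplex t‖ ≤ A' := fun i hi t =>
    (hA i t).trans (Finset.single_le_sum (fun i _ => hA0 i) (Finset.mem_range.2 (by omega)))
  refine ⟨2 ^ N * (C₀ + C₁ * (2 ^ N * A')), by positivity, fun g B hB ζ hζ => ?_⟩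
  have hB0 : 0 ≤ B := (norm_nonneg _).trans (hB 0 (Nat.zero_le _) 0)
  have h0 : ‖D.amp g ζ‖ ≤ C₀ * B := hC₀ g B (fun t => by simpa using hB 0 (Nat.zero_le _) t) ζ
  have h1 : ‖ζ‖ ^ N * ‖D.amp g ζ‖ ≤ (C₀ + C₁ * (2 ^ N * A')) * B := by
    by_cases hz : ζ = 0
    · have : ‖ζ‖ ^ N ≤ 1 := by rw [hz, norm_zero]; exact pow_le_one₀ le_rfl zero_le_one
      calc _ ≤ 1 * (C₀ * B) := by gcongr
        _ ≤ _ := by rw [one_mul]; gcongr; simp; positivity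
    · have hz' : 0 < ‖ζ‖ := norm_pos_iff.2 hz
      have hω : ‖‖ζ‖⁻¹ • ζ‖ ≤ 1 := by
        rw [norm_smul, norm_inv, norm_norm, inv_mul_cancel₀ hz'.ne']
      have h2 := hC₁ (‖ζ‖⁻¹ • ζ) hω (fun t ht => ?_) (2 * Real.pi * ‖ζ‖) (by positivity)
        (fun t => D.κ.toComplex t * g.toComplex t)
        (D.κ.toComplex.contDiff.mul g.toComplex.contDiff)
        (tsupport_mul_subset_left.trans (tsupport_toComplex D.κ).subset) (2 ^ N * B * A')
        (fun i hi t => ?_)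
      · have h3 : D.amp g ζ = ∫ t, D.κ.toComplex t * g.toComplex t *
            Complex.exp (Complex.I * (2 * Real.pi * ‖ζ‖ : ℝ) * (⟪D.v t, ‖ζ‖⁻¹ • ζ⟫_ℝ : ℂ)) := by
          refine integral_congr_ae (Eventually.of_forall fun t => ?_)
          simp only [toComplex_apply, planeWave, inner_smul_right]
          congr 2
          push_cast
          have : (‖ζ‖ : ℂ) ≠ 0 := by exact_mod_cast hz'.ne'
          field_simp
        rw [h3]
        calc _ ≤ (2 * Real.pi * ‖ζ‖) ^ N * _ := by
              gcongr
              nlinarith [Real.two_le_pi]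
          _ ≤ _ := h2
          _ = C₁ * (2 ^ N * A') * B := by ring
          _ ≤ _ := by gcongr; linarith
      · rw [inner_smul_right, abs_mul, abs_of_pos (inv_pos.2 hz'), ← div_eq_inv_mul,
          le_div_iff₀ hz']
        exact D.cone t ht ζ hζ
      · exact norm_iteratedFDeriv_mul_le_of_bounds (K := univ) D.κ.toComplex.contDiff
          g.toComplex.contDiff (subset_univ _)
          (fun j hj t _ => (norm_iteratedFDeriv_toComplex g j t).trans_le (hB j hj t)) hA' hi t hB0
  have h4 : (1 + ‖ζ‖) ^ N ≤ 2 ^ N * max 1 (‖ζ‖ ^ N) := by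
    rcases le_total ‖ζ‖ 1 with h | h
    · calc (1 + ‖ζ‖) ^ N ≤ 2 ^ N := by gcongr; linarith
        _ ≤ _ := le_mul_of_one_le_right (by positivity) (le_max_left _ _)
    · calc (1 + ‖ζ‖) ^ N ≤ (2 * ‖ζ‖) ^ N := by gcongr; linarith
        _ = 2 ^ N * ‖ζ‖ ^ N := mul_pow _ _ _
        _ ≤ _ := by gcongr; exact le_max_right _ _
  calc _ ≤ 2 ^ N * max 1 (‖ζ‖ ^ N) * ‖D.amp g ζ‖ := by gcongr
    _ = 2 ^ N * (max 1 (‖ζ‖ ^ N) * ‖D.amp g ζ‖) := by ring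
    _ ≤ 2 ^ N * ((C₀ + C₁ * (2 ^ N * A')) * B) := by
        refine mul_le_mul_of_nonneg_left ?_ (by positivity)
        rcases max_choice 1 (‖ζ‖ ^ N) with h | h
        · rw [h, one_mul]
          refine h0.trans ?_
          gcongr; simp; positivity
        · rw [h]; exact h1
    _ = _ := by ring

lemma exists_bound_iteratedFDeriv (g : 𝓓(I, ℝ)) (N : ℕ) :
    ∃ B : ℝ, ∀ i ≤ N, ∀ t, ‖iteratedFDeriv ℝ i g t‖ ≤ B := by
  choose B hB0 hB using fun i => (isCompact_singleton (x := g)).exists_bound_iteratedFDeriv i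
  exact ⟨∑ i ∈ Finset.range (N + 1), B i, fun i hi t => (hB i g rfl t).trans
    (Finset.single_le_sum (fun i _ => hB0 i) (Finset.mem_range.2 (by omega)))⟩

/-- The part of the amplitude outside of the cone. -/
def ampOut (g : 𝓓(I, ℝ)) : E → ℂ := D.Vᶜ.indicator (D.amp g)

lemma exists_norm_ampOut_le (N : ℕ) : ∃ C : ℝ, 0 ≤ C ∧ ∀ (g : 𝓓(I, ℝ)) (B : ℝ),
    (∀ i ≤ N, ∀ t, ‖iteratedFDeriv ℝ i g t‖ ≤ B) →
      ∀ ζ, (1 + ‖ζ‖) ^ N * ‖D.ampOut g ζ‖ ≤ C * B := by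
  obtain ⟨C, hC0, hC⟩ := D.exists_norm_amp_le_of_notMem N
  refine ⟨C, hC0, fun g B hB ζ => ?_⟩
  have hB0 : 0 ≤ B := (norm_nonneg _).trans (hB 0 (Nat.zero_le _) 0)
  by_cases hζ : ζ ∈ D.V
  · rw [ampOut, indicator_of_notMem (by simpa using hζ), norm_zero, mul_zero]; positivity
  · rw [ampOut, indicator_of_mem (by simpa using hζ)]
    exact hC g B hB ζ hζ

lemma hasMoments_ampOut (g : 𝓓(I, ℝ)) : HasMoments (D.ampOut g) := by
  refine RapidDecay.hasMoments (fun N => ?_)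
    ((D.continuous_amp g).aestronglyMeasurable.indicator D.isClosed.measurableSet.compl)
  obtain ⟨C, -, hC⟩ := D.exists_norm_ampOut_le N
  obtain ⟨B, hB⟩ := exists_bound_iteratedFDeriv g N
  exact ⟨C * B, hC g B hB⟩

lemma ampOut_add (g h : 𝓓(I, ℝ)) (ζ : E) : D.ampOut (g + h) ζ = D.ampOut g ζ + D.ampOut h ζ := by
  by_cases h0 : ζ ∈ D.Vᶜ
  · simp only [ampOut, indicator_of_mem h0, D.amp_add]
  · simp only [ampOut, indicator_of_notMem h0, add_zero]

lemma ampOut_smul (r : ℝ) (g : 𝓓(I, ℝ)) (ζ : E) : D.ampOut (r • g) ζ = r * D.ampOut g ζ := by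
  by_cases h0 : ζ ∈ D.Vᶜ
  · simp only [ampOut, indicator_of_mem h0, D.amp_smul]
  · simp only [ampOut, indicator_of_notMem h0, mul_zero]

/-- The test function whose pairing is the contribution of the frequencies outside the cone. -/
def outTest : 𝓓(I, ℝ) →ₗ[ℝ] 𝓓((⊤ : TopologicalSpace.Opens E), ℂ) where
  toFun g := (exists_testFunction_fourierIntegral D.θ.toComplex (D.hasMoments_ampOut g)).choose
  map_add' g h := by
    have hi (g : 𝓓(I, ℝ)) (x : E) :
        Integrable fun ζ => D.ampOut g ζ * planeWave ((2 * Real.pi) • ζ) x :=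
      (D.hasMoments_ampOut g).integrable_mul (C := 1) (M := 0)
        (contDiff_planeWave_uncurry.continuous.comp (continuous_const.prodMk
          (continuous_const_smul _))).aestronglyMeasurable fun ζ => by
            rw [norm_planeWave]; simp
    ext x
    have hadd (φ ψ : 𝓓((⊤ : TopologicalSpace.Opens E), ℂ)) : (φ + ψ) x = φ x + ψ x := rfl
    rw [hadd, (exists_testFunction_fourierIntegral D.θ.toComplex
        (D.hasMoments_ampOut (g + h))).choose_spec.1,
      (exists_testFunction_fourierIntegral D.θ.toComplex (D.hasMoments_ampOut g)).choose_spec.1,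
      (exists_testFunction_fourierIntegral D.θ.toComplex (D.hasMoments_ampOut h)).choose_spec.1,
      ← mul_add, ← integral_add (hi g x) (hi h x)]
    simp only [ampOut_add, add_mul]
  map_smul' r g := by
    ext x
    have hsmul (φ : 𝓓((⊤ : TopologicalSpace.Opens E), ℂ)) : (r • φ) x = r * φ x := by
      rw [← Complex.real_smul]; rfl
    rw [RingHom.id_apply, hsmul, (exists_testFunction_fourierIntegral D.θ.toComplex
        (D.hasMoments_ampOut (r • g))).choose_spec.1,
      (exists_testFunction_fourierIntegral D.θ.toComplex (D.hasMoments_ampOut g)).choose_spec.1]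
    simp only [ampOut_smul, mul_assoc, integral_const_mul]
    ring

lemma cext_outTest (u : 𝓓'((⊤ : TopologicalSpace.Opens E), ℂ)) (g : 𝓓(I, ℝ)) :
    cext u (D.outTest g) =
      ∫ ζ, D.ampOut g ζ * cext u (D.θ.toComplex.modulate ((2 * Real.pi) • ζ)) :=
  (exists_testFunction_fourierIntegral D.θ.toComplex (D.hasMoments_ampOut g)).choose_spec.2.2 u

lemma tsupport_outTest_subset (g : 𝓓(I, ℝ)) : tsupport (D.outTest g) ⊆ tsupport D.θ := by
  refine closure_mono fun x hx => ?_
  have h := (exists_testFunction_fourierIntegral D.θ.toComplex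
    (D.hasMoments_ampOut g)).choose_spec.1 x
  by_contra h0
  rw [Function.notMem_support] at h0
  refine hx (h.trans ?_)
  rw [toComplex_apply, h0]; simp

lemma exists_norm_iteratedFDeriv_outTest_le (i : ℕ) : ∃ (m : ℕ) (C : ℝ), 0 ≤ C ∧
    ∀ (g : 𝓓(I, ℝ)) (B : ℝ), (∀ j ≤ m, ∀ t, ‖iteratedFDeriv ℝ j g t‖ ≤ B) →
      ∀ x, ‖iteratedFDeriv ℝ i (D.outTest g) x‖ ≤ C * B := by
  obtain ⟨C, hC0, hC⟩ := exists_norm_structureMapCLM_modulateIn_le D.θ.toComplex i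
  -- Decay of order `i` pays for the derivatives of the plane wave, and `intExp E` for
  -- integrability.
  obtain ⟨C', hC0', hC'⟩ := D.exists_norm_ampOut_le (i + intExp E)
  let J := ∫ ζ : E, ((1 + ‖ζ‖) ^ intExp E)⁻¹
  have hJ : 0 ≤ J := integral_nonneg fun ζ => by positivity
  refine ⟨i + intExp E, C * (2 * Real.pi) ^ i * C' * J, by positivity, fun g B hB x => ?_⟩
  refine ((exists_testFunction_fourierIntegral D.θ.toComplex
    (D.hasMoments_ampOut g)).choose_spec.2.1 i x).trans ?_
  have h1 : C * (2 * Real.pi) ^ i * C' * J * B =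
      ∫ ζ : E, C * (2 * Real.pi) ^ i * (C' * B) * ((1 + ‖ζ‖) ^ intExp E)⁻¹ := by
    rw [integral_const_mul]; simp only [J]; ring
  rw [h1]
  refine integral_mono_of_nonneg (Eventually.of_forall fun ζ => by positivity)
    (integrable_inv_one_add_norm_pow.const_mul _) (Eventually.of_forall fun ζ => ?_)
  have h2 := hC' g B hB ζ
  beta_reduce
  calc _ ≤ ‖D.ampOut g ζ‖ * (C * (1 + ‖(2 * Real.pi) • ζ‖) ^ i) := by gcongr; exact hC _
    _ ≤ ‖D.ampOut g ζ‖ * (C * (2 * Real.pi * (1 + ‖ζ‖)) ^ i) := by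
        gcongr; exact one_add_norm_two_pi_smul_le ζ
    _ = C * (2 * Real.pi) ^ i * ((1 + ‖ζ‖) ^ (i + intExp E) * ‖D.ampOut g ζ‖) *
        ((1 + ‖ζ‖) ^ intExp E)⁻¹ := by
      rw [pow_add, mul_pow]; field_simp
    _ ≤ _ := by gcongr

lemma continuous_outTest : Continuous D.outTest :=
  TestFunction.continuous_of_bounds _ ⟨tsupport D.θ, D.θ.hasCompactSupport⟩ (subset_univ _)
    D.tsupport_outTest_subset D.exists_norm_iteratedFDeriv_outTest_le

/-- The pairing defined by the curve data. -/
def pairing (u : 𝓓'((⊤ : TopologicalSpace.Opens E), ℂ)) (g : 𝓓(I, ℝ)) : ℂ :=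
  ∫ ζ, D.amp g ζ * cext u (D.θ.toComplex.modulate ((2 * Real.pi) • ζ))

/-- The index of the seminorm that controls the frequencies in the cone. -/
def index : WavefrontSpace.SeminormIndex Λ where
  χ := D.θ
  V := D.V
  N := intExp E
  isClosed := D.isClosed
  isConic := D.isConic
  disjoint := disjoint_left.2 fun p hp => D.disjoint p.1 p.2 hp.2

lemma two_pi_smul_mem {ζ : E} (hζ : ζ ∈ D.V) : (2 * Real.pi) • ζ ∈ D.V :=
  D.isConic ζ hζ _ (by positivity)

lemma norm_indicator_le {f : E → ℂ} {A : ℝ} (hA : 0 ≤ A)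
    (hf : ∀ ζ ∈ D.V, (1 + ‖ζ‖) ^ intExp E * ‖f ζ‖ ≤ A) {C B : ℝ} (hCB : 0 ≤ C * B) {g : 𝓓(I, ℝ)}
    (hg : ∀ ζ, ‖D.amp g ζ‖ ≤ C * B) (ζ : E) :
    ‖D.V.indicator (fun ζ => D.amp g ζ * f ((2 * Real.pi) • ζ)) ζ‖ ≤
      C * B * A * ((1 + ‖ζ‖) ^ intExp E)⁻¹ := by
  by_cases hζ : ζ ∈ D.V
  · rw [indicator_of_mem hζ, norm_mul, mul_assoc (C * B)]
    refine mul_le_mul (hg ζ) ?_ (norm_nonneg _) hCB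
    rw [← div_eq_mul_inv, le_div_iff₀ (by positivity), mul_comm]
    refine le_trans ?_ (hf _ (D.two_pi_smul_mem hζ))
    gcongr ?_ ^ _ * _
    exact one_add_norm_le_one_add_norm_two_pi_smul ζ
  · rw [indicator_of_notMem hζ, norm_zero]; positivity

/-- On `V` the roles are exchanged: the amplitude is merely bounded, while the Fourier transform of
θu decays because `V` misses `Λ`. -/
lemma integrable_indicator (u : WavefrontSpace Λ) (g : 𝓓(I, ℝ)) :
    Integrable (D.V.indicator fun ζ => D.amp g ζ *
      cext u.toDistribution (D.θ.toComplex.modulate ((2 * Real.pi) • ζ))) := by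
  obtain ⟨A, hA0, hA⟩ := u.rapidOn D.index (intExp E)
  obtain ⟨C, hC0, hC⟩ := D.exists_norm_amp_le
  obtain ⟨B, hB⟩ := exists_bound_iteratedFDeriv g 0
  have hB' : ∀ t, ‖g t‖ ≤ B := fun t => by simpa using hB 0 le_rfl t
  have hB0 : 0 ≤ B := (norm_nonneg _).trans (hB' 0)
  refine (integrable_inv_one_add_norm_pow.const_mul (C * B * A)).mono'
    (((D.continuous_amp g).mul (continuous_cext_modulate_two_pi _
      _)).aestronglyMeasurable.indicator D.isClosed.measurableSet)
    (Eventually.of_forall fun ζ => ?_)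
  exact D.norm_indicator_le (f := fun ζ => cext u.toDistribution (D.θ.toComplex.modulate ζ)) hA0
    (fun ζ hζ => by
      have := hA () ζ hζ
      rwa [localFourier_eq_cext] at this) (by positivity) (hC g B hB') ζ

lemma integrable_ampOut_mul (u : 𝓓'((⊤ : TopologicalSpace.Opens E), ℂ)) (g : 𝓓(I, ℝ)) :
    Integrable fun ζ => D.ampOut g ζ * cext u (D.θ.toComplex.modulate ((2 * Real.pi) • ζ)) := by
  obtain ⟨C, M, -, hC⟩ := exists_norm_cext_modulate_two_pi_le u D.θ.toComplex
  exact (D.hasMoments_ampOut g).integrable_mul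
    (continuous_cext_modulate_two_pi u _).aestronglyMeasurable hC

lemma indicator_add_ampOut (g : 𝓓(I, ℝ)) (f : E → ℂ) (ζ : E) :
    D.amp g ζ * f ζ = D.V.indicator (fun ζ => D.amp g ζ * f ζ) ζ + D.ampOut g ζ * f ζ := by
  by_cases hζ : ζ ∈ D.V
  · rw [indicator_of_mem hζ, ampOut, indicator_of_notMem (by simpa using hζ)]; ring
  · rw [indicator_of_notMem hζ, ampOut, indicator_of_mem (by simpa using hζ)]; ring

lemma integrable_amp_mul (u : WavefrontSpace Λ) (g : 𝓓(I, ℝ)) :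
    Integrable fun ζ => D.amp g ζ *
      cext u.toDistribution (D.θ.toComplex.modulate ((2 * Real.pi) • ζ)) := by
  have := (D.integrable_indicator u g).add (D.integrable_ampOut_mul u.toDistribution g)
  refine this.congr (Eventually.of_forall fun ζ => ?_)
  exact (D.indicator_add_ampOut g (fun ζ => cext u.toDistribution
    (D.θ.toComplex.modulate ((2 * Real.pi) • ζ))) ζ).symm

/-- The frequencies in `V` are governed by one wavefront seminorm; all others add up to the value of
`u` on a single test function and are governed by the topology of 𝓓'. This is why the pairing is
continuous for the topology of 𝓓'_Λ. -/
lemma pairing_eq (u : WavefrontSpace Λ) (g : 𝓓(I, ℝ)) : D.pairing u.toDistribution g =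
    (∫ ζ, D.V.indicator (fun ζ => D.amp g ζ *
      cext u.toDistribution (D.θ.toComplex.modulate ((2 * Real.pi) • ζ))) ζ) +
    cext u.toDistribution (D.outTest g) := by
  rw [cext_outTest, ← integral_add (D.integrable_indicator u g)
    (D.integrable_ampOut_mul u.toDistribution g)]
  exact integral_congr_ae (Eventually.of_forall fun ζ => D.indicator_add_ampOut g
    (fun ζ => cext u.toDistribution (D.θ.toComplex.modulate ((2 * Real.pi) • ζ))) ζ)

lemma pairing_add (u : WavefrontSpace Λ) (g h : 𝓓(I, ℝ)) :
    D.pairing u.toDistribution (g + h) =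
      D.pairing u.toDistribution g + D.pairing u.toDistribution h := by
  rw [pairing, pairing, pairing,
    ← integral_add (D.integrable_amp_mul u g) (D.integrable_amp_mul u h)]
  simp only [amp_add, add_mul]

lemma pairing_smul (u : WavefrontSpace Λ) (r : ℝ) (g : 𝓓(I, ℝ)) :
    D.pairing u.toDistribution (r • g) = r * D.pairing u.toDistribution g := by
  rw [pairing, pairing, ← integral_const_mul]
  simp only [amp_smul, mul_assoc]

lemma exists_norm_pairing_le (u : WavefrontSpace Λ) : ∃ (m : ℕ) (C : ℝ), 0 ≤ C ∧
    ∀ (g : 𝓓(I, ℝ)) (B : ℝ), (∀ j ≤ m, ∀ t, ‖iteratedFDeriv ℝ j g t‖ ≤ B) →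
      ‖D.pairing u.toDistribution g‖ ≤ C * B := by
  obtain ⟨A, hA0, hA⟩ := u.rapidOn D.index (intExp E)
  obtain ⟨C, hC0, hC⟩ := D.exists_norm_amp_le
  obtain ⟨C₂, s, hC₂0, hC₂⟩ := exists_norm_le_of_clm
    (cextIn u.toDistribution ⟨tsupport D.θ, D.θ.hasCompactSupport⟩)
  choose m C₃ hC₃0 hC₃ using D.exists_norm_iteratedFDeriv_outTest_le
  let J := ∫ ζ : E, ((1 + ‖ζ‖) ^ intExp E)⁻¹
  have hJ : 0 ≤ J := integral_nonneg fun ζ => by positivity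
  refine ⟨s.sup m, C * A * J + C₂ * ∑ i ∈ s, C₃ i, add_nonneg (by positivity)
    (mul_nonneg hC₂0 (Finset.sum_nonneg fun i _ => hC₃0 i)), fun g B hB => ?_⟩
  have hB' : ∀ t, ‖g t‖ ≤ B := fun t => by simpa using hB 0 (Nat.zero_le _) t
  have hB0 : 0 ≤ B := (norm_nonneg _).trans (hB' 0)
  rw [pairing_eq, add_mul]
  refine (norm_add_le _ _).trans (add_le_add ?_ ?_)
  · have h1 : C * A * J * B = ∫ ζ : E, C * B * A * ((1 + ‖ζ‖) ^ intExp E)⁻¹ := by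
      rw [integral_const_mul]; simp only [J]; ring
    rw [h1]
    refine norm_integral_le_of_norm_le (integrable_inv_one_add_norm_pow.const_mul _)
      (Eventually.of_forall fun ζ => ?_)
    exact D.norm_indicator_le (f := fun ζ => cext u.toDistribution (D.θ.toComplex.modulate ζ)) hA0
      (fun ζ hζ => by
        have := hA () ζ hζ
        rwa [localFourier_eq_cext] at this) (by positivity) (hC g B hB') ζ
  · refine (hC₂ ((D.outTest g).toSupportedIn _ (D.tsupport_outTest_subset g))).trans ?_
    rw [mul_assoc, Finset.sum_mul]
    refine mul_le_mul_of_nonneg_left (Finset.sum_le_sum fun i hi => ?_) hC₂0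
    refine (BoundedContinuousFunction.norm_le (mul_nonneg (hC₃0 i) hB0)).2 fun x => ?_
    rw [congrFun (ContDiffMapSupportedIn.structureMapCLM_top_apply ℂ _) x]
    exact hC₃ i g B (fun j hj => hB j (hj.trans (Finset.le_sup hi))) x

/-- The pairing is continuous in the distribution, uniformly on compact sets of test functions. -/
lemma eventually_norm_pairing_sub_lt {κ : Type*} {l : Filter κ} {U : κ → WavefrontSpace Λ}
    {u : WavefrontSpace Λ} (hU : Tendsto U l (𝓝 u)) {S : Set 𝓓(I, ℝ)} (hS : IsCompact S) {ε : ℝ}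
    (hε : 0 < ε) : ∀ᶠ n in l, ∀ g ∈ S,
      ‖D.pairing (U n).toDistribution g - D.pairing u.toDistribution g‖ < ε := by
  obtain ⟨hU1, hU2⟩ := WavefrontSpace.tendsto_iff.1 hU
  obtain ⟨C, hC0, hC⟩ := D.exists_norm_amp_le
  obtain ⟨B, hB0, hB⟩ := hS.exists_bound_iteratedFDeriv 0
  let J := ∫ ζ : E, ((1 + ‖ζ‖) ^ intExp E)⁻¹
  have hJ : 0 ≤ J := integral_nonneg fun ζ => by positivity
  -- The tolerance in the seminorm on `V` is chosen so that the integral over `V` changes by at most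
  -- ε/4; the summand 1 keeps the denominator positive.
  have hδ : 0 < ε / 4 / (C * B * J + 1) := by positivity
  -- By continuity `outTest` maps the compact set `S` to a compact set of test functions, on which
  -- distributions converge uniformly. Real and imaginary parts are taken because distributions are
  -- tested on real functions.
  have hre := tendsto_distribution_iff.1 hU1 _ (hS.image ((TestFunction.postcompCLM
    Complex.reCLM).continuous.comp D.continuous_outTest)) (ε / 4) (by positivity)
  have him := tendsto_distribution_iff.1 hU1 _ (hS.image ((TestFunction.postcompCLM
    Complex.imCLM).continuous.comp D.continuous_outTest)) (ε / 4) (by positivity)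
  filter_upwards [hU2 D.index _ hδ, hre, him] with n h1 h2 h3 g hg
  have hB' : ∀ t, ‖g t‖ ≤ B := fun t => by simpa using hB g hg t
  rw [pairing_eq, pairing_eq, add_sub_add_comm,
    ← integral_sub (D.integrable_indicator _ g) (D.integrable_indicator _ g)]
  have h4 : ‖∫ ζ, (D.V.indicator (fun ζ => D.amp g ζ * cext (U n).toDistribution
      (D.θ.toComplex.modulate ((2 * Real.pi) • ζ))) ζ - D.V.indicator (fun ζ => D.amp g ζ *
        cext u.toDistribution (D.θ.toComplex.modulate ((2 * Real.pi) • ζ))) ζ)‖ ≤ ε / 4 := by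
    have h5 : C * B * (ε / 4 / (C * B * J + 1)) * J ≤ ε / 4 := by
      have : C * B * (ε / 4 / (C * B * J + 1)) * J = ε / 4 * ((C * B * J) / (C * B * J + 1)) := by
        field_simp
      rw [this]
      refine mul_le_of_le_one_right (by positivity) ?_
      rw [div_le_one (by positivity)]; linarith
    refine le_trans ?_ h5
    rw [← integral_const_mul]
    refine norm_integral_le_of_norm_le (integrable_inv_one_add_norm_pow.const_mul _)
      (Eventually.of_forall fun ζ => ?_)
    have h6 := D.norm_indicator_le (f := fun ζ => cext (U n).toDistribution
      (D.θ.toComplex.modulate ζ) - cext u.toDistribution (D.θ.toComplex.modulate ζ)) hδ.le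
      (fun ζ hζ => by
        have := h1 ζ hζ
        rw [localFourier_eq_cext, localFourier_eq_cext] at this
        exact this.le) (by positivity) (hC g B hB') ζ
    refine le_trans (le_of_eq ?_) h6
    by_cases hζ : ζ ∈ D.V
    · simp only [indicator_of_mem hζ, mul_sub]
    · simp only [indicator_of_notMem hζ, sub_zero]
  refine lt_of_le_of_lt (norm_add_le _ _) ?_
  have h5 := h2 _ (mem_image_of_mem _ hg)
  have h6 := h3 _ (mem_image_of_mem _ hg)
  simp only [Function.comp_apply] at h5 h6
  have h7 : ‖cext (U n).toDistribution (D.outTest g) - cext u.toDistribution (D.outTest g)‖ <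
      ε / 4 + ε / 4 := by
    rw [cext_apply, cext_apply, add_sub_add_comm, ← mul_sub]
    refine lt_of_le_of_lt (norm_add_le _ _) (add_lt_add h5 ?_)
    rw [norm_mul, Complex.norm_I, one_mul]
    exact h6
  linarith

end CurveData

end Pullback

/-! ### Consistency of the pairings, and the pullback as a continuous linear map. -/

section PullbackExistence

variable {E : Type*} [NormedAddCommGroup E] [InnerProductSpace ℝ E] [FiniteDimensional ℝ E]
  [MeasurableSpace E] [BorelSpace E]

lemma cext_modulate_eq_invF {u : 𝓓'((⊤ : TopologicalSpace.Opens E), ℂ)} {f : E → ℂ}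
    (hf : ContDiff ℝ ∞ f)
    (h : ∀ φ : 𝓓((⊤ : TopologicalSpace.Opens E), ℝ), u φ = ∫ x, φ x • f x)
    (θ : 𝓓((⊤ : TopologicalSpace.Opens E), ℂ)) (ζ : E) :
    cext u (θ.modulate ((2 * Real.pi) • ζ)) = invF (θ.mulSmoothC f hf) (-ζ) := by
  rw [cext_eq_integral_of_forall hf.continuous.locallyIntegrable h, invF_eq]
  refine integral_congr_ae (Eventually.of_forall fun x => ?_)
  simp only [modulate_apply, mulSmoothC_apply, smul_neg, neg_smul, neg_neg]
  ring

namespace CurveData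

variable {I : TopologicalSpace.Opens ℝ} {w : ℝ → E} {Λ : Set (E × E)} {K : Set ℝ}
  (D : CurveData I w Λ K)

/-- For smooth `f` the double integral converges absolutely. Fubini and Fourier inversion for θf at
the points of the curve leave ∫ κ g (θf)(v), and over `K` both cut-offs are 1 and `v = w`. -/
lemma pairing_of_smooth {u : 𝓓'((⊤ : TopologicalSpace.Opens E), ℂ)} {f : E → ℂ}
    (hf : ContDiff ℝ ∞ f)
    (h : ∀ φ : 𝓓((⊤ : TopologicalSpace.Opens E), ℝ), u φ = ∫ x, φ x • f x)
    {g : 𝓓(I, ℝ)} (hg : tsupport g ⊆ K) : D.pairing u g = ∫ t, g t • f (w t) := by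
  let φ := D.θ.toComplex.mulSmoothC f hf
  have hφ : Integrable fun ζ => invF φ (-ζ) := by
    have h0 := (hasMoments_invF φ).integrable 0
    simp only [pow_zero, one_mul] at h0
    exact ((integrable_norm_iff (continuous_invF φ).aestronglyMeasurable).1 h0).comp_neg
  have hκ := D.integrable_norm_kappa_mul g
  have hpc : Continuous fun p : E × ℝ => invF φ (-p.1) * (((D.κ p.2 : ℂ) * (g p.2 : ℂ)) *
      planeWave (-(2 * Real.pi) • p.1) (D.v p.2)) :=
    ((continuous_invF φ).comp continuous_fst.neg).mul (D.continuous_integrand g)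
  have hint : Integrable (fun p : E × ℝ => invF φ (-p.1) * (((D.κ p.2 : ℂ) * (g p.2 : ℂ)) *
      planeWave (-(2 * Real.pi) • p.1) (D.v p.2))) (volume.prod volume) := by
    refine (hφ.mul_prod hκ).mono hpc.aestronglyMeasurable (Eventually.of_forall fun p => ?_)
    rw [norm_mul, norm_mul _ (planeWave _ _), norm_planeWave, mul_one,
      ← norm_mul]
  have h1 : D.pairing u g = ∫ ζ, ∫ t, invF φ (-ζ) * (((D.κ t : ℂ) * (g t : ℂ)) *
      planeWave (-(2 * Real.pi) • ζ) (D.v t)) := by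
    refine integral_congr_ae (Eventually.of_forall fun ζ => ?_)
    beta_reduce
    rw [cext_modulate_eq_invF hf h, integral_const_mul, mul_comm]; rfl
  rw [h1, integral_integral_swap hint]
  refine integral_congr_ae (Eventually.of_forall fun t => ?_)
  have h2 : ∫ ζ, invF φ (-ζ) * planeWave (-(2 * Real.pi) • ζ) (D.v t) = φ (D.v t) := by
    rw [← integral_invF_mul_planeWave φ (D.v t), ← integral_neg_eq_self]
    simp only [neg_neg, smul_neg, neg_smul]
  have h3 : ∫ ζ, invF φ (-ζ) * (((D.κ t : ℂ) * (g t : ℂ)) *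
      planeWave (-(2 * Real.pi) • ζ) (D.v t)) = (D.κ t : ℂ) * (g t : ℂ) * φ (D.v t) := by
    rw [← h2, ← integral_const_mul]
    refine integral_congr_ae (Eventually.of_forall fun ζ => ?_)
    beta_reduce; ring
  beta_reduce
  rw [h3]
  by_cases ht : t ∈ tsupport g
  · rw [D.κ_eq t (hg ht), D.v_eq t (hg ht), mulSmoothC_apply, toComplex_apply, D.θ_eq t (hg ht)]
    simp
  · rw [image_eq_zero_of_notMem_tsupport ht]; simp

/-- For smooth functions the pairing is the integral along `w`, whatever the auxiliary data. Density
of smooth functions and continuity of the pairing carry this over to all of 𝓓'_Λ. -/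
lemma pairing_congr {K' : Set ℝ} (D' : CurveData I w Λ K') (u : WavefrontSpace Λ) {g : 𝓓(I, ℝ)}
    (hg : tsupport g ⊆ K) (hg' : tsupport g ⊆ K') :
    D.pairing u.toDistribution g = D'.pairing u.toDistribution g := by
  obtain ⟨f, U, hf, hUf, hU⟩ := u.exists_smooth_approximation
  have key {K : Set ℝ} (D : CurveData I w Λ K) : Tendsto (fun n =>
      D.pairing (U n).toDistribution g) atTop (𝓝 (D.pairing u.toDistribution g)) := by
    rw [Metric.tendsto_nhds]
    intro ε hε
    filter_upwards [D.eventually_norm_pairing_sub_lt hU (isCompact_singleton (x := g)) hε]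
      with n hn
    rw [dist_eq_norm]
    exact hn g rfl
  refine tendsto_nhds_unique (key D) ((key D').congr fun n => ?_)
  rw [D.pairing_of_smooth (hf n) (hUf n) hg, D'.pairing_of_smooth (hf n) (hUf n) hg']

lemma pairing_add_left (u u' : WavefrontSpace Λ) (g : 𝓓(I, ℝ)) :
    D.pairing (u + u').toDistribution g =
      D.pairing u.toDistribution g + D.pairing u'.toDistribution g := by
  rw [pairing, pairing, pairing,
    ← integral_add (D.integrable_amp_mul u g) (D.integrable_amp_mul u' g)]
  have h : (u + u').toDistribution = u.toDistribution + u'.toDistribution := rfl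
  simp only [h, cext_add, mul_add]

lemma pairing_smul_left (z : ℂ) (u : WavefrontSpace Λ) (g : 𝓓(I, ℝ)) :
    D.pairing (z • u).toDistribution g = z * D.pairing u.toDistribution g := by
  rw [pairing, pairing, ← integral_const_mul]
  have h : (z • u).toDistribution = z • u.toDistribution := rfl
  simp only [h, cext_smul, mul_left_comm]

end CurveData

variable {I : TopologicalSpace.Opens ℝ} {w : ℝ → E} {Λ : Set (E × E)}

/-- The curve data for the support of a test function. -/
def curveDataOf (hex : ∀ K : Set ℝ, IsCompact K → K ⊆ I → Nonempty (CurveData I w Λ K))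
    (g : 𝓓(I, ℝ)) : CurveData I w Λ (tsupport g) :=
  (hex _ g.hasCompactSupport g.tsupport_subset).some

lemma curveDataOf_pairing (hex : ∀ K : Set ℝ, IsCompact K → K ⊆ I → Nonempty (CurveData I w Λ K))
    {K : Set ℝ} (D : CurveData I w Λ K) (u : WavefrontSpace Λ) {g : 𝓓(I, ℝ)}
    (hg : tsupport g ⊆ K) :
    (curveDataOf hex g).pairing u.toDistribution g = D.pairing u.toDistribution g :=
  CurveData.pairing_congr _ D u subset_rfl hg

/-- The pullback of a distribution, as a linear functional. -/
def pullbackLinear (hex : ∀ K : Set ℝ, IsCompact K → K ⊆ I → Nonempty (CurveData I w Λ K))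
    (u : WavefrontSpace Λ) : 𝓓(I, ℝ) →ₗ[ℝ] ℂ where
  toFun g := (curveDataOf hex g).pairing u.toDistribution g
  map_add' g h := by
    -- Additivity is read off from one set of data that serves both supports.
    let D := (hex (tsupport g ∪ tsupport h) (g.hasCompactSupport.isCompact.union h.hasCompactSupport)
      (union_subset g.tsupport_subset h.tsupport_subset)).some
    rw [curveDataOf_pairing hex D u (tsupport_add g h), D.pairing_add,
      curveDataOf_pairing hex D u subset_union_left, curveDataOf_pairing hex D u subset_union_right]
  map_smul' r g := by
    have hs : tsupport (r • g) ⊆ tsupport g :=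
      closure_mono (Function.support_const_smul_subset r g)
    rw [curveDataOf_pairing hex (curveDataOf hex g) u hs, CurveData.pairing_smul]
    simp

/-- The pullback of a distribution along a curve. -/
def pullbackDist (hex : ∀ K : Set ℝ, IsCompact K → K ⊆ I → Nonempty (CurveData I w Λ K))
    (u : WavefrontSpace Λ) : 𝓓'(I, ℂ) where
  toLinearMap := pullbackLinear hex u
  cont := TestFunction.continuous_functional_of_bounds _ fun K hK => by
    let D := (hex K K.isCompact hK).some
    obtain ⟨m, C, hC0, hC⟩ := D.exists_norm_pairing_le u
    refine ⟨m, C, hC0, fun φ hφ B hB => ?_⟩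
    have h : pullbackLinear hex u φ = D.pairing u.toDistribution φ :=
      curveDataOf_pairing hex D u hφ
    rw [h]
    exact hC φ B hB

lemma pullbackDist_apply
    (hex : ∀ K : Set ℝ, IsCompact K → K ⊆ I → Nonempty (CurveData I w Λ K))
    {K : Set ℝ} (D : CurveData I w Λ K) (u : WavefrontSpace Λ) {g : 𝓓(I, ℝ)}
    (hg : tsupport g ⊆ K) : pullbackDist hex u g = D.pairing u.toDistribution g :=
  curveDataOf_pairing hex D u hg

/-- The pullback along a curve as a continuous linear map. -/
def pullbackCLM (hex : ∀ K : Set ℝ, IsCompact K → K ⊆ I → Nonempty (CurveData I w Λ K)) :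
    WavefrontSpace Λ →L[ℂ] 𝓓'(I, ℂ) where
  toFun := pullbackDist hex
  map_add' u u' := by
    ext g
    exact (curveDataOf hex g).pairing_add_left u u' g
  map_smul' z u := by
    ext g
    exact (curveDataOf hex g).pairing_smul_left z u g
  cont := by
    rw [continuous_iff_continuousAt]
    intro u
    refine tendsto_distribution_iff.2 fun S hS ε hε => ?_
    -- The common support allows a single choice of data for the whole compact set of test
    -- functions.
    obtain ⟨K, hK, hSK⟩ := hS.exists_common_support
    let D := (hex K K.isCompact hK).some
    filter_upwards [D.eventually_norm_pairing_sub_lt (tendsto_id (x := 𝓝 u)) hS hε] with u' h g hg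
    rw [pullbackDist_apply hex D u' (hSK g hg), pullbackDist_apply hex D u (hSK g hg)]
    exact h g hg

/-- Existence and uniqueness of the pullback along a curve. -/
theorem existsUnique_isPullback
    (hex : ∀ K : Set ℝ, IsCompact K → K ⊆ I → Nonempty (CurveData I w Λ K)) :
    ∃! P : WavefrontSpace Λ →L[ℂ] 𝓓'(I, ℂ), IsPullback I w P := by
  refine ⟨pullbackCLM hex, fun u f hf h g => ?_, fun P hP => ?_⟩
  · exact (curveDataOf hex g).pairing_of_smooth hf h subset_rfl
  · ext1 u
    obtain ⟨f, U, hf, hUf, hU⟩ := u.exists_smooth_approximation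
    refine tendsto_nhds_unique ((P.continuous.tendsto u).comp hU)
      ((((pullbackCLM hex).continuous.tendsto u).comp hU).congr fun n => ?_)
    ext g
    simp only [Function.comp_apply]
    rw [hP (U n) (f n) (hf n) (hUf n) g]
    exact (curveDataOf hex g).pairing_of_smooth (hf n) (hUf n) subset_rfl

/-- Existence of the curve data. -/
lemma nonempty_curveData {w : ℝ → E} (hw : ContDiffOn ℝ ∞ w I) {K : Set ℝ} (hK : IsCompact K)
    (hKI : K ⊆ I)
    (hcone : ∀ L : Set ℝ, IsCompact L → L ⊆ I → ∃ (V : Set E) (c : ℝ), IsClosed V ∧ IsConic V ∧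
      (∀ x, ∀ ξ ∈ V, (x, ξ) ∉ Λ) ∧ 0 < c ∧
        ∀ t ∈ L, ∀ ζ ∉ V, c * ‖ζ‖ ≤ |⟪deriv w t, ζ⟫_ℝ|) :
    Nonempty (CurveData I w Λ K) := by
  obtain ⟨κ, δ, hδ, hκ, hκI⟩ := exists_cutoff hK I.isOpen hKI
  -- The curve is smooth on `I` only. Multiplication by `κ'`, which is 1 near the support of `κ`,
  -- extends it smoothly to ℝ without changing position or velocity where `κ` lives.
  obtain ⟨κ', δ', hδ', hκ', hκI'⟩ := exists_cutoff κ.hasCompactSupport I.isOpen hκI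
  obtain ⟨V, c, hV, hVc, hVΛ, hc, hcV⟩ := hcone (tsupport κ) κ.hasCompactSupport hκI
  obtain ⟨θ, δ'', hδ'', hθ, -⟩ := exists_cutoff (hK.image_of_continuousOn
    (hw.continuousOn.mono hKI)) isOpen_univ (subset_univ _)
  have hv : ContDiff ℝ ∞ fun t => κ' t • w t := by
    refine contDiff_iff_contDiffAt.2 fun t => ?_
    by_cases ht : t ∉ tsupport fun t => κ' t • w t
    · exact contDiffAt_const.congr_of_eventuallyEq (notMem_tsupport_iff_eventuallyEq.1 ht)
    rw [not_not] at ht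
    have htI : t ∈ (I : Set ℝ) :=
      hκI' (tsupport_smul_subset_left (κ' : ℝ → ℝ) w ht)
    exact κ'.contDiff.contDiffAt.smul (hw.contDiffAt (I.isOpen.mem_nhds htI))
  have hvw : ∀ t ∈ tsupport κ, (fun t => κ' t • w t) =ᶠ[𝓝 t] w := by
    intro t ht
    have hmem : Metric.thickening δ' (tsupport κ) ∈ 𝓝 t :=
      Metric.isOpen_thickening.mem_nhds (Metric.self_subset_thickening hδ' _ ht)
    filter_upwards [hmem] with s hs
    rw [hκ' s (Metric.thickening_subset_cthickening _ _ hs), one_smul]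
  have hKκ : K ⊆ tsupport κ := fun t ht => subset_tsupport _ (by
    rw [Function.mem_support, hκ t (Metric.self_subset_cthickening _ ht)]; exact one_ne_zero)
  exact ⟨{
    κ := ⟨κ, κ.contDiff, κ.hasCompactSupport, hκI⟩
    v := fun t => κ' t • w t
    V := V
    c := c
    θ := θ
    κ_eq := fun t ht => hκ t (Metric.self_subset_cthickening _ ht)
    contDiff_v := hv
    v_eq := fun t ht => (hvw t (hKκ ht)).eq_of_nhds
    isClosed := hV
    isConic := hVc
    disjoint := hVΛ
    c_pos := hc
    cone := fun t ht ζ hζ => by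
      rw [(hvw t ht).deriv_eq]
      exact hcV t ht ζ hζ
    θ_eq := fun t ht => hθ _ (Metric.self_subset_cthickening _ (mem_image_of_mem w ht)) }⟩

end PullbackExistence

/-! ### The geometry of Minkowski space -/

section MinkowskiGeometry

variable {d : ℕ} [NeZero d]

/-- The unit vector in the time direction. -/
def timeVector (d : ℕ) [NeZero d] : Minkowski d := EuclideanSpace.single 0 1

theorem norm_timeVector : ‖timeVector d‖ = 1 := by simp [timeVector]

theorem inner_timeVector (x : Minkowski d) : ⟪timeVector d, x⟫_ℝ = x 0 := by
  simp [timeVector, EuclideanSpace.inner_single_left]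

/-- The reflection of the time coordinate. -/
def timeReflection (d : ℕ) [NeZero d] : Minkowski d ≃ₗᵢ[ℝ] Minkowski d :=
  (ℝ ∙ timeVector d)ᗮ.reflection

theorem timeReflection_apply (x : Minkowski d) :
    timeReflection d x = x - (2 * x 0) • timeVector d := by
  rw [timeReflection, Submodule.reflection_orthogonal_apply, Submodule.reflection_singleton_apply]
  simp [norm_timeVector, inner_timeVector, two_smul, ← add_smul, ← two_mul]

theorem timeReflection_timeReflection (x : Minkowski d) :
    timeReflection d (timeReflection d x) = x :=
  Submodule.reflection_reflection _ x

theorem inner_timeReflection_left (x y : Minkowski d) :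
    ⟪timeReflection d x, y⟫_ℝ = ⟪x, timeReflection d y⟫_ℝ := by
  rw [← (timeReflection d).inner_map_map x, timeReflection_timeReflection]

theorem minkowskiForm_eq_inner_sub (x y : Minkowski d) :
    minkowskiForm x y = ⟪x, y⟫_ℝ - 2 * (x 0 * y 0) := by
  have h : ⟪x, y⟫_ℝ = ∑ i, x i * y i := by
    simp [PiLp.inner_apply, mul_comm]
  rw [minkowskiForm, h, ← Finset.add_sum_erase _ _ (Finset.mem_univ (0 : Fin d))]
  ring

theorem minkowskiForm_eq_inner (x y : Minkowski d) :
    minkowskiForm x y = ⟪x, timeReflection d y⟫_ℝ := by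
  rw [minkowskiForm_eq_inner_sub, timeReflection_apply, inner_sub_right, inner_smul_right,
    real_inner_comm (timeVector d), inner_timeVector]
  ring

theorem minkowskiForm_smul_smul (c : ℝ) (x y : Minkowski d) :
    minkowskiForm (c • x) (c • y) = c ^ 2 * minkowskiForm x y := by
  simp only [minkowskiForm_eq_inner, map_smul, inner_smul_left, inner_smul_right]
  simp; ring

theorem gammaForm_eq (x : Minkowski d) : gammaForm x = -⟪x, timeReflection d x⟫_ℝ := by
  rw [gammaForm, minkowskiForm_eq_inner]

theorem gammaForm_eq_sub (x : Minkowski d) : gammaForm x = 2 * x 0 ^ 2 - ‖x‖ ^ 2 := by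
  rw [gammaForm, minkowskiForm_eq_inner_sub, real_inner_self_eq_norm_sq]; ring

theorem contDiff_gammaForm : ContDiff ℝ ∞ (gammaForm (d := d)) := by
  have : (gammaForm (d := d)) = fun x => -⟪x, timeReflection d x⟫_ℝ := funext gammaForm_eq
  rw [this]
  exact (contDiff_id.inner ℝ (timeReflection d).contDiff).neg

theorem continuous_minkowskiForm_self : Continuous fun x : Minkowski d => minkowskiForm x x := by
  simp only [minkowskiForm_eq_inner]
  exact continuous_id.inner (timeReflection d).continuous

theorem hasGradientAt_gammaForm (x : Minkowski d) :
    HasGradientAt gammaForm (-(2 : ℝ) • timeReflection d x) x := by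
  rw [hasGradientAt_iff_hasFDerivAt]
  have : (gammaForm (d := d)) = fun x => -⟪x, timeReflection d x⟫_ℝ := funext gammaForm_eq
  rw [this]
  have h := ((hasFDerivAt_id x).inner ℝ
    ((timeReflection d).toContinuousLinearEquiv.hasFDerivAt (x := x))).neg
  refine HasFDerivAt.congr_fderiv h (ContinuousLinearMap.ext fun y => ?_)
  have e : ⟪x, timeReflection d y⟫_ℝ = ⟪timeReflection d x, y⟫_ℝ :=
    (inner_timeReflection_left x y).symm
  have e' : ⟪y, timeReflection d x⟫_ℝ = ⟪timeReflection d x, y⟫_ℝ := real_inner_comm _ _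
  simp [fderivInnerCLM_apply, e, e']
  ring

theorem gradient_gammaForm (x : Minkowski d) :
    gradient gammaForm x = -(2 : ℝ) • timeReflection d x :=
  (hasGradientAt_gammaForm x).gradient

/-- A timelike vector and a nonzero causal covector pair nontrivially. -/
theorem inner_ne_zero_of_timelike {a ξ : Minkowski d} (ha : 0 < gammaForm a)
    (hξ : minkowskiForm ξ ξ ≤ 0) (hξ0 : ξ ≠ 0) : ⟪a, ξ⟫_ℝ ≠ 0 := by
  intro h
  rw [gammaForm_eq_sub] at ha
  rw [minkowskiForm_eq_inner_sub, real_inner_self_eq_norm_sq] at hξ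
  -- Cauchy–Schwarz for the spatial parts. If `a` and `ξ` were orthogonal, their spatial product
  -- would be -a₀ξ₀, and a₀²ξ₀² would be at most the product of two spatial norms squared, which is
  -- strictly smaller.
  have hcs := real_inner_mul_inner_self_le (a - a 0 • timeVector d) (ξ - ξ 0 • timeVector d)
  have e1 : ∀ x y : Minkowski d, ⟪x - x 0 • timeVector d, y - y 0 • timeVector d⟫_ℝ
      = ⟪x, y⟫_ℝ - x 0 * y 0 := by
    intro x y
    simp only [inner_sub_left, inner_sub_right, inner_smul_left, inner_smul_right,
      inner_timeVector, real_inner_comm (timeVector d) x, real_inner_self_eq_norm_sq,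
      norm_timeVector]
    simp
  rw [e1, e1, e1, h, real_inner_self_eq_norm_sq, real_inner_self_eq_norm_sq] at hcs
  have hpos : 0 < ‖ξ‖ ^ 2 := by positivity
  have h0 : 0 < ξ 0 ^ 2 := by nlinarith
  have ha' : 0 ≤ ‖a‖ ^ 2 - a 0 ^ 2 := by
    have := e1 a a
    rw [real_inner_self_eq_norm_sq, real_inner_self_eq_norm_sq] at this
    nlinarith [sq_nonneg ‖a - a 0 • timeVector d‖]
  nlinarith [mul_le_mul_of_nonneg_left (by linarith : ‖ξ‖ ^ 2 - ξ 0 ^ 2 ≤ ξ 0 ^ 2) ha']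

/-- On unit covectors the maximum of η(ξ,ξ) and |⟨w'(t),ξ⟩| is positive, since a covector that is
not spacelike pairs nontrivially with a timelike velocity. A positive lower bound δ over the compact
set of pairs (t,ξ) serves twice: for the aperture of the cone `V` of uniformly spacelike covectors,
and as the lower bound for the phase derivative off `V`. -/
theorem exists_cone_of_timelike {I : TopologicalSpace.Opens ℝ} {w : ℝ → Minkowski d}
    (hw : IsTimelikeCurve I w) {L : Set ℝ} (hL : IsCompact L) (hLI : L ⊆ I) :
    ∃ (V : Set (Minkowski d)) (c : ℝ), IsClosed V ∧ IsConic V ∧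
      (∀ x, ∀ ξ ∈ V, (x, ξ) ∉ rieszCone d) ∧ 0 < c ∧
      ∀ t ∈ L, ∀ ζ ∉ V, c * ‖ζ‖ ≤ |⟪deriv w t, ζ⟫_ℝ| := by
  have hcont : ContinuousOn (fun p : ℝ × Minkowski d =>
      max (minkowskiForm p.2 p.2) |⟪deriv w p.1, p.2⟫_ℝ|)
      (L ×ˢ Metric.sphere (0 : Minkowski d) 1) := by
    have hd : ContinuousOn (deriv w) L :=
      (hw.contDiffOn.continuousOn_deriv_of_isOpen I.isOpen (by simp)).mono hLI
    have hd' : ContinuousOn (fun p : ℝ × Minkowski d => deriv w p.1)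
        (L ×ˢ Metric.sphere (0 : Minkowski d) 1) :=
      hd.comp continuousOn_fst fun p hp => hp.1
    exact ((continuous_minkowskiForm_self.comp continuous_snd).continuousOn).sup
      ((hd'.inner continuousOn_snd).abs)
  obtain ⟨δ, hδ, hmin⟩ := (hL.prod (isCompact_sphere (0 : Minkowski d) 1)).exists_forall_le'
    hcont (a := 0) (by
      rintro ⟨t, ξ⟩ ⟨ht, hξ⟩
      have hξ0 : ξ ≠ 0 := by
        rintro rfl
        simp at hξ
      rw [lt_max_iff]
      rcases lt_or_ge 0 (minkowskiForm ξ ξ) with h | h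
      · exact Or.inl h
      · exact Or.inr (abs_pos.2 (inner_ne_zero_of_timelike (hw.timelike t (hLI ht)) h hξ0)))
  refine ⟨{ξ | δ * ‖ξ‖ ^ 2 ≤ minkowskiForm ξ ξ}, δ,
    isClosed_le (by fun_prop) continuous_minkowskiForm_self, ?_, ?_, hδ, ?_⟩
  · intro ξ hξ t ht
    simp only [mem_ofPred_eq] at hξ ⊢
    rw [minkowskiForm_smul_smul, norm_smul, mul_pow, Real.norm_eq_abs, sq_abs]
    nlinarith [sq_nonneg t, mul_le_mul_of_nonneg_left hξ (sq_nonneg t)]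
  · rintro x ξ hξ ⟨h0, hs, -⟩
    have h0' : 0 < ‖ξ‖ := norm_pos_iff.2 h0
    exact hs (lt_of_lt_of_le (by positivity) hξ)
  · intro t ht ζ hζ
    simp only [mem_ofPred_eq, not_le] at hζ
    have hζ0 : ζ ≠ 0 := by
      rintro rfl
      simp [minkowskiForm] at hζ
    have hn : 0 < ‖ζ‖ := norm_pos_iff.2 hζ0
    have h := hmin (t, ‖ζ‖⁻¹ • ζ) ⟨ht, by simp [norm_smul, hn.ne']⟩
    simp only [le_max_iff, minkowskiForm_smul_smul, inner_smul_right, abs_mul, abs_inv,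
      abs_norm] at h
    rcases h with h | h
    · exfalso
      have h2 := mul_le_mul_of_nonneg_left h (sq_nonneg ‖ζ‖)
      rw [← mul_assoc, ← mul_pow, mul_inv_cancel₀ hn.ne'] at h2
      linarith
    · have h2 := mul_le_mul_of_nonneg_left h hn.le
      rw [← mul_assoc, mul_inv_cancel₀ hn.ne'] at h2
      linarith

end MinkowskiGeometry

/-! ### Holomorphic families of distributions -/

/-- Differentiability at a point, for maps with values in a topological vector space, from the
convergence of the difference quotients. -/
theorem hasFDerivAt_of_tendsto_slope {F : Type*} [AddCommGroup F] [Module ℂ F]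
    [TopologicalSpace F] {f : ℂ → F} {α : ℂ} {f' : ℂ →L[ℂ] F}
    (h : ∀ c : ℂ, Tendsto (fun β => c • ((β - α)⁻¹ • (f β - f α) - f' 1)) (𝓝[≠] α) (𝓝 0)) :
    HasFDerivAt f f' α := by
  rw [hasFDerivAt_iff_isLittleOTVS, Asymptotics.isLittleOTVS_iff]
  intro U hU
  refine ⟨Metric.ball 0 1, Metric.ball_mem_nhds _ one_pos, fun ε hε => ?_⟩
  have hc : ((ε : ℝ) : ℂ)⁻¹ ≠ 0 := by simpa using hε
  -- The multiple ε⁻¹ is what the gauge estimate requires. Having all multiples in the hypothesis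
  -- replaces continuity of scalar multiplication on `F`.
  have h1 := (h ((ε : ℝ) : ℂ)⁻¹).eventually hU
  rw [eventually_nhdsWithin_iff] at h1
  filter_upwards [h1] with β hβ
  rcases eq_or_ne β α with rfl | hne
  · have : (0 : F) ∈ U := mem_of_mem_nhds hU
    simp [egauge_zero_right ℂ ⟨0, this⟩]
  · have hne' : β - α ≠ 0 := sub_ne_zero.2 hne
    have h2 := hβ hne
    have h3 : (((ε : ℝ) : ℂ)⁻¹ * (β - α)⁻¹) • (f β - f α - f' (β - α)) ∈ U := by
      have e : f' (β - α) = (β - α) • f' 1 := by rw [← map_smul, smul_eq_mul, mul_one]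
      have h4 : f β - f α - f' (β - α) =
          (β - α) • ((β - α)⁻¹ • (f β - f α) - f' 1) := by
        rw [e, smul_sub, smul_smul, mul_inv_cancel₀ hne', one_smul]
      rw [h4, smul_smul, mul_assoc, inv_mul_cancel₀ hne', mul_one]
      exact h2
    have h5 := egauge_le_of_smul_mem_of_ne h3 (mul_ne_zero hc (inv_ne_zero hne'))
    refine h5.trans ?_
    have h6 := le_egauge_ball_one ℂ (β - α)
    refine le_trans (le_of_eq ?_) (mul_le_mul_right h6 (ε : ENNReal))
    rw [nnnorm_mul, nnnorm_inv, nnnorm_inv, mul_inv, inv_inv, inv_inv, ENNReal.coe_mul]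
    congr 1
    simp

theorem norm_deriv_le_of_norm_le_closedBall {g : ℂ → ℂ} (hg : Differentiable ℂ g) {α : ℂ}
    {r M : ℝ} (hr : 0 < r) (hM : ∀ β ∈ Metric.closedBall α r, ‖g β‖ ≤ M) : ‖deriv g α‖ ≤ M / r :=
  Complex.norm_deriv_le_of_forall_mem_sphere_norm_le hr hg.diffContOnCl
    fun z hz => hM z (Metric.sphere_subset_closedBall hz)

/-- Two Cauchy estimates on discs of radius r/4 bound the second derivative by 16M/r² within r/2 of
`α`, and the mean value inequality gives the remainder. As the bound depends on `g` only through
`M`, it is uniform over test functions and over frequencies. -/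
theorem norm_slope_sub_deriv_le {g : ℂ → ℂ} (hg : Differentiable ℂ g) {α : ℂ} {r M : ℝ}
    (hr : 0 < r) (hM : ∀ β ∈ Metric.closedBall α r, ‖g β‖ ≤ M) {β : ℂ} (hβ : ‖β - α‖ ≤ r / 2)
    (hne : β ≠ α) :
    ‖(β - α)⁻¹ * (g β - g α) - deriv g α‖ ≤ M * (16 / r ^ 2) * ‖β - α‖ := by
  have hg' : Differentiable ℂ (deriv g) := fun z =>
    (((hg.differentiableOn (s := univ)).deriv isOpen_univ) z trivial).differentiableAt
      univ_mem
  have h1 : ∀ z ∈ Metric.closedBall α (r / 2 + r / 4), ‖deriv g z‖ ≤ M / (r / 4) := fun z hz =>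
    norm_deriv_le_of_norm_le_closedBall hg (by positivity) fun w hw => hM w (by
      rw [Metric.mem_closedBall] at *
      linarith [dist_triangle w z α])
  have h2 : ∀ z ∈ Metric.closedBall α (r / 2), ‖deriv (deriv g) z‖ ≤ M / (r / 4) / (r / 4) :=
    fun z hz => norm_deriv_le_of_norm_le_closedBall hg' (by positivity) fun w hw => h1 w (by
      rw [Metric.mem_closedBall] at *
      linarith [dist_triangle w z α])
  have hM0 : 0 ≤ M := (norm_nonneg _).trans (hM α (Metric.mem_closedBall_self hr.le))
  set D : ℝ := M * (16 / r ^ 2)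
  have hD : M / (r / 4) / (r / 4) = D := by simp only [D]; field_simp; norm_num
  rw [hD] at h2
  have hD0 : 0 ≤ D := by positivity
  have hsub : Metric.closedBall α ‖β - α‖ ⊆ Metric.closedBall α (r / 2) :=
    Metric.closedBall_subset_closedBall hβ
  have hαm : α ∈ Metric.closedBall α ‖β - α‖ := Metric.mem_closedBall_self (norm_nonneg _)
  have hβm : β ∈ Metric.closedBall α ‖β - α‖ := by simp [dist_eq_norm]
  have h3 : ∀ z ∈ Metric.closedBall α ‖β - α‖, ‖deriv g z - deriv g α‖ ≤ D * ‖β - α‖ :=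
    fun z hz => ((convex_closedBall _ _).norm_image_sub_le_of_norm_deriv_le
      (fun x _ => hg' x) (fun x hx => h2 x (hsub hx)) hαm hz).trans (by
        rw [Metric.mem_closedBall, dist_eq_norm] at hz
        gcongr)
  have hd : ∀ z, HasDerivAt (fun z => g z - deriv g α * z) (deriv g z - deriv g α) z := fun z => by
    have := (hg z).hasDerivAt.sub ((hasDerivAt_id' z).const_mul (deriv g α))
    rw [mul_one] at this
    exact this
  have h4 := (convex_closedBall α ‖β - α‖).norm_image_sub_le_of_norm_deriv_le
    (f := fun z => g z - deriv g α * z) (C := D * ‖β - α‖)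
    (fun x _ => (hd x).differentiableAt) (fun x hx => by rw [(hd x).deriv]; exact h3 x hx) hαm hβm
  have hne' : β - α ≠ 0 := sub_ne_zero.2 hne
  have e : (β - α)⁻¹ * (g β - g α) - deriv g α =
      (β - α)⁻¹ * ((g β - deriv g α * β) - (g α - deriv g α * α)) := by
    field_simp; ring
  rw [e, norm_mul, norm_inv]
  have hp : 0 < ‖β - α‖ := norm_pos_iff.2 hne'
  calc _ ≤ ‖β - α‖⁻¹ * (D * ‖β - α‖ * ‖β - α‖) := by gcongr
    _ = D * ‖β - α‖ := by field_simp

section HolomorphicFamily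

variable {E : Type*} [NormedAddCommGroup E] [NormedSpace ℝ E] {Ω : TopologicalSpace.Opens E}

/-- A weakly holomorphic, locally equicontinuous family of distributions. -/
structure IsHolomorphicFamily (T : ℂ → 𝓓'(Ω, ℂ)) : Prop where
  differentiable : ∀ φ : 𝓓(Ω, ℝ), Differentiable ℂ fun α => T α φ
  locally_bounded : ∀ α : ℂ, ∃ r : ℝ, 0 < r ∧ ∀ K : TopologicalSpace.Compacts E, (K : Set E) ⊆ Ω →
    ∃ (m : ℕ) (C : ℝ), 0 ≤ C ∧ ∀ β ∈ Metric.closedBall α r, ∀ φ : 𝓓(Ω, ℝ), tsupport φ ⊆ K →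
      ∀ B : ℝ, (∀ j ≤ m, ∀ x, ‖iteratedFDeriv ℝ j φ x‖ ≤ B) → ‖T β φ‖ ≤ C * B

namespace IsHolomorphicFamily

variable {T : ℂ → 𝓓'(Ω, ℂ)}

/-- The derivative of a holomorphic family. -/
def derivative (hT : IsHolomorphicFamily T) (α : ℂ) : 𝓓'(Ω, ℂ) :=
  let A : 𝓓(Ω, ℝ) →ₗ[ℝ] ℂ :=
    { toFun := fun φ => deriv (fun β => T β φ) α
      map_add' := fun φ ψ => by
        have e : (fun β => T β (φ + ψ)) = (fun β => T β φ) + fun β => T β ψ := by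
          funext β; simp [map_add]
        rw [e, deriv_add (hT.differentiable φ α) (hT.differentiable ψ α)]
      map_smul' := fun c φ => by
        have e : (fun β => T β (c • φ)) = fun β => (c : ℂ) * T β φ := by
          funext β; simp [map_smul]
        rw [e, deriv_const_mul _ (hT.differentiable φ α)]
        simp }
  { toLinearMap := A
    cont := TestFunction.continuous_functional_of_bounds A fun K hK => by
      obtain ⟨r, hr, h⟩ := hT.locally_bounded α
      obtain ⟨m, C, hC0, hC⟩ := h K hK
      refine ⟨m, C / r, by positivity, fun φ hφ B hB => ?_⟩
      rw [div_mul_eq_mul_div]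
      exact norm_deriv_le_of_norm_le_closedBall (hT.differentiable φ) hr fun β hβ => hC β hβ φ hφ B hB }

theorem derivative_apply (hT : IsHolomorphicFamily T) (α : ℂ) (φ : 𝓓(Ω, ℝ)) :
    hT.derivative α φ = deriv (fun β => T β φ) α := rfl

/-- On a compact set of test functions local equicontinuity yields one bound `M` for all the scalar
functions, hence uniform convergence of their difference quotients. -/
theorem tendsto_slope [FiniteDimensional ℝ E] (hT : IsHolomorphicFamily T) (α c : ℂ) :
    Tendsto (fun β => c • ((β - α)⁻¹ • (T β - T α) - hT.derivative α)) (𝓝[≠] α) (𝓝 0) := by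
  rw [tendsto_distribution_iff]
  intro S hS ε hε
  obtain ⟨K, hK, hSK⟩ := hS.exists_common_support
  obtain ⟨r, hr, h⟩ := hT.locally_bounded α
  obtain ⟨m, C, hC0, hC⟩ := h K hK
  choose B hB0 hB using hS.exists_bound_iteratedFDeriv
  set M : ℝ := C * ∑ j ∈ Finset.range (m + 1), B j with hM
  have hM' : ∀ φ ∈ S, ∀ β ∈ Metric.closedBall α r, ‖T β φ‖ ≤ M := fun φ hφ β hβ =>
    hC β hβ φ (hSK φ hφ) _ fun j hj x => (hB j φ hφ x).trans
      (Finset.single_le_sum (f := B) (fun i _ => hB0 i) (Finset.mem_range_succ_iff.2 hj))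
  have hlim : Tendsto (fun β => ‖c‖ * (M * (16 / r ^ 2) * ‖β - α‖)) (𝓝[≠] α) (𝓝 0) := by
    have : Continuous fun β : ℂ => ‖c‖ * (M * (16 / r ^ 2) * ‖β - α‖) := by fun_prop
    simpa using (this.tendsto α).mono_left nhdsWithin_le_nhds
  have hball : ∀ᶠ β in 𝓝[≠] α, ‖β - α‖ ≤ r / 2 := by
    have := Metric.closedBall_mem_nhds α (half_pos hr)
    filter_upwards [nhdsWithin_le_nhds this] with β hβ
    simpa [dist_eq_norm] using hβ
  filter_upwards [hlim.eventually (gt_mem_nhds hε), hball, self_mem_nhdsWithin] with β h1 h2 h3 φ hφ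
  have e : (c • ((β - α)⁻¹ • (T β - T α) - hT.derivative α)) φ - (0 : 𝓓'(Ω, ℂ)) φ =
      c * ((β - α)⁻¹ * (T β φ - T α φ) - deriv (fun β => T β φ) α) := by
    simp [derivative_apply]
  rw [e, norm_mul]
  refine lt_of_le_of_lt ?_ h1
  gcongr
  exact norm_slope_sub_deriv_le (hT.differentiable φ) hr (hM' φ hφ) h2 h3

end IsHolomorphicFamily

theorem continuous_smul_distribution (u : 𝓓'(Ω, ℂ)) : Continuous fun z : ℂ => z • u := by
  rw [continuous_iff_continuousAt]
  intro z
  rw [ContinuousAt, tendsto_distribution_iff]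
  intro S hS ε hε
  obtain ⟨C, hC⟩ := (hS.image u.continuous).isBounded.exists_norm_le
  have hlim : Tendsto (fun β : ℂ => ‖β - z‖ * |C|) (𝓝 z) (𝓝 0) := by
    have : Continuous fun β : ℂ => ‖β - z‖ * |C| := by fun_prop
    simpa using this.tendsto z
  filter_upwards [hlim.eventually (gt_mem_nhds hε)] with β hβ φ hφ
  have e : (β • u) φ - (z • u) φ = (β - z) * u φ := by simp [sub_mul]
  rw [e, norm_mul]
  refine lt_of_le_of_lt ?_ hβ
  gcongr
  exact (hC _ (mem_image_of_mem _ hφ)).trans (le_abs_self C)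

theorem IsHolomorphicFamily.differentiable_distribution [FiniteDimensional ℝ E]
    {T : ℂ → 𝓓'(Ω, ℂ)} (hT : IsHolomorphicFamily T) : Differentiable ℂ T := by
  intro α
  let f' : ℂ →L[ℂ] 𝓓'(Ω, ℂ) :=
    { toLinearMap := LinearMap.toSpanSingleton ℂ _ (hT.derivative α)
      cont := continuous_smul_distribution _ }
  have e : f' 1 = hT.derivative α := one_smul ℂ _
  exact ⟨f', hasFDerivAt_of_tendsto_slope fun c => by rw [e]; exact hT.tendsto_slope α c⟩

end HolomorphicFamily

/-! ### Holomorphy with values in 𝓓'_Λ. -/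

section WavefrontFamily

variable {E : Type*} [NormedAddCommGroup E] [InnerProductSpace ℝ E] {Λ : Set (E × E)}

theorem localFourier_sub (u v : 𝓓'((⊤ : TopologicalSpace.Opens E), ℂ))
    (χ : 𝓓((⊤ : TopologicalSpace.Opens E), ℝ)) (ξ : E) :
    localFourier (u - v) χ ξ = localFourier u χ ξ - localFourier v χ ξ := by
  have h (φ : 𝓓((⊤ : TopologicalSpace.Opens E), ℝ)) : (u - v) φ = u φ - v φ := rfl
  simp only [localFourier, h]
  ring

theorem IsHolomorphicFamily.hasDerivAt_localFourier
    {T : ℂ → 𝓓'((⊤ : TopologicalSpace.Opens E), ℂ)} (hT : IsHolomorphicFamily T)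
    (χ : 𝓓((⊤ : TopologicalSpace.Opens E), ℝ)) (ξ : E) (α : ℂ) :
    HasDerivAt (fun β => localFourier (T β) χ ξ) (localFourier (hT.derivative α) χ ξ) α := by
  have h (φ : 𝓓((⊤ : TopologicalSpace.Opens E), ℝ)) :
      HasDerivAt (fun β => T β φ) (hT.derivative α φ) α := (hT.differentiable φ α).hasDerivAt
  exact (h _).sub ((h _).const_mul Complex.I)

variable [FiniteDimensional ℝ E]

theorem WavefrontSpace.continuous_smul_const (u : WavefrontSpace Λ) :
    Continuous fun z : ℂ => z • u := by
  rw [continuous_iff_continuousAt]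
  intro z
  rw [ContinuousAt, WavefrontSpace.tendsto_iff]
  refine ⟨(continuous_smul_distribution u.toDistribution).tendsto z, fun i ε hε => ?_⟩
  obtain ⟨C, hC0, hC⟩ := WavefrontSpace.rapidOn u i i.N
  have hlim : Tendsto (fun β : ℂ => ‖β - z‖ * C) (𝓝 z) (𝓝 0) := by
    have : Continuous fun β : ℂ => ‖β - z‖ * C := by fun_prop
    simpa using this.tendsto z
  filter_upwards [hlim.eventually (gt_mem_nhds hε)] with β hβ η hη
  have e (c : ℂ) : localFourier (c • u).toDistribution i.χ η =
    c * localFourier u.toDistribution i.χ η := localFourier_smul c _ _ _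
  rw [e, e, ← sub_mul, norm_mul, mul_left_comm]
  refine lt_of_le_of_lt ?_ hβ
  gcongr
  exact hC () η hη

/-- A holomorphic family that is locally uniformly microlocally smooth off `Λ`. -/
structure IsHolomorphicWavefrontFamily (Λ : Set (E × E))
    (T : ℂ → 𝓓'((⊤ : TopologicalSpace.Opens E), ℂ)) : Prop
    extends IsHolomorphicFamily T where
  locally_microAt : ∀ α : ℂ, ∃ r : ℝ, 0 < r ∧ ∀ x ξ : E, ξ ≠ 0 → (x, ξ) ∉ Λ →
    MicroAt (fun β : Metric.closedBall α r => T β) x ξ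

namespace IsHolomorphicWavefrontFamily

variable {T : ℂ → 𝓓'((⊤ : TopologicalSpace.Opens E), ℂ)}

theorem wavefrontSet_subset (hT : IsHolomorphicWavefrontFamily Λ T) (α : ℂ) :
    wavefrontSet (T α) ⊆ Λ := by
  rintro ⟨x, ξ⟩ ⟨h0, h⟩
  by_contra hΛ
  obtain ⟨r, hr, hm⟩ := hT.locally_microAt α
  exact h ((hm x ξ h0 hΛ).microlocallySmoothAt ⟨α, Metric.mem_closedBall_self hr.le⟩)

/-- Cauchy's estimate in β for (1+|η|)^N times the localized Fourier transform, whose bound is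
uniform in the frequency, shows that the derivative decays where the family does. -/
theorem wavefrontSet_derivative_subset (hT : IsHolomorphicWavefrontFamily Λ T) (α : ℂ) :
    wavefrontSet (hT.derivative α) ⊆ Λ := by
  rintro ⟨x, ξ⟩ ⟨h0, h⟩
  by_contra hΛ
  obtain ⟨r, hr, hm⟩ := hT.locally_microAt α
  obtain ⟨U, hU, V, hV, hc, hR⟩ := hm x ξ h0 hΛ
  refine h ⟨U, hU, V, hV, hc, fun χ hχ N => ?_⟩
  obtain ⟨C, -, hC⟩ := hR χ hχ N
  refine ⟨C / r, fun η hη => ?_⟩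
  have hd (β : ℂ) := (hT.hasDerivAt_localFourier χ η β).const_mul (((1 + ‖η‖) ^ N : ℝ) : ℂ)
  have hn : ‖(((1 + ‖η‖) ^ N : ℝ) : ℂ)‖ = (1 + ‖η‖) ^ N := by
    rw [Complex.norm_real, Real.norm_of_nonneg (by positivity)]
  have h1 := norm_deriv_le_of_norm_le_closedBall (M := C) (fun β => (hd β).differentiableAt) hr
    (α := α) fun β hβ => by
      rw [norm_mul, hn]
      exact hC ⟨β, hβ⟩ η hη
  rw [(hd α).deriv, norm_mul, hn] at h1
  exact h1

theorem exists_rapid_closedBall (hT : IsHolomorphicWavefrontFamily Λ T)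
    (i : WavefrontSpace.SeminormIndex Λ) (α : ℂ) :
    ∃ r : ℝ, 0 < r ∧ ∃ C : ℝ, 0 ≤ C ∧ ∀ β ∈ Metric.closedBall α r, ∀ η ∈ i.V,
      (1 + ‖η‖) ^ i.N * ‖localFourier (T β) i.χ η‖ ≤ C := by
  obtain ⟨r, hr, hm⟩ := hT.locally_microAt α
  have h := rapidOn_of_microAt (T := fun β : Metric.closedBall α r => T β) i.isClosed i.isConic i.χ
    (fun χ => by
      obtain ⟨C, hC⟩ := ((isCompact_closedBall α r).image
        (hT.differentiable χ).continuous).isBounded.exists_norm_le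
      exact ⟨C, fun β => hC _ (mem_image_of_mem _ β.2)⟩)
    (fun x hx ξ hξ h0 => hm x ξ h0 fun hΛ => disjoint_left.1 i.disjoint ⟨hx, hξ⟩ hΛ)
  obtain ⟨C, hC0, hC⟩ := h i.N
  exact ⟨r, hr, C, hC0, fun β hβ η hη => hC ⟨β, hβ⟩ η hη⟩

/-- For the seminorms, the remainder estimate is applied at each frequency of the cone to the
weighted Fourier transform, with the common bound from `exists_rapid_closedBall`. -/
theorem tendsto_slope (hT : IsHolomorphicWavefrontFamily Λ T) (α c : ℂ) :
    Tendsto (fun β => c • ((β - α)⁻¹ • (WavefrontSpace.mk (T β) (hT.wavefrontSet_subset β) -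
      WavefrontSpace.mk (T α) (hT.wavefrontSet_subset α)) -
      WavefrontSpace.mk (hT.derivative α) (hT.wavefrontSet_derivative_subset α)))
      (𝓝[≠] α) (𝓝 0) := by
  rw [WavefrontSpace.tendsto_iff]
  refine ⟨hT.toIsHolomorphicFamily.tendsto_slope α c, fun i ε hε => ?_⟩
  obtain ⟨r, hr, M, hM0, hM⟩ := hT.exists_rapid_closedBall i α
  have hlim : Tendsto (fun β => ‖c‖ * (M * (16 / r ^ 2) * ‖β - α‖)) (𝓝[≠] α) (𝓝 0) := by
    have : Continuous fun β : ℂ => ‖c‖ * (M * (16 / r ^ 2) * ‖β - α‖) := by fun_prop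
    simpa using (this.tendsto α).mono_left nhdsWithin_le_nhds
  have hball : ∀ᶠ β in 𝓝[≠] α, ‖β - α‖ ≤ r / 2 := by
    have := Metric.closedBall_mem_nhds α (half_pos hr)
    filter_upwards [nhdsWithin_le_nhds this] with β hβ
    simpa [dist_eq_norm] using hβ
  filter_upwards [hlim.eventually (gt_mem_nhds hε), hball, self_mem_nhdsWithin] with β h1 h2 h3 η hη
  have hd (β : ℂ) := (hT.hasDerivAt_localFourier i.χ η β).const_mul (((1 + ‖η‖) ^ i.N : ℝ) : ℂ)
  have hn : ‖(((1 + ‖η‖) ^ i.N : ℝ) : ℂ)‖ = (1 + ‖η‖) ^ i.N := by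
    rw [Complex.norm_real, Real.norm_of_nonneg (by positivity)]
  have h4 := norm_slope_sub_deriv_le (fun β => (hd β).differentiableAt) hr
    (fun β hβ => by
      rw [norm_mul, hn]
      exact hM β hβ η hη) h2 h3
  rw [(hd α).deriv] at h4
  refine lt_of_le_of_lt ?_ h1
  have e : localFourier (c • ((β - α)⁻¹ • (WavefrontSpace.mk (T β) (hT.wavefrontSet_subset β) -
      WavefrontSpace.mk (T α) (hT.wavefrontSet_subset α)) -
      WavefrontSpace.mk (hT.derivative α)
        (hT.wavefrontSet_derivative_subset α))).toDistribution i.χ η =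
      c * ((β - α)⁻¹ * (localFourier (T β) i.χ η - localFourier (T α) i.χ η) -
        localFourier (hT.derivative α) i.χ η) := by
    change localFourier (c • ((β - α)⁻¹ • (T β - T α) - hT.derivative α)) i.χ η = _
    rw [localFourier_smul, localFourier_sub, localFourier_smul, localFourier_sub]
  have e0 : localFourier (0 : WavefrontSpace Λ).toDistribution i.χ η = 0 := by
    have := localFourier_smul 0 (0 : WavefrontSpace Λ).toDistribution i.χ η
    rw [zero_mul] at this
    rw [← this]
    congr 1
    exact (smul_zero _).symm
  rw [e, e0, sub_zero, ← hn, ← norm_mul, mul_left_comm, norm_mul]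
  gcongr
  refine le_trans (le_of_eq ?_) h4
  congr 1
  ring

/-- The continuous linear map `P` carries over the convergence of the difference quotients. The
identity gives holomorphy in 𝓓'_Λ, the pullback gives the last claim. -/
theorem differentiable_comp {F : Type*} [AddCommGroup F] [Module ℂ F] [TopologicalSpace F]
    (hT : IsHolomorphicWavefrontFamily Λ T) (P : WavefrontSpace Λ →L[ℂ] F) :
    Differentiable ℂ fun α => P (WavefrontSpace.mk (T α) (hT.wavefrontSet_subset α)) := by
  intro α
  let f' : ℂ →L[ℂ] WavefrontSpace Λ :=
    { toLinearMap := LinearMap.toSpanSingleton ℂ _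
        (WavefrontSpace.mk (hT.derivative α) (hT.wavefrontSet_derivative_subset α))
      cont := WavefrontSpace.continuous_smul_const _ }
  have e : f' 1 = WavefrontSpace.mk (hT.derivative α) (hT.wavefrontSet_derivative_subset α) :=
    one_smul ℂ _
  refine ⟨P.comp f', hasFDerivAt_of_tendsto_slope fun c => ?_⟩
  have h := (P.continuous.tendsto 0).comp (hT.tendsto_slope α c)
  rw [map_zero] at h
  refine h.congr fun β => ?_
  simp [e, map_smul, map_sub]

theorem differentiable_mk (hT : IsHolomorphicWavefrontFamily Λ T) :
    Differentiable ℂ fun α => WavefrontSpace.mk (T α) (hT.wavefrontSet_subset α) :=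
  hT.differentiable_comp (ContinuousLinearMap.id ℂ _)

end IsHolomorphicWavefrontFamily

end WavefrontFamily

/-! ### Complex powers of the Lorentzian distance on the light cone -/

section ConePower

variable {d : ℕ} [NeZero d]

theorem units_cast_mul_self (ε : ℤˣ) : ((ε : ℤ) : ℝ) * ((ε : ℤ) : ℝ) = 1 := by
  rcases Int.units_eq_one_or ε with rfl | rfl <;> norm_num

theorem abs_units_cast (ε : ℤˣ) : |((ε : ℤ) : ℝ)| = 1 := by
  rcases Int.units_eq_one_or ε with rfl | rfl <;> norm_num

/-- The spatial part of a vector. -/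
def spatialPart (d : ℕ) [NeZero d] : Minkowski d →L[ℝ] Minkowski d :=
  ContinuousLinearMap.id ℝ _ - (innerSL ℝ (timeVector d)).smulRight (timeVector d)

theorem spatialPart_apply (x : Minkowski d) : spatialPart d x = x - x 0 • timeVector d := by
  simp [spatialPart, inner_timeVector]

theorem norm_spatialPart_sq (x : Minkowski d) : ‖spatialPart d x‖ ^ 2 = ‖x‖ ^ 2 - x 0 ^ 2 := by
  rw [spatialPart_apply, norm_sub_sq_real, inner_smul_right, real_inner_comm, inner_timeVector,
    norm_smul, norm_timeVector, Real.norm_eq_abs, mul_one, sq_abs]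
  ring

theorem abs_time_le_norm (x : Minkowski d) : |x 0| ≤ ‖x‖ := by
  rw [← inner_timeVector]
  simpa [norm_timeVector] using abs_real_inner_le_norm (timeVector d) x

theorem norm_spatialPart_le (x : Minkowski d) : ‖spatialPart d x‖ ≤ ‖x‖ :=
  le_of_sq_le_sq (by rw [norm_spatialPart_sq]; nlinarith [sq_nonneg (x 0)]) (norm_nonneg _)

theorem gammaForm_eq_sq_sub_sq (x : Minkowski d) :
    gammaForm x = x 0 ^ 2 - ‖spatialPart d x‖ ^ 2 := by
  rw [gammaForm_eq_sub, norm_spatialPart_sq]; ring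

theorem gammaForm_le_norm_sq (x : Minkowski d) : gammaForm x ≤ ‖x‖ ^ 2 := by
  have h := pow_le_pow_left₀ (abs_nonneg _) (abs_time_le_norm x) 2
  rw [sq_abs] at h
  rw [gammaForm_eq_sub]
  linarith

theorem continuous_gammaForm : Continuous (gammaForm (d := d)) := contDiff_gammaForm.continuous

/-- The open future or past light cone. -/
def openCone (d : ℕ) [NeZero d] (ε : ℤˣ) : Set (Minkowski d) :=
  {x | 0 < gammaForm x ∧ 0 < ((ε : ℤ) : ℝ) * x 0}

theorem mem_openCone {ε : ℤˣ} {x : Minkowski d} :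
    x ∈ openCone d ε ↔ 0 < gammaForm x ∧ 0 < ((ε : ℤ) : ℝ) * x 0 := Iff.rfl

theorem isOpen_openCone (ε : ℤˣ) : IsOpen (openCone d ε) :=
  (isOpen_lt continuous_const continuous_gammaForm).inter
    (isOpen_lt continuous_const
      (by fun_prop : Continuous fun x : Minkowski d => ((ε : ℤ) : ℝ) * x 0))

theorem mem_openCone_iff {ε : ℤˣ} {x : Minkowski d} :
    x ∈ openCone d ε ↔ ‖spatialPart d x‖ < ((ε : ℤ) : ℝ) * x 0 := by
  have h1 := units_cast_mul_self ε
  have h2 : (((ε : ℤ) : ℝ) * x 0) ^ 2 = x 0 ^ 2 := by rw [mul_pow, sq, h1, one_mul]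
  rw [mem_openCone, gammaForm_eq_sq_sub_sq, ← h2, sub_pos]
  constructor
  · rintro ⟨h, h'⟩
    exact lt_of_pow_lt_pow_left₀ 2 h'.le h
  · intro h
    exact ⟨pow_lt_pow_left₀ h (norm_nonneg _) two_ne_zero, (norm_nonneg _).trans_lt h⟩

theorem mem_causalCone_iff {ε : ℤˣ} {x : Minkowski d} :
    x ∈ causalCone d ε ↔ ‖spatialPart d x‖ ≤ ((ε : ℤ) : ℝ) * x 0 := by
  have h1 := units_cast_mul_self ε
  have h2 : (((ε : ℤ) : ℝ) * x 0) ^ 2 = x 0 ^ 2 := by rw [mul_pow, sq, h1, one_mul]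
  rw [causalCone, mem_ofPred_eq, gammaForm_eq_sq_sub_sq, ← h2, sub_nonneg]
  constructor
  · rintro ⟨h, h'⟩
    exact le_of_sq_le_sq h h'
  · intro h
    exact ⟨pow_le_pow_left₀ (norm_nonneg _) h 2, (norm_nonneg _).trans h⟩

/-- Near a point outside the open cone, `γ` is small on the cone. -/
theorem gammaForm_le_of_notMem {ε : ℤˣ} {x y : Minkowski d} (hx : x ∉ openCone d ε)
    (hy : y ∈ openCone d ε) : gammaForm y ≤ 4 * ‖y‖ * ‖y - x‖ := by
  rw [mem_openCone_iff] at hx hy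
  have h1 := units_cast_mul_self ε
  have h2 : (((ε : ℤ) : ℝ) * y 0) ^ 2 = y 0 ^ 2 := by rw [mul_pow, sq, h1, one_mul]
  have h3 : ((ε : ℤ) : ℝ) * y 0 - ((ε : ℤ) : ℝ) * x 0 ≤ ‖y - x‖ := by
    have h := abs_time_le_norm (y - x)
    calc _ = ((ε : ℤ) : ℝ) * (y - x) 0 := by simp [mul_sub]
      _ ≤ |((ε : ℤ) : ℝ) * (y - x) 0| := le_abs_self _
      _ ≤ _ := by rw [abs_mul, abs_units_cast, one_mul]; exact h
  have h4 : ‖spatialPart d x‖ - ‖spatialPart d y‖ ≤ ‖y - x‖ := by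
    have h := norm_spatialPart_le (x - y)
    rw [map_sub] at h
    rw [norm_sub_rev y x]
    exact (norm_sub_norm_le _ _).trans h
  have h5 : ((ε : ℤ) : ℝ) * y 0 ≤ ‖y‖ := (le_abs_self _).trans
    (by rw [abs_mul, abs_units_cast, one_mul]; exact abs_time_le_norm y)
  have h6 := norm_spatialPart_le y
  rw [gammaForm_eq_sq_sub_sq, ← h2]
  nlinarith [norm_nonneg (y - x), norm_nonneg y, norm_nonneg (spatialPart d y)]

open Classical in
/-- The function `γ^s` on the open future or past light cone, extended by zero. -/
def conePow (ε : ℤˣ) (s : ℂ) (x : Minkowski d) : ℂ :=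
  if x ∈ openCone d ε then ((gammaForm x : ℝ) : ℂ) ^ s else 0

theorem conePow_of_mem {ε : ℤˣ} {x : Minkowski d} (hx : x ∈ openCone d ε) (s : ℂ) :
    conePow ε s x = ((gammaForm x : ℝ) : ℂ) ^ s := if_pos hx

theorem conePow_of_notMem {ε : ℤˣ} {x : Minkowski d} (hx : x ∉ openCone d ε) (s : ℂ) :
    conePow ε s x = 0 := if_neg hx

theorem norm_conePow_of_mem {ε : ℤˣ} {x : Minkowski d} (hx : x ∈ openCone d ε) (s : ℂ) :
    ‖conePow ε s x‖ = gammaForm x ^ s.re := by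
  rw [conePow_of_mem hx, Complex.norm_cpow_eq_rpow_re_of_pos hx.1]

theorem gammaForm_mul_conePow (ε : ℤˣ) (s : ℂ) (x : Minkowski d) :
    (gammaForm x : ℂ) * conePow ε (s - 1) x = conePow ε s x := by
  by_cases hx : x ∈ openCone d ε
  · rw [conePow_of_mem hx, conePow_of_mem hx, Complex.cpow_sub _ _ (by exact_mod_cast hx.1.ne'),
      Complex.cpow_one]
    have : (gammaForm x : ℂ) ≠ 0 := by exact_mod_cast hx.1.ne'
    field_simp
  · simp [conePow_of_notMem hx]

theorem measurable_conePow (ε : ℤˣ) (s : ℂ) : Measurable (conePow (d := d) ε s) := by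
  classical
  refine Measurable.ite (isOpen_openCone ε).measurableSet ?_ measurable_const
  exact (Complex.measurable_ofReal.comp continuous_gammaForm.measurable).pow_const s

theorem norm_conePow_le {ε : ℤˣ} {s : ℂ} {m : ℕ} (h0 : 0 ≤ s.re) (hm : s.re ≤ m) (x : Minkowski d) :
    ‖conePow ε s x‖ ≤ (1 + ‖x‖ ^ 2) ^ m := by
  by_cases hx : x ∈ openCone d ε
  · rw [norm_conePow_of_mem hx]
    have h1 : gammaForm x ≤ 1 + ‖x‖ ^ 2 := (gammaForm_le_norm_sq x).trans (by linarith)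
    calc gammaForm x ^ s.re ≤ (1 + ‖x‖ ^ 2) ^ s.re := Real.rpow_le_rpow hx.1.le h1 h0
      _ ≤ (1 + ‖x‖ ^ 2) ^ (m : ℝ) := Real.rpow_le_rpow_of_exponent_le (by nlinarith [sq_nonneg ‖x‖]) hm
      _ = _ := Real.rpow_natCast _ _
  · rw [conePow_of_notMem hx, norm_zero]
    positivity

theorem locallyIntegrable_conePow (ε : ℤˣ) {s : ℂ} (h0 : 0 ≤ s.re) :
    LocallyIntegrable (conePow (d := d) ε s) := by
  have hc : Continuous fun x : Minkowski d => (1 + ‖x‖ ^ 2) ^ ⌈s.re⌉₊ := by fun_prop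
  exact hc.locallyIntegrable.mono (measurable_conePow ε s).aestronglyMeasurable
    (Eventually.of_forall fun x => (norm_conePow_le h0 (Nat.le_ceil _) x).trans (le_abs_self _))

/-- The powers with exponent `Re s ≥ 2` are differentiable, across the light cone as well. -/
theorem hasFDerivAt_conePow (ε : ℤˣ) {s : ℂ} (hs : 2 ≤ s.re) (x : Minkowski d) :
    HasFDerivAt (conePow ε s)
      ((innerSL ℝ (timeReflection d x)).smulRight (-2 * s * conePow ε (s - 1) x)) x := by
  by_cases hx : x ∈ openCone d ε
  · have hs0 : s ≠ 0 := by rintro rfl; norm_num at hs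
    have h1 := (hasDerivAt_ofReal_cpow_const hx.1.ne' hs0).hasFDerivAt.comp x
      (hasGradientAt_gammaForm x).hasFDerivAt
    have h2 : conePow ε s =ᶠ[𝓝 x] fun y => ((gammaForm y : ℝ) : ℂ) ^ s := by
      filter_upwards [(isOpen_openCone ε).mem_nhds hx] with y hy using conePow_of_mem hy s
    refine (h1.congr_of_eventuallyEq h2).congr_fderiv (ContinuousLinearMap.ext fun y => ?_)
    simp [conePow_of_mem hx]
    ring
  · rw [conePow_of_notMem hx, mul_zero]
    have e : (innerSL ℝ (timeReflection d x)).smulRight (0 : ℂ) = 0 := by ext; simp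
    rw [e]
    -- On and outside the light cone the derivative is 0: γ^s = γ² γ^(s-2), where the second factor
    -- is locally bounded as Re s ≥ 2, and γ(y) = O(|y - x|) on the cone, so the function is O(|y -
    -- x|²).
    refine Asymptotics.IsBigO.hasFDerivAt (n := 2) ?_ one_lt_two
    refine Asymptotics.IsBigO.of_bound
      ((4 * (‖x‖ + 1)) ^ 2 * (1 + (‖x‖ + 1) ^ 2) ^ ⌈s.re⌉₊) ?_
    filter_upwards [Metric.ball_mem_nhds x one_pos] with y hy
    rw [Metric.mem_ball, dist_eq_norm] at hy
    have hyn : ‖y‖ ≤ ‖x‖ + 1 := by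
      have := norm_le_norm_add_norm_sub' y x
      rw [norm_sub_rev] at this
      linarith [norm_sub_rev x y]
    by_cases hyc : y ∈ openCone d ε
    · have h1 : ‖conePow ε s y‖ = gammaForm y ^ 2 * ‖conePow ε (s - 2) y‖ := by
        rw [norm_conePow_of_mem hyc, norm_conePow_of_mem hyc, ← Real.rpow_natCast,
          ← Real.rpow_add hyc.1]
        congr 1
        simp
      rw [h1, norm_pow, norm_norm]
      have h2 := gammaForm_le_of_notMem hx hyc
      have h3 : gammaForm y ≤ 4 * (‖x‖ + 1) * ‖y - x‖ := h2.trans (by gcongr)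
      have h4 : ‖conePow ε (s - 2) y‖ ≤ (1 + (‖x‖ + 1) ^ 2) ^ ⌈s.re⌉₊ :=
        (norm_conePow_le (by simpa using hs) (by
          have := Nat.le_ceil s.re
          simp only [Complex.sub_re, Complex.re_ofNat]; linarith) y).trans (by gcongr)
      calc _ ≤ (4 * (‖x‖ + 1) * ‖y - x‖) ^ 2 * (1 + (‖x‖ + 1) ^ 2) ^ ⌈s.re⌉₊ := by
            have := hyc.1.le
            gcongr
        _ = _ := by ring
    · rw [conePow_of_notMem hyc, norm_zero]
      positivity

theorem integrable_mul_conePow (ε : ℤˣ) {s : ℂ} (h0 : 0 ≤ s.re) {ψ : Minkowski d → ℂ}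
    (hψ : Continuous ψ) (hc : HasCompactSupport ψ) : Integrable fun x => ψ x * conePow ε s x :=
  ((locallyIntegrable_conePow ε h0).integrable_smul_left_of_hasCompactSupport hψ hc)

/-- Integration by parts against a power of `γ` on the cone. -/
theorem integral_fderiv_mul_conePow (ε : ℤˣ) {s : ℂ} (hs : 2 ≤ s.re) {ψ : Minkowski d → ℂ}
    (hψ : ContDiff ℝ ∞ ψ) (hc : HasCompactSupport ψ) (v : Minkowski d) :
    ∫ x, fderiv ℝ ψ x v * conePow ε s x =
      2 * s * ∫ x, ψ x * ⟪timeReflection d x, v⟫_ℝ * conePow ε (s - 1) x := by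
  have h0 : 0 ≤ s.re := by linarith
  have h1 : 0 ≤ (s - 1).re := by simp; linarith
  have hfd (x : Minkowski d) : fderiv ℝ (conePow ε s) x v =
      -2 * s * (⟪timeReflection d x, v⟫_ℝ * conePow ε (s - 1) x) := by
    rw [(hasFDerivAt_conePow ε hs x).fderiv]
    simp
    ring
  have hj : Continuous fun x : Minkowski d => ((⟪timeReflection d x, v⟫_ℝ : ℝ) : ℂ) :=
    Complex.continuous_ofReal.comp ((timeReflection d).continuous.inner continuous_const)
  have hI := integrable_mul_conePow ε h1 (hψ.continuous.mul hj) hc.mul_right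
  have h := integral_mul_fderiv_eq_neg_fderiv_mul_of_integrable (μ := volume) (f := ψ)
    (g := conePow ε s) (v := v)
    (integrable_mul_conePow ε h0 ((hψ.continuous_fderiv (by simp)).clm_apply continuous_const)
      (hc.fderiv_apply (𝕜 := ℝ) v))
    (by
      refine (hI.const_mul (-2 * s)).congr (Eventually.of_forall fun x => ?_)
      simp only [hfd, Pi.mul_apply]
      ring)
    (integrable_mul_conePow ε h0 hψ.continuous hc)
    (fun x _ => hψ.differentiable (by simp) x)
    (fun x _ => (hasFDerivAt_conePow ε hs x).differentiableAt)
  rw [eq_comm, neg_eq_iff_eq_neg] at h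
  rw [h, ← integral_const_mul, ← integral_neg]
  refine integral_congr_ae (Eventually.of_forall fun x => ?_)
  simp only [hfd]
  ring

end ConePower

/-! ### Local holomorphy and its stability under differential operators -/

section HolomorphicNear

variable {E : Type*} [NormedAddCommGroup E] [NormedSpace ℝ E] {Ω : TopologicalSpace.Opens E}

/-- Local version of `IsHolomorphicFamily`. -/
def HolomorphicNear (T : ℂ → 𝓓'(Ω, ℂ)) (α : ℂ) : Prop :=
  ∃ r : ℝ, 0 < r ∧ (∀ φ : 𝓓(Ω, ℝ), ∀ β ∈ Metric.ball α r, DifferentiableAt ℂ (fun β => T β φ) β) ∧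
    ∀ K : TopologicalSpace.Compacts E, (K : Set E) ⊆ Ω →
      ∃ (m : ℕ) (C : ℝ), 0 ≤ C ∧ ∀ β ∈ Metric.ball α r, ∀ φ : 𝓓(Ω, ℝ), tsupport φ ⊆ K →
        ∀ B : ℝ, (∀ j ≤ m, ∀ x, ‖iteratedFDeriv ℝ j φ x‖ ≤ B) → ‖T β φ‖ ≤ C * B

theorem isHolomorphicFamily_of_near {T : ℂ → 𝓓'(Ω, ℂ)} (h : ∀ α, HolomorphicNear T α) :
    IsHolomorphicFamily T where
  differentiable φ α := by
    obtain ⟨r, hr, hd, -⟩ := h α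
    exact hd φ α (Metric.mem_ball_self hr)
  locally_bounded α := by
    obtain ⟨r, hr, -, hb⟩ := h α
    refine ⟨r / 2, half_pos hr, fun K hK => ?_⟩
    obtain ⟨m, C, hC0, hC⟩ := hb K hK
    exact ⟨m, C, hC0, fun β hβ => hC β (Metric.closedBall_subset_ball (half_lt_self hr) hβ)⟩

namespace HolomorphicNear

variable {T T' : ℂ → 𝓓'(Ω, ℂ)} {α : ℂ}

theorem congr (h : HolomorphicNear T α) (he : T' =ᶠ[𝓝 α] T) : HolomorphicNear T' α := by
  obtain ⟨r, hr, hd, hb⟩ := h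
  obtain ⟨r', hr', he⟩ := Metric.eventually_nhds_iff_ball.1 he
  have hs : Metric.ball α (min r r') ⊆ Metric.ball α r := Metric.ball_subset_ball (min_le_left _ _)
  have hs' : Metric.ball α (min r r') ⊆ Metric.ball α r' :=
    Metric.ball_subset_ball (min_le_right _ _)
  refine ⟨min r r', lt_min hr hr', fun φ β hβ => ?_, fun K hK => ?_⟩
  · refine (hd φ β (hs hβ)).congr_of_eventuallyEq ?_
    filter_upwards [Metric.isOpen_ball.mem_nhds (hs' hβ)] with z hz
    rw [he z hz]
  · obtain ⟨m, C, hC0, hC⟩ := hb K hK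
    exact ⟨m, C, hC0, fun β hβ => by rw [he β (hs' hβ)]; exact hC β (hs hβ)⟩

theorem comp_add_const {c : ℂ} (h : HolomorphicNear T (α + c)) :
    HolomorphicNear (fun β => T (β + c)) α := by
  obtain ⟨r, hr, hd, hb⟩ := h
  have hs : ∀ β ∈ Metric.ball α r, β + c ∈ Metric.ball (α + c) r := fun β hβ => by simpa using hβ
  refine ⟨r, hr, fun φ β hβ => ?_, fun K hK => ?_⟩
  · exact (hd φ (β + c) (hs β hβ)).comp β (differentiableAt_id.add_const c)
  · obtain ⟨m, C, hC0, hC⟩ := hb K hK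
    exact ⟨m, C, hC0, fun β hβ => hC _ (hs β hβ)⟩

theorem zero : HolomorphicNear (fun _ => (0 : 𝓓'(Ω, ℂ))) α := by
  refine ⟨1, one_pos, fun φ β _ => ?_, fun K hK => ⟨0, 0, le_rfl, fun β _ φ _ B _ => ?_⟩⟩
  · exact differentiableAt_const (c := (0 : ℂ))
  · simp

theorem add (h : HolomorphicNear T α) (h' : HolomorphicNear T' α) :
    HolomorphicNear (fun β => T β + T' β) α := by
  obtain ⟨r, hr, hd, hb⟩ := h
  obtain ⟨r', hr', hd', hb'⟩ := h'
  have hs : Metric.ball α (min r r') ⊆ Metric.ball α r := Metric.ball_subset_ball (min_le_left _ _)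
  have hs' : Metric.ball α (min r r') ⊆ Metric.ball α r' :=
    Metric.ball_subset_ball (min_le_right _ _)
  refine ⟨min r r', lt_min hr hr', fun φ β hβ => (hd φ β (hs hβ)).add (hd' φ β (hs' hβ)),
    fun K hK => ?_⟩
  obtain ⟨m, C, hC0, hC⟩ := hb K hK
  obtain ⟨m', C', hC0', hC'⟩ := hb' K hK
  refine ⟨max m m', C + C', by positivity, fun β hβ φ hφ B hB => ?_⟩
  have h1 := hC β (hs hβ) φ hφ B fun j hj => hB j (hj.trans (le_max_left _ _))
  have h2 := hC' β (hs' hβ) φ hφ B fun j hj => hB j (hj.trans (le_max_right _ _))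
  calc ‖(T β + T' β) φ‖ ≤ ‖T β φ‖ + ‖T' β φ‖ := norm_add_le _ _
    _ ≤ (C + C') * B := by linarith

theorem neg (h : HolomorphicNear T α) : HolomorphicNear (fun β => -T β) α := by
  obtain ⟨r, hr, hd, hb⟩ := h
  refine ⟨r, hr, fun φ β hβ => (hd φ β hβ).neg, fun K hK => ?_⟩
  obtain ⟨m, C, hC0, hC⟩ := hb K hK
  refine ⟨m, C, hC0, fun β hβ φ hφ B hB => ?_⟩
  have := hC β hβ φ hφ B hB
  rwa [← norm_neg] at this

theorem sum {ι : Type*} (s : Finset ι) {T : ι → ℂ → 𝓓'(Ω, ℂ)}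
    (h : ∀ i ∈ s, HolomorphicNear (T i) α) : HolomorphicNear (fun β => ∑ i ∈ s, T i β) α := by
  classical
  induction s using Finset.induction_on with
  | empty => simpa using zero
  | insert i s hi ih =>
    simp only [Finset.sum_insert hi]
    exact (h i (Finset.mem_insert_self _ _)).add
      (ih fun j hj => h j (Finset.mem_insert_of_mem hj))

/-- The derivative moves to the test function: bounds need one more derivative of it, and the radius
does not shrink. -/
theorem lineDeriv (h : HolomorphicNear T α) (v : E) :
    HolomorphicNear (fun β => LineDeriv.lineDerivOp v (T β)) α := by
  obtain ⟨r, hr, hd, hb⟩ := h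
  refine ⟨r, hr, fun φ β hβ => ?_, fun K hK => ?_⟩
  · simp only [Distribution.lineDerivOp_apply_apply]
    exact hd _ β hβ
  · obtain ⟨m, C, hC0, hC⟩ := hb K hK
    refine ⟨m + 1, C * ‖v‖, by positivity, fun β hβ φ hφ B hB => ?_⟩
    rw [Distribution.lineDerivOp_apply_apply, map_neg, norm_neg, mul_assoc]
    have e : ⇑(LineDeriv.lineDerivOp v φ : 𝓓(Ω, ℝ)) = fun x => fderiv ℝ φ x v := by
      funext x
      rw [TestFunction.lineDerivOp_eq_lineDerivCLM ℝ, TestFunction.lineDerivCLM_eq_fderivCLM,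
        TestFunction.fderivCLM_apply_of_le _ (by simp)]
    refine hC β hβ _ ?_ _ fun j hj x => ?_
    · rw [e]
      exact (tsupport_fderiv_apply_subset ℝ v).trans hφ
    · rw [e]
      have h1 : ContDiff ℝ ∞ (fderiv ℝ φ) := φ.contDiff.fderiv_right (by simp)
      have h2 := (ContinuousLinearMap.apply ℝ ℝ v).norm_iteratedFDeriv_comp_left
        (f := fderiv ℝ φ) (x := x) h1.contDiffAt (n := j) (by exact_mod_cast le_top)
      have hv : ‖ContinuousLinearMap.apply ℝ ℝ v‖ ≤ ‖v‖ :=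
        ContinuousLinearMap.opNorm_le_bound _ (norm_nonneg v) fun L => by
          rw [mul_comm]; exact L.le_opNorm v
      refine (h2.trans (mul_le_mul hv le_rfl (by positivity)
        (by positivity))).trans ?_
      rw [norm_iteratedFDeriv_fderiv]
      exact mul_le_mul_of_nonneg_left (hB (j + 1) (by omega) x) (norm_nonneg v)

end HolomorphicNear

end HolomorphicNear

/-! ### Families given by powers of the Lorentzian distance -/

section RieszBase

variable {d : ℕ} [NeZero d]

/-- The d'Alembert operator `∂₀² - ∑ ∂ᵢ²` on distributions. -/
def dalembertian (u : 𝓓'((⊤ : TopologicalSpace.Opens (Minkowski d)), ℂ)) :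
    𝓓'((⊤ : TopologicalSpace.Opens (Minkowski d)), ℂ) :=
  -∑ i, LineDeriv.lineDerivOp (EuclideanSpace.basisFun (Fin d) ℝ i)
    (LineDeriv.lineDerivOp (timeReflection d (EuclideanSpace.basisFun (Fin d) ℝ i)) u)

theorem HolomorphicNear.dalembertian
    {T : ℂ → 𝓓'((⊤ : TopologicalSpace.Opens (Minkowski d)), ℂ)} {α : ℂ} (h : HolomorphicNear T α) :
    HolomorphicNear (fun β => dalembertian (T β)) α :=
  (HolomorphicNear.sum _ fun _ _ => (h.lineDeriv _).lineDeriv _).neg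

theorem HolomorphicNear.iterate_dalembertian
    {T : ℂ → 𝓓'((⊤ : TopologicalSpace.Opens (Minkowski d)), ℂ)} {α : ℂ} (h : HolomorphicNear T α)
    (k : ℕ) : HolomorphicNear (fun β => _root_.dalembertian^[k] (T β)) α := by
  induction k with
  | zero => exact h
  | succ k ih =>
    simp only [Function.iterate_succ_apply']
    exact ih.dalembertian

/-- A point on the boundary cone |x'| = εx₀ leaves the causal cone when it is moved slightly against
the time orientation. -/
theorem causalCone_diff_openCone_subset (ε : ℤˣ) :
    causalCone d ε \ openCone d ε ⊆ frontier (causalCone d ε) := by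
  rintro x ⟨hx, hx'⟩
  refine ⟨subset_closure hx, fun hi => ?_⟩
  have hc : Continuous fun t : ℝ => x - (t * ((ε : ℤ) : ℝ)) • timeVector d := by fun_prop
  have h0 : ∀ᶠ t : ℝ in 𝓝 0, x - (t * ((ε : ℤ) : ℝ)) • timeVector d ∈ causalCone d ε := by
    refine hc.continuousAt.eventually_mem ?_
    simpa using mem_interior_iff_mem_nhds.1 hi
  obtain ⟨t, ht, ht0⟩ := ((h0.filter_mono nhdsWithin_le_nhds).and
    (self_mem_nhdsWithin (s := Ioi (0 : ℝ)))).exists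
  rw [mem_causalCone_iff] at ht
  rw [mem_openCone_iff, not_lt] at hx'
  have h1 : spatialPart d (timeVector d) = 0 := by
    rw [spatialPart_apply]; simp [timeVector]
  have h2 : (timeVector d) 0 = 1 := by simp [timeVector]
  rw [map_sub, map_smul, h1, smul_zero, sub_zero] at ht
  simp only [PiLp.sub_apply, PiLp.smul_apply, smul_eq_mul, h2, mul_one, mul_sub] at ht
  have h3 : ((ε : ℤ) : ℝ) * (t * ((ε : ℤ) : ℝ)) = t := by
    rw [mul_left_comm, units_cast_mul_self, mul_one]
  rw [h3] at ht
  have : (0 : ℝ) < t := ht0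
  linarith

theorem convex_causalCone (ε : ℤˣ) : Convex ℝ (causalCone d ε) := by
  intro x hx y hy a b ha hb _
  rw [mem_causalCone_iff] at *
  calc ‖spatialPart d (a • x + b • y)‖ ≤ a * ‖spatialPart d x‖ + b * ‖spatialPart d y‖ := by
        rw [map_add, map_smul, map_smul]
        refine (norm_add_le _ _).trans ?_
        rw [norm_smul, norm_smul, Real.norm_of_nonneg ha, Real.norm_of_nonneg hb]
    _ ≤ a * (((ε : ℤ) : ℝ) * x 0) + b * (((ε : ℤ) : ℝ) * y 0) := by gcongr
    _ = _ := by simp; ring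

theorem openCone_subset_causalCone (ε : ℤˣ) : openCone d ε ⊆ causalCone d ε :=
  fun _ hx => ⟨hx.1.le, hx.2.le⟩

/-- The two functions can differ only on the light cone, for instance at α = d, where 0^0 = 1. This
is the boundary of a convex set, hence null. -/
theorem rieszFun_ae_eq (ε : ℤˣ) (α : ℂ) :
    rieszFun d ε α =ᵐ[volume] fun x => rieszConst d α * conePow ε ((α - d) / 2) x := by
  have h : ∀ᵐ x : Minkowski d, x ∉ frontier (causalCone d ε) :=
    measure_eq_zero_iff_ae_notMem.1 ((convex_causalCone ε).addHaar_frontier volume)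
  filter_upwards [h] with x hx
  by_cases hc : x ∈ causalCone d ε
  · have ho : x ∈ openCone d ε := by
      by_contra ho
      exact hx (causalCone_diff_openCone_subset ε ⟨hc, ho⟩)
    rw [rieszFun, if_pos hc, conePow_of_mem ho]
  · rw [rieszFun, if_neg hc, conePow_of_notMem fun ho => hc (openCone_subset_causalCone ε ho),
      mul_zero]

theorem rieszConst_eq (α : ℂ) : rieszConst d α =
    (2 : ℂ) ^ (1 - α) * (Real.pi : ℂ) ^ ((2 - (d : ℂ)) / 2) *
      ((Complex.Gamma (α / 2))⁻¹ * (Complex.Gamma ((α - d + 2) / 2))⁻¹) := by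
  rw [rieszConst, div_eq_mul_inv, mul_inv]

theorem differentiable_rieszConst : Differentiable ℂ (rieszConst d) := by
  have e : rieszConst d = fun α => _ := funext rieszConst_eq
  rw [e]
  refine ((Differentiable.const_cpow (by fun_prop) (Or.inl two_ne_zero)).mul_const _).mul
    ((Complex.differentiable_one_div_Gamma.comp (by fun_prop)).mul
      (Complex.differentiable_one_div_Gamma.comp (by fun_prop)))

/-- The functional equation of Γ in both factors. The factor α(α-d+2) is the one in □γ^s for s =
(α+2-d)/2. -/
theorem rieszConst_add_two (α : ℂ) :
    α * (α - d + 2) * rieszConst d (α + 2) = rieszConst d α := by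
  rw [rieszConst_eq, rieszConst_eq, Complex.one_div_Gamma_eq_self_mul_one_div_Gamma_add_one (α / 2),
    Complex.one_div_Gamma_eq_self_mul_one_div_Gamma_add_one ((α - d + 2) / 2)]
  have e1 : (α + 2) / 2 = α / 2 + 1 := by ring
  have e2 : (α + 2 - d + 2) / 2 = (α - d + 2) / 2 + 1 := by ring
  have e3 : (2 : ℂ) ^ (1 - α) = 4 * (2 : ℂ) ^ (1 - (α + 2)) := by
    have : 1 - α = 2 + (1 - (α + 2)) := by ring
    rw [this, Complex.cpow_add _ _ two_ne_zero]
    norm_num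
  rw [e1, e2, e3]
  ring

/-- The integral of a test function against `γ^s` on the cone depends holomorphically on `s`. -/
theorem differentiableAt_integral_conePow (ε : ℤˣ) {ψ : Minkowski d → ℂ} (hψ : Continuous ψ)
    (hc : HasCompactSupport ψ) {s₀ : ℂ} (hs₀ : 0 < s₀.re) :
    DifferentiableAt ℂ (fun s => ∫ x, ψ x * conePow ε s x) s₀ := by
  -- For `s` within δ of `s₀` the exponents s ± δ still have nonnegative real part, so the logarithm
  -- from differentiating in `s`, being at most (γ^δ + γ^(-δ))/δ, is harmless.
  set δ : ℝ := s₀.re / 4 with hδ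
  have hδ0 : 0 < δ := by positivity
  set m : ℕ := ⌈s₀.re + 2 * δ⌉₊
  have hre : ∀ s ∈ Metric.ball s₀ δ, 2 * δ ≤ s.re ∧ s.re + δ ≤ m := fun s hs => by
    rw [Metric.mem_ball, dist_eq_norm] at hs
    have h1 := (Complex.abs_re_le_norm (s - s₀)).trans hs.le
    rw [Complex.sub_re, abs_le] at h1
    have h2 := Nat.le_ceil (s₀.re + 2 * δ)
    constructor
    · linarith [h1.1]
    · linarith [h1.2]
  have hball : Metric.ball s₀ δ ∈ 𝓝 s₀ := Metric.ball_mem_nhds _ hδ0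
  refine (hasDerivAt_integral_of_dominated_loc_of_deriv_le (s := Metric.ball s₀ δ)
    (F := fun s x => ψ x * conePow ε s x)
    (F' := fun s x => ψ x * (conePow ε s x * Real.log (gammaForm x)))
    (bound := fun x => ‖ψ x‖ * (2 / δ * (1 + ‖x‖ ^ 2) ^ m)) hball ?_ ?_ ?_ ?_ ?_ ?_).2.differentiableAt
  · exact Eventually.of_forall fun s =>
      (hψ.measurable.mul (measurable_conePow ε s)).aestronglyMeasurable
  · exact integrable_mul_conePow ε hs₀.le hψ hc
  · exact (hψ.measurable.mul ((measurable_conePow ε s₀).mul (Complex.measurable_ofReal.comp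
      (Real.measurable_log.comp continuous_gammaForm.measurable)))).aestronglyMeasurable
  · refine Eventually.of_forall fun x s hs => ?_
    obtain ⟨h1, h2⟩ := hre s hs
    rw [norm_mul]
    refine mul_le_mul_of_nonneg_left ?_ (norm_nonneg _)
    by_cases hx : x ∈ openCone d ε
    · have hp := norm_conePow_le (ε := ε) (s := s + δ) (m := m) (by simp; linarith)
        (by simpa using h2) x
      have hm := norm_conePow_le (ε := ε) (s := s - δ) (m := m) (by simp; linarith)
        (by simp; linarith) x
      rw [norm_conePow_of_mem hx] at hp hm
      have hg : 0 < gammaForm x := hx.1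
      have hl1 := Real.log_le_rpow_div hg.le hδ0
      have hl2 := Real.log_le_rpow_div (inv_pos.2 hg).le hδ0
      rw [Real.log_inv, Real.inv_rpow hg.le, ← Real.rpow_neg hg.le] at hl2
      have hl : |Real.log (gammaForm x)| ≤ (gammaForm x ^ δ + gammaForm x ^ (-δ)) / δ := by
        have ha : 0 ≤ gammaForm x ^ δ / δ := by positivity
        have hb : 0 ≤ gammaForm x ^ (-δ) / δ := by positivity
        rw [add_div, abs_le]
        constructor <;> linarith
      rw [norm_mul, Complex.norm_real, norm_conePow_of_mem hx, Real.norm_eq_abs]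
      calc gammaForm x ^ s.re * |Real.log (gammaForm x)|
          ≤ gammaForm x ^ s.re * ((gammaForm x ^ δ + gammaForm x ^ (-δ)) / δ) := by gcongr
        _ = (gammaForm x ^ (s + δ).re + gammaForm x ^ (s - δ).re) / δ := by
          simp only [Complex.add_re, Complex.neg_re, Complex.ofReal_re, sub_eq_add_neg,
            Real.rpow_add hg]
          ring
        _ ≤ ((1 + ‖x‖ ^ 2) ^ m + (1 + ‖x‖ ^ 2) ^ m) / δ := by gcongr
        _ = _ := by ring
    · rw [conePow_of_notMem hx, zero_mul, norm_zero]
      positivity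
  · exact (Continuous.integrable_of_hasCompactSupport (by fun_prop) (hc.norm.mul_right))
  · refine Eventually.of_forall fun x s _ => ?_
    refine HasDerivAt.const_mul _ ?_
    by_cases hx : x ∈ openCone d ε
    · have hne : (gammaForm x : ℂ) ≠ 0 := by exact_mod_cast hx.1.ne'
      have h := (hasDerivAt_id s).const_cpow (c := (gammaForm x : ℂ)) (Or.inl hne)
      simp only [conePow_of_mem hx]
      rw [Complex.ofReal_log hx.1.le]
      simpa using h
    · simp only [conePow_of_notMem hx, zero_mul]
      exact hasDerivAt_const _ _

/-- The holomorphic family `c_α γ^{(α-d)/2}` on the cone, for `Re α > d`. -/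
def rieszBase (d : ℕ) [NeZero d] (ε : ℤˣ) (α : ℂ) :
    𝓓'((⊤ : TopologicalSpace.Opens (Minkowski d)), ℂ) :=
  rieszConst d α • distOfFun (conePow ε ((α - d) / 2))

theorem rieszBase_apply (ε : ℤˣ) {α : ℂ} (hα : (d : ℝ) ≤ α.re)
    (φ : 𝓓((⊤ : TopologicalSpace.Opens (Minkowski d)), ℝ)) :
    rieszBase d ε α φ = rieszConst d α * ∫ x, (φ x : ℂ) * conePow ε ((α - d) / 2) x := by
  have h0 : 0 ≤ ((α - d) / 2).re := by simp; linarith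
  have h : rieszBase d ε α φ = rieszConst d α * distOfFun (conePow ε ((α - d) / 2)) φ := rfl
  rw [h, distOfFun_apply (locallyIntegrable_conePow ε h0)]
  simp only [Complex.real_smul]

theorem cext_rieszBase (ε : ℤˣ) {α : ℂ} (hα : (d : ℝ) ≤ α.re)
    (φ : 𝓓((⊤ : TopologicalSpace.Opens (Minkowski d)), ℂ)) :
    cext (rieszBase d ε α) φ = rieszConst d α * ∫ x, φ x * conePow ε ((α - d) / 2) x := by
  have h0 : 0 ≤ ((α - d) / 2).re := by simp; linarith
  rw [rieszBase, cext_smul, cext_eq_integral_of_forall (locallyIntegrable_conePow ε h0)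
    (distOfFun_apply (locallyIntegrable_conePow ε h0))]

theorem differentiableAt_rieszBase (ε : ℤˣ) {α : ℂ} (hα : (d : ℝ) < α.re)
    (φ : 𝓓((⊤ : TopologicalSpace.Opens (Minkowski d)), ℝ)) :
    DifferentiableAt ℂ (fun β => rieszBase d ε β φ) α := by
  have h1 : (fun β => rieszBase d ε β φ) =ᶠ[𝓝 α]
      fun β => rieszConst d β * ∫ x, (φ x : ℂ) * conePow ε ((β - d) / 2) x := by
    have : ∀ᶠ β : ℂ in 𝓝 α, (d : ℝ) < β.re := Complex.continuous_re.continuousAt.eventually_const_lt hα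
    filter_upwards [this] with β hβ using rieszBase_apply ε hβ.le φ
  refine DifferentiableAt.congr_of_eventuallyEq ?_ h1
  refine (differentiable_rieszConst α).mul ?_
  have h2 := differentiableAt_integral_conePow ε (ψ := fun x => (φ x : ℂ))
    (Complex.continuous_ofReal.comp φ.contDiff.continuous) φ.toComplex.hasCompactSupport
    (s₀ := (α - d) / 2) (by simpa using hα)
  exact h2.comp (f := fun β : ℂ => (β - d) / 2) α (by fun_prop)

theorem holomorphicNear_rieszBase (ε : ℤˣ) {α : ℂ} (hα : (d : ℝ) < α.re) :
    HolomorphicNear (rieszBase d ε) α := by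
  set r : ℝ := α.re - d with hr
  have hr0 : 0 < r := by linarith
  have hre : ∀ β ∈ Metric.ball α r, (d : ℝ) < β.re ∧ β.re ≤ α.re + r := fun β hβ => by
    rw [Metric.mem_ball, dist_eq_norm] at hβ
    have h1 := (Complex.abs_re_le_norm (β - α)).trans_lt hβ
    rw [Complex.sub_re, abs_lt] at h1
    constructor <;> linarith [h1.1, h1.2]
  refine ⟨r, hr0, fun φ β hβ => differentiableAt_rieszBase ε (hre β hβ).1 φ, fun K hK => ?_⟩
  obtain ⟨M, hM⟩ := ((isCompact_closedBall α r).image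
    (differentiable_rieszConst (d := d)).continuous).isBounded.exists_norm_le
  set m : ℕ := ⌈α.re + r⌉₊
  have hc : Continuous fun x : Minkowski d => (1 + ‖x‖ ^ 2) ^ m := by fun_prop
  have hK' : IntegrableOn (fun x : Minkowski d => (1 + ‖x‖ ^ 2) ^ m) K :=
    hc.continuousOn.integrableOn_compact K.isCompact
  have hI0 : 0 ≤ ∫ x in (K : Set (Minkowski d)), (1 + ‖x‖ ^ 2) ^ m :=
    integral_nonneg fun x => by positivity
  refine ⟨0, |M| * ∫ x in (K : Set (Minkowski d)), (1 + ‖x‖ ^ 2) ^ m, by positivity,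
    fun β hβ φ hφ B hB => ?_⟩
  obtain ⟨h1, h2⟩ := hre β hβ
  rw [rieszBase_apply ε h1.le, norm_mul, mul_assoc]
  have hMβ : ‖rieszConst d β‖ ≤ |M| :=
    (hM _ (mem_image_of_mem _ (Metric.ball_subset_closedBall hβ))).trans (le_abs_self M)
  refine mul_le_mul hMβ ?_ (norm_nonneg _) (abs_nonneg _)
  have hset : ∫ x, (φ x : ℂ) * conePow ε ((β - d) / 2) x =
      ∫ x in (K : Set (Minkowski d)), (φ x : ℂ) * conePow ε ((β - d) / 2) x := by
    refine (setIntegral_eq_integral_of_forall_compl_eq_zero fun x hx => ?_).symm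
    rw [image_eq_zero_of_notMem_tsupport fun h => hx (hφ h)]
    simp
  rw [hset, ← integral_mul_const]
  refine norm_integral_le_of_norm_le (hK'.mul_const B) (Eventually.of_forall fun x => ?_)
  have hb : ‖φ x‖ ≤ B := by simpa using hB 0 le_rfl x
  rw [norm_mul, Complex.norm_real, mul_comm]
  have hd0 : (0 : ℝ) ≤ d := Nat.cast_nonneg d
  have hm := Nat.le_ceil (α.re + r)
  exact mul_le_mul (norm_conePow_le (by simp; linarith) (by simp; linarith) x) hb
    (norm_nonneg _) (by positivity)

end RieszBase

/-! ### The Riesz distributions -/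

section RieszFamily

variable {d : ℕ} [NeZero d]

theorem lineDerivOp_testFunction_apply {E : Type*} [NormedAddCommGroup E] [NormedSpace ℝ E]
    {Ω : TopologicalSpace.Opens E} {F : Type*} [NormedAddCommGroup F] [NormedSpace ℝ F]
    (φ : 𝓓(Ω, F)) (v x : E) :
    (LineDeriv.lineDerivOp v φ : 𝓓(Ω, F)) x = fderiv ℝ φ x v := by
  rw [TestFunction.lineDerivOp_eq_lineDerivCLM ℝ, TestFunction.lineDerivCLM_eq_fderivCLM,
    TestFunction.fderivCLM_apply_of_le _ (by simp)]

theorem dalembertian_apply (u : 𝓓'((⊤ : TopologicalSpace.Opens (Minkowski d)), ℂ))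
    (φ : 𝓓((⊤ : TopologicalSpace.Opens (Minkowski d)), ℝ)) :
    dalembertian u φ = -∑ i, u (LineDeriv.lineDerivOp
      (timeReflection d (EuclideanSpace.basisFun (Fin d) ℝ i))
      (LineDeriv.lineDerivOp (EuclideanSpace.basisFun (Fin d) ℝ i) φ)) := by
  have h1 : dalembertian u φ = -(∑ i, LineDeriv.lineDerivOp (EuclideanSpace.basisFun (Fin d) ℝ i)
    (LineDeriv.lineDerivOp (timeReflection d (EuclideanSpace.basisFun (Fin d) ℝ i)) u)) φ := rfl
  rw [h1, sum_apply]
  simp [Distribution.lineDerivOp_apply_apply]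

theorem sum_inner_basisFun_mul (x y : Minkowski d) :
    ∑ i, ⟪x, EuclideanSpace.basisFun (Fin d) ℝ i⟫_ℝ * ⟪EuclideanSpace.basisFun (Fin d) ℝ i, y⟫_ℝ =
      ⟪x, y⟫_ℝ :=
  (EuclideanSpace.basisFun (Fin d) ℝ).sum_inner_mul_inner x y

/-- `□ γ^s = 4 s (s - 1 + d/2) γ^(s-1)` on the cone, in the weak sense. -/
theorem sum_integral_fderiv_fderiv_mul_conePow (ε : ℤˣ) {s : ℂ} (hs : 3 ≤ s.re)
    {ψ : Minkowski d → ℂ} (hψ : ContDiff ℝ ∞ ψ) (hc : HasCompactSupport ψ) :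
    ∑ i, ∫ x, fderiv ℝ (fun y => fderiv ℝ ψ y (EuclideanSpace.basisFun (Fin d) ℝ i)) x
        (timeReflection d (EuclideanSpace.basisFun (Fin d) ℝ i)) * conePow ε s x =
      -(2 * s * (2 * s - 2 + d)) * ∫ x, ψ x * conePow ε (s - 1) x := by
  set b := EuclideanSpace.basisFun (Fin d) ℝ with hb
  have h1 : 2 ≤ (s - 1).re := by simp; linarith
  have h2 : 0 ≤ (s - 1 - 1).re := by simp; linarith
  have hdψ (i : Fin d) : ContDiff ℝ ∞ fun y => fderiv ℝ ψ y (b i) :=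
    (hψ.fderiv_right (by simp)).clm_apply contDiff_const
  have hl (v : Minkowski d) : ContDiff ℝ ∞ fun x : Minkowski d => ((⟪x, v⟫_ℝ : ℝ) : ℂ) :=
    Complex.ofRealCLM.contDiff.comp (contDiff_id.inner ℝ contDiff_const)
  have hlJ : ∀ v : Minkowski d, Continuous fun x : Minkowski d =>
      ((⟪timeReflection d x, v⟫_ℝ : ℝ) : ℂ) := fun v =>
    Complex.continuous_ofReal.comp ((timeReflection d).continuous.inner continuous_const)
  -- Integration by parts along Jb_i and then along b_i. On summing over i, ∑⟨x,b_i⟩⟨b_i,Jx⟩ = -γ(x)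
  -- restores the power γ^(s-1), and the d copies of the second term produce the summand d.
  have key (i : Fin d) : ∫ x, fderiv ℝ (fun y => fderiv ℝ ψ y (b i)) x
      (timeReflection d (b i)) * conePow ε s x =
      2 * s * (2 * (s - 1) * ∫ x, ψ x * ((⟪x, b i⟫_ℝ : ℝ) : ℂ) *
        ((⟪timeReflection d x, b i⟫_ℝ : ℝ) : ℂ) * conePow ε (s - 1 - 1) x) -
      2 * s * ∫ x, ψ x * conePow ε (s - 1) x := by
    rw [integral_fderiv_mul_conePow ε (by linarith) (hdψ i) (hc.fderiv_apply (𝕜 := ℝ) _),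
      ← integral_fderiv_mul_conePow ε h1 (hψ.mul (hl (b i))) hc.mul_right, ← mul_sub,
      ← integral_sub]
    · congr 1
      refine integral_congr_ae (Eventually.of_forall fun x => ?_)
      have hd1 : HasFDerivAt ψ (fderiv ℝ ψ x) x := (hψ.differentiable (by simp) x).hasFDerivAt
      have hd2 : HasFDerivAt (fun x : Minkowski d => ((⟪x, b i⟫_ℝ : ℝ) : ℂ))
          (Complex.ofRealCLM.comp (innerSL ℝ (b i))) x := by
        have : (fun x : Minkowski d => ((⟪x, b i⟫_ℝ : ℝ) : ℂ)) =
          fun x => (Complex.ofRealCLM.comp (innerSL ℝ (b i))) x := by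
          funext y; simp [real_inner_comm]
        rw [this]
        exact ContinuousLinearMap.hasFDerivAt _
      have hd3 : fderiv ℝ (fun x => ψ x * ((⟪x, b i⟫_ℝ : ℝ) : ℂ)) x (b i) =
          ψ x + fderiv ℝ ψ x (b i) * ((⟪x, b i⟫_ℝ : ℝ) : ℂ) := by
        have hm := (hd1.mul hd2).fderiv
        rw [show (ψ * fun x : Minkowski d => ((⟪x, b i⟫_ℝ : ℝ) : ℂ)) =
          fun x => ψ x * ((⟪x, b i⟫_ℝ : ℝ) : ℂ) from rfl] at hm
        rw [hm]
        have hn : ‖b i‖ = 1 := b.norm_eq_one i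
        simp [hn]
        ring
      simp only [inner_timeReflection_left, timeReflection_timeReflection]
      rw [hd3]
      ring
    · exact integrable_mul_conePow ε (by linarith) ((((hψ.mul (hl (b i))).continuous_fderiv
        (by simp)).clm_apply continuous_const)) ((hc.mul_right).fderiv_apply (𝕜 := ℝ) _)
    · exact integrable_mul_conePow ε (by linarith) hψ.continuous hc
  simp only [key]
  rw [Finset.sum_sub_distrib, ← Finset.mul_sum, ← Finset.mul_sum, ← integral_finsetSum]
  · have e (x : Minkowski d) : ∑ i, ψ x * ((⟪x, b i⟫_ℝ : ℝ) : ℂ) *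
        ((⟪timeReflection d x, b i⟫_ℝ : ℝ) : ℂ) * conePow ε (s - 1 - 1) x =
        -(ψ x * conePow ε (s - 1) x) := by
      have h3 : ∑ i, ψ x * ((⟪x, b i⟫_ℝ : ℝ) : ℂ) *
        ((⟪timeReflection d x, b i⟫_ℝ : ℝ) : ℂ) * conePow ε (s - 1 - 1) x =
        ψ x * conePow ε (s - 1 - 1) x *
          ((∑ i, ⟪x, b i⟫_ℝ * ⟪b i, timeReflection d x⟫_ℝ : ℝ) : ℂ) := by
        rw [Complex.ofReal_sum, Finset.mul_sum]
        refine Finset.sum_congr rfl fun i _ => ?_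
        rw [real_inner_comm (timeReflection d x) (b i)]
        push_cast
        ring
      rw [h3, sum_inner_basisFun_mul, ← gammaForm_mul_conePow ε (s - 1) x, gammaForm_eq]
      push_cast
      ring
    simp only [e, integral_neg]
    simp
    ring
  · intro i _
    exact integrable_mul_conePow ε h2 ((hψ.continuous.mul (hl (b i)).continuous).mul (hlJ (b i)))
      (hc.mul_right.mul_right)

/-- The factor in □γ^s cancels against the recursion of c_α. The bound d + 4 makes the exponent of γ
in R(α+2) at least 3, as two integrations by parts require. -/
theorem dalembertian_rieszBase (ε : ℤˣ) {α : ℂ} (hα : (d : ℝ) + 4 ≤ α.re) :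
    dalembertian (rieszBase d ε (α + 2)) = rieszBase d ε α := by
  ext φ
  have hd2 : (d : ℝ) ≤ (α + 2).re := by simp; linarith
  rw [dalembertian_apply, rieszBase_apply ε (by linarith)]
  simp only [rieszBase_apply ε hd2, lineDerivOp_testFunction_apply]
  have hs : 3 ≤ ((α + 2 - d) / 2).re := by simp; linarith
  have h := sum_integral_fderiv_fderiv_mul_conePow ε hs (ψ := φ.toComplex)
    φ.toComplex.contDiff φ.toComplex.hasCompactSupport
  have hf (ψ : 𝓓((⊤ : TopologicalSpace.Opens (Minkowski d)), ℝ)) (x v : Minkowski d) :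
      fderiv ℝ (fun y => (ψ y : ℂ)) x v = ((fderiv ℝ ψ x v : ℝ) : ℂ) := by
    have := (Complex.ofRealCLM.hasFDerivAt.comp x
      (ψ.contDiff.differentiable (by simp) x).hasFDerivAt).fderiv
    rw [show (fun y => (ψ y : ℂ)) = Complex.ofRealCLM ∘ ψ from rfl, this]
    rfl
  have hg (i : Fin d) : (fun y => fderiv ℝ φ.toComplex y (EuclideanSpace.basisFun (Fin d) ℝ i)) =
      fun y => (((LineDeriv.lineDerivOp (EuclideanSpace.basisFun (Fin d) ℝ i) φ :
        𝓓((⊤ : TopologicalSpace.Opens (Minkowski d)), ℝ)) y : ℝ) : ℂ) := by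
    funext y
    rw [lineDerivOp_testFunction_apply, ← hf]
    rfl
  simp only [hg, hf] at h
  rw [← Finset.mul_sum, h, ← rieszConst_add_two α]
  have e : (α + 2 - d) / 2 - 1 = (α - d) / 2 := by ring
  simp only [e, toComplex_apply]
  ring

/-- The order of differentiation that is used to define the Riesz distribution `R(α)`. -/
def rieszOrder (d : ℕ) (α : ℂ) : ℕ := ⌈(d + 4 - α.re) / 2⌉₊

/-- The Riesz distributions `□^k R(α + 2k)` with `k` large. -/
def rieszExtension (d : ℕ) [NeZero d] (ε : ℤˣ) (α : ℂ) :
    𝓓'((⊤ : TopologicalSpace.Opens (Minkowski d)), ℂ) :=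
  dalembertian^[rieszOrder d α] (rieszBase d ε (α + 2 * rieszOrder d α))

/-- Independence of k, from □R(α+2) = R(α). It allows one fixed k in a neighbourhood of a given α,
although `rieszOrder` jumps. -/
theorem rieszExtension_eq (ε : ℤˣ) {α : ℂ} {k : ℕ} (hk : (d : ℝ) + 4 ≤ α.re + 2 * k) :
    rieszExtension d ε α = dalembertian^[k] (rieszBase d ε (α + 2 * k)) := by
  have h0 : (d : ℝ) + 4 ≤ α.re + 2 * rieszOrder d α := by
    have := Nat.le_ceil (((d : ℝ) + 4 - α.re) / 2)
    rw [← rieszOrder] at this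
    linarith
  have hle : rieszOrder d α ≤ k := Nat.ceil_le.2 (by linarith)
  clear hk
  induction k, hle using Nat.le_induction with
  | base => rfl
  | succ k hle ih =>
    have hk' : ((rieszOrder d α : ℕ) : ℝ) ≤ k := by exact_mod_cast hle
    have e : α + 2 * ((k + 1 : ℕ) : ℂ) = (α + 2 * k) + 2 := by push_cast; ring
    rw [Function.iterate_succ_apply, e, dalembertian_rieszBase, ih]
    simp
    linarith

theorem eventually_rieszExtension_eq (d : ℕ) [NeZero d] (α : ℂ) :
    ∃ k : ℕ, (d : ℝ) + 4 < (α + 2 * k).re ∧ ∀ᶠ β in 𝓝 α, ∀ ε : ℤˣ,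
      rieszExtension d ε β = dalembertian^[k] (rieszBase d ε (β + 2 * k)) := by
  obtain ⟨k, hk⟩ := exists_nat_gt (((d : ℝ) + 4 - α.re) / 2)
  have h1 : (d : ℝ) + 4 - 2 * k < α.re := by linarith
  refine ⟨k, by simp; linarith, ?_⟩
  filter_upwards [Complex.continuous_re.continuousAt.eventually_const_lt h1] with β hβ ε
  exact rieszExtension_eq ε (by linarith)

theorem isHolomorphicFamily_rieszExtension (ε : ℤˣ) :
    IsHolomorphicFamily (rieszExtension d ε) :=
  isHolomorphicFamily_of_near fun α => by
    obtain ⟨k, hk, he⟩ := eventually_rieszExtension_eq d α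
    refine HolomorphicNear.congr ?_ (he.mono fun β hβ => hβ ε)
    exact (HolomorphicNear.comp_add_const (T := rieszBase d ε) (holomorphicNear_rieszBase ε
      (by linarith))).iterate_dalembertian k

/-- Entire functions that agree on a right half plane are equal. -/
theorem eq_of_eq_on_halfPlane {f g : ℂ → ℂ} {a : ℝ} (hf : Differentiable ℂ f)
    (hg : Differentiable ℂ g) (h : ∀ z : ℂ, a < z.re → f z = g z) : f = g := by
  refine AnalyticOnNhd.eq_of_eventuallyEq (𝕜 := ℂ) (z₀ := ((a + 1 : ℝ) : ℂ))
    (fun z _ => hf.analyticAt z) (fun z _ => hg.analyticAt z) ?_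
  have : ∀ᶠ z : ℂ in 𝓝 ((a + 1 : ℝ) : ℂ), a < z.re :=
    Complex.continuous_re.continuousAt.eventually_const_lt (by simp)
  exact this.mono h

/-- Integrations by parts give the equality only far to the right; since both sides are holomorphic
on Re α > d, the identity theorem extends it. -/
theorem rieszExtension_apply_of_lt (ε : ℤˣ) {α : ℂ} (hα : (d : ℝ) < α.re)
    (φ : 𝓓((⊤ : TopologicalSpace.Opens (Minkowski d)), ℝ)) :
    rieszExtension d ε α φ = rieszBase d ε α φ := by
  have hU : IsOpen {z : ℂ | (d : ℝ) < z.re} := isOpen_lt continuous_const Complex.continuous_re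
  have hpre : IsPreconnected {z : ℂ | (d : ℝ) < z.re} :=
    (convex_halfSpace_re_gt (d : ℝ)).isPreconnected
  have h1 : AnalyticOnNhd ℂ (fun z => rieszExtension d ε z φ) {z : ℂ | (d : ℝ) < z.re} :=
    ((isHolomorphicFamily_rieszExtension ε).differentiable φ).differentiableOn.analyticOnNhd hU
  have h2 : AnalyticOnNhd ℂ (fun z => rieszBase d ε z φ) {z : ℂ | (d : ℝ) < z.re} :=
    DifferentiableOn.analyticOnNhd (fun z hz =>
      (differentiableAt_rieszBase ε hz φ).differentiableWithinAt) hU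
  have hz : ((d + 5 : ℝ) : ℂ) ∈ {z : ℂ | (d : ℝ) < z.re} := by
    simp only [mem_ofPred_eq, Complex.ofReal_re]; linarith
  refine h1.eqOn_of_preconnected_of_eventuallyEq h2 hpre hz ?_ hα
  have : ∀ᶠ z : ℂ in 𝓝 ((d + 5 : ℝ) : ℂ), (d : ℝ) + 4 < z.re :=
    Complex.continuous_re.continuousAt.eventually_const_lt (by simp only [Complex.ofReal_re]; linarith)
  filter_upwards [this] with z hz
  rw [rieszExtension_eq ε (k := 0) (by simp; linarith)]
  simp

theorem tendsto_integral_conePow (ε : ℤˣ) {ψ : Minkowski d → ℂ} (hψ : Continuous ψ)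
    (hc : HasCompactSupport ψ) {s : ℂ} (hs : 0 ≤ s.re) :
    Tendsto (fun t : ℝ => ∫ x, ψ x * conePow ε (s + t) x) (𝓝[>] 0)
      (𝓝 (∫ x, ψ x * conePow ε s x)) := by
  set m : ℕ := ⌈s.re + 1⌉₊
  refine tendsto_integral_filter_of_dominated_convergence
    (fun x => ‖ψ x‖ * (1 + ‖x‖ ^ 2) ^ m) ?_ ?_ ?_ ?_
  · exact Eventually.of_forall fun t =>
      (hψ.measurable.mul (measurable_conePow ε _)).aestronglyMeasurable
  · have h1 : ∀ᶠ t : ℝ in 𝓝[>] 0, t < 1 := nhdsWithin_le_nhds (gt_mem_nhds one_pos)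
    filter_upwards [h1, self_mem_nhdsWithin] with t ht ht0
    have ht0' : (0 : ℝ) < t := ht0
    refine Eventually.of_forall fun x => ?_
    rw [norm_mul]
    have := Nat.le_ceil (s.re + 1)
    exact mul_le_mul_of_nonneg_left (norm_conePow_le (by simp; linarith) (by simp; linarith) x)
      (norm_nonneg _)
  · exact Continuous.integrable_of_hasCompactSupport (by fun_prop) (hc.norm.mul_right)
  · refine Eventually.of_forall fun x => ?_
    by_cases hx : x ∈ openCone d ε
    · simp only [conePow_of_mem hx]
      have hne : (gammaForm x : ℂ) ≠ 0 := by exact_mod_cast hx.1.ne'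
      have hcont : Continuous fun t : ℝ => ψ x * (gammaForm x : ℂ) ^ (s + t) :=
        continuous_const.mul ((continuous_const.add Complex.continuous_ofReal).const_cpow
          (Or.inl hne))
      simpa using (hcont.tendsto 0).mono_left nhdsWithin_le_nhds
    · simp [conePow_of_notMem hx]

/-- On the line Re α = d the integral is reached from the right by dominated convergence, the
left-hand side by continuity. -/
theorem rieszExtension_apply (ε : ℤˣ) {α : ℂ} (hα : (d : ℝ) ≤ α.re)
    (φ : 𝓓((⊤ : TopologicalSpace.Opens (Minkowski d)), ℝ)) :
    rieszExtension d ε α φ = rieszBase d ε α φ := by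
  have hcont : Continuous fun t : ℝ => α + 2 * (t : ℂ) := by fun_prop
  have h1 : Tendsto (fun t : ℝ => rieszExtension d ε (α + 2 * (t : ℂ)) φ) (𝓝[>] 0)
      (𝓝 (rieszExtension d ε α φ)) := by
    have := ((((isHolomorphicFamily_rieszExtension (d := d) ε).differentiable φ).continuous.comp
      hcont).tendsto 0).mono_left (nhdsWithin_le_nhds (s := Ioi 0))
    simpa [Function.comp_def] using this
  have h2 : Tendsto (fun t : ℝ => rieszExtension d ε (α + 2 * (t : ℂ)) φ) (𝓝[>] 0)
      (𝓝 (rieszBase d ε α φ)) := by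
    rw [rieszBase_apply ε hα]
    have h3 := tendsto_integral_conePow ε (ψ := fun x => (φ x : ℂ)) (s := (α - d) / 2)
      (Complex.continuous_ofReal.comp φ.contDiff.continuous) φ.toComplex.hasCompactSupport
      (by simp; linarith)
    have h4 : Tendsto (fun t : ℝ => rieszConst d (α + 2 * (t : ℂ))) (𝓝[>] 0)
        (𝓝 (rieszConst d α)) := by
      have := (((differentiable_rieszConst (d := d)).continuous.comp hcont).tendsto 0).mono_left
        (nhdsWithin_le_nhds (s := Ioi 0))
      simpa [Function.comp_def] using this
    refine (h4.mul h3).congr' ?_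
    filter_upwards [self_mem_nhdsWithin] with t ht
    have ht' : (0 : ℝ) < t := ht
    have hlt : (d : ℝ) < (α + 2 * (t : ℂ)).re := by simp; linarith
    rw [rieszExtension_apply_of_lt ε hlt, rieszBase_apply ε hlt.le]
    have e : (α + 2 * (t : ℂ) - d) / 2 = (α - d) / 2 + t := by ring
    rw [e]
  exact tendsto_nhds_unique h1 h2

theorem isRieszFamily_rieszExtension (d : ℕ) [NeZero d] (ε : ℤˣ) :
    IsRieszFamily d ε (rieszExtension d ε) := by
  refine ⟨(isHolomorphicFamily_rieszExtension ε).differentiable_distribution, fun α hα φ => ?_⟩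
  rw [rieszExtension_apply ε hα, rieszBase_apply ε hα, ← integral_const_mul]
  refine integral_congr_ae ?_
  filter_upwards [rieszFun_ae_eq ε α] with x hx
  rw [hx, Complex.real_smul]
  ring

/-- Evaluation at a test function. -/
def Distribution.evalCLM {E : Type*} [NormedAddCommGroup E] [NormedSpace ℝ E]
    {Ω : TopologicalSpace.Opens E} (φ : 𝓓(Ω, ℝ)) : 𝓓'(Ω, ℂ) →L[ℂ] ℂ where
  toFun u := u φ
  map_add' _ _ := rfl
  map_smul' _ _ := rfl
  cont := continuous_eval_const φ

theorem IsRieszFamily.differentiable_apply {ε : ℤˣ}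
    {R : ℂ → 𝓓'((⊤ : TopologicalSpace.Opens (Minkowski d)), ℂ)} (hR : IsRieszFamily d ε R)
    (φ : 𝓓((⊤ : TopologicalSpace.Opens (Minkowski d)), ℝ)) : Differentiable ℂ fun α => R α φ := by
  intro α
  obtain ⟨f', hf'⟩ := hR.1 α
  refine ⟨(Distribution.evalCLM φ).comp f', ?_⟩
  rw [hasFDerivAt_iff_isLittleOTVS]
  refine ((Distribution.evalCLM φ).isBigOTVS_comp.trans_isLittleOTVS hf'.isLittleOTVS).congr_left
    fun β => ?_
  simp only [Function.comp_apply, map_sub]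
  rfl

theorem existsUnique_isRieszFamily (d : ℕ) [NeZero d] (ε : ℤˣ) :
    ∃! R : ℂ → 𝓓'((⊤ : TopologicalSpace.Opens (Minkowski d)), ℂ), IsRieszFamily d ε R := by
  refine ⟨rieszExtension d ε, isRieszFamily_rieszExtension d ε, fun R hR => ?_⟩
  funext α
  ext φ
  refine congrFun (eq_of_eq_on_halfPlane (a := d) (hR.differentiable_apply φ)
    ((isRieszFamily_rieszExtension d ε).differentiable_apply φ) fun z hz => ?_) α
  rw [hR.2 z hz.le, (isRieszFamily_rieszExtension d ε).2 z hz.le]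

/-- Uniqueness identifies the family picked by the choice operator with the explicit one. -/
theorem riesz_eq_rieszExtension (d : ℕ) [NeZero d] (ε : ℤˣ) : riesz d ε = rieszExtension d ε :=
  (existsUnique_isRieszFamily d ε).unique
    (Classical.epsilon_spec ⟨_, isRieszFamily_rieszExtension d ε⟩)
    (isRieszFamily_rieszExtension d ε)

theorem isHolomorphicFamily_rieszDiff (d : ℕ) [NeZero d] : IsHolomorphicFamily (rieszDiff d) := by
  have e : rieszDiff d = fun α => rieszExtension d 1 α + -rieszExtension d (-1) α := by
    funext α
    rw [rieszDiff, riesz_eq_rieszExtension, riesz_eq_rieszExtension, sub_eq_add_neg]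
  rw [e]
  refine isHolomorphicFamily_of_near fun α => ?_
  have h (ε : ℤˣ) : HolomorphicNear (rieszExtension d ε) α := by
    obtain ⟨k, hk, he⟩ := eventually_rieszExtension_eq d α
    refine HolomorphicNear.congr ?_ (he.mono fun β hβ => hβ ε)
    exact (HolomorphicNear.comp_add_const (T := rieszBase d ε) (holomorphicNear_rieszBase ε
      (by linarith))).iterate_dalembertian k
  exact (h 1).add (h (-1)).neg

end RieszFamily

/-! ### Microlocal smoothness under differential operators -/

section MicroOperators

variable {E : Type*} [NormedAddCommGroup E] [InnerProductSpace ℝ E] {ι : Type*}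
  {T T' : ι → 𝓓'((⊤ : TopologicalSpace.Opens E), ℂ)} {x ξ : E}

theorem RapidOn.add_family {χ : 𝓓((⊤ : TopologicalSpace.Opens E), ℝ)} {W : Set E}
    (h : RapidOn T χ W) (h' : RapidOn T' χ W) : RapidOn (fun a => T a + T' a) χ W := by
  intro N
  obtain ⟨C, hC0, hC⟩ := h N
  obtain ⟨C', hC0', hC'⟩ := h' N
  refine ⟨C + C', add_nonneg hC0 hC0', fun a η hη => ?_⟩
  rw [localFourier_add]
  calc _ ≤ (1 + ‖η‖) ^ N * (‖localFourier (T a) χ η‖ + ‖localFourier (T' a) χ η‖) := by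
        gcongr; exact norm_add_le _ _
    _ ≤ C + C' := by rw [mul_add]; exact add_le_add (hC a η hη) (hC' a η hη)

theorem MicroAt.add_family (h : MicroAt T x ξ) (h' : MicroAt T' x ξ) :
    MicroAt (fun a => T a + T' a) x ξ := by
  obtain ⟨U, hU, V, hV, hVc, h⟩ := h
  obtain ⟨U', hU', V', hV', hVc', h'⟩ := h'
  exact ⟨U ∩ U', inter_mem hU hU', V ∩ V', inter_mem hV hV',
    fun η hη t ht => ⟨hVc η hη.1 t ht, hVc' η hη.2 t ht⟩, fun χ hχ =>
      ((h χ (hχ.trans inter_subset_left)).mono inter_subset_left).add_family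
        ((h' χ (hχ.trans inter_subset_right)).mono inter_subset_right)⟩

theorem MicroAt.zero_family : MicroAt (fun _ : ι => (0 : 𝓓'((⊤ : TopologicalSpace.Opens E), ℂ))) x ξ :=
  ⟨univ, univ_mem, univ, univ_mem, fun _ _ _ _ => mem_univ _, fun χ _ N => ⟨0, le_rfl, fun a η _ => by
    have h := localFourier_smul 0 (0 : 𝓓'((⊤ : TopologicalSpace.Opens E), ℂ)) χ η
    rw [zero_mul, smul_zero] at h
    simp [h]⟩⟩

theorem MicroAt.neg_family (h : MicroAt T x ξ) : MicroAt (fun a => -T a) x ξ := by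
  obtain ⟨U, hU, V, hV, hVc, h⟩ := h
  refine ⟨U, hU, V, hV, hVc, fun χ hχ N => ?_⟩
  obtain ⟨C, hC0, hC⟩ := h χ hχ N
  refine ⟨C, hC0, fun a η hη => ?_⟩
  have e : localFourier (-T a) χ η = -localFourier (T a) χ η := by
    rw [← neg_one_smul ℂ (T a), localFourier_smul, neg_one_mul]
  rw [e, norm_neg]
  exact hC a η hη

theorem MicroAt.sum_family {κ : Type*} (s : Finset κ)
    {T : κ → ι → 𝓓'((⊤ : TopologicalSpace.Opens E), ℂ)} (h : ∀ i ∈ s, MicroAt (T i) x ξ) :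
    MicroAt (fun a => ∑ i ∈ s, T i a) x ξ := by
  classical
  induction s using Finset.induction_on with
  | empty => simpa using MicroAt.zero_family
  | insert i s hi ih =>
    simp only [Finset.sum_insert hi]
    exact (h i (Finset.mem_insert_self _ _)).add_family
      (ih fun j hj => h j (Finset.mem_insert_of_mem hj))

theorem MicroAt.comp_index {κ : Type*} (h : MicroAt T x ξ) (g : κ → ι) :
    MicroAt (fun b => T (g b)) x ξ := by
  obtain ⟨U, hU, V, hV, hVc, h⟩ := h
  refine ⟨U, hU, V, hV, hVc, fun χ hχ N => ?_⟩
  obtain ⟨C, hC0, hC⟩ := h χ hχ N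
  exact ⟨C, hC0, fun b => hC (g b)⟩

/-- The Leibniz rule for a modulated cut-off. The derivative of the plane wave costs one power of
the frequency, which rapid decay absorbs; so derivatives do not enlarge the wavefront set. -/
theorem localFourier_lineDeriv (u : 𝓓'((⊤ : TopologicalSpace.Opens E), ℂ)) (v : E)
    (χ : 𝓓((⊤ : TopologicalSpace.Opens E), ℝ)) (η : E) :
    localFourier (LineDeriv.lineDerivOp v u) χ η =
      -localFourier u (LineDeriv.lineDerivOp v χ) η +
        Complex.I * ((⟪v, η⟫_ℝ : ℝ) : ℂ) * localFourier u χ η := by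
  have hi (y : E) : HasFDerivAt (fun x : E => ⟪x, η⟫_ℝ) (innerSL ℝ η) y := by
    have : (fun x : E => ⟪x, η⟫_ℝ) = innerSL ℝ η := by
      funext z; rw [innerSL_apply_apply, real_inner_comm]
    rw [this]
    exact ContinuousLinearMap.hasFDerivAt _
  have hχ (y : E) : HasFDerivAt χ (fderiv ℝ χ y) y :=
    (χ.contDiff.differentiable (by simp) y).hasFDerivAt
  have h1 : LineDeriv.lineDerivOp v
      (mulSmooth χ (fun x => Real.cos ⟪x, η⟫_ℝ) (contDiff_cos_inner η)) =
      mulSmooth (LineDeriv.lineDerivOp v χ) (fun x => Real.cos ⟪x, η⟫_ℝ) (contDiff_cos_inner η) -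
      ⟪v, η⟫_ℝ • mulSmooth χ (fun x => Real.sin ⟪x, η⟫_ℝ) (contDiff_sin_inner η) := by
    ext y
    have h := ((hχ y).mul (hi y).cos).fderiv
    rw [lineDerivOp_testFunction_apply]
    change fderiv ℝ (⇑χ * fun x => Real.cos ⟪x, η⟫_ℝ) y v =
      (LineDeriv.lineDerivOp v χ : 𝓓((⊤ : TopologicalSpace.Opens E), ℝ)) y * Real.cos ⟪y, η⟫_ℝ -
      ⟪v, η⟫_ℝ * (χ y * Real.sin ⟪y, η⟫_ℝ)
    rw [h, lineDerivOp_testFunction_apply]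
    simp only [add_apply, smul_apply, innerSL_apply_apply,
      smul_eq_mul, real_inner_comm v η]
    ring
  have h2 : LineDeriv.lineDerivOp v
      (mulSmooth χ (fun x => Real.sin ⟪x, η⟫_ℝ) (contDiff_sin_inner η)) =
      mulSmooth (LineDeriv.lineDerivOp v χ) (fun x => Real.sin ⟪x, η⟫_ℝ) (contDiff_sin_inner η) +
      ⟪v, η⟫_ℝ • mulSmooth χ (fun x => Real.cos ⟪x, η⟫_ℝ) (contDiff_cos_inner η) := by
    ext y
    have h := ((hχ y).mul (hi y).sin).fderiv
    rw [lineDerivOp_testFunction_apply]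
    change fderiv ℝ (⇑χ * fun x => Real.sin ⟪x, η⟫_ℝ) y v =
      (LineDeriv.lineDerivOp v χ : 𝓓((⊤ : TopologicalSpace.Opens E), ℝ)) y * Real.sin ⟪y, η⟫_ℝ +
      ⟪v, η⟫_ℝ * (χ y * Real.cos ⟪y, η⟫_ℝ)
    rw [h, lineDerivOp_testFunction_apply]
    simp only [add_apply, smul_apply, innerSL_apply_apply,
      smul_eq_mul, real_inner_comm v η]
    ring
  simp only [localFourier, Distribution.lineDerivOp_apply_apply, h1, h2, map_neg, map_sub, map_add,
    map_smul, Complex.real_smul]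
  linear_combination ((⟪v, η⟫_ℝ : ℂ) *
    u (mulSmooth χ (fun x => Real.sin ⟪x, η⟫_ℝ) (contDiff_sin_inner η))) * Complex.I_sq

theorem MicroAt.lineDeriv (h : MicroAt T x ξ) (v : E) :
    MicroAt (fun a => LineDeriv.lineDerivOp v (T a)) x ξ := by
  obtain ⟨U, hU, V, hV, hVc, h⟩ := h
  refine ⟨U, hU, V, hV, hVc, fun χ hχ N => ?_⟩
  have hχ' : tsupport (LineDeriv.lineDerivOp v χ : 𝓓((⊤ : TopologicalSpace.Opens E), ℝ)) ⊆ U := by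
    have e : ⇑(LineDeriv.lineDerivOp v χ : 𝓓((⊤ : TopologicalSpace.Opens E), ℝ)) =
      fun x => fderiv ℝ χ x v := funext fun x => lineDerivOp_testFunction_apply χ v x
    rw [e]
    exact (tsupport_fderiv_apply_subset ℝ v).trans hχ
  obtain ⟨C, hC0, hC⟩ := h χ hχ (N + 1)
  obtain ⟨C', hC0', hC'⟩ := h _ hχ' N
  refine ⟨C' + ‖v‖ * C, by positivity, fun a η hη => ?_⟩
  rw [localFourier_lineDeriv]
  have h1 : ‖Complex.I * ((⟪v, η⟫_ℝ : ℝ) : ℂ) * localFourier (T a) χ η‖ ≤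
      ‖v‖ * ((1 + ‖η‖) * ‖localFourier (T a) χ η‖) := by
    rw [norm_mul, norm_mul, Complex.norm_I, one_mul, Complex.norm_real, ← mul_assoc]
    gcongr
    refine (norm_inner_le_norm v η).trans ?_
    gcongr
    linarith
  calc _ ≤ (1 + ‖η‖) ^ N * (‖localFourier (T a) (LineDeriv.lineDerivOp v χ) η‖ +
        ‖v‖ * ((1 + ‖η‖) * ‖localFourier (T a) χ η‖)) := by
        gcongr
        refine (norm_add_le _ _).trans ?_
        rw [norm_neg]
        gcongr
    _ = (1 + ‖η‖) ^ N * ‖localFourier (T a) (LineDeriv.lineDerivOp v χ) η‖ +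
        ‖v‖ * ((1 + ‖η‖) ^ (N + 1) * ‖localFourier (T a) χ η‖) := by ring
    _ ≤ C' + ‖v‖ * C := by
        have := hC a η hη
        have := hC' a η hη
        gcongr

end MicroOperators

/-! ### Rapid decay on conic neighbourhoods -/

section RayNeighbourhood

variable {E : Type*} [NormedAddCommGroup E] [InnerProductSpace ℝ E] {ι : Type*}

/-- The cone generated by a closed ball. -/
def rayNhd (ξ : E) (ρ : ℝ) : Set E :=
  {η | ∃ w ∈ Metric.closedBall ξ ρ, ∃ l : ℝ, 0 < l ∧ η = l • w}

theorem isConic_rayNhd (ξ : E) (ρ : ℝ) : IsConic (rayNhd ξ ρ) := by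
  rintro η ⟨w, hw, l, hl, rfl⟩ t ht
  exact ⟨w, hw, t * l, mul_pos ht hl, smul_smul _ _ _⟩

theorem rayNhd_mem_nhds (ξ : E) {ρ : ℝ} (hρ : 0 < ρ) : rayNhd ξ ρ ∈ 𝓝 ξ :=
  mem_of_superset (Metric.closedBall_mem_nhds ξ hρ) fun w hw =>
    ⟨w, hw, 1, one_pos, (one_smul _ _).symm⟩

/-- On the cone over a bounded ball 1 + |lw| is at most a constant times 1 + l, so weights in the
scaling parameter dominate weights in the frequency. -/
theorem rapidOn_rayNhd {T : ι → 𝓓'((⊤ : TopologicalSpace.Opens E), ℂ)}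
    {χ : 𝓓((⊤ : TopologicalSpace.Opens E), ℝ)} {ξ : E} {ρ : ℝ}
    (h : ∀ N : ℕ, ∃ C : ℝ, 0 ≤ C ∧ ∀ a, ∀ w ∈ Metric.closedBall ξ ρ, ∀ l : ℝ, 0 < l →
      l ^ N * ‖localFourier (T a) χ (l • w)‖ ≤ C) : RapidOn T χ (rayNhd ξ ρ) := by
  intro N
  obtain ⟨C, hC0, hC⟩ := h N
  obtain ⟨C', hC0', hC'⟩ := h 0
  set R : ℝ := ‖ξ‖ + |ρ|
  have hR0 : 0 ≤ R := by positivity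
  refine ⟨2 ^ N * ((1 + R) ^ N * (C + C')), by positivity, ?_⟩
  rintro a η ⟨w, hw, l, hl, rfl⟩
  have hwR : ‖w‖ ≤ R := by
    rw [Metric.mem_closedBall, dist_eq_norm] at hw
    have := norm_le_norm_add_norm_sub' w ξ
    linarith [le_abs_self ρ]
  have h1 : 1 + ‖l • w‖ ≤ (1 + R) * (1 + l) := by
    rw [norm_smul, Real.norm_of_nonneg hl.le]
    nlinarith [mul_le_mul_of_nonneg_left hwR hl.le]
  have h2 : (1 + l) ^ N ≤ 2 ^ N * (1 + l ^ N) := by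
    rcases le_total l 1 with hl1 | hl1
    · calc (1 + l) ^ N ≤ 2 ^ N := pow_le_pow_left₀ (by positivity) (by linarith) N
        _ ≤ _ := le_mul_of_one_le_right (by positivity) (by linarith [pow_nonneg hl.le N])
    · calc (1 + l) ^ N ≤ (2 * l) ^ N := pow_le_pow_left₀ (by positivity) (by linarith) N
        _ = 2 ^ N * l ^ N := mul_pow _ _ _
        _ ≤ _ := by gcongr; linarith
  have h3 := hC a w hw l hl
  have h4 := hC' a w hw l hl
  rw [pow_zero, one_mul] at h4
  calc _ ≤ ((1 + R) * (1 + l)) ^ N * ‖localFourier (T a) χ (l • w)‖ := by gcongr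
    _ = (1 + R) ^ N * ((1 + l) ^ N * ‖localFourier (T a) χ (l • w)‖) := by rw [mul_pow]; ring
    _ ≤ (1 + R) ^ N * (2 ^ N * (1 + l ^ N) * ‖localFourier (T a) χ (l • w)‖) := by gcongr
    _ = 2 ^ N * ((1 + R) ^ N * (l ^ N * ‖localFourier (T a) χ (l • w)‖ +
          ‖localFourier (T a) χ (l • w)‖)) := by ring
    _ ≤ _ := by gcongr

variable [FiniteDimensional ℝ E] [MeasurableSpace E] [BorelSpace E]

/-- Rapid decay passes from a cut-off `θ` to the test functions supported where `θ = 1`. -/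
theorem RapidOn.of_mul_eq {T : ι → 𝓓'((⊤ : TopologicalSpace.Opens E), ℂ)}
    {θ χ : 𝓓((⊤ : TopologicalSpace.Opens E), ℝ)} (h : ∀ x, θ x * χ x = χ x) {ξ : E} {ρ : ℝ}
    (hρ : 0 < ρ) (hR : RapidOn T θ (rayNhd ξ ρ)) {B : ℝ} {M : ℕ} (hB0 : 0 ≤ B)
    (hB : ∀ a ζ, ‖localFourier (T a) θ ζ‖ ≤ B * (1 + ‖ζ‖) ^ M) :
    RapidOn T χ (rayNhd ξ (ρ / 2)) := by
  intro N
  set R : ℝ := ‖ξ‖ + ρ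
  have hRpos : 0 < R := by positivity
  -- The aperture: a frequency within ρ/(2R) times |lw| of lw, divided by l, lies within ρ/2 of w
  -- because |w| ≤ R. With w in the ball of radius ρ/2 it stays in that of radius ρ.
  have hc : 0 < ρ / (2 * R) := by positivity
  obtain ⟨D, hD0, hD⟩ := exists_conv_bound (rapidDecay_invF χ.toComplex) M N hc
  obtain ⟨A, hA0, hA⟩ := hR N
  set A' : ℝ := A + B * (2 * Real.pi) ^ M
  have hA'0 : 0 ≤ A' := by positivity
  have hpi : 0 < 2 * Real.pi := by positivity
  refine ⟨(2 * Real.pi) ^ N * (D * A'), by positivity, ?_⟩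
  rintro a η ⟨w, hw, l, hl, rfl⟩
  have hwR : ‖w‖ ≤ R := by
    rw [Metric.mem_closedBall, dist_eq_norm] at hw
    have := norm_le_norm_add_norm_sub' w ξ
    simp only [R]
    linarith
  have key := hD (fun ζ => localFourier (T a) θ ((2 * Real.pi) • ζ)) A'
    {ζ | (2 * Real.pi) • ζ ∈ rayNhd ξ ρ} hA'0
    (fun ζ => by
      calc _ ≤ B * (1 + ‖(2 * Real.pi) • ζ‖) ^ M := hB a _
        _ ≤ B * (2 * Real.pi * (1 + ‖ζ‖)) ^ M := by
            gcongr
            exact one_add_norm_two_pi_smul_le ζ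
        _ = B * (2 * Real.pi) ^ M * (1 + ‖ζ‖) ^ M := by rw [mul_pow]; ring
        _ ≤ A' * (1 + ‖ζ‖) ^ M := by gcongr; simp only [A']; linarith)
    (fun ζ hζ => by
      calc _ ≤ (1 + ‖(2 * Real.pi) • ζ‖) ^ N * ‖localFourier (T a) θ ((2 * Real.pi) • ζ)‖ := by
            gcongr
            linarith [one_add_norm_le_one_add_norm_two_pi_smul ζ]
        _ ≤ A := hA a _ hζ
        _ ≤ A' := by simp only [A']; linarith [mul_nonneg hB0 (pow_nonneg hpi.le M)])
    ((2 * Real.pi)⁻¹ • l • w)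
    (fun ζ hζ => by
      refine ⟨(l⁻¹ * (2 * Real.pi)) • ζ, ?_, l, hl, ?_⟩
      · have e : (l⁻¹ * (2 * Real.pi)) • ζ - w =
            (l⁻¹ * (2 * Real.pi)) • (ζ - (2 * Real.pi)⁻¹ • l • w) := by
          rw [smul_sub, smul_smul, smul_smul]
          congr 1
          rw [show l⁻¹ * (2 * Real.pi) * (2 * Real.pi)⁻¹ * l = 1 by field_simp, one_smul]
        rw [Metric.mem_closedBall, dist_eq_norm] at hw ⊢
        have h1 : ‖(l⁻¹ * (2 * Real.pi)) • ζ - w‖ ≤ ρ / 2 := by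
          rw [e, norm_smul, Real.norm_of_nonneg (by positivity)]
          rw [norm_smul, norm_smul, Real.norm_of_nonneg (by positivity : 0 ≤ (2 * Real.pi)⁻¹),
            Real.norm_of_nonneg hl.le] at hζ
          calc _ ≤ l⁻¹ * (2 * Real.pi) * (ρ / (2 * R) * ((2 * Real.pi)⁻¹ * (l * ‖w‖))) := by
                gcongr
            _ = ρ / (2 * R) * ‖w‖ := by field_simp
            _ ≤ ρ / (2 * R) * R := by gcongr
            _ = ρ / 2 := by field_simp
        calc _ ≤ ‖(l⁻¹ * (2 * Real.pi)) • ζ - w‖ + ‖w - ξ‖ := norm_sub_le_norm_sub_add_norm_sub _ _ _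
          _ ≤ ρ := by linarith
      · rw [smul_smul, ← mul_assoc, mul_inv_cancel₀ hl.ne', one_mul])
  have e : localFourier (T a) χ (l • w) = ∫ ζ, invF χ.toComplex (ζ - (2 * Real.pi)⁻¹ • l • w) *
      localFourier (T a) θ ((2 * Real.pi) • ζ) := by
    rw [localFourier_eq_cext, cext_modulate_eq_integral (T a) θ.toComplex χ.toComplex fun x => by
      rw [toComplex_apply, toComplex_apply, ← Complex.ofReal_mul, h x]]
    simp only [localFourier_eq_cext]
  rw [e]
  calc _ ≤ (2 * Real.pi * (1 + ‖(2 * Real.pi)⁻¹ • l • w‖)) ^ N * _ := by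
        gcongr
        exact one_add_norm_le_two_pi _
    _ = (2 * Real.pi) ^ N * ((1 + ‖(2 * Real.pi)⁻¹ • l • w‖) ^ N * _) := by rw [mul_pow, mul_assoc]
    _ ≤ _ := by gcongr

end RayNeighbourhood

/-! ### Non-stationary phase against a family of singular functions -/

section NonstationaryFamily

variable {E : Type*} [NormedAddCommGroup E] [InnerProductSpace ℝ E] [FiniteDimensional ℝ E]
  [MeasurableSpace E] [BorelSpace E] {P : Type*} [NormedAddCommGroup P] [NormedSpace ℝ P]

/-- The hypothesis `hid` is a first-order equation for `f` along `Y` in weak form. Test it with g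
exp(-il⟨x,w⟩), g = b/⟨Y,w⟩: the derivative of the phase returns -il times the original integral, and
the rest is the same kind of integral with amplitude Yg + κg. Each round gains a factor 1/l and
never differentiates `f`, so `f` may be singular. The amplitude changes in each round, hence the
induction for all `b` at once. -/
theorem exists_nonstationary_bound_family {K : Set E} (hK : IsCompact K) {Q : Set P}
    (hQ : IsCompact Q) {Y : E × P → E} (hY : ContDiff ℝ ∞ Y) {κ : E × P → ℂ} (hκ : ContDiff ℝ ∞ κ)
    {w : P → E} (hw : ContDiff ℝ ∞ w) {f : P → E → ℂ} (hf : ∀ p ∈ Q, LocallyIntegrable (f p))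
    {M : ℝ} (hM : ∀ p ∈ Q, ∀ x ∈ K, ‖f p x‖ ≤ M)
    (hid : ∀ p ∈ Q, ∀ ψ : E → ℂ, ContDiff ℝ ∞ ψ → HasCompactSupport ψ →
      ∫ x, (fderiv ℝ ψ x (Y (x, p)) + κ (x, p) * ψ x) * f p x = 0)
    {δ : ℝ} (hδ : 0 < δ) (ha : ∀ p ∈ Q, ∀ x ∈ K, δ ≤ ⟪Y (x, p), w p⟫_ℝ) (N : ℕ) :
    ∀ b : E × P → ℂ, ContDiff ℝ ∞ b → (∀ p ∈ Q, ∀ x ∉ K, b (x, p) = 0) →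
    ∃ C : ℝ, 0 ≤ C ∧ ∀ p ∈ Q, ∀ l : ℝ, 0 ≤ l →
      l ^ N * ‖∫ x, b (x, p) * planeWave (l • w p) x * f p x‖ ≤ C := by
  obtain ⟨H, hH, hHinv⟩ := exists_smooth_inv hδ
  induction N with
  | zero =>
    intro b hb hbK
    obtain ⟨B, hB⟩ := ((hK.prod hQ).image hb.continuous).isBounded.exists_norm_le
    refine ⟨|B| * |M| * volume.real K, by positivity, fun p hp l _ => ?_⟩
    rw [pow_zero, one_mul]
    have hset : ∫ x, b (x, p) * planeWave (l • w p) x * f p x =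
        ∫ x in K, b (x, p) * planeWave (l • w p) x * f p x := by
      refine (setIntegral_eq_integral_of_forall_compl_eq_zero fun x hx => ?_).symm
      rw [hbK p hp x hx]
      simp
    rw [hset]
    refine norm_setIntegral_le_of_norm_le_const hK.measure_lt_top fun x hx => ?_
    rw [norm_mul, norm_mul, norm_planeWave, mul_one]
    exact mul_le_mul ((hB _ (mem_image_of_mem b ⟨hx, hp⟩)).trans (le_abs_self B))
      ((hM p hp x hx).trans (le_abs_self M)) (norm_nonneg _) (abs_nonneg _)
  | succ N ih =>
    intro b hb hbK
    have hpair : ContDiff ℝ ∞ fun q : E × P => ⟪Y q, w q.2⟫_ℝ := hY.inner ℝ (hw.comp contDiff_snd)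
    set g : E × P → ℂ := fun q => b q * ((H ⟪Y q, w q.2⟫_ℝ : ℝ) : ℂ) with hg
    have hgs : ContDiff ℝ ∞ g := hb.mul (Complex.ofRealCLM.contDiff.comp (hH.comp hpair))
    have hgK : ∀ p ∈ Q, ∀ x ∉ K, g (x, p) = 0 := fun p hp x hx => by simp [hg, hbK p hp x hx]
    set L : E × P → ℂ := fun q => fderiv ℝ g q (Y q, 0) + κ q * g q with hL
    have hLs : ContDiff ℝ ∞ L :=
      ((hgs.fderiv_right (by simp)).clm_apply (hY.prodMk contDiff_const)).add (hκ.mul hgs)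
    have hpart (p : P) (x : E) : HasFDerivAt (fun y => g (y, p))
        ((fderiv ℝ g (x, p)).comp (ContinuousLinearMap.inl ℝ E P)) x :=
      (hgs.differentiable (by simp) (x, p)).hasFDerivAt.comp (f := fun y : E => (y, p)) x
        (hasFDerivAt_prodMk_left x p)
    have hLK : ∀ p ∈ Q, ∀ x ∉ K, L (x, p) = 0 := fun p hp x hx => by
      have h0 : (fun y => g (y, p)) =ᶠ[𝓝 x] fun _ => 0 := by
        filter_upwards [hK.isClosed.isOpen_compl.mem_nhds hx] with y hy using hgK p hp y hy
      have h1 := (hpart p x).unique ((hasFDerivAt_const (0 : ℂ) x).congr_of_eventuallyEq h0)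
      have h2 := congrArg (fun A : E →L[ℝ] ℂ => A (Y (x, p))) h1
      simp only [ContinuousLinearMap.comp_apply, ContinuousLinearMap.inl_apply,
        zero_apply] at h2
      simp only [hL, h2, hgK p hp x hx, mul_zero, add_zero]
    obtain ⟨C, hC0, hC⟩ := ih L hLs hLK
    refine ⟨C, hC0, fun p hp l hl => ?_⟩
    have hcs {h : E × P → ℂ} (hh : ∀ x ∉ K, h (x, p) = 0) :
        HasCompactSupport fun x => h (x, p) * planeWave (l • w p) x :=
      (HasCompactSupport.intro hK hh).mul_right
    have hx : ContDiff ℝ ∞ fun x : E => (x, p) := contDiff_id.prodMk contDiff_const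
    have hI {h : E × P → ℂ} (hc : ContDiff ℝ ∞ h) (hh : ∀ x ∉ K, h (x, p) = 0) :
        Integrable fun x => h (x, p) * planeWave (l • w p) x * f p x :=
      (hf p hp).integrable_smul_left_of_hasCompactSupport
        ((hc.comp hx).mul (contDiff_planeWave _)).continuous (hcs hh)
    have h1 := hid p hp (fun x => g (x, p) * planeWave (l • w p) x)
      ((hgs.comp hx).mul (contDiff_planeWave _)) (hcs (hgK p hp))
    have h2 (x : E) : (fderiv ℝ (fun x => g (x, p) * planeWave (l • w p) x) x (Y (x, p)) +
        κ (x, p) * (g (x, p) * planeWave (l • w p) x)) * f p x =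
        L (x, p) * planeWave (l • w p) x * f p x -
          (Complex.I * l) * (b (x, p) * planeWave (l • w p) x * f p x) := by
      have hpw : HasFDerivAt (planeWave (l • w p))
          (planeWave (l • w p) x • -(Complex.I • (Complex.ofRealCLM.comp (innerSL ℝ (l • w p))))) x := by
        have hi : HasFDerivAt (fun y : E => ((⟪y, l • w p⟫_ℝ : ℝ) : ℂ))
            (Complex.ofRealCLM.comp (innerSL ℝ (l • w p))) x := by
          have : (fun y : E => ((⟪y, l • w p⟫_ℝ : ℝ) : ℂ)) =
            fun y => (Complex.ofRealCLM.comp (innerSL ℝ (l • w p))) y := by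
            funext y; simp [real_inner_comm, inner_smul_right]
          rw [this]
          exact ContinuousLinearMap.hasFDerivAt _
        exact ((hi.const_mul Complex.I).neg).cexp
      have hm := ((hpart p x).mul hpw).fderiv
      rw [show ((fun y => g (y, p)) * planeWave (l • w p)) =
        fun x => g (x, p) * planeWave (l • w p) x from rfl] at hm
      have hgb : g (x, p) * ((⟪w p, Y (x, p)⟫_ℝ : ℝ) : ℂ) = b (x, p) := by
        by_cases hxK : x ∈ K
        · have h3 := ha p hp x hxK
          have h4 : H ⟪Y (x, p), w p⟫_ℝ = (⟪Y (x, p), w p⟫_ℝ)⁻¹ := hHinv _ (h3.trans (le_abs_self _))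
          have h5 : ((⟪Y (x, p), w p⟫_ℝ : ℝ) : ℂ) ≠ 0 := by
            exact_mod_cast (hδ.trans_le h3).ne'
          simp only [hg]
          rw [h4, real_inner_comm (Y (x, p)) (w p), Complex.ofReal_inv, mul_assoc, inv_mul_cancel₀ h5, mul_one]
        · rw [hgK p hp x hxK, hbK p hp x hxK, zero_mul]
      rw [hm, ← hgb]
      simp only [hL, add_apply, smul_apply,
        neg_apply, ContinuousLinearMap.comp_apply, innerSL_apply_apply,
        Complex.ofRealCLM_apply, smul_eq_mul, ContinuousLinearMap.inl_apply, inner_smul_left]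
      simp
      ring
    simp only [h2] at h1
    rw [integral_sub (hI hLs (hLK p hp)) ((hI hb (hbK p hp)).const_mul _), integral_const_mul,
      sub_eq_zero] at h1
    have h3 := hC p hp l hl
    rw [h1, norm_mul, norm_mul, Complex.norm_I, one_mul, Complex.norm_real,
      Real.norm_of_nonneg hl] at h3
    rw [pow_succ, mul_assoc]
    exact h3

end NonstationaryFamily

/-! ### A vector field tangent to the light cone -/

section ConeField

variable {d : ℕ} [NeZero d]

/-- The vector field `|x|² w - ⟨Jx, w⟩ Jx + ⟨x, w⟩ x`, where `J` is the time reflection. It is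
tangent to the light cone. The parameter is the pair of the covector `w` and an exponent. -/
def coneField (q : Minkowski d × (Minkowski d × ℂ)) : Minkowski d :=
  ‖q.1‖ ^ 2 • q.2.1 - ⟪timeReflection d q.1, q.2.1⟫_ℝ • timeReflection d q.1 + ⟪q.1, q.2.1⟫_ℝ • q.1

theorem contDiff_coneField : ContDiff ℝ ∞ (coneField (d := d)) := by
  have h1 : ContDiff ℝ ∞ fun q : Minkowski d × (Minkowski d × ℂ) => q.1 := contDiff_fst
  have h2 : ContDiff ℝ ∞ fun q : Minkowski d × (Minkowski d × ℂ) => q.2.1 :=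
    contDiff_fst.comp contDiff_snd
  have h3 : ContDiff ℝ ∞ fun q : Minkowski d × (Minkowski d × ℂ) => timeReflection d q.1 :=
    (timeReflection d).contDiff.comp contDiff_fst
  exact (((h1.norm_sq ℝ).smul h2).sub ((h3.inner ℝ h2).smul h3)).add ((h1.inner ℝ h2).smul h1)

/-- The divergence of `coneField` plus the factor from differentiating `γ^s`. -/
def coneDensity (q : Minkowski d × (Minkowski d × ℂ)) : ℂ :=
  ((∑ i, ⟪EuclideanSpace.basisFun (Fin d) ℝ i,
    fderiv ℝ coneField q (EuclideanSpace.basisFun (Fin d) ℝ i, 0)⟫_ℝ : ℝ) : ℂ) +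
    2 * q.2.2 * ((⟪q.1, q.2.1⟫_ℝ : ℝ) : ℂ)

theorem contDiff_coneDensity : ContDiff ℝ ∞ (coneDensity (d := d)) := by
  have h1 : ContDiff ℝ ∞ fun q : Minkowski d × (Minkowski d × ℂ) =>
      ∑ i, ⟪EuclideanSpace.basisFun (Fin d) ℝ i,
        fderiv ℝ coneField q (EuclideanSpace.basisFun (Fin d) ℝ i, 0)⟫_ℝ :=
    ContDiff.sum fun i _ => contDiff_const.inner ℝ
      ((contDiff_coneField.fderiv_right (by simp)).clm_apply contDiff_const)
  refine (Complex.ofRealCLM.contDiff.comp h1).add ?_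
  · exact (contDiff_const.mul (contDiff_snd.comp contDiff_snd)).mul
      (Complex.ofRealCLM.contDiff.comp (contDiff_fst.inner ℝ (contDiff_fst.comp contDiff_snd)))

/-- As the gradient of γ is -2Jx, this means Yγ = 2⟨x,w⟩γ. Differentiating γ^s along the field thus
gives γ^s times a smooth factor, without lowering the exponent. -/
theorem inner_timeReflection_coneField (x w : Minkowski d) (s : ℂ) :
    ⟪timeReflection d x, coneField (x, (w, s))⟫_ℝ = -(⟪x, w⟫_ℝ * gammaForm x) := by
  have h : ⟪timeReflection d x, x⟫_ℝ = -gammaForm x := by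
    rw [inner_timeReflection_left, gammaForm_eq, neg_neg]
  simp only [coneField, inner_add_right, inner_sub_right, inner_smul_right,
    real_inner_self_eq_norm_sq, LinearIsometryEquiv.norm_map, h]
  ring

theorem inner_coneField (x w : Minkowski d) (s : ℂ) :
    ⟪coneField (x, (w, s)), w⟫_ℝ =
      ‖x‖ ^ 2 * ‖w‖ ^ 2 - ⟪timeReflection d x, w⟫_ℝ ^ 2 + ⟪x, w⟫_ℝ ^ 2 := by
  simp only [coneField, inner_add_left, inner_sub_left, inner_smul_left, real_inner_self_eq_norm_sq]
  simp
  ring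

/-- By Cauchy–Schwarz the product is at least ⟨x,w⟩². If it vanishes, w is a multiple of Jx and
orthogonal to x, so γ(x) = 0 and w is a lightlike multiple of the gradient -2Jx: exactly the pairs
in Λ over nonzero points. -/
theorem inner_coneField_pos {x w : Minkowski d} (hx : x ≠ 0) (hw : w ≠ 0)
    (h : (x, w) ∉ rieszCone d) (s : ℂ) : 0 < ⟪coneField (x, (w, s)), w⟫_ℝ := by
  rw [inner_coneField]
  have hcs := abs_real_inner_le_norm (timeReflection d x) w
  rw [LinearIsometryEquiv.norm_map] at hcs
  have hcs2 : ⟪timeReflection d x, w⟫_ℝ ^ 2 ≤ ‖x‖ ^ 2 * ‖w‖ ^ 2 := by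
    rw [← mul_pow, ← sq_abs]
    exact pow_le_pow_left₀ (abs_nonneg _) hcs 2
  by_contra hle
  have h1 : ⟪x, w⟫_ℝ ^ 2 = 0 := by nlinarith [sq_nonneg ⟪x, w⟫_ℝ]
  have h2 : ⟪timeReflection d x, w⟫_ℝ ^ 2 = ‖x‖ ^ 2 * ‖w‖ ^ 2 := by nlinarith
  have hxw : ⟪x, w⟫_ℝ = 0 := by simpa using h1
  have hJx : timeReflection d x ≠ 0 := by simpa using hx
  have h3 : ‖⟪timeReflection d x, w⟫_ℝ‖ = ‖timeReflection d x‖ * ‖w‖ := by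
    rw [Real.norm_eq_abs, LinearIsometryEquiv.norm_map]
    rw [← sq_eq_sq₀ (abs_nonneg _) (by positivity), sq_abs, mul_pow, h2]
  have h4 : timeReflection d x = 0 ∨ ∃ r : ℝ, w = r • timeReflection d x :=
    ((norm_inner_eq_norm_tfae ℝ (timeReflection d x) w).out 0 2).1 h3
  obtain ⟨c, hc⟩ := h4.resolve_left hJx
  have hc0 : c ≠ 0 := fun h0 => hw (by rw [hc, h0, zero_smul])
  have hg : gammaForm x = 0 := by
    rw [hc, inner_smul_right, ← neg_neg ⟪x, timeReflection d x⟫_ℝ, ← gammaForm_eq] at hxw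
    simpa [hc0] using hxw
  refine h ⟨hw, ?_, fun _ => ⟨hg, -c / 2, ?_⟩⟩
  · rw [IsSpacelike, minkowskiForm_eq_inner, hc, map_smul, timeReflection_timeReflection,
      inner_smul_left, inner_smul_right, inner_timeReflection_left, ← neg_neg ⟪x, _⟫_ℝ,
      ← gammaForm_eq, hg]
    simp
  · rw [gradient_gammaForm, smul_smul, show -c / 2 * -(2 : ℝ) = c by ring]
    exact hc

/-- The divergence theorem for ψ γ^s Y, carried out in coordinates. The divergence of Y and the
factor 2s⟨x,w⟩ from differentiating γ^s together form `coneDensity`. -/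
theorem integral_coneField (ε : ℤˣ) {s : ℂ} (hs : 2 ≤ s.re) (w : Minkowski d)
    {ψ : Minkowski d → ℂ} (hψ : ContDiff ℝ ∞ ψ) (hc : HasCompactSupport ψ) :
    ∫ x, (fderiv ℝ ψ x (coneField (x, (w, s))) + coneDensity (x, (w, s)) * ψ x) * conePow ε s x
      = 0 := by
  set b := EuclideanSpace.basisFun (Fin d) ℝ with hb
  have hs0 : 0 ≤ s.re := by linarith
  have hs1 : 0 ≤ (s - 1).re := by simp; linarith
  have hx : ContDiff ℝ ∞ fun x : Minkowski d => (x, (w, s)) := contDiff_id.prodMk contDiff_const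
  have hY : ContDiff ℝ ∞ fun x : Minkowski d => coneField (x, (w, s)) := contDiff_coneField.comp hx
  have hYi (i : Fin d) : ContDiff ℝ ∞ fun x : Minkowski d =>
      ((⟪b i, coneField (x, (w, s))⟫_ℝ : ℝ) : ℂ) :=
    Complex.ofRealCLM.contDiff.comp (contDiff_const.inner ℝ hY)
  have hJ (v : Minkowski d) : Continuous fun x : Minkowski d =>
      ((⟪timeReflection d x, v⟫_ℝ : ℝ) : ℂ) :=
    Complex.continuous_ofReal.comp ((timeReflection d).continuous.inner continuous_const)
  have key (i : Fin d) := integral_fderiv_mul_conePow ε hs (hψ.mul (hYi i)) hc.mul_right (b i)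
  have hsum := Finset.sum_congr (rfl : (Finset.univ : Finset (Fin d)) = Finset.univ)
    fun i _ => key i
  rw [← Finset.mul_sum, ← integral_finsetSum, ← integral_finsetSum] at hsum
  rotate_left
  · intro i _
    exact integrable_mul_conePow ε hs1 (((hψ.mul (hYi i)).continuous).mul (hJ (b i)))
      hc.mul_right.mul_right
  · intro i _
    exact integrable_mul_conePow ε hs0 (((hψ.mul (hYi i)).continuous_fderiv (by simp)).clm_apply
      continuous_const) (hc.mul_right.fderiv_apply (𝕜 := ℝ) _)
  have hR (x : Minkowski d) : ∑ i, ψ x * ((⟪b i, coneField (x, (w, s))⟫_ℝ : ℝ) : ℂ) *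
      ((⟪timeReflection d x, b i⟫_ℝ : ℝ) : ℂ) * conePow ε (s - 1) x =
      -(((⟪x, w⟫_ℝ : ℝ) : ℂ) * ψ x * conePow ε s x) := by
    have h3 : ∑ i, ψ x * ((⟪b i, coneField (x, (w, s))⟫_ℝ : ℝ) : ℂ) *
        ((⟪timeReflection d x, b i⟫_ℝ : ℝ) : ℂ) * conePow ε (s - 1) x =
        ψ x * conePow ε (s - 1) x * ((∑ i, ⟪timeReflection d x, b i⟫_ℝ *
          ⟪b i, coneField (x, (w, s))⟫_ℝ : ℝ) : ℂ) := by
      rw [Complex.ofReal_sum, Finset.mul_sum]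
      refine Finset.sum_congr rfl fun i _ => ?_
      push_cast
      ring
    rw [h3, sum_inner_basisFun_mul, inner_timeReflection_coneField, ← gammaForm_mul_conePow ε s x]
    push_cast
    ring
  have hL (x : Minkowski d) : ∑ i, fderiv ℝ (fun x => ψ x *
      ((⟪b i, coneField (x, (w, s))⟫_ℝ : ℝ) : ℂ)) x (b i) * conePow ε s x =
      (fderiv ℝ ψ x (coneField (x, (w, s))) + coneDensity (x, (w, s)) * ψ x) * conePow ε s x -
        2 * s * (((⟪x, w⟫_ℝ : ℝ) : ℂ) * ψ x * conePow ε s x) := by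
    have hψd : HasFDerivAt ψ (fderiv ℝ ψ x) x := (hψ.differentiable (by simp) x).hasFDerivAt
    have hYd : HasFDerivAt (fun x : Minkowski d => coneField (x, (w, s)))
        ((fderiv ℝ coneField (x, (w, s))).comp (ContinuousLinearMap.inl ℝ (Minkowski d) _)) x :=
      (contDiff_coneField.differentiable (by simp) (x, (w, s))).hasFDerivAt.comp
        (f := fun y : Minkowski d => (y, (w, s))) x (hasFDerivAt_prodMk_left x (w, s))
    have hi (i : Fin d) : fderiv ℝ (fun x => ψ x *
        ((⟪b i, coneField (x, (w, s))⟫_ℝ : ℝ) : ℂ)) x (b i) =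
        fderiv ℝ ψ x (b i) * ((⟪b i, coneField (x, (w, s))⟫_ℝ : ℝ) : ℂ) +
          ψ x * ((⟪b i, fderiv ℝ coneField (x, (w, s)) (b i, 0)⟫_ℝ : ℝ) : ℂ) := by
      have h1 := (Complex.ofRealCLM.hasFDerivAt.comp x
        ((innerSL ℝ (b i)).hasFDerivAt.comp x hYd))
      have h2 := (hψd.mul h1).fderiv
      rw [show (ψ * (Complex.ofRealCLM ∘ (innerSL ℝ (b i)) ∘
        fun x : Minkowski d => coneField (x, (w, s)))) =
        fun x => ψ x * ((⟪b i, coneField (x, (w, s))⟫_ℝ : ℝ) : ℂ) from rfl] at h2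
      rw [h2]
      simp
      ring
    have hexp : fderiv ℝ ψ x (coneField (x, (w, s))) =
        ∑ i, fderiv ℝ ψ x (b i) * ((⟪b i, coneField (x, (w, s))⟫_ℝ : ℝ) : ℂ) := by
      conv_lhs => rw [← b.sum_repr' (coneField (x, (w, s))), map_sum]
      refine Finset.sum_congr rfl fun i _ => ?_
      rw [map_smul, Complex.real_smul, mul_comm]
    simp only [hi, coneDensity, hexp, ← Finset.sum_mul, Finset.sum_add_distrib, ← Finset.mul_sum]
    push_cast
    ring
  simp only [hL, hR] at hsum
  rw [integral_neg, integral_sub, integral_const_mul] at hsum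
  · linear_combination hsum
  · refine integrable_mul_conePow ε hs0 (((hψ.continuous_fderiv (by simp)).clm_apply
      hY.continuous).add ((contDiff_coneDensity.comp hx).continuous.mul hψ.continuous))
      (HasCompactSupport.add ?_ hc.mul_left)
    refine HasCompactSupport.intro hc fun x hx => ?_
    have : fderiv ℝ ψ x = 0 := image_eq_zero_of_notMem_tsupport
      fun h => hx (tsupport_fderiv_subset ℝ h)
    rw [this, zero_apply]
  · refine (integrable_mul_conePow ε hs0 (Continuous.mul ?_ hψ.continuous) hc.mul_left).const_mul _
    exact Complex.continuous_ofReal.comp (continuous_id.inner continuous_const)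

/-- The difference of the powers of `γ` on the future and on the past light cone. -/
def coneDiff (s : ℂ) (x : Minkowski d) : ℂ := conePow 1 s x - conePow (-1) s x

theorem locallyIntegrable_coneDiff {s : ℂ} (h0 : 0 ≤ s.re) :
    LocallyIntegrable (coneDiff (d := d) s) :=
  (locallyIntegrable_conePow 1 h0).sub (locallyIntegrable_conePow (-1) h0)

theorem norm_coneDiff_le {s : ℂ} {m : ℕ} (h0 : 0 ≤ s.re) (hm : s.re ≤ m) (x : Minkowski d) :
    ‖coneDiff s x‖ ≤ 2 * (1 + ‖x‖ ^ 2) ^ m := by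
  have h1 := norm_conePow_le (ε := 1) h0 hm x
  have h2 := norm_conePow_le (ε := -1) h0 hm x
  refine (norm_sub_le _ _).trans ?_
  linarith

theorem integral_coneField_coneDiff {s : ℂ} (hs : 2 ≤ s.re) (w : Minkowski d)
    {ψ : Minkowski d → ℂ} (hψ : ContDiff ℝ ∞ ψ) (hc : HasCompactSupport ψ) :
    ∫ x, (fderiv ℝ ψ x (coneField (x, (w, s))) + coneDensity (x, (w, s)) * ψ x) * coneDiff s x
      = 0 := by
  have hx : ContDiff ℝ ∞ fun x : Minkowski d => (x, (w, s)) := contDiff_id.prodMk contDiff_const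
  have hI (ε : ℤˣ) : Integrable fun x => (fderiv ℝ ψ x (coneField (x, (w, s))) +
      coneDensity (x, (w, s)) * ψ x) * conePow ε s x := by
    refine integrable_mul_conePow ε (by linarith) (((hψ.continuous_fderiv (by simp)).clm_apply
      (contDiff_coneField.comp hx).continuous).add
        ((contDiff_coneDensity.comp hx).continuous.mul hψ.continuous))
      (HasCompactSupport.add ?_ hc.mul_left)
    refine HasCompactSupport.intro hc fun x hx => ?_
    have : fderiv ℝ ψ x = 0 := image_eq_zero_of_notMem_tsupport
      fun h => hx (tsupport_fderiv_subset ℝ h)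
    rw [this, zero_apply]
  simp only [coneDiff, mul_sub]
  rw [integral_sub (hI 1) (hI (-1)), integral_coneField 1 hs w hψ hc,
    integral_coneField (-1) hs w hψ hc, sub_zero]

/-- Non-stationary phase for `coneDiff`, where the field `coneField` is not stationary. -/
theorem exists_nonstationary_bound_coneDiff {K W : Set (Minkowski d)} {S : Set ℂ}
    (hK : IsCompact K) (hW : IsCompact W) (hS : IsCompact S) (hS2 : ∀ s ∈ S, 2 ≤ s.re)
    (hpos : ∀ x ∈ K, ∀ w ∈ W, 0 < ⟪coneField (x, (w, 0)), w⟫_ℝ)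
    {b : Minkowski d × (Minkowski d × ℂ) → ℂ} (hb : ContDiff ℝ ∞ b)
    (hbK : ∀ w ∈ W, ∀ s ∈ S, ∀ x ∉ K, b (x, (w, s)) = 0) (N : ℕ) :
    ∃ C : ℝ, 0 ≤ C ∧ ∀ w ∈ W, ∀ s ∈ S, ∀ l : ℝ, 0 ≤ l →
      l ^ N * ‖∫ x, b (x, (w, s)) * planeWave (l • w) x * coneDiff s x‖ ≤ C := by
  have hcont : Continuous fun q : Minkowski d × (Minkowski d × ℂ) => ⟪coneField q, q.2.1⟫_ℝ :=
    contDiff_coneField.continuous.inner (continuous_fst.comp continuous_snd)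
  obtain ⟨δ, hδ, hmin⟩ := (hK.prod (hW.prod hS)).exists_forall_le' hcont.continuousOn (a := 0) (by
    rintro ⟨x, w, s⟩ ⟨hx, hw, hs⟩
    exact hpos x hx w hw)
  obtain ⟨R, hR⟩ := hK.isBounded.exists_norm_le
  obtain ⟨A, hA⟩ := hS.isBounded.exists_norm_le
  have hSA : ∀ s ∈ S, s.re ≤ ⌈A⌉₊ := fun s hs =>
    (Complex.re_le_norm s).trans ((hA s hs).trans (Nat.le_ceil A))
  obtain ⟨C, hC0, hC⟩ := exists_nonstationary_bound_family hK (hW.prod hS) contDiff_coneField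
    contDiff_coneDensity (w := Prod.fst) contDiff_fst (f := fun p x => coneDiff p.2 x)
    (fun p hp => locallyIntegrable_coneDiff (by linarith [hS2 p.2 hp.2]))
    (M := 2 * (1 + R ^ 2) ^ ⌈A⌉₊)
    (fun p hp x hx => by
      refine (norm_coneDiff_le (by linarith [hS2 p.2 hp.2]) (hSA p.2 hp.2) x).trans ?_
      have := hR x hx
      gcongr)
    (fun p hp ψ hψ hc => integral_coneField_coneDiff (hS2 p.2 hp.2) p.1 hψ hc)
    hδ (fun p hp x hx => hmin (x, p) ⟨hx, hp⟩) N b hb (fun p hp x hx => hbK p.1 hp.1 p.2 hp.2 x hx)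
  exact ⟨C, hC0, fun w hw s hs l hl => hC (w, s) ⟨hw, hs⟩ l hl⟩

end ConeField

/-! ### Time-reversing Lorentz transformations -/

section LorentzReflection

variable {d : ℕ} [NeZero d]

/-- The map `x ↦ -x + 2 c ⟨x, w⟩ Jw`. For `c = η(w, w)⁻¹` it is the Lorentz transformation that
fixes the covector `w` and is `-1` on the orthogonal complement. -/
def lorentzMap (w : Minkowski d) (c : ℝ) : Minkowski d →L[ℝ] Minkowski d :=
  -ContinuousLinearMap.id ℝ _ + (innerSL ℝ w).smulRight ((2 * c) • timeReflection d w)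

theorem lorentzMap_apply (w : Minkowski d) (c : ℝ) (x : Minkowski d) :
    lorentzMap w c x = -x + (2 * c * ⟪x, w⟫_ℝ) • timeReflection d w := by
  simp [lorentzMap, smul_smul, real_inner_comm, mul_comm]

variable {w : Minkowski d} {c : ℝ}

theorem inner_lorentzMap (hc : c * minkowskiForm w w = 1) (x : Minkowski d) :
    ⟪lorentzMap w c x, w⟫_ℝ = ⟪x, w⟫_ℝ := by
  rw [lorentzMap_apply, inner_add_left, inner_neg_left, real_inner_smul_left,
    inner_timeReflection_left, ← minkowskiForm_eq_inner]
  linear_combination (2 * ⟪x, w⟫_ℝ) * hc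

theorem lorentzMap_lorentzMap (hc : c * minkowskiForm w w = 1) (x : Minkowski d) :
    lorentzMap w c (lorentzMap w c x) = x := by
  rw [lorentzMap_apply w c (lorentzMap w c x), inner_lorentzMap hc, lorentzMap_apply]
  abel

theorem minkowskiForm_lorentzMap (x : Minkowski d) :
    minkowskiForm x (lorentzMap w c x) = gammaForm x + 2 * c * ⟪x, w⟫_ℝ ^ 2 := by
  rw [minkowskiForm_eq_inner, lorentzMap_apply, map_add, map_neg, map_smul,
    timeReflection_timeReflection, inner_add_right, inner_neg_right, inner_smul_right, gammaForm_eq]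
  ring

theorem gammaForm_lorentzMap (hc : c * minkowskiForm w w = 1) (x : Minkowski d) :
    gammaForm (lorentzMap w c x) = gammaForm x := by
  rw [gammaForm_eq, gammaForm_eq, lorentzMap_apply, map_add, map_neg, map_smul,
    timeReflection_timeReflection]
  have h : ⟪w, timeReflection d w⟫_ℝ = minkowskiForm w w := (minkowskiForm_eq_inner w w).symm
  simp only [inner_add_left, inner_add_right, inner_neg_left, inner_neg_right, inner_smul_right,
    real_inner_smul_left, inner_timeReflection_left, timeReflection_timeReflection, h,
    real_inner_comm x w]
  linear_combination (-4 * c * ⟪x, w⟫_ℝ ^ 2) * hc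

/-- Timelike vectors with a positive Lorentzian product have opposite time orientations. -/
theorem time_mul_time_neg {x y : Minkowski d} (hx : 0 < gammaForm x) (hy : 0 < gammaForm y)
    (h : 0 < minkowskiForm x y) : x 0 * y 0 < 0 := by
  have h1 : ⟪spatialPart d x, spatialPart d y⟫_ℝ = ⟪x, y⟫_ℝ - x 0 * y 0 := by
    rw [spatialPart_apply, spatialPart_apply]
    simp only [inner_sub_left, inner_sub_right, real_inner_smul_left, real_inner_smul_right,
      inner_timeVector, real_inner_comm (timeVector d) x, real_inner_self_eq_norm_sq,
      norm_timeVector]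
    ring
  have h2 := abs_real_inner_le_norm (spatialPart d x) (spatialPart d y)
  rw [h1] at h2
  rw [gammaForm_eq_sq_sub_sq] at hx hy
  rw [minkowskiForm_eq_inner_sub] at h
  have hx' : ‖spatialPart d x‖ < |x 0| := lt_of_pow_lt_pow_left₀ 2 (abs_nonneg _)
    (by rw [sq_abs]; linarith)
  have hy' : ‖spatialPart d y‖ < |y 0| := lt_of_pow_lt_pow_left₀ 2 (abs_nonneg _)
    (by rw [sq_abs]; linarith)
  have h3 : ‖spatialPart d x‖ * ‖spatialPart d y‖ < |x 0| * |y 0| :=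
    mul_lt_mul'' hx' hy' (norm_nonneg _) (norm_nonneg _)
  rw [← abs_mul] at h3
  by_contra hle
  rw [abs_of_nonneg (not_lt.1 hle)] at h3
  linarith [le_abs_self (⟪x, y⟫_ℝ - x 0 * y 0)]

/-- With L the map, η(x,Lx) = γ(x) + 2c⟨x,w⟩² is positive for timelike x and c > 0, and timelike
vectors with positive product have opposite time orientation. -/
theorem lorentzMap_mem_openCone (hc : c * minkowskiForm w w = 1) (hc0 : 0 < c) {ε : ℤˣ}
    {x : Minkowski d} (hx : x ∈ openCone d ε) : lorentzMap w c x ∈ openCone d (-ε) := by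
  have hg : 0 < gammaForm (lorentzMap w c x) := by rw [gammaForm_lorentzMap hc]; exact hx.1
  refine ⟨hg, ?_⟩
  have h1 := time_mul_time_neg hx.1 hg (by
    rw [minkowskiForm_lorentzMap]
    have := hx.1
    positivity)
  have h2 := hx.2
  have h3 : (((-ε : ℤˣ) : ℤ) : ℝ) = -((ε : ℤ) : ℝ) := by push_cast; rfl
  have h4 : x 0 * lorentzMap w c x 0 =
      (((ε : ℤ) : ℝ) * x 0) * (((ε : ℤ) : ℝ) * lorentzMap w c x 0) := by
    have := units_cast_mul_self ε
    linear_combination (-(x 0 * lorentzMap w c x 0)) * this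
  rw [h4] at h1
  rw [h3, neg_mul]
  linarith [(pos_iff_neg_of_mul_neg h1).1 h2]

theorem conePow_lorentzMap (hc : c * minkowskiForm w w = 1) (hc0 : 0 < c) (ε : ℤˣ) (s : ℂ)
    (x : Minkowski d) : conePow ε s (lorentzMap w c x) = conePow (-ε) s x := by
  by_cases hx : x ∈ openCone d (-ε)
  · have h := lorentzMap_mem_openCone hc hc0 hx
    rw [neg_neg] at h
    rw [conePow_of_mem hx, conePow_of_mem h, gammaForm_lorentzMap hc]
  · rw [conePow_of_notMem hx, conePow_of_notMem]
    intro h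
    have h' := lorentzMap_mem_openCone hc hc0 h
    rw [lorentzMap_lorentzMap hc] at h'
    exact hx h'

/-- The map preserves γ and exchanges the two cones. This oddness is the point where the difference
of R_+ and R_- is needed. -/
theorem coneDiff_lorentzMap (hc : c * minkowskiForm w w = 1) (hc0 : 0 < c) (s : ℂ)
    (x : Minkowski d) : coneDiff s (lorentzMap w c x) = -coneDiff s x := by
  rw [coneDiff, coneDiff, conePow_lorentzMap hc hc0, conePow_lorentzMap hc hc0, neg_neg, neg_sub]

/-- A linear involution has determinant ±1. -/
theorem integral_comp_lorentzMap (hc : c * minkowskiForm w w = 1) (F : Minkowski d → ℂ) :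
    ∫ x, F (lorentzMap w c x) = ∫ x, F x := by
  set A : Minkowski d →ₗ[ℝ] Minkowski d := (lorentzMap w c : Minkowski d →ₗ[ℝ] Minkowski d) with hA
  have hAA : A ∘ₗ A = LinearMap.id := LinearMap.ext fun x => lorentzMap_lorentzMap hc x
  have hdet : LinearMap.det A * LinearMap.det A = 1 := by
    rw [← LinearMap.det_comp, hAA, LinearMap.det_id]
  have hne : LinearMap.det A ≠ 0 := fun h => by simp [h] at hdet
  have habs : |(LinearMap.det A)⁻¹| = 1 := by
    rw [abs_inv, inv_eq_one]
    have h : |LinearMap.det A| ^ 2 = 1 := by rw [sq_abs, sq, hdet]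
    exact (pow_eq_one_iff_of_nonneg (abs_nonneg _) two_ne_zero).1 h
  have hmap := Measure.map_linearMap_addHaar_eq_smul_addHaar (volume : Measure (Minkowski d)) hne
  rw [habs, ENNReal.ofReal_one, one_smul] at hmap
  let e : Minkowski d ≃ₜ Minkowski d :=
    { toFun := lorentzMap w c
      invFun := lorentzMap w c
      left_inv := lorentzMap_lorentzMap hc
      right_inv := lorentzMap_lorentzMap hc
      continuous_toFun := (lorentzMap w c).continuous
      continuous_invFun := (lorentzMap w c).continuous }
  have he := e.measurableEmbedding.integral_map (μ := volume) F
  have hm : Measure.map e (volume : Measure (Minkowski d)) = volume := hmap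
  rw [hm] at he
  exact he.symm

/-- The reflection identity for the localized Fourier transforms of `coneDiff`. -/
theorem integral_sub_lorentzMap (hc : c * minkowskiForm w w = 1) (hc0 : 0 < c) {s : ℂ}
    (hs : 0 ≤ s.re) (θ : 𝓓((⊤ : TopologicalSpace.Opens (Minkowski d)), ℂ)) (l : ℝ) :
    ∫ x, (θ x - θ (lorentzMap w c x)) * planeWave (l • w) x * coneDiff s x =
      2 * ∫ x, θ x * planeWave (l • w) x * coneDiff s x := by
  -- The phase is invariant and `coneDiff` is odd, so reflecting the cut-off changes the sign of the
  -- integral.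
  have hpw (x : Minkowski d) : planeWave (l • w) (lorentzMap w c x) = planeWave (l • w) x := by
    rw [planeWave, planeWave, inner_smul_right, inner_smul_right, inner_lorentzMap hc]
  have hI : Integrable fun x => θ x * planeWave (l • w) x * coneDiff s x :=
    integrable_smul_of_locallyIntegrable (locallyIntegrable_coneDiff hs) (θ.modulate (l • w))
  have e : (fun x => θ (lorentzMap w c x) * planeWave (l • w) x * coneDiff s x) = fun x =>
      -(fun y => θ y * planeWave (l • w) y * coneDiff s y) (lorentzMap w c x) := by
    funext x
    simp only [hpw, coneDiff_lorentzMap hc hc0]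
    ring
  have hF : Integrable fun x => θ (lorentzMap w c x) * planeWave (l • w) x * coneDiff s x := by
    have hcomp : HasCompactSupport fun x => θ (lorentzMap w c x) := by
      let e : Minkowski d ≃ₜ Minkowski d :=
        { toFun := lorentzMap w c
          invFun := lorentzMap w c
          left_inv := lorentzMap_lorentzMap hc
          right_inv := lorentzMap_lorentzMap hc
          continuous_toFun := (lorentzMap w c).continuous
          continuous_invFun := (lorentzMap w c).continuous }
      exact θ.hasCompactSupport.comp_homeomorph e
    exact (locallyIntegrable_coneDiff hs).integrable_smul_left_of_hasCompactSupport
      ((θ.contDiff.continuous.comp (lorentzMap w c).continuous).mul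
        (contDiff_planeWave _).continuous) hcomp.mul_right
  have h1 : ∫ x, θ (lorentzMap w c x) * planeWave (l • w) x * coneDiff s x =
      -∫ x, θ x * planeWave (l • w) x * coneDiff s x := by
    rw [e, integral_neg, integral_comp_lorentzMap hc
      (fun y => θ y * planeWave (l • w) y * coneDiff s y)]
  simp only [sub_mul]
  rw [integral_sub hI hF, h1]
  ring

end LorentzReflection

/-! ### The wavefront set of the difference Riesz distributions -/

section RieszWavefront

variable {d : ℕ} [NeZero d]

theorem localFourier_rieszBase_diff {β : ℂ} (hβ : (d : ℝ) ≤ β.re)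
    (χ : 𝓓((⊤ : TopologicalSpace.Opens (Minkowski d)), ℝ)) (η : Minkowski d) :
    localFourier (rieszBase d 1 β + -rieszBase d (-1) β) χ η =
      rieszConst d β * ∫ x, (χ x : ℂ) * planeWave η x * coneDiff ((β - d) / 2) x := by
  have h0 : 0 ≤ ((β - d) / 2).re := by simp; linarith
  have hI (ε : ℤˣ) : Integrable fun x => (χ x : ℂ) * planeWave η x * conePow ε ((β - d) / 2) x :=
    integrable_smul_of_locallyIntegrable (locallyIntegrable_conePow ε h0) (χ.toComplex.modulate η)
  rw [localFourier_eq_cext, ← sub_eq_add_neg, cext_sub, cext_rieszBase 1 hβ, cext_rieszBase (-1) hβ,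
    ← mul_sub]
  simp only [modulate_apply, toComplex_apply, coneDiff, mul_sub]
  rw [integral_sub (hI 1) (hI (-1)), mul_sub]

theorem isCompact_rieszExponents (α : ℂ) (r : ℝ) :
    IsCompact ((fun β : ℂ => (β - d) / 2) '' Metric.closedBall α r) :=
  (isCompact_closedBall α r).image (by fun_prop)

/-- Rapid decay of the localized Fourier transforms from bounds for the integrals. -/
theorem rapidOn_rieszBase_diff {α : ℂ} {r : ℝ} (hr : ∀ β ∈ Metric.closedBall α r, (d : ℝ) ≤ β.re)
    {χ : 𝓓((⊤ : TopologicalSpace.Opens (Minkowski d)), ℝ)} {ξ : Minkowski d} {ρ : ℝ}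
    (h : ∀ N : ℕ, ∃ C : ℝ, 0 ≤ C ∧ ∀ w ∈ Metric.closedBall ξ ρ,
      ∀ s ∈ (fun β : ℂ => (β - d) / 2) '' Metric.closedBall α r, ∀ l : ℝ, 0 ≤ l →
        l ^ N * ‖∫ x, (χ x : ℂ) * planeWave (l • w) x * coneDiff s x‖ ≤ C) :
    RapidOn (fun β : Metric.closedBall α r => rieszBase d 1 β + -rieszBase d (-1) β) χ
      (rayNhd ξ ρ) := by
  obtain ⟨M, hM⟩ := ((isCompact_closedBall α r).image
    (differentiable_rieszConst (d := d)).continuous).isBounded.exists_norm_le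
  refine rapidOn_rayNhd fun N => ?_
  obtain ⟨C, hC0, hC⟩ := h N
  refine ⟨|M| * C, by positivity, fun β w hw l hl => ?_⟩
  rw [localFourier_rieszBase_diff (hr β β.2), norm_mul, mul_left_comm]
  exact mul_le_mul ((hM _ (mem_image_of_mem _ β.2)).trans (le_abs_self M))
    (hC w hw _ (mem_image_of_mem _ β.2) l hl.le) (by positivity) (abs_nonneg _)

theorem exists_norm_localFourier_rieszBase_diff_le {α : ℂ} {r : ℝ}
    (hr : ∀ β ∈ Metric.closedBall α r, (d : ℝ) ≤ β.re)
    (θ : 𝓓((⊤ : TopologicalSpace.Opens (Minkowski d)), ℝ)) :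
    ∃ B : ℝ, 0 ≤ B ∧ ∀ (β : Metric.closedBall α r) (ζ : Minkowski d),
      ‖localFourier (rieszBase d 1 β + -rieszBase d (-1) β) θ ζ‖ ≤ B := by
  obtain ⟨M, hM⟩ := ((isCompact_closedBall α r).image
    (differentiable_rieszConst (d := d)).continuous).isBounded.exists_norm_le
  obtain ⟨A, hA⟩ := (isCompact_rieszExponents (d := d) α r).isBounded.exists_norm_le
  have hI0 : 0 ≤ ∫ x : Minkowski d, ‖θ x‖ * (2 * (1 + ‖x‖ ^ 2) ^ ⌈A⌉₊) :=
    integral_nonneg fun x => by positivity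
  refine ⟨|M| * ∫ x : Minkowski d, ‖θ x‖ * (2 * (1 + ‖x‖ ^ 2) ^ ⌈A⌉₊), by positivity,
    fun β ζ => ?_⟩
  rw [localFourier_rieszBase_diff (hr β β.2), norm_mul]
  refine mul_le_mul ((hM _ (mem_image_of_mem _ β.2)).trans (le_abs_self M)) ?_ (norm_nonneg _)
    (abs_nonneg _)
  have hθ : Continuous θ := θ.contDiff.continuous
  refine norm_integral_le_of_norm_le (Continuous.integrable_of_hasCompactSupport (by fun_prop)
    θ.hasCompactSupport.norm.mul_right) (Eventually.of_forall fun x => ?_)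
  rw [norm_mul, norm_mul, norm_planeWave, mul_one, Complex.norm_real]
  refine mul_le_mul_of_nonneg_left (norm_coneDiff_le ?_ ?_ x) (norm_nonneg _)
  · have := hr β β.2
    simp
    linarith
  · exact (Complex.re_le_norm _).trans
      ((hA _ (mem_image_of_mem (fun β : ℂ => (β - d) / 2) β.2)).trans (Nat.le_ceil A))

theorem two_le_re_of_mem_rieszExponents {α : ℂ} {r : ℝ}
    (hr : ∀ β ∈ Metric.closedBall α r, (d : ℝ) + 4 ≤ β.re) :
    ∀ s ∈ (fun β : ℂ => (β - d) / 2) '' Metric.closedBall α r, 2 ≤ s.re := by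
  rintro _ ⟨β, hβ, rfl⟩
  have := hr β hβ
  simp
  linarith

/-- Non-stationarity of the field is an open condition on the pair of point and covector, so it
persists on small closed balls around it. -/
theorem microAt_rieszBase_diff_of_ne_zero {α : ℂ} {r : ℝ}
    (hr : ∀ β ∈ Metric.closedBall α r, (d : ℝ) + 4 ≤ β.re) {x ξ : Minkowski d} (hx : x ≠ 0)
    (hξ : ξ ≠ 0) (h : (x, ξ) ∉ rieszCone d) :
    MicroAt (fun β : Metric.closedBall α r => rieszBase d 1 β + -rieszBase d (-1) β) x ξ := by
  have hcont : Continuous fun q : Minkowski d × Minkowski d =>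
      ⟪coneField (q.1, (q.2, (0 : ℂ))), q.2⟫_ℝ :=
    (contDiff_coneField.continuous.comp (by fun_prop)).inner continuous_snd
  have hopen : IsOpen {q : Minkowski d × Minkowski d | 0 < ⟪coneField (q.1, (q.2, (0 : ℂ))), q.2⟫_ℝ} :=
    isOpen_lt continuous_const hcont
  obtain ⟨r₀, hr₀, hball⟩ := Metric.isOpen_iff.1 hopen (x, ξ) (inner_coneField_pos hx hξ h 0)
  have hpos : ∀ y ∈ Metric.closedBall x (r₀ / 2), ∀ w ∈ Metric.closedBall ξ (r₀ / 2),
      0 < ⟪coneField (y, (w, (0 : ℂ))), w⟫_ℝ := fun y hy w hw => by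
    refine hball (a := (y, w)) ?_
    rw [Metric.mem_ball, Prod.dist_eq]
    exact (max_le hy hw).trans_lt (half_lt_self hr₀)
  refine ⟨Metric.closedBall x (r₀ / 2), Metric.closedBall_mem_nhds x (half_pos hr₀),
    rayNhd ξ (r₀ / 2), rayNhd_mem_nhds ξ (half_pos hr₀), isConic_rayNhd ξ _, fun χ hχ => ?_⟩
  refine rapidOn_rieszBase_diff (fun β hβ => by linarith [hr β hβ]) fun N => ?_
  exact exists_nonstationary_bound_coneDiff (isCompact_closedBall x (r₀ / 2))
    (isCompact_closedBall ξ (r₀ / 2)) (isCompact_rieszExponents α r)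
    (two_le_re_of_mem_rieszExponents hr) hpos
    (b := fun q => (χ q.1 : ℂ)) (Complex.ofRealCLM.contDiff.comp (χ.contDiff.comp contDiff_fst))
    (fun w _ s _ y hy => by
      simp [image_eq_zero_of_notMem_tsupport fun hy' => hy (hχ hy')]) N

theorem norm_lorentzMap_le (w : Minkowski d) {c R δ : ℝ} (hc0 : 0 ≤ c) (hc : c ≤ δ⁻¹)
    (hw : ‖w‖ ≤ R) (x : Minkowski d) : ‖lorentzMap w c x‖ ≤ (1 + 2 * δ⁻¹ * R ^ 2) * ‖x‖ := by
  rw [lorentzMap_apply]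
  have h1 : |⟪x, w⟫_ℝ| ≤ ‖x‖ * R := (abs_real_inner_le_norm x w).trans (by gcongr)
  have hδ : 0 ≤ δ⁻¹ := hc0.trans hc
  have hR : 0 ≤ R := (norm_nonneg w).trans hw
  calc _ ≤ ‖x‖ + 2 * c * |⟪x, w⟫_ℝ| * ‖w‖ := by
        refine (norm_add_le _ _).trans ?_
        rw [norm_neg, norm_smul, Real.norm_eq_abs, abs_mul, abs_of_nonneg (by positivity),
          LinearIsometryEquiv.norm_map]
    _ ≤ ‖x‖ + 2 * δ⁻¹ * (‖x‖ * R) * R := by gcongr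
    _ = _ := by ring

/-- `coneField` vanishes at the origin, so non-stationary phase does not apply there directly. The
reflection identity replaces a cut-off θ that is 1 near 0 by half of θ - θ∘L, which lives away from
0, and there spacelike covectors are never stationary. -/
theorem microAt_rieszBase_diff_zero {α : ℂ} {r : ℝ}
    (hr : ∀ β ∈ Metric.closedBall α r, (d : ℝ) + 4 ≤ β.re) {ξ : Minkowski d}
    (hξ : IsSpacelike ξ) :
    MicroAt (fun β : Metric.closedBall α r => rieszBase d 1 β + -rieszBase d (-1) β) 0 ξ := by
  set δ : ℝ := minkowskiForm ξ ξ / 2 with hδ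
  have hδ0 : 0 < δ := half_pos hξ
  obtain ⟨r₀, hr₀, hball⟩ := Metric.isOpen_iff.1
    (isOpen_lt continuous_const (continuous_minkowskiForm_self (d := d))) ξ
    (half_lt_self hξ : δ < minkowskiForm ξ ξ)
  set ρ : ℝ := r₀ / 2
  have hρ : 0 < ρ := half_pos hr₀
  have hq : ∀ w ∈ Metric.closedBall ξ ρ, δ ≤ minkowskiForm w w := fun w hw =>
    (hball (Metric.closedBall_subset_ball (half_lt_self hr₀) hw)).le
  -- The reflection depends on `w` through 1/η(w,w); `H` makes this dependence smooth for all `w`,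
  -- as the amplitude in the phase estimate must be.
  obtain ⟨H, hH, hHinv⟩ := exists_smooth_inv hδ0
  have hHq : ∀ w ∈ Metric.closedBall ξ ρ, H (minkowskiForm w w) = (minkowskiForm w w)⁻¹ :=
    fun w hw => hHinv _ ((hq w hw).trans (le_abs_self _))
  have hc : ∀ w ∈ Metric.closedBall ξ ρ, H (minkowskiForm w w) * minkowskiForm w w = 1 :=
    fun w hw => by rw [hHq w hw, inv_mul_cancel₀ (hδ0.trans_le (hq w hw)).ne']
  have hc0 : ∀ w ∈ Metric.closedBall ξ ρ, 0 < H (minkowskiForm w w) :=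
    fun w hw => by rw [hHq w hw]; exact inv_pos.2 (hδ0.trans_le (hq w hw))
  set R : ℝ := ‖ξ‖ + ρ
  set A : ℝ := 1 + 2 * δ⁻¹ * R ^ 2
  have hA1 : 1 ≤ A := le_add_of_nonneg_right (by positivity)
  have hA0 : 0 < A := by linarith
  have hnorm : ∀ w ∈ Metric.closedBall ξ ρ, ∀ x,
      ‖lorentzMap w (H (minkowskiForm w w)) x‖ ≤ A * ‖x‖ := fun w hw x => by
    refine norm_lorentzMap_le w (hc0 w hw).le ?_ ?_ x
    · rw [hHq w hw]
      exact inv_anti₀ hδ0 (hq w hw)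
    · rw [Metric.mem_closedBall, dist_eq_norm] at hw
      have := norm_le_norm_add_norm_sub' w ξ
      simp only [R]
      linarith
  obtain ⟨θ, δ', hδ', hθ, -⟩ := exists_cutoff (isCompact_singleton (x := (0 : Minkowski d)))
    isOpen_univ (subset_univ _)
  rw [Metric.cthickening_singleton _ hδ'.le] at hθ
  obtain ⟨R', hR'⟩ := θ.hasCompactSupport.isBounded.exists_norm_le
  -- The reflection, which is its own inverse, expands norms at most by `A`. So for |x| < δ'/A both
  -- values of θ are 1, and for |x| > A|R'| both are 0.
  set K : Set (Minkowski d) := Metric.closedBall 0 (A * |R'|) \ Metric.ball 0 (δ' / A)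
  have hK : IsCompact K := (isCompact_closedBall _ _).diff Metric.isOpen_ball
  have hK0 : ∀ x ∈ K, x ≠ 0 := by
    rintro _ ⟨-, hx⟩ rfl
    exact hx (Metric.mem_ball_self (by positivity))
  have hθ0 : ∀ x, |R'| < ‖x‖ → θ x = 0 := fun x hx =>
    image_eq_zero_of_notMem_tsupport fun h => by
      have := (hR' x h).trans (le_abs_self R')
      linarith
  have hbK : ∀ w ∈ Metric.closedBall ξ ρ, ∀ x ∉ K,
      θ x = θ (lorentzMap w (H (minkowskiForm w w)) x) := fun w hw x hx => by
    rw [Set.mem_sdiff, not_and_not_right] at hx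
    by_cases hx1 : x ∈ Metric.closedBall 0 (A * |R'|)
    · have hx2 := hx hx1
      rw [mem_ball_zero_iff, lt_div_iff₀ hA0] at hx2
      rw [hθ x, hθ]
      · rw [mem_closedBall_zero_iff]
        exact (hnorm w hw x).trans (by linarith)
      · rw [mem_closedBall_zero_iff]
        nlinarith [norm_nonneg x]
    · rw [mem_closedBall_zero_iff, not_le] at hx1
      rw [hθ0 x, hθ0]
      · have h1 := hnorm w hw (lorentzMap w (H (minkowskiForm w w)) x)
        rw [lorentzMap_lorentzMap (hc w hw)] at h1
        exact lt_of_mul_lt_mul_left (hx1.trans_le h1) hA0.le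
      · nlinarith [abs_nonneg R']
  have hpos : ∀ x ∈ K, ∀ w ∈ Metric.closedBall ξ ρ, 0 < ⟪coneField (x, (w, (0 : ℂ))), w⟫_ℝ := by
    intro x hx w hw
    have hs : IsSpacelike w := hδ0.trans_le (hq w hw)
    refine inner_coneField_pos (hK0 x hx) ?_ (fun h => h.2.1 hs) 0
    rintro rfl
    simp [IsSpacelike, minkowskiForm] at hs
  have hsmooth : ContDiff ℝ ∞ fun q : Minkowski d × (Minkowski d × ℂ) =>
      ((θ q.1 : ℂ) - (θ (lorentzMap q.2.1 (H (minkowskiForm q.2.1 q.2.1)) q.1) : ℂ)) := by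
    have h1 : ContDiff ℝ ∞ fun q : Minkowski d × (Minkowski d × ℂ) => q.1 := contDiff_fst
    have h2 : ContDiff ℝ ∞ fun q : Minkowski d × (Minkowski d × ℂ) => q.2.1 :=
      contDiff_fst.comp contDiff_snd
    have h3 : ContDiff ℝ ∞ fun q : Minkowski d × (Minkowski d × ℂ) => timeReflection d q.2.1 :=
      (timeReflection d).contDiff.comp h2
    have h4 : ContDiff ℝ ∞ fun q : Minkowski d × (Minkowski d × ℂ) =>
        minkowskiForm q.2.1 q.2.1 := by
      simp only [minkowskiForm_eq_inner]
      exact h2.inner ℝ h3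
    have h5 : ContDiff ℝ ∞ fun q : Minkowski d × (Minkowski d × ℂ) =>
        lorentzMap q.2.1 (H (minkowskiForm q.2.1 q.2.1)) q.1 := by
      simp only [lorentzMap_apply]
      exact h1.neg.add (((contDiff_const.mul (hH.comp h4)).mul (h1.inner ℝ h2)).smul h3)
    exact (Complex.ofRealCLM.contDiff.comp (θ.contDiff.comp h1)).sub
      (Complex.ofRealCLM.contDiff.comp (θ.contDiff.comp h5))
  have hrapid : RapidOn (fun β : Metric.closedBall α r =>
      rieszBase d 1 β + -rieszBase d (-1) β) θ (rayNhd ξ ρ) := by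
    refine rapidOn_rieszBase_diff (fun β hβ => by linarith [hr β hβ]) fun N => ?_
    obtain ⟨C, hC0, hC⟩ := exists_nonstationary_bound_coneDiff hK (isCompact_closedBall ξ ρ)
      (isCompact_rieszExponents α r) (two_le_re_of_mem_rieszExponents hr) hpos hsmooth
      (fun w hw s _ x hx => by rw [← hbK w hw x hx, sub_self]) N
    refine ⟨C, hC0, fun w hw s hs l hl => ?_⟩
    have h1 := hC w hw s hs l hl
    have h2 := integral_sub_lorentzMap (hc w hw) (hc0 w hw) (s := s)
      (by linarith [two_le_re_of_mem_rieszExponents hr s hs]) θ.toComplex l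
    simp only [toComplex_apply] at h2
    rw [h2, norm_mul, Complex.norm_ofNat, mul_left_comm] at h1
    have h3 : 0 ≤ l ^ N * ‖∫ x, (θ x : ℂ) * planeWave (l • w) x * coneDiff s x‖ := by positivity
    linarith
  obtain ⟨B, hB0, hB⟩ := exists_norm_localFourier_rieszBase_diff_le (α := α) (r := r)
    (fun β hβ => by linarith [hr β hβ]) θ
  refine ⟨Metric.closedBall 0 δ', Metric.closedBall_mem_nhds _ hδ', rayNhd ξ (ρ / 2),
    rayNhd_mem_nhds ξ (half_pos hρ), isConic_rayNhd ξ _, fun χ hχ => ?_⟩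
  -- The decay is known for the one cut-off θ; it passes to every χ supported where θ = 1, on a
  -- smaller cone.
  refine hrapid.of_mul_eq (fun x => ?_) hρ (M := 0) hB0 (fun β ζ => by simpa using hB β ζ)
  by_cases hx : x ∈ tsupport χ
  · rw [hθ x (hχ hx), one_mul]
  · rw [image_eq_zero_of_notMem_tsupport hx, mul_zero]

theorem microAt_rieszBase_diff {α : ℂ} {r : ℝ}
    (hr : ∀ β ∈ Metric.closedBall α r, (d : ℝ) + 4 ≤ β.re) {x ξ : Minkowski d}
    (hξ : ξ ≠ 0) (h : (x, ξ) ∉ rieszCone d) :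
    MicroAt (fun β : Metric.closedBall α r => rieszBase d 1 β + -rieszBase d (-1) β) x ξ := by
  rcases eq_or_ne x 0 with rfl | hx
  · refine microAt_rieszBase_diff_zero hr ?_
    by_contra hs
    exact h ⟨hξ, hs, fun h0 => absurd rfl h0⟩
  · exact microAt_rieszBase_diff_of_ne_zero hr hx hξ h

theorem dalembertian_add (u v : 𝓓'((⊤ : TopologicalSpace.Opens (Minkowski d)), ℂ)) :
    dalembertian (u + v) = dalembertian u + dalembertian v := by
  ext φ
  simp only [dalembertian_apply, add_apply, Finset.sum_add_distrib, neg_add]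

theorem dalembertian_neg (u : 𝓓'((⊤ : TopologicalSpace.Opens (Minkowski d)), ℂ)) :
    dalembertian (-u) = -dalembertian u := by
  ext φ
  simp only [dalembertian_apply, neg_apply, Finset.sum_neg_distrib]

theorem iterate_dalembertian_add_neg (k : ℕ)
    (u v : 𝓓'((⊤ : TopologicalSpace.Opens (Minkowski d)), ℂ)) :
    dalembertian^[k] (u + -v) = dalembertian^[k] u + -dalembertian^[k] v := by
  induction k generalizing u v with
  | zero => rfl
  | succ k ih => rw [Function.iterate_succ_apply, dalembertian_add, dalembertian_neg, ih]; rfl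

theorem MicroAt.iterate_dalembertian {ι : Type*}
    {T : ι → 𝓓'((⊤ : TopologicalSpace.Opens (Minkowski d)), ℂ)} {x ξ : Minkowski d}
    (h : MicroAt T x ξ) (k : ℕ) : MicroAt (fun a => dalembertian^[k] (T a)) x ξ := by
  induction k with
  | zero => exact h
  | succ k ih =>
    simp only [Function.iterate_succ_apply']
    exact (MicroAt.sum_family _ fun _ _ => (ih.lineDeriv _).lineDeriv _).neg_family

/-- The difference Riesz distributions form a holomorphic family in `𝓓'_Λ`. -/
theorem isHolomorphicWavefrontFamily_rieszDiff (d : ℕ) [NeZero d] :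
    IsHolomorphicWavefrontFamily (rieszCone d) (rieszDiff d) where
  toIsHolomorphicFamily := isHolomorphicFamily_rieszDiff d
  locally_microAt α := by
    -- Near `α` the family is □^k, with k fixed, of the difference shifted by 2k into the half plane
    -- Re ≥ d + 4, where the phase estimates hold. The radius is chosen so that both properties
    -- persist on the closed ball.
    obtain ⟨k, hk, he⟩ := eventually_rieszExtension_eq d α
    obtain ⟨r₁, hr₁, he⟩ := Metric.eventually_nhds_iff_ball.1 he
    set t : ℝ := (α + 2 * k).re - (d + 4) with ht
    have ht0 : 0 < t := by linarith
    set r : ℝ := min (r₁ / 2) t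
    have hr0 : 0 < r := lt_min (half_pos hr₁) ht0
    have hre : ∀ β ∈ Metric.closedBall (α + 2 * (k : ℂ)) r, (d : ℝ) + 4 ≤ β.re := fun β hβ => by
      rw [Metric.mem_closedBall, dist_eq_norm] at hβ
      have h1 := (Complex.abs_re_le_norm (β - (α + 2 * k))).trans (hβ.trans (min_le_right _ _))
      rw [Complex.sub_re, abs_le] at h1
      linarith [h1.1]
    refine ⟨r, hr0, fun x ξ hξ h => ?_⟩
    have h1 := ((microAt_rieszBase_diff hre hξ h).iterate_dalembertian k).comp_index
      (fun β : Metric.closedBall α r =>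
        (⟨(β : ℂ) + 2 * k, by
        have h : dist (β : ℂ) α ≤ r := β.2
        simpa [Metric.mem_closedBall] using h⟩ : Metric.closedBall (α + 2 * (k : ℂ)) r))
    have e : (fun β : Metric.closedBall α r => rieszDiff d β) = fun β : Metric.closedBall α r =>
        dalembertian^[k] (rieszBase d 1 ((β : ℂ) + 2 * k) +
          -rieszBase d (-1) ((β : ℂ) + 2 * k)) := by
      funext β
      have hβ : (β : ℂ) ∈ Metric.ball α r₁ := Metric.closedBall_subset_ball
        ((min_le_left _ _).trans_lt (half_lt_self hr₁)) β.2
      rw [rieszDiff, riesz_eq_rieszExtension, riesz_eq_rieszExtension, he β hβ, he β hβ,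
        iterate_dalembertian_add_neg, sub_eq_add_neg]
    rw [e]
    exact h1

end RieszWavefront

end

end

theorem theorem2p5 (d : ℕ) [NeZero d] (hd : 2 ≤ d) :
    (∀ ε : ℤˣ, ∃! R : ℂ → 𝓓'((⊤ : TopologicalSpace.Opens (Minkowski d)), ℂ),
      IsRieszFamily d ε R) ∧
    ∃ hWF : ∀ α : ℂ, wavefrontSet (rieszDiff d α) ⊆ rieszCone d,
      Differentiable ℂ (fun α : ℂ => WavefrontSpace.mk (rieszDiff d α) (hWF α)) ∧
      ∀ (I : TopologicalSpace.Opens ℝ) (w : ℝ → Minkowski d), IsTimelikeCurve I w →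
        (∃! P : WavefrontSpace (rieszCone d) →L[ℂ] 𝓓'(I, ℂ), IsPullback I w P) ∧
        ∀ P : WavefrontSpace (rieszCone d) →L[ℂ] 𝓓'(I, ℂ), IsPullback I w P →
          Differentiable ℂ (fun α : ℂ => P (WavefrontSpace.mk (rieszDiff d α) (hWF α))) := by
  have hfam := isHolomorphicWavefrontFamily_rieszDiff d
  refine ⟨existsUnique_isRieszFamily d, hfam.wavefrontSet_subset, hfam.differentiable_mk, fun I w hw => ⟨?_, fun P _ =>
    hfam.differentiable_comp P⟩⟩
  -- That the curve is timelike enters only through the splitting of frequency space into a cone off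
  -- Λ and its complement.
  exact existsUnique_isPullback fun K hK hKI => nonempty_curveData hw.contDiffOn hK hKI
    fun L hL hLI => exists_cone_of_timelike hw hL hLI
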